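/- Let $M$ be a smooth manifold (Hausdorff, second countable, without boundary) and let $V\subset M$ be a closed embedded submanifold of dimension $p$ and codimension $n$. Fix a smooth positive density $\mu$ on $M$; smooth functions are regarded as distributions through $\mu$. A compactly supported distribution on $M$ is a continuous linear form on $C^\infty(M)=C^\infty(M;\mathbb{C})$. *Conormal distributions.* A classical symbol of order $m\in\mathbb{C}$ on $\mathbb{R}^p\times\mathbb{R}^n$ is a smooth function $a(u,\xi)$ such that $a\sim\sum_{j\ge 0}a_{m-j}$, where $a_{m-j}$ is smooth on $\{\xi\neq 0\}$ and $a_{m-j}(u,t\xi)=t^{m-j}a_{m-j}(u,\xi)$ for $t>0$; here $\sim$ means that for all $k,\alpha,\beta$ and all compact $K\subset\mathbb{R}^p$ there is $C$ with $|\partial_\xi^\alpha\partial_u^\beta(a-\sum_{j<k}a_{m-j})(u,\xi)|\le C\|\xi\|^{\operatorname{Re}m-k-|\alpha|}$ for $u\in K$, $\|\xi\|\ge 1$. Put $$P_a(f)=(2\pi)^{-n}\int a(u,\xi)\Big(\int_{\mathbb{R}^n}e^{-i\langle x,\xi\rangle}f(u,x)\,dx\Big)du\,d\xi .$$ $\mathcal{I}_c^m(M,V)$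 is the space of compactly supported distributions on $M$ that are given by a smooth function near every point of $M\setminus V$ and that, near every point of $V$, in some chart with values in $\mathbb{R}^p\times\mathbb{R}^n$ in which $V=\{x=0\}$, are of the form $P_a+\kappa$ with $a$ a classical symbol of order $m$ and $\kappa$ a smooth function. *Schwartz functions.* Let $N$ be the normal bundle of $V$ in $M$ and $DNC_+(M,V)=M\times\mathbb{R}_+^*\sqcup N\times\{0\}$ the deformation to the normal cone, an open subset of the spherical blow-up $SBlup(M\times\mathbb{R},V\times\{0\})$. Let $\mathcal{S}(M,V)$ be the space of smooth compactly supported complex functions on $SBlup(M\times\mathbb{R},V\times\{0\})$ that vanish to infinite order on the complement of $DNC_+(M,V)$. Such a $k$ defines smooth functions $k_t$ on $M$ $(t>0)$, regarded as distributions by means of the density $t^{-n}\mu$ on $M\times\{t\}$ (the family of densities which extends smoothly, without zeros, to $t=0$ on $DNC_+(M,V)$): $$\langle k_t\,|\,f\rangle=\int_M k_t(x)f(x)\,t^{-n}\,d\mu(x)\qquad(f\in C^\infty(M)).$$ Let $\mathcal{J}(M,V)\subset\mathcal{S}(M,V)$ be the subspace of those $k$ such that, for every $f\in C^\infty(M)$,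 the function $t\mapsto\langle k_t|f\rangle$ extends to a smooth function on $\mathbb{R}$ all of whose derivatives vanish at $t=0$. **Theorem.** Let $m\in\mathbb{C}$. For every $k\in\mathcal{J}(M,V)$ and $f\in C^\infty(M)$ the function $t\mapsto\langle k_t|f\rangle\,t^{-1-m}$ is integrable on $(0,\infty)$, and $\mathcal{I}_c^m(M,V)$ is exactly the set of linear forms $$f\longmapsto\int_0^\infty\langle k_t\,|\,f\rangle\,t^{-1-m}\,dt,\qquad k\in\mathcal{J}(M,V).$$ -/

import Mathlib

open MeasureTheory Set
open scoped Manifold ContDiff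

noncomputable section

namespace Conormal

/-- The coordinate space `ℝᵖ × ℝⁿ`; `ℝᵖ × {0}` is the local model of a submanifold of dimension
`p` and codimension `n`. Its measure is Lebesgue measure. -/
abbrev Coord (p n : ℕ) : Type := EuclideanSpace ℝ (Fin p) × EuclideanSpace ℝ (Fin n)

/-! ### Symbols and oscillatory integrals in coordinates -/

/-- `a` is a classical symbol of complex order `m` on the trivial bundle `ℝᵖ × ℝⁿ → ℝᵖ`:
`a` is smooth and `a ∼ ∑ⱼ b j`, where `b j` is smooth off the zero section and homogeneous of
degree `m - j` in `ξ`. The estimates bound all derivatives `∂_ξ^α ∂_u^β` with `|α| = i`,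
`|β| = l`, locally uniformly in `u`, for `‖ξ‖ ≥ 1`. -/
def IsClassicalSymbol {p n : ℕ} (m : ℂ) (a : Coord p n → ℂ) : Prop :=
  ContDiff ℝ ∞ a ∧ ∃ b : ℕ → Coord p n → ℂ,
    (∀ j, ContDiffOn ℝ ∞ (b j) {q | q.2 ≠ 0}) ∧
    (∀ (j : ℕ) (t : ℝ) (u : EuclideanSpace ℝ (Fin p)) (ξ : EuclideanSpace ℝ (Fin n)),
      0 < t → ξ ≠ 0 → b j (u, t • ξ) = (t : ℂ) ^ (m - j) * b j (u, ξ)) ∧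
    ∀ (k i l : ℕ) (K : Set (EuclideanSpace ℝ (Fin p))), IsCompact K →
      ∃ C : ℝ, ∀ u ∈ K, ∀ ξ : EuclideanSpace ℝ (Fin n), 1 ≤ ‖ξ‖ →
        ‖iteratedFDeriv ℝ i (fun η => iteratedFDeriv ℝ l
            (fun v => a (v, η) - ∑ j ∈ Finset.range k, b j (v, η)) u) ξ‖
          ≤ C * ‖ξ‖ ^ (m.re - k - i)

/-- Fourier transform along the fibres:
`f̂(u, ξ) = ∫ e^{-i⟨x, ξ⟩} f(u, x) dx`. -/
def fibreFourier {p n : ℕ} (f : Coord p n → ℂ) (q : Coord p n) : ℂ :=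
  ∫ x : EuclideanSpace ℝ (Fin n), Complex.exp (-(Complex.I * (inner ℝ x q.2 : ℝ))) * f (q.1, x)

/-- The distribution `P_a(f) = (2π)⁻ⁿ ∫ a(u, ξ) f̂(u, ξ) du dξ`. -/
def oscillatory {p n : ℕ} (a f : Coord p n → ℂ) : ℂ :=
  ((2 * Real.pi : ℝ) : ℂ)⁻¹ ^ n * ∫ q : Coord p n, a q * fibreFourier f q

section Manifold

variable (E : Type*) [NormedAddCommGroup E] [NormedSpace ℝ E]
variable {M : Type*} [TopologicalSpace M] [ChartedSpace E M]
variable {p n : ℕ}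

/-! ### Charts, submanifolds, measures -/

/-- A smooth chart of `M` with values in `ℝᵖ × ℝⁿ`: a diffeomorphism between open sets. -/
def IsSmoothChart (e : OpenPartialHomeomorph M (Coord p n)) : Prop :=
  ContMDiffOn 𝓘(ℝ, E) 𝓘(ℝ, Coord p n) ∞ e e.source ∧
  ContMDiffOn 𝓘(ℝ, Coord p n) 𝓘(ℝ, E) ∞ e.symm e.target

/-- A smooth chart in which `V` is given by the vanishing of the second coordinate. -/
def IsAdaptedChart (V : Set M) (e : OpenPartialHomeomorph M (Coord p n)) : Prop :=
  IsSmoothChart E e ∧ ∀ x ∈ e.source, (x ∈ V ↔ (e x).2 = 0)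

/-- `V` is a closed (embedded, smooth) submanifold of `M` of dimension `p` and codimension `n`. -/
def IsClosedSubmanifold (p n : ℕ) (V : Set M) : Prop :=
  IsClosed V ∧ ∀ x ∈ V, ∃ e : OpenPartialHomeomorph M (Coord p n),
    IsAdaptedChart E V e ∧ x ∈ e.source

/-- `μ` is given by a smooth positive density: in every smooth chart it has a smooth positive
density with respect to Lebesgue measure. (`p + n` is the dimension of `M`.) -/
def IsSmoothMeasure (p n : ℕ) [MeasurableSpace M] (μ : Measure M) : Prop :=
  ∀ e : OpenPartialHomeomorph M (Coord p n), IsSmoothChart E e →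
    ∃ ρ : Coord p n → ℝ, ContDiffOn ℝ ∞ ρ e.target ∧ (∀ y ∈ e.target, 0 < ρ y) ∧
      (μ.restrict e.source).map e =
        ((volume : Measure (Coord p n)).restrict e.target).withDensity
          (fun y => ENNReal.ofReal (ρ y))

/-! ### Distributions -/

variable (M) in
/-- The space `C^∞(M)` of smooth complex valued functions. -/
def SmoothFun : Submodule ℂ (M → ℂ) where
  carrier := {f | ContMDiff 𝓘(ℝ, E) 𝓘(ℝ, ℂ) ∞ f}
  add_mem' hf hg := ContMDiff.add hf hg
  zero_mem' := contMDiff_const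
  smul_mem' c _ hf := ContMDiff.comp (g := fun z : ℂ => c • z)
    ((contDiff_const_smul c).contMDiff) hf

/-- A linear form `Q` on `C^∞(M)` is a compactly supported distribution if it is continuous for
the usual Fréchet topology, i.e. `|Q f|` is bounded by a constant times the maximum of finitely
many of the seminorms `sup_K ‖D^j (f ∘ e⁻¹)‖`, `e` a chart and `K` compact in its target. -/
def IsCompactDistribution (p n : ℕ) (Q : SmoothFun E M →ₗ[ℂ] ℂ) : Prop :=
  ∃ (r N : ℕ) (C : ℝ) (e : Fin r → OpenPartialHomeomorph M (Coord p n))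
    (K : Fin r → Set (Coord p n)),
    (∀ i, IsSmoothChart E (e i) ∧ IsCompact (K i) ∧ K i ⊆ (e i).target) ∧
    ∀ (f : SmoothFun E M) (B : ℝ), 0 ≤ B →
      (∀ i, ∀ j ≤ N, ∀ y ∈ K i, ‖iteratedFDeriv ℝ j (f.1 ∘ (e i).symm) y‖ ≤ B) →
      ‖Q f‖ ≤ C * B

/-- The space `𝓘_c^m(M, V)` of compactly supported (classical) conormal distributions of order
`m`: the distributions which are smooth off `V` and which near every point of `V` are, in an
adapted chart, the sum of an oscillatory integral `P_a` with `a` a classical symbol of order `m`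
and of a smooth function `κ`. Smooth functions are distributions through `μ`. -/
def conormal (p n : ℕ) [MeasurableSpace M] (μ : Measure M) (V : Set M) (m : ℂ) :
    Set (SmoothFun E M →ₗ[ℂ] ℂ) :=
  {Q | IsCompactDistribution E p n Q ∧
    (∀ x ∉ V, ∃ U : Set M, IsOpen U ∧ x ∈ U ∧ ∃ κ : M → ℂ,
      ContMDiffOn 𝓘(ℝ, E) 𝓘(ℝ, ℂ) ∞ κ U ∧
      ∀ f : SmoothFun E M, HasCompactSupport f.1 → tsupport f.1 ⊆ U →
        Q f = ∫ y, κ y * f.1 y ∂μ) ∧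
    ∀ x ∈ V, ∃ e : OpenPartialHomeomorph M (Coord p n), IsAdaptedChart E V e ∧ x ∈ e.source ∧
      ∃ (a : Coord p n → ℂ) (κ : M → ℂ), IsClassicalSymbol m a ∧
        ContMDiffOn 𝓘(ℝ, E) 𝓘(ℝ, ℂ) ∞ κ e.source ∧
        ∀ f : SmoothFun E M, HasCompactSupport f.1 → tsupport f.1 ⊆ e.source →
          Q f = oscillatory a (e.target.indicator (f.1 ∘ e.symm)) + ∫ y, κ y * f.1 y ∂μ}

/-! ### Schwartz functions on the deformation to the normal cone -/

/-- The space `𝓢(M, V)` of Schwartz functions on `DNC₊(M, V) = M × ℝ₊* ⊔ N_V^M`: the smooth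
compactly supported functions on the spherical blow-up `SBlup(M × ℝ, V × {0})` which vanish to
infinite order on the complement of the open subset `DNC₊(M, V)`.

Such a function is determined by its restriction `k` to the dense open subset
`(M × ℝ) \ (V × {0})` of the blow-up, extended here by `0` to `V × {0}`.
* A smooth function on the blow-up vanishes to infinite order on the complement of
  `DNC₊(M, V)` if and only if `k` is zero for `t ≤ 0`, as this complement is the closure of the
  open set `t < 0`.
* The blow-up is the quotient by the free, proper action of `ℝ₊*` of the space
  `DNC₊(M × ℝ, V × {0}) \ (V × {0} × ℝ₊)`. In an adapted chart the latter has coordinates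
  `(u, ξ, τ, s)` with `(ξ, τ) ≠ 0`, `s ≥ 0`, and it is mapped to `M × ℝ` by
  `(u, ξ, τ, s) ↦ ((u, s ξ), s τ)`. So smoothness at the boundary of the blow-up means that
  `k` composed with this map extends smoothly to `s = 0`.
* The blow-up is proper over `M × ℝ`, so the support is compact if and only if its image in
  `M × ℝ` is contained in a compact set. -/
def schwartzDNC (p n : ℕ) (V : Set M) : Set (M → ℝ → ℂ) :=
  {k | (∀ x, ∀ t ≤ 0, k x t = 0) ∧
    ContMDiffOn (𝓘(ℝ, E).prod 𝓘(ℝ, ℝ)) 𝓘(ℝ, ℂ) ∞ (fun q : M × ℝ => k q.1 q.2)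
      {q | ¬ (q.1 ∈ V ∧ q.2 = 0)} ∧
    (∀ e : OpenPartialHomeomorph M (Coord p n), IsAdaptedChart E V e →
      ∃ G : EuclideanSpace ℝ (Fin p) × EuclideanSpace ℝ (Fin n) × ℝ × ℝ → ℂ,
        ContDiffOn ℝ ∞ G {w | (w.2.1, w.2.2.1) ≠ 0 ∧ 0 ≤ w.2.2.2 ∧
          (w.1, w.2.2.2 • w.2.1) ∈ e.target} ∧
        ∀ (u : EuclideanSpace ℝ (Fin p)) (ξ : EuclideanSpace ℝ (Fin n)) (τ s : ℝ),
          (ξ, τ) ≠ 0 → 0 < s → (u, s • ξ) ∈ e.target →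
          G (u, ξ, τ, s) = k (e.symm (u, s • ξ)) (s * τ)) ∧
    ∃ (K : Set M) (T : ℝ), IsCompact K ∧ ∀ x t, k x t ≠ 0 → x ∈ K ∧ t ≤ T}

/-- The pairing `⟨k_t | f⟩` for `t > 0`. The density on the fibre `M × {t}` of the deformation is
`t⁻ⁿ μ`, with `n` the codimension of `V`: in coordinates `(u, ξ) = (u, x / t)` this is the family
which is smooth and nowhere zero up to `t = 0`, where it is a Lebesgue density on the normal
bundle. -/
def pairing (n : ℕ) [MeasurableSpace M] (μ : Measure M) (k : M → ℝ → ℂ) (t : ℝ) (f : M → ℂ) : ℂ :=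
  (t : ℂ)⁻¹ ^ n * ∫ x, k x t * f x ∂μ

/-- The subspace `𝓙(M, V)` of those `k` in `𝓢(M, V)` whose family `(k_t)` vanishes to infinite
order at `t = 0` as a distribution on `M`. -/
def flatSchwartz (p n : ℕ) [MeasurableSpace M] (μ : Measure M) (V : Set M) :
    Set (M → ℝ → ℂ) :=
  {k | k ∈ schwartzDNC E p n V ∧ ∀ f : SmoothFun E M, ∃ h : ℝ → ℂ, ContDiff ℝ ∞ h ∧
    (∀ t, 0 < t → h t = pairing n μ k t f.1) ∧ ∀ j : ℕ, iteratedDeriv j h 0 = 0}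

end Manifold

end Conormal

end

/-!
A point of the blow-up near its exceptional divisor is written `(u, ξ, τ, s)` and lies over
`x = s ξ`, `t = s τ`. With `t = r²`, the Schwartz functions on the deformation to the normal cone
become smooth functions `k(u, r² ξ, r²)` that are even in `r`, and their flatness at the boundary
`τ = 0` becomes rapid decay in `ξ` (`LocalKernel.isRapid_fibreKernel`).

*Mellin integrals are conormal.* Let `χ(u, η, r)` be the Fourier transform of `k(u, r² ξ, r²)` in
`ξ`; it is smooth, even in `r`, and decreases rapidly in `η`. Testing the infinite order of
vanishing of `⟨k_t | f⟩` on `f(u) e^{i⟨x, η⟩ / r²}` shows that `χ(u, w² η, w r)` is divisible by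
every power of `w` (`LocalKernel.IsFlat.exists_dilatedKernel_eq_pow`). So
`B(u, η, r) = 2 ∫ χ(u, w² η, w r) w ^ (-1 - 2 m) dw` converges for every complex `m` and is smooth
off `(η, r) = 0` (`LocalKernel.IsFlat.contDiffOn_mellinKernel`). It is even in `r` and
`B(u, c² η, c r) = c ^ (2 m) B(u, η, r)`; such a function restricts to a classical symbol
`a = B(·, 1)`, whose expansion is the Taylor expansion of `B` in `r²`
(`isClassicalSymbol_of_isQuasiHomogeneous`). Parseval's formula in the fibres, with Fubini's theorem
and the substitution `t = w²`, identifies the Mellin integral of the pairings with `P_a`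
(`LocalKernel.IsFlat.integral_pairing`). Off `V`, where `k` is `O(t^∞)`, the integral of
`k t ^ (-n - 1 - m)` is a smooth density (`integral_pairing_off`).

*Conormal distributions are Mellin integrals.* To a symbol `a` is attached the kernel
`(2π)⁻ⁿ c(t) t ^ m ∫ φ(‖η‖) a(u, η / t) e^{-i⟨x, η⟩ / t} dη` with `φ` supported in `(1, 2)` and
`∫ φ(s) s⁻¹ ds = 1`. By the asymptotic expansion of `a`, the family `t ^ m a(u, η / t)` has, for each
`N`, an extension of class `C^N` to `t = 0` where `η ≠ 0`; since `x / t = ξ / τ`, the kernel lifts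
to the blow-up with class `C^N` (`IsClassicalSymbol.exists_lift_symbolKernel`). All lifts take the
values prescribed for `s > 0`, so that together they are smooth (`exists_contDiffOn_glue`), and
changes of adapted charts lift to the blow-up (`exists_transition_lift`). The kernel at time `t` only
sees frequencies of size `1 / t`, so its pairings with a smooth function are flat at `t = 0`, and
their Mellin integral gives back `P_a` except for bounded frequencies, which contribute a smooth
kernel (`IsClassicalSymbol.oscillatory_eq`). A smooth density `κ` is the Mellin integral of
`κ(x) tⁿ t ^ m φ(t)` (`isMellinForm_integral_mul`). A finite partition of unity near the support
puts the pieces together (`isMellinForm_of_mem_conormal`).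
-/

open Filter Topology

noncomputable section

namespace Conormal

universe u

/-! ### Differentiation under the integral sign -/

section Calculus

variable {X Y F G : Type*} [NormedAddCommGroup X] [NormedSpace ℝ X] [NormedAddCommGroup Y]
  [NormedSpace ℝ Y] [NormedAddCommGroup F] [NormedSpace ℝ F] [NormedAddCommGroup G]
  [NormedSpace ℝ G]

theorem iteratedFDeriv_comp_clm {f : X → F} (g : G →L[ℝ] X) {x : G} {i : ℕ}
    (hf : ContDiffAt ℝ i f (g x)) :
    iteratedFDeriv ℝ i (f ∘ g) x
      = (iteratedFDeriv ℝ i f (g x)).compContinuousLinearMap fun _ => g := by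
  obtain ⟨s, hs, hxs, hfs⟩ := hf.contDiffOn' le_rfl (by simp)
  simp only [insert_eq_of_mem (mem_univ _), univ_inter] at hfs
  have h := g.iteratedFDerivWithin_comp_right hfs hs.uniqueDiffOn
    (hs.preimage g.continuous).uniqueDiffOn hxs le_rfl
  rwa [iteratedFDerivWithin_of_isOpen i (hs.preimage g.continuous) hxs,
    iteratedFDerivWithin_of_isOpen i hs hxs] at h

theorem norm_iteratedFDeriv_comp_clm_le {f : X → F} (g : G →L[ℝ] X) {x : G} {i : ℕ}
    (hf : ContDiffAt ℝ i f (g x)) :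
    ‖iteratedFDeriv ℝ i (f ∘ g) x‖ ≤ ‖iteratedFDeriv ℝ i f (g x)‖ * ‖g‖ ^ i := by
  rw [iteratedFDeriv_comp_clm g hf]
  refine (ContinuousMultilinearMap.norm_compContinuousLinearMap_le _ _).trans ?_
  simp

theorem iteratedFDeriv_partial_left {f : X × Y → F} {x : X} {y : Y} {i : ℕ}
    (hf : ContDiffAt ℝ i f (x, y)) :
    iteratedFDeriv ℝ i (fun v => f (v, y)) x
      = (iteratedFDeriv ℝ i f (x, y)).compContinuousLinearMap
          fun _ => ContinuousLinearMap.inl ℝ X Y := by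
  have h : (fun v => f (v, y)) = (fun z => f (z + (0, y))) ∘ ContinuousLinearMap.inl ℝ X Y := by
    ext v; simp
  have hf' : ContDiffAt ℝ i (fun z => f (z + (0, y))) (ContinuousLinearMap.inl ℝ X Y x) := by
    refine ContDiffAt.comp _ ?_ (contDiff_id.add contDiff_const).contDiffAt
    simpa using hf
  rw [h, iteratedFDeriv_comp_clm _ hf', iteratedFDeriv_comp_add_right]
  simp

theorem iteratedFDeriv_partial_right {f : X × Y → F} {x : X} {y : Y} {i : ℕ}
    (hf : ContDiffAt ℝ i f (x, y)) :
    iteratedFDeriv ℝ i (fun v => f (x, v)) y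
      = (iteratedFDeriv ℝ i f (x, y)).compContinuousLinearMap
          fun _ => ContinuousLinearMap.inr ℝ X Y := by
  have h : (fun v => f (x, v)) = (fun z => f (z + (x, 0))) ∘ ContinuousLinearMap.inr ℝ X Y := by
    ext v; simp
  have hf' : ContDiffAt ℝ i (fun z => f (z + (x, 0))) (ContinuousLinearMap.inr ℝ X Y y) := by
    refine ContDiffAt.comp _ ?_ (contDiff_id.add contDiff_const).contDiffAt
    simpa using hf
  rw [h, iteratedFDeriv_comp_clm _ hf', iteratedFDeriv_comp_add_right]
  simp

theorem norm_inl_pow_le (i : ℕ) : ‖ContinuousLinearMap.inl ℝ X Y‖ ^ i ≤ 1 :=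
  pow_le_one₀ (norm_nonneg _) (ContinuousLinearMap.norm_inl_le_one ℝ X Y)

theorem norm_inr_pow_le (i : ℕ) : ‖ContinuousLinearMap.inr ℝ X Y‖ ^ i ≤ 1 :=
  pow_le_one₀ (norm_nonneg _) (ContinuousLinearMap.norm_inr_le_one ℝ X Y)

theorem norm_iteratedFDeriv_partial_left_le {f : X × Y → F} {x : X} {y : Y} {i : ℕ}
    (hf : ContDiffAt ℝ i f (x, y)) :
    ‖iteratedFDeriv ℝ i (fun v => f (v, y)) x‖ ≤ ‖iteratedFDeriv ℝ i f (x, y)‖ := by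
  rw [iteratedFDeriv_partial_left hf]
  refine (ContinuousMultilinearMap.norm_compContinuousLinearMap_le _ _).trans ?_
  simpa using mul_le_mul_of_nonneg_left (norm_inl_pow_le (X := X) (Y := Y) i)
    (norm_nonneg (iteratedFDeriv ℝ i f (x, y)))

end Calculus

/-- Differentiation under the integral sign, to order `N`, for integrands whose derivatives are
locally dominated. -/
theorem contDiffOn_integral_of_dominated {α : Type*} [MeasurableSpace α] {ν : Measure α}
    {X : Type u} [NormedAddCommGroup X] [NormedSpace ℝ X] {U : Set X} (hU : IsOpen U) (N : ℕ) :
    ∀ {F : Type u} [NormedAddCommGroup F] [NormedSpace ℝ F] {f : X → α → F},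
      (∀ᵐ a ∂ν, ContDiffOn ℝ N (f · a) U) →
      (∀ i ≤ N, ∀ x ∈ U, AEStronglyMeasurable (fun a => iteratedFDeriv ℝ i (f · a) x) ν) →
      (∀ i ≤ N, ∀ x ∈ U, ∃ bound : α → ℝ, Integrable bound ν ∧ ∃ s ∈ 𝓝 x,
        ∀ᵐ a ∂ν, ∀ y ∈ s, ‖iteratedFDeriv ℝ i (f · a) y‖ ≤ bound a) →
      ContDiffOn ℝ N (fun x => ∫ a, f x a ∂ν) U := by
  have meas0 : ∀ {F : Type u} [NormedAddCommGroup F] [NormedSpace ℝ F] {f : X → α → F} {x : X},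
      AEStronglyMeasurable (fun a => iteratedFDeriv ℝ 0 (f · a) x) ν →
      AEStronglyMeasurable (f x) ν := by
    intro F _ _ f x h
    exact (continuousMultilinearCurryFin0 ℝ X F).continuous.comp_aestronglyMeasurable h
  induction N with
  | zero =>
    intro F _ _ f hf hm hb
    rw [Nat.cast_zero, contDiffOn_zero]
    intro x hx
    obtain ⟨bound, hbi, s, hs, hbd⟩ := hb 0 le_rfl x hx
    refine (continuousAt_of_dominated (bound := bound) ?_ ?_ hbi ?_).continuousWithinAt
    · filter_upwards [hU.mem_nhds hx] with y hy using meas0 (hm 0 le_rfl y hy)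
    · filter_upwards [hs] with y hy
      filter_upwards [hbd] with a ha
      simpa using ha y hy
    · filter_upwards [hf] with a ha
      exact ha.continuousOn.continuousAt (hU.mem_nhds hx)
  | succ N ih =>
    intro F _ _ f hf hm hb
    have hf1 : ∀ᵐ a ∂ν, DifferentiableOn ℝ (f · a) U ∧ ContDiffOn ℝ N (fderiv ℝ (f · a)) U := by
      filter_upwards [hf] with a ha
      have := (contDiffOn_succ_iff_fderiv_of_isOpen (n := (N : WithTop ℕ∞)) hU).1 (by simpa using ha)
      exact ⟨this.1, this.2.2⟩
    have hcurry : ∀ (i : ℕ) (x : X) (a : α),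
        iteratedFDeriv ℝ i (fun y => fderiv ℝ (f · a) y) x
          = continuousMultilinearCurryRightEquiv' ℝ i X F
              (iteratedFDeriv ℝ (i + 1) (f · a) x) := by
      intro i x a
      rw [iteratedFDeriv_succ_eq_comp_right]
      simp
    have hm' : ∀ i ≤ N, ∀ x ∈ U, AEStronglyMeasurable
        (fun a => iteratedFDeriv ℝ i (fun y => fderiv ℝ (f · a) y) x) ν := by
      intro i hi x hx
      simp only [hcurry]
      exact (continuousMultilinearCurryRightEquiv' ℝ i X F).continuous.comp_aestronglyMeasurable
        (hm (i + 1) (by omega) x hx)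
    have hder : ∀ x ∈ U, HasFDerivAt (fun x => ∫ a, f x a ∂ν) (∫ a, fderiv ℝ (f · a) x ∂ν) x := by
      intro x hx
      obtain ⟨bound, hbi, s, hs, hbd⟩ := hb 1 (by omega) x hx
      obtain ⟨bound0, hbi0, s0, hs0, hbd0⟩ := hb 0 (by omega) x hx
      refine hasFDerivAt_integral_of_dominated_of_fderiv_le (𝕜 := ℝ) (F := f)
        (F' := fun x a => fderiv ℝ (f · a) x) (bound := bound) (s := s ∩ U)
        (inter_mem hs (hU.mem_nhds hx)) ?_ ?_ ?_ ?_ hbi ?_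
      · filter_upwards [hU.mem_nhds hx] with y hy using meas0 (hm 0 (by omega) y hy)
      · refine hbi0.mono' (meas0 (hm 0 (by omega) x hx)) ?_
        filter_upwards [hbd0] with a ha
        simpa using ha x (mem_of_mem_nhds hs0)
      · exact meas0 (F := X →L[ℝ] F) (f := fun (x : X) (a : α) => fderiv ℝ (f · a) x) (hm' 0 (by omega) x hx)
      · filter_upwards [hbd] with a ha y hy
        simpa [norm_iteratedFDeriv_one] using ha y hy.1
      · filter_upwards [hf1] with a ha y hy
        exact (ha.1.differentiableAt (hU.mem_nhds hy.2)).hasFDerivAt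
    have hN : ((N + 1 : ℕ) : WithTop ℕ∞) = (N : WithTop ℕ∞) + 1 := by simp
    rw [hN, contDiffOn_succ_iff_fderiv_of_isOpen hU]
    refine ⟨fun x hx => (hder x hx).differentiableAt.differentiableWithinAt,
      fun h => absurd h (by simp), ?_⟩
    refine ContDiffOn.congr (f := fun x => ∫ a, fderiv ℝ (f · a) x ∂ν) ?_
      fun x hx => (hder x hx).fderiv
    refine ih (F := X →L[ℝ] F) (f := fun (x : X) (a : α) => fderiv ℝ (f · a) x) (hf1.mono fun a ha => ha.2) hm' ?_
    intro i hi x hx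
    obtain ⟨bound, hbi, s, hs, hbd⟩ := hb (i + 1) (by omega) x hx
    refine ⟨bound, hbi, s, hs, ?_⟩
    filter_upwards [hbd] with a ha y hy
    have := ha y hy
    rwa [← norm_iteratedFDeriv_fderiv] at this

section Joint

variable {𝕜 : Type*} [RCLike 𝕜] {X Y F : Type u} [NormedAddCommGroup X] [NormedSpace ℝ X]
  [NormedAddCommGroup Y] [NormedSpace ℝ Y] [FiniteDimensional ℝ Y] [MeasurableSpace Y]
  [BorelSpace Y] [NormedAddCommGroup F] [NormedSpace ℝ F] [NormedSpace 𝕜 F] [SMulCommClass ℝ 𝕜 F]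
  {ν : Measure Y} {U : Set X} {Ω S : Set Y}

/-- Weighted parametric integrals of a jointly `C^N` integrand; the weight need only be
measurable. -/
theorem contDiffOn_setIntegral_smul (hU : IsOpen U) (hΩ : IsOpen Ω) (hS : MeasurableSet S)
    (hSΩ : S ⊆ Ω) {N : ℕ} {f : X × Y → F} (hf : ContDiffOn ℝ N f (U ×ˢ Ω)) {wt : Y → 𝕜}
    (hwt : AEStronglyMeasurable wt (ν.restrict S))
    (hb : ∀ i ≤ N, ∀ x ∈ U, ∃ bound : Y → ℝ, IntegrableOn (fun y => ‖wt y‖ * bound y) S ν ∧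
      ∃ s ∈ 𝓝 x, ∀ y ∈ S, ∀ x' ∈ s, ‖iteratedFDeriv ℝ i (fun v => f (v, y)) x'‖ ≤ bound y) :
    ContDiffOn ℝ N (fun x => ∫ y in S, wt y • f (x, y) ∂ν) U := by
  have hat : ∀ x ∈ U, ∀ y ∈ Ω, ContDiffAt ℝ N f (x, y) := fun x hx y hy =>
    hf.contDiffAt ((hU.prod hΩ).mem_nhds ⟨hx, hy⟩)
  have hsec : ∀ x ∈ U, ∀ y ∈ Ω, ContDiffAt ℝ N (fun v => f (v, y)) x := fun x hx y hy =>
    ContDiffAt.comp x (hat x hx y hy) (contDiff_id.prodMk contDiff_const).contDiffAt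
  have hsm : ∀ i ≤ N, ∀ x ∈ U, ∀ y ∈ Ω, iteratedFDeriv ℝ i (fun v => wt y • f (v, y)) x
      = wt y • iteratedFDeriv ℝ i (fun v => f (v, y)) x := fun i hi x hx y hy =>
    iteratedFDeriv_const_smul_apply' ((hsec x hx y hy).of_le (by exact_mod_cast hi))
  refine contDiffOn_integral_of_dominated hU N ?_ ?_ ?_
  · refine (ae_restrict_iff' hS).2 (Eventually.of_forall fun y hy x hx => ?_)
    exact ((hsec x hx y (hSΩ hy)).const_smul (wt y)).contDiffWithinAt
  · intro i hi x hx
    have h1 : ContinuousOn (fun y => iteratedFDeriv ℝ i (fun v => f (v, y)) x) Ω := by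
      have : ContinuousOn (fun y => (iteratedFDeriv ℝ i f (x, y)).compContinuousLinearMap
          fun _ => ContinuousLinearMap.inl ℝ X Y) Ω := by
        intro y hy
        have hc : ContinuousAt (iteratedFDeriv ℝ i f) (x, y) :=
          ((hat x hx y hy).iteratedFDeriv_right (m := 0) (by simpa using hi)).continuousAt
        refine ContinuousAt.continuousWithinAt ?_
        refine (ContinuousMultilinearMap.compContinuousLinearMapL
          (F := F) (fun _ : Fin i => ContinuousLinearMap.inl ℝ X Y)).continuous.continuousAt.comp ?_
        exact ContinuousAt.comp (f := fun y => (x, y)) hc (by fun_prop)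
      refine this.congr fun y hy => ?_
      exact iteratedFDeriv_partial_left ((hat x hx y hy).of_le (by exact_mod_cast hi))
    have h2 : AEStronglyMeasurable (fun y => iteratedFDeriv ℝ i (fun v => f (v, y)) x)
        (ν.restrict S) := (h1.mono hSΩ).aestronglyMeasurable hS
    refine (hwt.smul h2).congr ?_
    refine (ae_restrict_iff' hS).2 (Eventually.of_forall fun y hy => ?_)
    exact (hsm i hi x hx y (hSΩ hy)).symm
  · intro i hi x hx
    obtain ⟨bound, hbi, s, hs, hbd⟩ := hb i hi x hx
    refine ⟨_, hbi, s ∩ U, inter_mem hs (hU.mem_nhds hx), ?_⟩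
    refine (ae_restrict_iff' hS).2 (Eventually.of_forall fun y hy x' hx' => ?_)
    rw [hsm i hi x' hx'.2 y (hSΩ hy), norm_smul]
    exact mul_le_mul_of_nonneg_left (hbd y hy x' hx'.1) (norm_nonneg _)

omit [FiniteDimensional ℝ Y] [MeasurableSpace Y] [BorelSpace Y] in
/-- The derivatives of a jointly `C^N` function in one variable are bounded, locally uniformly,
as the other variable runs through a compact set. -/
theorem exists_bound_iteratedFDeriv_partial [FiniteDimensional ℝ X] (hU : IsOpen U)
    (hΩ : IsOpen Ω) {Z : Set Y} (hZ : IsCompact Z) (hZΩ : Z ⊆ Ω) {N : ℕ} {f : X × Y → F}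
    (hf : ContDiffOn ℝ N f (U ×ˢ Ω)) {i : ℕ} (hi : i ≤ N) {x : X} (hx : x ∈ U) :
    ∃ C : ℝ, 0 ≤ C ∧ ∃ s ∈ 𝓝 x, ∀ y ∈ Z, ∀ x' ∈ s,
      ‖iteratedFDeriv ℝ i (fun v => f (v, y)) x'‖ ≤ C := by
  have hat : ∀ x ∈ U, ∀ y ∈ Ω, ContDiffAt ℝ N f (x, y) := fun x hx y hy =>
    hf.contDiffAt ((hU.prod hΩ).mem_nhds ⟨hx, hy⟩)
  obtain ⟨ε, hε, hball⟩ := Metric.nhds_basis_closedBall.mem_iff.1 (hU.mem_nhds hx)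
  have hcomp : IsCompact (Metric.closedBall x ε ×ˢ Z) :=
    (@isCompact_closedBall X _ (FiniteDimensional.proper ℝ X) x ε).prod hZ
  have hcont : ContinuousOn (iteratedFDeriv ℝ i f) (Metric.closedBall x ε ×ˢ Z) := by
    rintro ⟨x', y⟩ ⟨h1, h2⟩
    exact ((hat x' (hball h1) y (hZΩ h2)).iteratedFDeriv_right (m := 0)
      (by simpa using hi)).continuousAt.continuousWithinAt
  obtain ⟨C, hC⟩ := hcomp.exists_bound_of_continuousOn hcont
  refine ⟨max C 0, le_max_right _ _, _, Metric.closedBall_mem_nhds x hε, fun y hy x' hx' => ?_⟩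
  exact (norm_iteratedFDeriv_partial_left_le
    ((hat x' (hball hx') y (hZΩ hy)).of_le (by exact_mod_cast hi))).trans
    ((hC (x', y) ⟨hx', hy⟩).trans (le_max_left _ _))

theorem contDiffOn_setIntegral_smul_of_isCompact [FiniteDimensional ℝ X] (hU : IsOpen U)
    (hΩ : IsOpen Ω) {Z : Set Y} (hZ : IsCompact Z) (hZΩ : Z ⊆ Ω) {N : ℕ} {f : X × Y → F}
    (hf : ContDiffOn ℝ N f (U ×ˢ Ω)) {wt : Y → 𝕜} (hwt : IntegrableOn wt Z ν) :
    ContDiffOn ℝ N (fun x => ∫ y in Z, wt y • f (x, y) ∂ν) U := by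
  refine contDiffOn_setIntegral_smul hU hΩ hZ.measurableSet hZΩ hf hwt.aestronglyMeasurable ?_
  intro i hi x hx
  obtain ⟨C, -, s, hs, hC⟩ := exists_bound_iteratedFDeriv_partial hU hΩ hZ hZΩ hf hi hx
  exact ⟨fun _ => C, hwt.norm.mul_const C, s, hs, hC⟩

end Joint

/-! ### Division by a coordinate -/

section Hadamard

variable {Q F : Type} [NormedAddCommGroup Q] [NormedSpace ℝ Q] [FiniteDimensional ℝ Q]
  [NormedAddCommGroup F] [NormedSpace ℝ F] [CompleteSpace F]

/-- Hadamard's lemma with parameters: on an open set which is star-shaped in the last variable,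
`f(q, s) - f(q, 0)` is smoothly divisible by `s`. -/
theorem exists_contDiffOn_eq_add_smul {Ω : Set (Q × ℝ)} (hΩ : IsOpen Ω)
    (hstar : ∀ x ∈ Ω, ∀ θ ∈ Icc (0 : ℝ) 1, (x.1, θ * x.2) ∈ Ω) {f : Q × ℝ → F}
    (hf : ContDiffOn ℝ ∞ f Ω) :
    ∃ h : Q × ℝ → F, ContDiffOn ℝ ∞ h Ω ∧ ∀ x ∈ Ω, f x = f (x.1, 0) + x.2 • h x := by
  have hfd : ContDiffOn ℝ ∞ (fderiv ℝ f) Ω := hf.fderiv_of_isOpen hΩ (by simp)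
  have hc : Continuous fun z : (Q × ℝ) × ℝ => (z.1.1, z.2 * z.1.2) := by fun_prop
  have hcd : ContDiff ℝ ∞ fun z : (Q × ℝ) × ℝ => (z.1.1, z.2 * z.1.2) := by fun_prop
  refine ⟨fun x => ∫ θ in Icc (0 : ℝ) 1, (1 : ℝ) • fderiv ℝ f (x.1, θ * x.2) (0, 1), ?_, ?_⟩
  · rw [contDiffOn_infty]
    intro N x hx
    obtain ⟨u, v, hu, hv, hxu, hIv, huv⟩ := generalized_tube_lemma (s := {x})
      (t := Icc (0 : ℝ) 1) isCompact_singleton isCompact_Icc (hΩ.preimage hc) (by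
        rintro ⟨x', θ⟩ ⟨rfl, hθ⟩
        exact hstar _ hx θ hθ)
    have := contDiffOn_setIntegral_smul_of_isCompact (𝕜 := ℝ) (ν := volume) (N := N) hu hv
      (Z := Icc (0 : ℝ) 1) isCompact_Icc hIv
      (f := fun z : (Q × ℝ) × ℝ => fderiv ℝ f (z.1.1, z.2 * z.1.2) (0, 1)) ?_
      (wt := fun _ => (1 : ℝ)) (by simp)
    · exact (this.contDiffAt (hu.mem_nhds (hxu rfl))).contDiffWithinAt
    · have h2 := (hfd.of_le (m := N) (by exact_mod_cast le_top)).comp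
        (hcd.of_le (by exact_mod_cast le_top)).contDiffOn (s := u ×ˢ v) huv
      exact h2.clm_apply contDiffOn_const
  · rintro ⟨q, s⟩ hx
    have hder : ∀ θ ∈ uIcc (0 : ℝ) 1,
        HasDerivAt (fun θ : ℝ => f (q, θ * s)) (s • fderiv ℝ f (q, θ * s) (0, 1)) θ := by
      intro θ hθ
      rw [uIcc_of_le zero_le_one] at hθ
      have h1 : HasFDerivAt f (fderiv ℝ f (q, θ * s)) (q, θ * s) :=
        ((hf.differentiableOn (by simp)).differentiableAt
          (hΩ.mem_nhds (hstar _ hx θ hθ))).hasFDerivAt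
      have h2 : HasDerivAt (fun θ : ℝ => (q, θ * s)) ((0 : Q), s) θ := by
        simpa using (hasDerivAt_const θ q).prodMk ((hasDerivAt_id θ).mul_const s)
      have h3 := h1.comp_hasDerivAt θ h2
      have h4 : ((0 : Q), s) = s • ((0 : Q), (1 : ℝ)) := by simp
      rwa [h4, map_smul] at h3
    have hcont : ContinuousOn (fun θ : ℝ => fderiv ℝ f (q, θ * s) (0, 1)) (uIcc 0 1) := by
      intro θ hθ
      rw [uIcc_of_le zero_le_one] at hθ
      have h1 : ContinuousAt (fderiv ℝ f) (q, θ * s) :=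
        hfd.continuousOn.continuousAt (hΩ.mem_nhds (hstar _ hx θ hθ))
      have h2 : ContinuousAt (fun θ : ℝ => fderiv ℝ f (q, θ * s)) θ :=
        ContinuousAt.comp (f := fun θ : ℝ => (q, θ * s)) h1 (by fun_prop)
      exact (h2.clm_apply continuousAt_const).continuousWithinAt
    have hint := intervalIntegral.integral_eq_sub_of_hasDerivAt hder
      (hcont.const_smul s).intervalIntegrable
    rw [intervalIntegral.integral_smul, intervalIntegral.integral_of_le zero_le_one,
      ← integral_Icc_eq_integral_Ioc] at hint
    simp only [one_mul, zero_mul, one_smul] at hint ⊢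
    rw [hint]
    abel

variable {U : Set Q}

/-- Smooth functions that vanish for `s < 0` are smoothly divisible by every power of `s`. -/
theorem exists_contDiffOn_eq_pow_smul_of_neg (hU : IsOpen U) {f : Q × ℝ → F}
    (hf : ContDiffOn ℝ ∞ f (U ×ˢ univ)) (h0 : ∀ q ∈ U, ∀ s < 0, f (q, s) = 0) (N : ℕ) :
    ∃ h : Q × ℝ → F, ContDiffOn ℝ ∞ h (U ×ˢ univ) ∧ (∀ q ∈ U, ∀ s < 0, h (q, s) = 0) ∧
      ∀ q ∈ U, ∀ s, f (q, s) = s ^ N • h (q, s) := by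
  induction N with
  | zero => exact ⟨f, hf, h0, by simp⟩
  | succ N ih =>
    obtain ⟨h, hh, hneg, heq⟩ := ih
    -- the quotient vanishes for `s < 0`, hence also at `s = 0`, and Hadamard divides it once more
    obtain ⟨h', hh', heq'⟩ := exists_contDiffOn_eq_add_smul (hU.prod isOpen_univ)
      (fun x hx θ _ => ⟨hx.1, mem_univ _⟩) hh
    have hz : ∀ q ∈ U, h (q, 0) = 0 := by
      intro q hq
      have hc : ContinuousAt (fun s : ℝ => h (q, s)) 0 :=
        ContinuousAt.comp (f := fun s : ℝ => (q, s))
          (hh.continuousOn.continuousAt ((hU.prod isOpen_univ).mem_nhds ⟨hq, mem_univ _⟩))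
          (by fun_prop)
      have h1 : Tendsto (fun s : ℝ => h (q, s)) (𝓝[<] 0) (𝓝 (h (q, 0))) :=
        hc.tendsto.mono_left nhdsWithin_le_nhds
      have h2 : Tendsto (fun s : ℝ => h (q, s)) (𝓝[<] 0) (𝓝 0) := by
        refine tendsto_const_nhds.congr' ?_
        filter_upwards [self_mem_nhdsWithin] with s hs using (hneg q hq s hs).symm
      exact tendsto_nhds_unique h1 h2
    refine ⟨h', hh', fun q hq s hs => ?_, fun q hq s => ?_⟩
    · have := heq' (q, s) ⟨hq, mem_univ _⟩
      rw [hneg q hq s hs, hz q hq, zero_add] at this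
      exact (smul_eq_zero.1 this.symm).resolve_left hs.ne
    · rw [heq q hq s, heq' (q, s) ⟨hq, mem_univ _⟩, hz q hq, zero_add, smul_smul, pow_succ]

/-- A smooth function that is even in `r` is, up to its value at `r = 0`, smoothly divisible
by `r²`. -/
theorem exists_contDiffOn_eq_add_sq_smul (hU : IsOpen U) {f : Q × ℝ → F}
    (hf : ContDiffOn ℝ ∞ f (U ×ˢ univ)) (heven : ∀ q ∈ U, ∀ r, f (q, -r) = f (q, r)) :
    ∃ h : Q × ℝ → F, ContDiffOn ℝ ∞ h (U ×ˢ univ) ∧ (∀ q ∈ U, ∀ r, h (q, -r) = h (q, r)) ∧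
      ∀ q ∈ U, ∀ r, f (q, r) = f (q, 0) + r ^ 2 • h (q, r) := by
  have hO := hU.prod (isOpen_univ (X := ℝ))
  obtain ⟨h, hh, heq⟩ := exists_contDiffOn_eq_add_smul hO (fun x hx θ _ => ⟨hx.1, mem_univ _⟩) hf
  have hcont : ∀ {g : Q × ℝ → F}, ContDiffOn ℝ ∞ g (U ×ˢ univ) → ∀ q ∈ U,
      Continuous fun s : ℝ => g (q, s) := by
    intro g hg q hq
    refine continuous_iff_continuousAt.2 fun s => ?_
    exact ContinuousAt.comp (f := fun s : ℝ => (q, s))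
      (hg.continuousOn.continuousAt (hO.mem_nhds ⟨hq, mem_univ _⟩)) (by fun_prop)
  -- the quotient `h` of the even function by `r` is odd; so it vanishes at `r = 0` and can be
  -- divided by `r` again
  have hodd' : ∀ q ∈ U, ∀ r, r ≠ 0 → h (q, -r) = -h (q, r) := by
    intro q hq r hr
    have h1 := heq (q, r) ⟨hq, mem_univ _⟩
    have h2 := heq (q, -r) ⟨hq, mem_univ _⟩
    simp only [heven q hq r] at h2
    rw [h1] at h2
    have h3 : r • (h (q, r) + h (q, -r)) = 0 := by
      have := add_left_cancel h2
      rw [smul_add, this]; simp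
    have h4 := (smul_eq_zero.1 h3).resolve_left hr
    exact eq_neg_of_add_eq_zero_right h4
  have hodd : ∀ q ∈ U, ∀ r, h (q, -r) = -h (q, r) := by
    intro q hq r
    have e1 : Continuous fun r : ℝ => h (q, -r) := (hcont hh q hq).comp continuous_neg
    have e2 : Continuous fun r : ℝ => -h (q, r) := (hcont hh q hq).neg
    have := Continuous.ext_on (dense_compl_singleton (0 : ℝ)) e1 e2 fun r hr => hodd' q hq r hr
    exact congrFun this r
  have hz : ∀ q ∈ U, h (q, 0) = 0 := by
    intro q hq
    have := hodd q hq 0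
    rw [neg_zero] at this
    have h2 : (2 : ℝ) • h (q, 0) = 0 := by
      rw [two_smul]; nth_rewrite 1 [this]; simp
    exact (smul_eq_zero.1 h2).resolve_left two_ne_zero
  obtain ⟨h', hh', heq'⟩ := exists_contDiffOn_eq_add_smul hO
    (fun x hx θ _ => ⟨hx.1, mem_univ _⟩) hh
  have heq2 : ∀ q ∈ U, ∀ r, h (q, r) = r • h' (q, r) := by
    intro q hq r
    have := heq' (q, r) ⟨hq, mem_univ _⟩
    simpa [hz q hq] using this
  refine ⟨h', hh', fun q hq r => ?_, fun q hq r => ?_⟩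
  · have e1 : Continuous fun r : ℝ => h' (q, -r) := (hcont hh' q hq).comp continuous_neg
    have := Continuous.ext_on (dense_compl_singleton (0 : ℝ)) e1 (hcont hh' q hq) fun r hr => by
      have h1 := heq2 q hq (-r)
      rw [hodd q hq r, heq2 q hq r, neg_smul, neg_inj] at h1
      exact (smul_right_injective F hr h1).symm
    exact congrFun this r
  · have := heq (q, r) ⟨hq, mem_univ _⟩
    rw [this, heq2 q hq r, smul_smul, sq]

end Hadamard

/-! ### Mixed and joint derivatives -/

section Mixed

variable {X Y : Type u} [NormedAddCommGroup X] [NormedSpace ℝ X] [NormedAddCommGroup Y]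
  [NormedSpace ℝ Y] {O : Set (X × Y)}

section

variable {F : Type u} [NormedAddCommGroup F] [NormedSpace ℝ F] {f : X × Y → F}

theorem contDiffOn_iteratedFDeriv_partial_left (hO : IsOpen O) (hf : ContDiffOn ℝ ∞ f O) (l : ℕ) :
    ContDiffOn ℝ ∞ (fun q : X × Y => iteratedFDeriv ℝ l (fun v => f (v, q.2)) q.1) O := by
  have h1 : ContDiffOn ℝ ∞ (iteratedFDeriv ℝ l f) O := fun q hq =>
    ((hf.contDiffAt (hO.mem_nhds hq)).iteratedFDeriv_right (m := ∞) (by exact_mod_cast le_top)).contDiffWithinAt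
  refine ((ContinuousMultilinearMap.compContinuousLinearMapL
    (F := F) (fun _ : Fin l => ContinuousLinearMap.inl ℝ X Y)).contDiff.comp_contDiffOn h1).congr ?_
  intro q hq
  exact iteratedFDeriv_partial_left
    ((hf.contDiffAt (hO.mem_nhds hq)).of_le (by exact_mod_cast le_top))

theorem fderiv_partial_left {x : X} {y : Y} (hf : DifferentiableAt ℝ f (x, y)) :
    fderiv ℝ (fun v => f (v, y)) x = (fderiv ℝ f (x, y)).comp (ContinuousLinearMap.inl ℝ X Y) :=
  (hf.hasFDerivAt.comp x (hasFDerivAt_prodMk_left x y)).fderiv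

theorem fderiv_partial_right {x : X} {y : Y} (hf : DifferentiableAt ℝ f (x, y)) :
    fderiv ℝ (fun v => f (x, v)) y = (fderiv ℝ f (x, y)).comp (ContinuousLinearMap.inr ℝ X Y) :=
  (hf.hasFDerivAt.comp y (hasFDerivAt_prodMk_right x y)).fderiv

end

omit [NormedSpace ℝ X] [NormedSpace ℝ Y] in
theorem eventually_mem_left (hO : IsOpen O) {x : X} {y : Y} (h : (x, y) ∈ O) :
    ∀ᶠ v in 𝓝 x, (v, y) ∈ O :=
  (Continuous.prodMk_left y).continuousAt.preimage_mem_nhds (hO.mem_nhds h)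

omit [NormedSpace ℝ X] [NormedSpace ℝ Y] in
theorem eventually_mem_right (hO : IsOpen O) {x : X} {y : Y} (h : (x, y) ∈ O) :
    ∀ᶠ v in 𝓝 y, (x, v) ∈ O :=
  (Continuous.prodMk_right x).continuousAt.preimage_mem_nhds (hO.mem_nhds h)

theorem differentiableAt_multilinear_apply {E F : Type*} [NormedAddCommGroup E]
    [NormedSpace ℝ E] [NormedAddCommGroup F] [NormedSpace ℝ F] {l : ℕ} {A : E → X [×l]→L[ℝ] F}
    {x : E} (hA : DifferentiableAt ℝ A x) (m : Fin l → X) :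
    DifferentiableAt ℝ (fun z => A z m) x :=
  ((ContinuousMultilinearMap.apply ℝ (fun _ : Fin l => X) F m).hasFDerivAt.comp x
    hA.hasFDerivAt).differentiableAt

theorem fderiv_multilinear_apply {E F : Type*} [NormedAddCommGroup E] [NormedSpace ℝ E]
    [NormedAddCommGroup F] [NormedSpace ℝ F] {l : ℕ} {A : E → X [×l]→L[ℝ] F} {x : E}
    (hA : DifferentiableAt ℝ A x) (v : E) (m : Fin l → X) :
    fderiv ℝ A x v m = fderiv ℝ (fun z => A z m) x v := by
  have := ((ContinuousMultilinearMap.apply ℝ (fun _ : Fin l => X) F m).hasFDerivAt.comp x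
    hA.hasFDerivAt).fderiv
  exact (congrArg (fun B => B v) this).symm

theorem fderiv_clm_apply_const {E H F : Type*} [NormedAddCommGroup E] [NormedSpace ℝ E]
    [NormedAddCommGroup F] [NormedSpace ℝ F] [NormedAddCommGroup H] [NormedSpace ℝ H]
    {A : E → H →L[ℝ] F} {x : E} (hA : DifferentiableAt ℝ A x) (v : E) (w : H) :
    fderiv ℝ A x v w = fderiv ℝ (fun z => A z w) x v := by
  rw [fderiv_clm_apply hA (differentiableAt_const w)]
  simp

/-- Derivatives in one variable commute with a derivative in the other. -/
theorem iteratedFDeriv_partial_fderiv_comm {F : Type u} [NormedAddCommGroup F] [NormedSpace ℝ F]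
    (hO : IsOpen O) {f : X × Y → F} (hf : ContDiffOn ℝ ∞ f O) (l : ℕ) :
    ∀ x y, (x, y) ∈ O →
      iteratedFDeriv ℝ l (fun v => fderiv ℝ (fun y' => f (v, y')) y) x
        = (fderiv ℝ (fun y' => iteratedFDeriv ℝ l (fun v => f (v, y')) x) y).flipMultilinear := by
  have hT := contDiffOn_iteratedFDeriv_partial_left hO hf
  have hfd : ContDiffOn ℝ ∞ (fderiv ℝ f) O := hf.fderiv_of_isOpen hO (by simp)
  have hs2 : ContDiffOn ℝ ∞ (fun q : X × Y => fderiv ℝ (fun v => f (q.1, v)) q.2) O :=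
    (hfd.clm_comp (contDiffOn_const (c := ContinuousLinearMap.inr ℝ X Y))).congr
      fun q hq => fderiv_partial_right
        ((hf.differentiableOn (by simp)).differentiableAt (hO.mem_nhds hq))
  have hdiff : ∀ l, ∀ q ∈ O, DifferentiableAt ℝ
      (fun q : X × Y => iteratedFDeriv ℝ l (fun v => f (v, q.2)) q.1) q := fun l q hq =>
    ((hT l).differentiableOn (by simp)).differentiableAt (hO.mem_nhds hq)
  have hsec : ∀ l x y, (x, y) ∈ O → DifferentiableAt ℝ
      (fun y' => iteratedFDeriv ℝ l (fun v => f (v, y')) x) y := fun l x y h =>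
    (hdiff l (x, y) h).comp (f := fun y' => (x, y')) y (by fun_prop)
  have hsec1 : ∀ l x y, (x, y) ∈ O → DifferentiableAt ℝ
      (fun x' => iteratedFDeriv ℝ l (fun v => f (v, y)) x') x := fun l x y h =>
    (hdiff l (x, y) h).comp (f := fun x' => (x', y)) x (by fun_prop)
  induction l with
  | zero =>
    intro x y h
    ext m w
    rw [ContinuousLinearMap.flipMultilinear_apply_apply, fderiv_multilinear_apply (hsec 0 x y h)]
    simp
  | succ l ih =>
    intro x y h
    ext m w
    set t : X × Y → F :=
      fun q => iteratedFDeriv ℝ l (fun v => f (v, q.2)) q.1 (Fin.tail m) with ht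
    have htO : ContDiffOn ℝ ∞ t O :=
      (ContinuousMultilinearMap.apply ℝ (fun _ : Fin l => X) F (Fin.tail m)).contDiff.comp_contDiffOn
        (hT l)
    have htd : ∀ q ∈ O, DifferentiableAt ℝ t q := fun q hq =>
      (htO.differentiableOn (by simp)).differentiableAt (hO.mem_nhds hq)
    have htat : ContDiffAt ℝ ∞ t (x, y) := htO.contDiffAt (hO.mem_nhds h)
    have hA : DifferentiableAt ℝ (fderiv ℝ t) (x, y) :=
      (htat.fderiv_right (m := 1) (by rw [one_add_one_eq_two]; exact ENat.LEInfty.out)).differentiableAt (by simp)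
    have hsymm : IsSymmSndFDerivAt ℝ t (x, y) :=
      htat.isSymmSndFDerivAt (by simpa using ENat.LEInfty.out)
    have hdl : DifferentiableAt ℝ
        (fun x' => iteratedFDeriv ℝ l (fun v => fderiv ℝ (fun y' => f (v, y')) y) x') x :=
      (((contDiffOn_iteratedFDeriv_partial_left hO hs2 l).differentiableOn
        (by simp)).differentiableAt (hO.mem_nhds h)).comp (f := fun x' => (x', y)) x (by fun_prop)
    have hL : (fun x' => iteratedFDeriv ℝ l (fun v => fderiv ℝ (fun y' => f (v, y')) y) x'
        (Fin.tail m) w) =ᶠ[𝓝 x] fun x' => fderiv ℝ t (x', y) (0, w) := by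
      filter_upwards [eventually_mem_left hO h] with x' hx'
      rw [ih x' y hx', ContinuousLinearMap.flipMultilinear_apply_apply,
        fderiv_multilinear_apply (hsec l x' y hx')]
      have := fderiv_partial_right (htd _ hx')
      simp only [ht] at this ⊢
      rw [this]
      simp
    have hR : (fun y' => iteratedFDeriv ℝ (l + 1) (fun v => f (v, y')) x m)
        =ᶠ[𝓝 y] fun y' => fderiv ℝ t (x, y') (m 0, 0) := by
      filter_upwards [eventually_mem_right hO h] with y' hy'
      rw [iteratedFDeriv_succ_apply_left, fderiv_multilinear_apply (hsec1 l x y' hy')]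
      have := fderiv_partial_left (htd _ hy')
      simp only [ht] at this ⊢
      rw [this]
      simp
    -- both sides are the second derivative of `t` along `(m 0, 0)` and `(0, w)`
    have hdl2 : DifferentiableAt ℝ (fun x' => iteratedFDeriv ℝ l
        (fun v => fderiv ℝ (fun y' => f (v, y')) y) x' (Fin.tail m)) x :=
      differentiableAt_multilinear_apply hdl _
    rw [ContinuousLinearMap.flipMultilinear_apply_apply,
      fderiv_multilinear_apply (hsec (l + 1) x y h), iteratedFDeriv_succ_apply_left,
      fderiv_multilinear_apply hdl, fderiv_clm_apply_const hdl2, hL.fderiv_eq, hR.fderiv_eq]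
    have hA1 : DifferentiableAt ℝ (fun x' => fderiv ℝ t (x', y)) x :=
      DifferentiableAt.comp (f := fun x' => (x', y)) x hA (by fun_prop)
    have hA2 : DifferentiableAt ℝ (fun y' => fderiv ℝ t (x, y')) y :=
      DifferentiableAt.comp (f := fun y' => (x, y')) y hA (by fun_prop)
    rw [← fderiv_clm_apply_const hA1, ← fderiv_clm_apply_const hA2, fderiv_partial_left hA,
      fderiv_partial_right hA]
    simp only [ContinuousLinearMap.comp_apply, ContinuousLinearMap.inl_apply,
      ContinuousLinearMap.inr_apply]
    rw [hsymm.eq]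

theorem norm_iteratedFDeriv_linearMap_comp_le {E E₁ E₂ : Type*} [NormedAddCommGroup E]
    [NormedSpace ℝ E] [NormedAddCommGroup E₁] [NormedSpace ℝ E₁] [NormedAddCommGroup E₂]
    [NormedSpace ℝ E₂] (φ : E₁ →ₗ[ℝ] E₂) (hφ : ∀ z, ‖φ z‖ ≤ ‖z‖) {S : E → E₁} {y : E} {i : ℕ}
    (hS : ContDiffAt ℝ i S y) :
    ‖iteratedFDeriv ℝ i (fun z => φ (S z)) y‖ ≤ ‖iteratedFDeriv ℝ i S y‖ := by
  have h := (φ.mkContinuous 1 (by simpa using hφ)).norm_iteratedFDeriv_comp_left hS le_rfl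
  refine h.trans (mul_le_of_le_one_left (norm_nonneg _) ?_)
  exact φ.mkContinuous_norm_le zero_le_one _

theorem norm_flipMultilinear_le {F : Type u} [NormedAddCommGroup F] [NormedSpace ℝ F] {l : ℕ}
    (A : Y →L[ℝ] (X [×l]→L[ℝ] F)) : ‖A.flipMultilinear‖ ≤ ‖A‖ := by
  refine ContinuousMultilinearMap.opNorm_le_bound (ContinuousLinearMap.opNorm_nonneg A) fun m => ?_
  refine ContinuousLinearMap.opNorm_le_bound _ (mul_nonneg (ContinuousLinearMap.opNorm_nonneg A)
    (by positivity)) fun w => ?_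
  rw [ContinuousLinearMap.flipMultilinear_apply_apply]
  calc ‖A w m‖ ≤ ‖A w‖ * ∏ i, ‖m i‖ := (A w).le_opNorm m
    _ ≤ ‖A‖ * ‖w‖ * ∏ i, ‖m i‖ := by gcongr; exact A.le_opNorm w
    _ = _ := by ring

/-- Bounds on all mixed derivatives `D_y^i D_x^l f` with `i + l = N` control the joint derivative
of order `N`. -/
theorem exists_norm_iteratedFDeriv_le_of_mixed (hO : IsOpen O) (N : ℕ) :
    ∀ (F : Type u) [NormedAddCommGroup F] [NormedSpace ℝ F], ∃ C : ℝ, 0 ≤ C ∧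
      ∀ f : X × Y → F, ContDiffOn ℝ ∞ f O → ∀ x y, (x, y) ∈ O → ∀ B : ℝ,
        (∀ i l, i + l = N →
          ‖iteratedFDeriv ℝ i (fun y' => iteratedFDeriv ℝ l (fun v => f (v, y')) x) y‖ ≤ B) →
        ‖iteratedFDeriv ℝ N f (x, y)‖ ≤ C * B := by
  induction N with
  | zero =>
    intro F _ _
    refine ⟨1, zero_le_one, fun f _ x y _ B hB => ?_⟩
    have := hB 0 0 rfl
    simpa using this
  | succ N ih =>
    intro F _ _
    obtain ⟨C1, hC1, h1⟩ := ih (X →L[ℝ] F)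
    obtain ⟨C2, hC2, h2⟩ := ih (Y →L[ℝ] F)
    let L1 := (ContinuousLinearMap.compL ℝ (X × Y) X F).flip (ContinuousLinearMap.fst ℝ X Y)
    let L2 := (ContinuousLinearMap.compL ℝ (X × Y) Y F).flip (ContinuousLinearMap.snd ℝ X Y)
    refine ⟨‖L1‖ * C1 + ‖L2‖ * C2, by positivity, fun f hf x y hxy B hB => ?_⟩
    have hB0 : 0 ≤ B := (norm_nonneg _).trans (hB 0 (N + 1) (by omega))
    have hfd : ContDiffOn ℝ ∞ (fderiv ℝ f) O := hf.fderiv_of_isOpen hO (by simp)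
    have hdiff : ∀ q ∈ O, DifferentiableAt ℝ f q := fun q hq =>
      (hf.differentiableOn (by simp)).differentiableAt (hO.mem_nhds hq)
    -- split `D f` into the two partial differentials and apply the case `N` to each of them
    set f1 : X × Y → X →L[ℝ] F := fun q => fderiv ℝ (fun v => f (v, q.2)) q.1 with hf1
    set f2 : X × Y → Y →L[ℝ] F := fun q => fderiv ℝ (fun v => f (q.1, v)) q.2 with hf2
    have hs1 : ContDiffOn ℝ ∞ f1 O :=
      (hfd.clm_comp (contDiffOn_const (c := ContinuousLinearMap.inl ℝ X Y))).congr
        fun q hq => fderiv_partial_left (hdiff q hq)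
    have hs2 : ContDiffOn ℝ ∞ f2 O :=
      (hfd.clm_comp (contDiffOn_const (c := ContinuousLinearMap.inr ℝ X Y))).congr
        fun q hq => fderiv_partial_right (hdiff q hq)
    have hat1 : ContDiffAt ℝ N f1 (x, y) :=
      (hs1.contDiffAt (hO.mem_nhds hxy)).of_le (by exact_mod_cast le_top)
    have hat2 : ContDiffAt ℝ N f2 (x, y) :=
      (hs2.contDiffAt (hO.mem_nhds hxy)).of_le (by exact_mod_cast le_top)
    have hsplit : fderiv ℝ f =ᶠ[𝓝 (x, y)] (L1 ∘ f1) + (L2 ∘ f2) := by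
      filter_upwards [hO.mem_nhds hxy] with q hq
      refine ContinuousLinearMap.ext fun v => ?_
      have e1 : f1 q = _ := fderiv_partial_left (hdiff q hq)
      have e2 : f2 q = _ := fderiv_partial_right (hdiff q hq)
      simp [L1, L2, e1, e2, ← map_add]
    have hb1 : ‖iteratedFDeriv ℝ N f1 (x, y)‖ ≤ C1 * B := by
      refine h1 f1 hs1 x y hxy B fun i l hil => ?_
      have : (fun y' => iteratedFDeriv ℝ l (fun v => f1 (v, y')) x)
          = (continuousMultilinearCurryRightEquiv' ℝ l X F) ∘
            fun y' => iteratedFDeriv ℝ (l + 1) (fun v => f (v, y')) x := by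
        ext1 y'
        simp only [Function.comp_apply]
        rw [iteratedFDeriv_succ_eq_comp_right]
        simp [hf1]
      rw [this, LinearIsometryEquiv.norm_iteratedFDeriv_comp_left]
      exact hB i (l + 1) (by omega)
    have hb2 : ‖iteratedFDeriv ℝ N f2 (x, y)‖ ≤ C2 * B := by
      refine h2 f2 hs2 x y hxy _ fun i l hil => ?_
      have hev : (fun y' => iteratedFDeriv ℝ l (fun v => f2 (v, y')) x) =ᶠ[𝓝 y]
          fun z => ContinuousLinearMap.flipMultilinearEquivₗ ℝ (fun _ : Fin l => X) Y F
            (fderiv ℝ (fun y' => iteratedFDeriv ℝ l (fun v => f (v, y')) x) z) := by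
        filter_upwards [eventually_mem_right hO hxy] with y' hy'
        exact iteratedFDeriv_partial_fderiv_comm hO hf l x y' hy'
      have hS : ContDiffAt ℝ ∞ (fun y' => iteratedFDeriv ℝ l (fun v => f (v, y')) x) y :=
        ContDiffAt.comp y ((contDiffOn_iteratedFDeriv_partial_left hO hf l).contDiffAt
          (hO.mem_nhds hxy)) (contDiff_const.prodMk contDiff_id).contDiffAt
      rw [(Filter.EventuallyEq.iteratedFDeriv ℝ hev i).eq_of_nhds]
      refine (norm_iteratedFDeriv_linearMap_comp_le _ norm_flipMultilinear_le
        ((hS.fderiv_right (m := i) (by exact_mod_cast le_top)))).trans ?_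
      rw [norm_iteratedFDeriv_fderiv]
      exact hB (i + 1) l (by omega)
    rw [← norm_iteratedFDeriv_fderiv, (Filter.EventuallyEq.iteratedFDeriv ℝ hsplit N).eq_of_nhds,
      iteratedFDeriv_add_apply (L1.contDiff.contDiffAt.comp _ hat1)
        (L2.contDiff.contDiffAt.comp _ hat2)]
    refine (norm_add_le _ _).trans ?_
    have e1 := L1.norm_iteratedFDeriv_comp_left hat1 le_rfl
    have e2 := L2.norm_iteratedFDeriv_comp_left hat2 le_rfl
    calc _ ≤ ‖L1‖ * (C1 * B) + ‖L2‖ * (C2 * B) :=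
          add_le_add (e1.trans (by gcongr)) (e2.trans (by gcongr))
      _ = _ := by ring

theorem norm_iteratedFDeriv_iteratedFDeriv {E : Type u} [NormedAddCommGroup E] [NormedSpace ℝ E]
    {x : E} (j l : ℕ) : ∀ {F : Type u} [NormedAddCommGroup F] [NormedSpace ℝ F] {f : E → F},
    ‖iteratedFDeriv ℝ j (iteratedFDeriv ℝ l f) x‖ = ‖iteratedFDeriv ℝ (j + l) f x‖ := by
  induction l with
  | zero =>
    intro F _ _ f
    have : iteratedFDeriv ℝ 0 f = (continuousMultilinearCurryFin0 ℝ E F).symm ∘ f := rfl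
    rw [this, LinearIsometryEquiv.norm_iteratedFDeriv_comp_left]; rfl
  | succ l ih =>
    intro F _ _ f
    have : iteratedFDeriv ℝ l (fderiv ℝ f)
        = continuousMultilinearCurryRightEquiv' ℝ l E F ∘ iteratedFDeriv ℝ (l + 1) f := by
      ext1 y
      simp only [Function.comp_apply]
      rw [iteratedFDeriv_succ_eq_comp_right]
      simp
    have h2 : ‖iteratedFDeriv ℝ j (iteratedFDeriv ℝ l (fderiv ℝ f)) x‖
        = ‖iteratedFDeriv ℝ j (iteratedFDeriv ℝ (l + 1) f) x‖ := by
      rw [this, LinearIsometryEquiv.norm_iteratedFDeriv_comp_left]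
    rw [← h2, ih, norm_iteratedFDeriv_fderiv, show j + l + 1 = j + (l + 1) by omega]

/-- Mixed derivatives are bounded by the joint derivative of the same order. -/
theorem norm_mixed_iteratedFDeriv_le {F : Type u} [NormedAddCommGroup F] [NormedSpace ℝ F]
    (hO : IsOpen O) {f : X × Y → F} (hf : ContDiffOn ℝ ∞ f O) {x : X} {y : Y} (h : (x, y) ∈ O)
    (i l : ℕ) :
    ‖iteratedFDeriv ℝ i (fun y' => iteratedFDeriv ℝ l (fun v => f (v, y')) x) y‖
      ≤ ‖iteratedFDeriv ℝ (i + l) f (x, y)‖ := by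
  have hD : ContDiffOn ℝ ∞ (iteratedFDeriv ℝ l f) O := fun q hq =>
    ((hf.contDiffAt (hO.mem_nhds hq)).iteratedFDeriv_right (m := ∞) (by exact_mod_cast le_top)).contDiffWithinAt
  have hDat := hD.contDiffAt (hO.mem_nhds h)
  let Ψ := ContinuousMultilinearMap.compContinuousLinearMapL
    (F := F) (fun _ : Fin l => ContinuousLinearMap.inl ℝ X Y)
  have hΨ : ‖Ψ‖ ≤ 1 := by
    refine ContinuousLinearMap.opNorm_le_bound _ zero_le_one fun A => ?_
    refine (ContinuousMultilinearMap.norm_compContinuousLinearMap_le _ _).trans ?_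
    rw [mul_comm]
    simpa using mul_le_mul_of_nonneg_right (norm_inl_pow_le (X := X) (Y := Y) l) (norm_nonneg A)
  have hev : (fun y' => iteratedFDeriv ℝ l (fun v => f (v, y')) x) =ᶠ[𝓝 y]
      Ψ ∘ fun y' => iteratedFDeriv ℝ l f (x, y') := by
    filter_upwards [eventually_mem_right hO h] with y' hy'
    exact iteratedFDeriv_partial_left
      ((hf.contDiffAt (hO.mem_nhds hy')).of_le (by exact_mod_cast le_top))
  rw [(Filter.EventuallyEq.iteratedFDeriv ℝ hev i).eq_of_nhds]
  have hsec : ContDiffAt ℝ i (fun y' => iteratedFDeriv ℝ l f (x, y')) y :=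
    ContDiffAt.comp y (hDat.of_le (by exact_mod_cast le_top))
      (contDiff_const.prodMk contDiff_id).contDiffAt
  refine (Ψ.norm_iteratedFDeriv_comp_left hsec le_rfl).trans ?_
  refine (mul_le_of_le_one_left (norm_nonneg _) hΨ).trans ?_
  rw [← norm_iteratedFDeriv_iteratedFDeriv, iteratedFDeriv_partial_right (hDat.of_le (by exact_mod_cast le_top))]
  refine (ContinuousMultilinearMap.norm_compContinuousLinearMap_le _ _).trans ?_
  simpa using mul_le_mul_of_nonneg_left (norm_inr_pow_le (X := X) (Y := Y) i)
    (norm_nonneg (iteratedFDeriv ℝ i (iteratedFDeriv ℝ l f) (x, y)))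

end Mixed

/-! ### Dilated families of decaying functions -/

section Dilation

variable {P Z : Type u} [NormedAddCommGroup P] [NormedSpace ℝ P] [FiniteDimensional ℝ P]
  [NormedAddCommGroup Z] [NormedSpace ℝ Z]

/-- The family `τ ^ (-z) r(p, ζ / τ)`, extended by `0` to `τ ≤ 0`. -/
def dilated {F : Type*} [NormedAddCommGroup F] [NormedSpace ℂ F] (z : ℂ) (r : P × Z → F)
    (x : P × Z × ℝ) : F :=
  if 0 < x.2.2 then (x.2.2 : ℂ) ^ (-z) • r (x.1, x.2.2⁻¹ • x.2.1) else 0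

/-- All derivatives of `r` of order at most `N` are `O(‖ζ‖ ^ (-M))`, locally uniformly in `p`. -/
def DecaysAt {F : Type*} [NormedAddCommGroup F] [NormedSpace ℝ F] (N : ℕ) (M : ℝ)
    (r : P × Z → F) : Prop :=
  ∀ K : Set P, IsCompact K → ∃ C : ℝ, ∀ p ∈ K, ∀ ζ : Z, 1 ≤ ‖ζ‖ → ∀ j ≤ N,
    ‖iteratedFDeriv ℝ j r (p, ζ)‖ ≤ C * ‖ζ‖ ^ (-M)

omit [NormedSpace ℝ P] [FiniteDimensional ℝ P] [NormedSpace ℝ Z] in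
theorem isOpen_snd_ne_zero : IsOpen {q : P × Z | q.2 ≠ 0} :=
  isOpen_compl_singleton.preimage continuous_snd

omit [NormedSpace ℝ P] [FiniteDimensional ℝ P] [NormedSpace ℝ Z] in
theorem isOpen_snd_fst_ne_zero : IsOpen {x : P × Z × ℝ | x.2.1 ≠ 0} :=
  isOpen_compl_singleton.preimage (continuous_fst.comp continuous_snd)

/-- The dilated family vanishes to second order at `τ ≤ 0`, `ζ ≠ 0`, so that it is differentiable
there with derivative `0`. -/
theorem dilated_isBigO {F : Type*} [NormedAddCommGroup F] [NormedSpace ℂ F] {N : ℕ} {M : ℝ}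
    {z : ℂ} {r : P × Z → F} (hr : DecaysAt N M r) (hM : z.re + 2 ≤ M) {x₀ : P × Z × ℝ}
    (hx : x₀.2.1 ≠ 0) (hτ : x₀.2.2 ≤ 0) :
    dilated z r =O[𝓝 x₀] fun x => ‖x - x₀‖ ^ 2 := by
  obtain ⟨p₀, ζ₀, τ₀⟩ := x₀
  simp only at hx hτ
  have hpos : 0 < ‖ζ₀‖ := norm_pos_iff.2 hx
  have := FiniteDimensional.proper ℝ P
  obtain ⟨C, hC⟩ := hr _ (isCompact_closedBall p₀ 1)
  have hcont : ContinuousAt (fun x : P × Z × ℝ => ‖x.2.1‖ ^ (-M)) (p₀, ζ₀, τ₀) := by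
    refine ContinuousAt.rpow_const ?_ (Or.inl hpos.ne')
    fun_prop
  have hb : ∀ᶠ x : P × Z × ℝ in 𝓝 (p₀, ζ₀, τ₀), ‖x.2.1‖ ^ (-M) < ‖ζ₀‖ ^ (-M) + 1 :=
    hcont.eventually_lt continuousAt_const (by simp)
  have h1 : ∀ᶠ x : P × Z × ℝ in 𝓝 (p₀, ζ₀, τ₀), x.1 ∈ Metric.closedBall p₀ 1 :=
    continuous_fst.continuousAt.preimage_mem_nhds (Metric.closedBall_mem_nhds p₀ one_pos)
  have h2 : ∀ᶠ x : P × Z × ℝ in 𝓝 (p₀, ζ₀, τ₀), ‖ζ₀‖ / 2 < ‖x.2.1‖ :=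
    ContinuousAt.eventually_lt continuousAt_const (by fun_prop) (by simpa using half_lt_self hpos)
  have h3 : ∀ᶠ x : P × Z × ℝ in 𝓝 (p₀, ζ₀, τ₀), x.2.2 < min 1 (‖ζ₀‖ / 2) :=
    ContinuousAt.eventually_lt (by fun_prop) continuousAt_const
      (lt_of_le_of_lt hτ (lt_min one_pos (half_pos hpos)))
  refine Asymptotics.IsBigO.of_bound (|C| * (‖ζ₀‖ ^ (-M) + 1)) ?_
  filter_upwards [hb, h1, h2, h3] with x hxb hx1 hx2 hx3
  obtain ⟨p, ζ, τ⟩ := x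
  simp only at hxb hx1 hx2 hx3
  have hnn : (0 : ℝ) ≤ ‖ζ₀‖ ^ (-M) := Real.rpow_nonneg hpos.le _
  by_cases hτp : 0 < τ
  · have ht1 : τ ≤ 1 := (hx3.trans_le (min_le_left _ _)).le
    have ht2 : τ ≤ ‖ζ‖ := ((hx3.trans_le (min_le_right _ _)).trans hx2).le
    -- so the decay of `r` applies: `τ ^ (-Re z) ‖ζ / τ‖ ^ (-M) = O(τ ^ (M - Re z)) = O(τ²)`
    have hζ : 1 ≤ ‖τ⁻¹ • ζ‖ := by
      rw [norm_smul, norm_inv, Real.norm_of_nonneg hτp.le, inv_mul_eq_div]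
      exact (one_le_div hτp).2 ht2
    have hr0 := hC p hx1 (τ⁻¹ • ζ) hζ 0 (Nat.zero_le _)
    rw [norm_iteratedFDeriv_zero] at hr0
    have hn : ‖τ⁻¹ • ζ‖ ^ (-M) = τ ^ M * ‖ζ‖ ^ (-M) := by
      rw [norm_smul, norm_inv, Real.norm_of_nonneg hτp.le, Real.mul_rpow (by positivity)
        (norm_nonneg _), Real.rpow_neg (inv_nonneg.2 hτp.le), Real.inv_rpow hτp.le, inv_inv]
    have hτd : τ ≤ ‖(p, ζ, τ) - (p₀, ζ₀, τ₀)‖ := by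
      have e1 : ‖τ - τ₀‖ ≤ ‖(p, ζ, τ) - (p₀, ζ₀, τ₀)‖ :=
        (norm_snd_le ((ζ, τ) - (ζ₀, τ₀))).trans (norm_snd_le ((p, ζ, τ) - (p₀, ζ₀, τ₀)))
      rw [Real.norm_eq_abs] at e1
      linarith [le_abs_self (τ - τ₀)]
    have hpow : τ ^ (-z.re) * τ ^ M ≤ τ ^ 2 := by
      rw [← Real.rpow_add hτp, ← Real.rpow_natCast]
      exact Real.rpow_le_rpow_of_exponent_ge hτp ht1 (by push_cast; linarith)
    simp only [dilated, hτp, if_true, norm_smul]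
    rw [Complex.norm_cpow_eq_rpow_re_of_pos hτp, Complex.neg_re, norm_pow, norm_norm]
    calc τ ^ (-z.re) * ‖r (p, τ⁻¹ • ζ)‖ ≤ τ ^ (-z.re) * (|C| * (τ ^ M * ‖ζ‖ ^ (-M))) := by
          refine mul_le_mul_of_nonneg_left (hr0.trans ?_) (Real.rpow_nonneg hτp.le _)
          rw [hn]
          exact mul_le_mul_of_nonneg_right (le_abs_self C)
            (mul_nonneg (Real.rpow_nonneg hτp.le _) (Real.rpow_nonneg (norm_nonneg _) _))
      _ = |C| * ‖ζ‖ ^ (-M) * (τ ^ (-z.re) * τ ^ M) := by ring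
      _ ≤ |C| * (‖ζ₀‖ ^ (-M) + 1) * ‖(p, ζ, τ) - (p₀, ζ₀, τ₀)‖ ^ 2 := by
          refine mul_le_mul (by gcongr) (hpow.trans (by gcongr)) ?_ (by positivity)
          exact mul_nonneg (Real.rpow_nonneg hτp.le _) (Real.rpow_nonneg hτp.le _)
  · simp only [dilated, hτp, if_false, norm_zero]
    positivity

/-- The linear map `(dp, dζ, dτ) ↦ (τ² dp, τ dζ - dτ ζ)`, which is `τ²` times the derivative of
`(p, ζ, τ) ↦ (p, ζ / τ)`. -/
def dilatedMap (x : P × Z × ℝ) : P × Z × ℝ →L[ℝ] P × Z :=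
  (x.2.2 ^ 2 • ContinuousLinearMap.fst ℝ P (Z × ℝ)).prod
    (x.2.2 • (ContinuousLinearMap.fst ℝ Z ℝ).comp (ContinuousLinearMap.snd ℝ P (Z × ℝ))
      - ((ContinuousLinearMap.snd ℝ Z ℝ).comp (ContinuousLinearMap.snd ℝ P (Z × ℝ))).smulRight x.2.1)

omit [FiniteDimensional ℝ P] in
theorem contDiff_dilatedMap : ContDiff ℝ ∞ (dilatedMap : P × Z × ℝ → _) := by
  unfold dilatedMap
  have h1 : ContDiff ℝ ∞ fun x : P × Z × ℝ =>
      ((ContinuousLinearMap.snd ℝ Z ℝ).comp (ContinuousLinearMap.snd ℝ P (Z × ℝ))).smulRight x.2.1 :=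
    (ContinuousLinearMap.smulRightL ℝ (P × Z × ℝ) Z ((ContinuousLinearMap.snd ℝ Z ℝ).comp
      (ContinuousLinearMap.snd ℝ P (Z × ℝ)))).contDiff.comp (by fun_prop)
  have h2 : ContDiff ℝ ∞ fun x : P × Z × ℝ =>
      x.2.2 ^ 2 • ContinuousLinearMap.fst ℝ P (Z × ℝ) := by fun_prop
  have h3 : ContDiff ℝ ∞ fun x : P × Z × ℝ => x.2.2 • (ContinuousLinearMap.fst ℝ Z ℝ).comp
      (ContinuousLinearMap.snd ℝ P (Z × ℝ)) := by fun_prop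
  exact (ContinuousLinearMap.prodₗᵢ ℝ (𝕜 := ℝ) (E := P × Z × ℝ) (F := P) (G := Z)
    ).toContinuousLinearEquiv.contDiff.comp (h2.prodMk (h3.sub h1))

omit [FiniteDimensional ℝ P] in
theorem hasFDerivAt_dilated {F : Type*} [NormedAddCommGroup F] [NormedSpace ℂ F] {z : ℂ}
    {r : P × Z → F} {x : P × Z × ℝ} (hτ : 0 < x.2.2)
    (hr : DifferentiableAt ℝ r (x.1, x.2.2⁻¹ • x.2.1)) :
    HasFDerivAt (dilated z r)
      ((dilated (z + 2) (fderiv ℝ r) x).comp (dilatedMap x)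
        - ((ContinuousLinearMap.snd ℝ Z ℝ).comp (ContinuousLinearMap.snd ℝ P (Z × ℝ))).smulRight
          (z • dilated (z + 1) r x)) x := by
  obtain ⟨p, ζ, τ⟩ := x
  simp only at hτ hr
  have hev : dilated z r =ᶠ[𝓝 (p, ζ, τ)]
      fun x => (x.2.2 : ℂ) ^ (-z) • r (x.1, x.2.2⁻¹ • x.2.1) := by
    have : ∀ᶠ x : P × Z × ℝ in 𝓝 (p, ζ, τ), 0 < x.2.2 :=
      ContinuousAt.eventually_lt continuousAt_const (by fun_prop) hτ
    filter_upwards [this] with x hx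
    simp [dilated, hx]
  refine HasFDerivAt.congr_of_eventuallyEq ?_ hev
  have hsnd : HasFDerivAt (fun x : P × Z × ℝ => x.2.2)
      ((ContinuousLinearMap.snd ℝ Z ℝ).comp (ContinuousLinearMap.snd ℝ P (Z × ℝ))) (p, ζ, τ) :=
    ((ContinuousLinearMap.snd ℝ Z ℝ).comp (ContinuousLinearMap.snd ℝ P (Z × ℝ))).hasFDerivAt
  have hpow : HasDerivAt (fun y : ℝ => (y : ℂ) ^ (-z)) (-z * (τ : ℂ) ^ (-z - 1)) τ := by
    have h := (hasDerivAt_id (τ : ℂ)).cpow_const (c := -z) (Or.inl (by simpa using hτ))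
    simpa using h.comp_ofReal
  have hpow' := hpow.hasFDerivAt.comp _ hsnd
  have hinv : HasFDerivAt (fun x : P × Z × ℝ => x.2.2⁻¹) _ (p, ζ, τ) :=
    (hasDerivAt_inv hτ.ne').hasFDerivAt.comp (p, ζ, τ) hsnd
  have hfst : HasFDerivAt (fun x : P × Z × ℝ => x.2.1)
      ((ContinuousLinearMap.fst ℝ Z ℝ).comp (ContinuousLinearMap.snd ℝ P (Z × ℝ))) (p, ζ, τ) :=
    ((ContinuousLinearMap.fst ℝ Z ℝ).comp (ContinuousLinearMap.snd ℝ P (Z × ℝ))).hasFDerivAt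
  have hinner : HasFDerivAt (fun x : P × Z × ℝ => (x.1, x.2.2⁻¹ • x.2.1)) _ (p, ζ, τ) :=
    (ContinuousLinearMap.fst ℝ P (Z × ℝ)).hasFDerivAt.prodMk (hinv.smul hfst)
  have hcomp : HasFDerivAt (fun x : P × Z × ℝ => r (x.1, x.2.2⁻¹ • x.2.1)) _ (p, ζ, τ) :=
    HasFDerivAt.comp (f := fun x : P × Z × ℝ => (x.1, x.2.2⁻¹ • x.2.1)) (p, ζ, τ)
      hr.hasFDerivAt hinner
  have htot := hpow'.smul hcomp
  refine htot.congr_fderiv ?_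
  refine ContinuousLinearMap.ext fun v => ?_
  obtain ⟨dp, dζ, dτ⟩ := v
  have hτc : (τ : ℂ) ≠ 0 := by exact_mod_cast hτ.ne'
  have e1 : (τ : ℂ) ^ (-(z + 1)) = (τ : ℂ) ^ (-z - 1) := by ring_nf
  have e2 : (τ : ℂ) ^ (-z) = (τ : ℂ) ^ (-(z + 2)) * (τ : ℂ) ^ 2 := by
    rw [← Complex.cpow_natCast, ← Complex.cpow_add _ _ hτc]; congr 1; push_cast; ring
  have e3 : fderiv ℝ r (p, τ⁻¹ • ζ) (τ ^ 2 • dp, τ • dζ - dτ • ζ)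
      = (τ ^ 2) • fderiv ℝ r (p, τ⁻¹ • ζ) (dp, τ⁻¹ • dζ - (dτ * (τ ^ 2)⁻¹) • ζ) := by
    rw [← map_smul]
    congr 1
    ext
    · simp
    · have : τ ^ 2 * τ⁻¹ = τ := by field_simp
      have h' : τ ^ 2 * (dτ * (τ ^ 2)⁻¹) = dτ := by field_simp
      simp [smul_sub, smul_smul, this, h']
  simp only [dilated, hτ, if_true, dilatedMap, _root_.sub_apply,
    ContinuousLinearMap.comp_apply, ContinuousLinearMap.smulRight_apply,
    _root_.add_apply, _root_.smul_apply, ContinuousLinearMap.prod_apply,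
    ContinuousLinearMap.coe_fst', ContinuousLinearMap.coe_snd', e3]
  have a1 : (ContinuousLinearMap.toSpanSingleton ℝ (-(τ ^ 2)⁻¹)) dτ • ζ
      = -((dτ * (τ ^ 2)⁻¹) • ζ) := by simp [ContinuousLinearMap.toSpanSingleton_apply]
  have a2 : ∀ w : F, (τ ^ 2) • w = (τ : ℂ) ^ 2 • w := fun w => by
    rw [← Complex.coe_smul]; push_cast; rfl
  rw [a1, ← sub_eq_add_neg, a2, smul_smul, ← e2, e1, ContinuousLinearMap.toSpanSingleton_apply,
    smul_assoc, neg_mul, neg_smul, smul_neg, mul_smul z, ← sub_eq_add_neg]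
  rfl

/-- The dilated family is of class `C^N` up to and across `τ = 0` if `r` decays fast enough: every
derivative costs at most two powers of `τ`. -/
theorem contDiffOn_dilated (N : ℕ) :
    ∀ {F : Type u} [NormedAddCommGroup F] [NormedSpace ℂ F] {M : ℝ} {z : ℂ} {r : P × Z → F},
      ContDiffOn ℝ N r {q | q.2 ≠ 0} → DecaysAt N M r → z.re + 2 * N + 2 ≤ M →
      ContDiffOn ℝ N (dilated z r) {x | x.2.1 ≠ 0} := by
  have hO := isOpen_snd_fst_ne_zero (P := P) (Z := Z)
  have hin : ∀ x : P × Z × ℝ, x.2.1 ≠ 0 → 0 < x.2.2 →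
      (x.1, x.2.2⁻¹ • x.2.1) ∈ {q : P × Z | q.2 ≠ 0} := fun x hx hτ =>
    smul_ne_zero (inv_ne_zero hτ.ne') hx
  induction N with
  | zero =>
    intro F _ _ M z r hr hd hM
    rw [Nat.cast_zero, contDiffOn_zero] at hr ⊢
    intro x hx
    refine ContinuousAt.continuousWithinAt ?_
    rcases lt_or_ge 0 x.2.2 with hτ | hτ
    · have hev : dilated z r =ᶠ[𝓝 x]
          fun x => (x.2.2 : ℂ) ^ (-z) • r (x.1, x.2.2⁻¹ • x.2.1) := by
        have : ∀ᶠ x : P × Z × ℝ in 𝓝 x, 0 < x.2.2 :=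
          ContinuousAt.eventually_lt continuousAt_const (by fun_prop) hτ
        filter_upwards [this] with x hx
        simp [dilated, hx]
      refine ContinuousAt.congr ?_ hev.symm
      refine ContinuousAt.smul ?_ ?_
      · refine ContinuousAt.cpow (by fun_prop) continuousAt_const (Or.inl (by simpa using hτ))
      · have hc : ContinuousAt r (x.1, x.2.2⁻¹ • x.2.1) :=
          hr.continuousAt (isOpen_snd_ne_zero.mem_nhds (hin x hx hτ))
        refine ContinuousAt.comp (f := fun x : P × Z × ℝ => (x.1, x.2.2⁻¹ • x.2.1)) hc ?_
        have : ContinuousAt (fun x : P × Z × ℝ => x.2.2⁻¹) x :=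
          ContinuousAt.inv₀ (by fun_prop) hτ.ne'
        fun_prop
    · have h : HasFDerivAt (𝕜 := ℝ) (dilated z r) 0 x :=
        (dilated_isBigO hd (by simpa using hM) hx hτ).hasFDerivAt (by norm_num)
      exact h.continuousAt
  | succ N ih =>
    intro F _ _ M z r hr hd hM
    have hN : ((N + 1 : ℕ) : WithTop ℕ∞) = (N : WithTop ℕ∞) + 1 := by simp
    rw [hN, contDiffOn_succ_iff_fderiv_of_isOpen isOpen_snd_ne_zero] at hr
    rw [hN, contDiffOn_succ_iff_fderiv_of_isOpen hO]
    push_cast at hM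
    have hder : ∀ x : P × Z × ℝ, x.2.1 ≠ 0 → HasFDerivAt (dilated z r)
        ((dilated (z + 2) (fderiv ℝ r) x).comp (dilatedMap x)
          - ((ContinuousLinearMap.snd ℝ Z ℝ).comp (ContinuousLinearMap.snd ℝ P (Z × ℝ))).smulRight
            (z • dilated (z + 1) r x)) x := by
      intro x hx
      rcases lt_or_ge 0 x.2.2 with hτ | hτ
      · exact hasFDerivAt_dilated hτ
          (hr.1.differentiableAt (isOpen_snd_ne_zero.mem_nhds (hin x hx hτ)))
      · have h : HasFDerivAt (𝕜 := ℝ) (dilated z r) 0 x :=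
          (dilated_isBigO (z := z) hd (by linarith) hx hτ).hasFDerivAt (by norm_num)
        refine h.congr_fderiv ?_
        refine ContinuousLinearMap.ext fun v => ?_
        simp [dilated, not_lt.2 hτ]
    refine ⟨fun x hx => (hder x hx).differentiableAt.differentiableWithinAt,
      fun h => absurd h (by simp), ?_⟩
    refine ContDiffOn.congr ?_ fun x hx => (hder x hx).fderiv
    have hd1 : DecaysAt N M (fderiv ℝ r) := by
      intro K hK
      obtain ⟨C, hC⟩ := hd K hK
      refine ⟨C, fun p hp ζ hζ j hj => ?_⟩
      rw [norm_iteratedFDeriv_fderiv]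
      exact hC p hp ζ hζ (j + 1) (by omega)
    have hd2 : DecaysAt N M r := by
      intro K hK
      obtain ⟨C, hC⟩ := hd K hK
      exact ⟨C, fun p hp ζ hζ j hj => hC p hp ζ hζ j (by omega)⟩
    have hr2 : ContDiffOn ℝ N r {q | q.2 ≠ 0} := by
      have := (contDiffOn_succ_iff_fderiv_of_isOpen (n := (N : WithTop ℕ∞))
        (isOpen_snd_ne_zero (P := P) (Z := Z))).2 hr
      exact this.of_le le_self_add
    -- the derivative is again made of dilated families: of `D r` with exponent `z + 2`, and of `r`
    -- with exponent `z + 1`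
    have i1 := ih (F := P × Z →L[ℝ] F) (z := z + 2) hr.2.2 hd1
      (by simp only [Complex.add_re, Complex.re_ofNat]; linarith)
    have i2 := ih (F := F) (z := z + 1) hr2 hd2
      (by simp only [Complex.add_re, Complex.one_re]; linarith)
    refine ContDiffOn.sub ?_ ?_
    · exact i1.clm_comp ((contDiff_dilatedMap (P := P) (Z := Z)).of_le ENat.LEInfty.out).contDiffOn
    · exact (ContinuousLinearMap.smulRightL ℝ (P × Z × ℝ) F ((ContinuousLinearMap.snd ℝ Z ℝ).comp
        (ContinuousLinearMap.snd ℝ P (Z × ℝ)))).contDiff.comp_contDiffOn (i2.const_smul z)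

end Dilation

/-! ### Fourier transforms along the fibres -/

section Fourier

variable {P V : Type u} [NormedAddCommGroup P] [NormedSpace ℝ P] [FiniteDimensional ℝ P]
  [NormedAddCommGroup V] [InnerProductSpace ℝ V] [FiniteDimensional ℝ V] [MeasurableSpace V]
  [BorelSpace V]

/-- The Fourier transform of `g` along the fibres of `P × V → P`. -/
def partialFourier {F : Type*} [NormedAddCommGroup F] [NormedSpace ℂ F] (g : P × V → F)
    (q : P × V) : F :=
  ∫ x : V, Complex.exp (-(Complex.I * (inner ℝ x q.2 : ℝ))) • g (q.1, x)

/-- `g` is of class `C^N` and its derivatives of order at most `N` decay faster than any power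
of `‖ξ‖`, locally uniformly in the parameter. -/
def IsRapid {F : Type*} [NormedAddCommGroup F] [NormedSpace ℝ F] (N : ℕ) (g : P × V → F) : Prop :=
  ContDiff ℝ N g ∧ ∀ K : Set P, IsCompact K → ∀ M j : ℕ, j ≤ N → ∃ C : ℝ, ∀ p ∈ K, ∀ ξ : V,
    (1 + ‖ξ‖) ^ M * ‖iteratedFDeriv ℝ j g (p, ξ)‖ ≤ C

/-- The bilinear map `(ξ, c) ↦ ((dp, dη) ↦ ⟨ξ, dη⟩ c)`. -/
def innerSmul (P V F : Type*) [NormedAddCommGroup P] [NormedSpace ℝ P] [NormedAddCommGroup V]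
    [InnerProductSpace ℝ V] [NormedAddCommGroup F] [NormedSpace ℝ F] :
    V →L[ℝ] F →L[ℝ] (P × V →L[ℝ] F) :=
  (ContinuousLinearMap.smulRightL ℝ (P × V) F).comp
    (((ContinuousLinearMap.compL ℝ (P × V) V ℝ).flip (ContinuousLinearMap.snd ℝ P V)).comp
      (innerSL ℝ))

/-- The function whose fibrewise Fourier transform is the derivative of that of `g`. -/
def fourierDeriv {F : Type*} [NormedAddCommGroup F] [NormedSpace ℂ F] (g : P × V → F)
    (q : P × V) : P × V →L[ℝ] F :=
  (fderiv ℝ g q).comp ((ContinuousLinearMap.inl ℝ P V).comp (ContinuousLinearMap.fst ℝ P V))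
    + innerSmul P V F q.2 (-Complex.I • g q)

variable {F : Type u} [NormedAddCommGroup F] [NormedSpace ℂ F]

omit [FiniteDimensional ℝ P] [FiniteDimensional ℝ V] [MeasurableSpace V] [BorelSpace V] in
theorem IsRapid.of_le {N N' : ℕ} {g : P × V → F} (hg : IsRapid N g) (h : N' ≤ N) : IsRapid N' g :=
  ⟨hg.1.of_le (by exact_mod_cast h), fun K hK M j hj => hg.2 K hK M j (hj.trans h)⟩

omit [FiniteDimensional ℝ P] [FiniteDimensional ℝ V] [MeasurableSpace V] [BorelSpace V] in
theorem IsRapid.bilinear_snd {F G : Type*} [NormedAddCommGroup F] [NormedSpace ℝ F]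
    [NormedAddCommGroup G] [NormedSpace ℝ G] (B : V →L[ℝ] F →L[ℝ] G) {N : ℕ} {g : P × V → F}
    (hg : IsRapid N g) : IsRapid N fun q : P × V => B q.2 (g q) := by
  have hsnd : ContDiff ℝ N (fun q : P × V => q.2) := contDiff_snd
  have hB : ContDiff ℝ N fun q : P × V => B q.2 := B.contDiff.comp hsnd
  refine ⟨hB.clm_apply hg.1, fun K hK M j hj => ?_⟩
  have hjN : (j : WithTop ℕ∞) ≤ N := by exact_mod_cast hj
  choose! C hC using fun i hi => hg.2 K hK (M + 1) i hi
  refine ⟨‖B‖ * ∑ i ∈ Finset.range (j + 1), (j.choose i : ℝ) * C (j - i), fun p hp ξ => ?_⟩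
  have hpos : 0 < 1 + ‖ξ‖ := by positivity
  have hone : 1 ≤ 1 + ‖ξ‖ := by simp
  have e2 := B.norm_iteratedFDeriv_le_of_bilinear (N := N) hsnd hg.1 (p, ξ) hjN
  have e3 : ∀ i, ‖iteratedFDeriv ℝ i (fun q : P × V => q.2) (p, ξ)‖ ≤ 1 + ‖ξ‖ := by
    intro i
    have hL : (fun q : P × V => q.2) = ContinuousLinearMap.snd ℝ P V := rfl
    rcases i with _ | _ | i
    · rw [norm_iteratedFDeriv_zero]; simp
    · rw [hL, norm_iteratedFDeriv_one, ContinuousLinearMap.fderiv]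
      exact (ContinuousLinearMap.norm_snd_le ℝ P V).trans hone
    · have hc : fderiv ℝ (ContinuousLinearMap.snd ℝ P V)
          = fun _ => ContinuousLinearMap.snd ℝ P V :=
        funext fun q => ContinuousLinearMap.fderiv _
      rw [hL, ← norm_iteratedFDeriv_fderiv, hc, iteratedFDeriv_succ_const]
      simpa using hpos.le
  calc (1 + ‖ξ‖) ^ M * ‖_‖ ≤ (1 + ‖ξ‖) ^ M * (‖B‖ *
        ∑ i ∈ Finset.range (j + 1), (j.choose i : ℝ) * (1 + ‖ξ‖)
          * ‖iteratedFDeriv ℝ (j - i) g (p, ξ)‖) := by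
        gcongr
        refine e2.trans ?_
        gcongr with i hi
        exact e3 i
    _ = ‖B‖ * ∑ i ∈ Finset.range (j + 1), (j.choose i : ℝ) *
          ((1 + ‖ξ‖) ^ (M + 1) * ‖iteratedFDeriv ℝ (j - i) g (p, ξ)‖) := by
        rw [Finset.mul_sum, Finset.mul_sum, Finset.mul_sum]
        refine Finset.sum_congr rfl fun i _ => ?_
        ring
    _ ≤ _ := by
        gcongr with i hi
        exact hC (j - i) (by omega) p hp ξ

omit [FiniteDimensional ℝ P] [FiniteDimensional ℝ V] [MeasurableSpace V] [BorelSpace V] in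
theorem IsRapid.add {F : Type*} [NormedAddCommGroup F] [NormedSpace ℝ F] {N : ℕ} {f g : P × V → F}
    (hf : IsRapid N f) (hg : IsRapid N g) : IsRapid N fun q => f q + g q := by
  refine ⟨hf.1.add hg.1, fun K hK M j hj => ?_⟩
  have hjN : (j : WithTop ℕ∞) ≤ N := by exact_mod_cast hj
  obtain ⟨C, hC⟩ := hf.2 K hK M j hj
  obtain ⟨D, hD⟩ := hg.2 K hK M j hj
  refine ⟨C + D, fun p hp ξ => ?_⟩
  have hadd : iteratedFDeriv ℝ j (fun q => f q + g q) (p, ξ)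
      = iteratedFDeriv ℝ j f (p, ξ) + iteratedFDeriv ℝ j g (p, ξ) :=
    iteratedFDeriv_add_apply (hf.1.contDiffAt.of_le hjN) (hg.1.contDiffAt.of_le hjN)
  rw [hadd]
  have := mul_le_mul_of_nonneg_left (norm_add_le (iteratedFDeriv ℝ j f (p, ξ))
    (iteratedFDeriv ℝ j g (p, ξ))) (show 0 ≤ (1 + ‖ξ‖) ^ M by positivity)
  linarith [hC p hp ξ, hD p hp ξ]

omit [FiniteDimensional ℝ P] [FiniteDimensional ℝ V] [MeasurableSpace V] [BorelSpace V] in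
theorem IsRapid.clm_comp {F G : Type*} [NormedAddCommGroup F] [NormedSpace ℝ F]
    [NormedAddCommGroup G] [NormedSpace ℝ G] (L : F →L[ℝ] G) {N : ℕ} {g : P × V → F}
    (hg : IsRapid N g) : IsRapid N fun q : P × V => L (g q) := by
  refine ⟨L.contDiff.comp hg.1, fun K hK M j hj => ?_⟩
  obtain ⟨C, hC⟩ := hg.2 K hK M j hj
  refine ⟨‖L‖ * C, fun p hp ξ => ?_⟩
  have e1 : ‖iteratedFDeriv ℝ j (fun q => L (g q)) (p, ξ)‖ ≤ ‖L‖ * ‖iteratedFDeriv ℝ j g (p, ξ)‖ :=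
    L.norm_iteratedFDeriv_comp_left hg.1.contDiffAt (by exact_mod_cast hj)
  calc _ ≤ (1 + ‖ξ‖) ^ M * (‖L‖ * ‖iteratedFDeriv ℝ j g (p, ξ)‖) := by gcongr
    _ = ‖L‖ * ((1 + ‖ξ‖) ^ M * ‖iteratedFDeriv ℝ j g (p, ξ)‖) := by ring
    _ ≤ _ := by gcongr; exact hC p hp ξ

omit [FiniteDimensional ℝ P] [FiniteDimensional ℝ V] [MeasurableSpace V] [BorelSpace V] in
theorem IsRapid.fderiv {F : Type*} [NormedAddCommGroup F] [NormedSpace ℝ F] {N : ℕ}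
    {g : P × V → F} (hg : IsRapid (N + 1) g) : IsRapid N (fderiv ℝ g) := by
  refine ⟨hg.1.fderiv_right (by simp), fun K hK M j hj => ?_⟩
  obtain ⟨C, hC⟩ := hg.2 K hK M (j + 1) (by omega)
  refine ⟨C, fun p hp ξ => ?_⟩
  rw [norm_iteratedFDeriv_fderiv]
  exact hC p hp ξ

omit [FiniteDimensional ℝ P] [FiniteDimensional ℝ V] [MeasurableSpace V] [BorelSpace V] in
theorem isRapid_fourierDeriv {N : ℕ} {g : P × V → F} (hg : IsRapid (N + 1) g) :
    IsRapid N (fourierDeriv g) := by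
  have h1 := hg.fderiv.clm_comp ((ContinuousLinearMap.compL ℝ (P × V) (P × V) F).flip
    ((ContinuousLinearMap.inl ℝ P V).comp (ContinuousLinearMap.fst ℝ P V)))
  have hm : IsRapid N fun q : P × V => -Complex.I • g q :=
    (hg.of_le (Nat.le_succ N)).clm_comp ((-Complex.I) • ContinuousLinearMap.id ℝ F)
  have h2 := hm.bilinear_snd (G := P × V →L[ℝ] F) (innerSmul P V F)
  exact h1.add h2

/-- Bounds on `M` derivatives of `f` give decay of order `M` of its Fourier transform. -/
theorem exists_norm_fourier_le (V F : Type*) [NormedAddCommGroup V] [InnerProductSpace ℝ V]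
    [FiniteDimensional ℝ V] [MeasurableSpace V] [BorelSpace V] [NormedAddCommGroup F]
    [NormedSpace ℂ F] (M : ℕ) :
    ∃ A : ℝ, 0 ≤ A ∧ ∀ (f : V → F) (B : ℝ), ContDiff ℝ M f →
      (∀ j ≤ M, ∀ x, (1 + ‖x‖) ^ (Module.finrank ℝ V + 1) * ‖iteratedFDeriv ℝ j f x‖ ≤ B) →
      ∀ η : V, (1 + ‖η‖) ^ M *
        ‖∫ x : V, Complex.exp (-(Complex.I * (inner ℝ x η : ℝ))) • f x‖ ≤ A * B := by
  set d := Module.finrank ℝ V with hd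
  let I₀ : ℝ := ∫ x : V, (1 + ‖x‖) ^ (-((d : ℝ) + 1))
  have hI₀ : Integrable fun x : V => (1 + ‖x‖) ^ (-((d : ℝ) + 1)) :=
    integrable_one_add_norm (by simp [hd])
  have hI₀n : 0 ≤ I₀ := integral_nonneg fun x => by positivity
  refine ⟨2 ^ M * (I₀ + (2 * Real.pi) ^ M * (2 ^ M * ((M + 1) * I₀))), by positivity,
    fun f B hf hB η => ?_⟩
  have hB0 : 0 ≤ B := le_trans (by positivity) (hB 0 (Nat.zero_le _) 0)
  have hpt : ∀ j ≤ M, ∀ x, ‖iteratedFDeriv ℝ j f x‖ ≤ B * (1 + ‖x‖) ^ (-((d : ℝ) + 1)) := by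
    intro j hj x
    have hpos : 0 < 1 + ‖x‖ := by positivity
    have h1 := hB j hj x
    have h2 : (1 + ‖x‖) ^ (-((d : ℝ) + 1)) = ((1 + ‖x‖) ^ (d + 1))⁻¹ := by
      rw [Real.rpow_neg hpos.le]; norm_cast
    rw [h2, ← div_eq_mul_inv, le_div_iff₀ (by positivity), mul_comm]
    exact h1
  have hint : ∀ j ≤ M, Integrable fun x => ‖iteratedFDeriv ℝ j f x‖ := by
    intro j hj
    refine (hI₀.const_mul B).mono' ?_ (Eventually.of_forall fun x => by
      rw [norm_norm]; exact hpt j hj x)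
    exact (hf.continuous_iteratedFDeriv (by exact_mod_cast hj)).norm.aestronglyMeasurable
  have hintle : ∀ j ≤ M, ∫ x, ‖iteratedFDeriv ℝ j f x‖ ≤ B * I₀ := by
    intro j hj
    rw [← integral_const_mul]
    exact integral_mono (hint j hj) (hI₀.const_mul B) (hpt j hj)
  have hpi : (0 : ℝ) < 2 * Real.pi := by positivity
  set w : V := (2 * Real.pi)⁻¹ • η with hw
  have hFT : ∫ x : V, Complex.exp (-(Complex.I * (inner ℝ x η : ℝ))) • f x
      = FourierTransform.fourier f w := by
    rw [Real.fourier_eq']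
    congr 1
    ext x
    congr 2
    rw [hw, inner_smul_right]
    push_cast
    field_simp
  have hzero : ‖FourierTransform.fourier f w‖ ≤ B * I₀ := by
    rw [← hFT]
    refine (norm_integral_le_integral_norm _).trans ((le_of_eq ?_).trans (hintle 0 (Nat.zero_le _)))
    congr 1
    ext x
    rw [norm_smul, norm_iteratedFDeriv_zero]
    have : ‖Complex.exp (-(Complex.I * (inner ℝ x η : ℝ)))‖ = 1 := by
      rw [Complex.norm_exp]; simp
    rw [this, one_mul]
  have hdecay := Real.pow_mul_norm_iteratedFDeriv_fourier_le (f := f) (K := 0) (N := M)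
    (by exact_mod_cast hf) (fun k n hk hn => by
      have hk0 : k = 0 := by simpa using hk
      subst hk0
      simpa using hint n (by exact_mod_cast hn)) (k := 0) (n := M) (by simp) le_rfl w
  rw [norm_iteratedFDeriv_zero] at hdecay
  have hsum : ∑ p ∈ Finset.range (0 + 1) ×ˢ Finset.range (M + 1),
      ∫ v : V, ‖v‖ ^ p.1 * ‖iteratedFDeriv ℝ p.2 f v‖ ≤ (M + 1) * (B * I₀) := by
    rw [Finset.sum_product]
    simp only [zero_add, Finset.range_one, Finset.sum_singleton, pow_zero, one_mul]
    refine (Finset.sum_le_card_nsmul _ _ (B * I₀) fun j hj => hintle j ?_).trans ?_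
    · have := Finset.mem_range.1 hj; omega
    · simp
  have hη : ‖η‖ ^ M * ‖FourierTransform.fourier f w‖
      ≤ (2 * Real.pi) ^ M * (2 ^ M * ((M + 1) * (B * I₀))) := by
    have : ‖η‖ = (2 * Real.pi) * ‖w‖ := by
      rw [hw, norm_smul, norm_inv, Real.norm_of_nonneg hpi.le]; field_simp
    rw [this, mul_pow, mul_assoc]
    refine mul_le_mul_of_nonneg_left ?_ (by positivity)
    refine hdecay.trans ?_
    simp only [pow_zero, one_mul, CharP.cast_eq_zero, mul_zero, zero_add]
    gcongr
  rw [hFT]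
  calc (1 + ‖η‖) ^ M * ‖FourierTransform.fourier f w‖
      ≤ (2 ^ M * (1 + ‖η‖ ^ M)) * ‖FourierTransform.fourier f w‖ := by
        gcongr
        have h := add_pow_le zero_le_one (norm_nonneg η) M
        rw [one_pow] at h
        refine h.trans ?_
        gcongr
        · norm_num
        · omega
    _ = 2 ^ M * (‖FourierTransform.fourier f w‖ + ‖η‖ ^ M * ‖FourierTransform.fourier f w‖) := by
        ring
    _ ≤ 2 ^ M * (B * I₀ + (2 * Real.pi) ^ M * (2 ^ M * ((M + 1) * (B * I₀)))) := by gcongr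
    _ = _ := by ring

omit [FiniteDimensional ℝ P] [FiniteDimensional ℝ V] [MeasurableSpace V] [BorelSpace V] in
theorem contDiff_fibre {N : ℕ} {g : P × V → F} (hg : ContDiff ℝ N g) (p : P) :
    ContDiff ℝ N fun x => g (p, x) := hg.comp (contDiff_const.prodMk contDiff_id)

omit [FiniteDimensional ℝ P] [FiniteDimensional ℝ V] [MeasurableSpace V] [BorelSpace V] in
theorem norm_iteratedFDeriv_fibre_le {N j : ℕ} (hj : j ≤ N) {g : P × V → F} (hg : ContDiff ℝ N g)
    (p : P) (x : V) :
    ‖iteratedFDeriv ℝ j (fun x => g (p, x)) x‖ ≤ ‖iteratedFDeriv ℝ j g (p, x)‖ := by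
  rw [iteratedFDeriv_partial_right (hg.contDiffAt.of_le (by exact_mod_cast hj))]
  refine (ContinuousMultilinearMap.norm_compContinuousLinearMap_le _ _).trans ?_
  simpa using mul_le_mul_of_nonneg_left (norm_inr_pow_le (X := P) (Y := V) j)
    (norm_nonneg (iteratedFDeriv ℝ j g (p, x)))

omit [FiniteDimensional ℝ P] in
theorem exists_norm_partialFourier_le {M : ℕ} {g : P × V → F} (hg : IsRapid M g) {K : Set P}
    (hK : IsCompact K) :
    ∃ C : ℝ, ∀ p ∈ K, ∀ η : V, (1 + ‖η‖) ^ M * ‖partialFourier g (p, η)‖ ≤ C := by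
  obtain ⟨A, hA, h⟩ := exists_norm_fourier_le V F M
  choose! C hC using fun i hi => hg.2 K hK (Module.finrank ℝ V + 1) i hi
  refine ⟨A * ∑ j ∈ Finset.range (M + 1), |C j|, fun p hp η => ?_⟩
  refine h (fun x => g (p, x)) _ (contDiff_fibre hg.1 p) (fun j hj x => ?_) η
  calc _ ≤ (1 + ‖x‖) ^ (Module.finrank ℝ V + 1) * ‖iteratedFDeriv ℝ j g (p, x)‖ := by
        gcongr; exact norm_iteratedFDeriv_fibre_le hj hg.1 p x
    _ ≤ |C j| := (hC j hj p hp x).trans (le_abs_self _)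
    _ ≤ _ := Finset.single_le_sum (f := fun j => |C j|) (fun _ _ => abs_nonneg _)
        (Finset.mem_range.2 (by omega))

theorem norm_exp_neg_I_mul (t : ℝ) : ‖Complex.exp (-(Complex.I * (t : ℂ)))‖ = 1 := by
  rw [Complex.norm_exp]; simp

omit [FiniteDimensional ℝ P] [FiniteDimensional ℝ V] [MeasurableSpace V] [BorelSpace V] in
theorem hasFDerivAt_exp_smul {g : P × V → F} (hg : Differentiable ℝ g) (x : V) (q : P × V) :
    HasFDerivAt (fun q : P × V => Complex.exp (-(Complex.I * (inner ℝ x q.2 : ℝ))) • g (q.1, x))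
      (Complex.exp (-(Complex.I * (inner ℝ x q.2 : ℝ))) • fourierDeriv g (q.1, x)) q := by
  have h1 : HasFDerivAt (fun q : P × V => (inner ℝ x q.2 : ℝ))
      ((innerSL ℝ x).comp (ContinuousLinearMap.snd ℝ P V)) q :=
    ((innerSL ℝ x).comp (ContinuousLinearMap.snd ℝ P V)).hasFDerivAt
  have h2 : HasFDerivAt (fun q : P × V => ((inner ℝ x q.2 : ℝ) : ℂ)) _ q :=
    Complex.ofRealCLM.hasFDerivAt.comp q h1
  have h3 := ((h2.const_mul Complex.I).neg).cexp
  have h4 : HasFDerivAt (fun q : P × V => g (q.1, x)) _ q :=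
    (hg (q.1, x)).hasFDerivAt.comp q
      ((ContinuousLinearMap.fst ℝ P V).hasFDerivAt.prodMk (hasFDerivAt_const x q))
  refine (h3.smul h4).congr_fderiv ?_
  refine ContinuousLinearMap.ext fun v => ?_
  simp only [fourierDeriv, innerSmul]
  simp [smul_smul]
  rw [← Complex.coe_smul (inner ℝ x v.2), smul_smul, smul_smul]
  congr 1
  ring

omit [FiniteDimensional ℝ P] in
theorem aestronglyMeasurable_exp_smul {g : P × V → F} (hg : IsRapid 0 g) (q : P × V) :
    AEStronglyMeasurable
      (fun x => Complex.exp (-(Complex.I * (inner ℝ x q.2 : ℝ))) • g (q.1, x)) volume := by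
  have hc : Continuous g := hg.1.continuous
  exact Continuous.aestronglyMeasurable (by fun_prop)

theorem exists_integrable_bound_exp_smul {g : P × V → F} (hg : IsRapid 0 g) (p₀ : P) :
    ∃ bound : V → ℝ, Integrable bound ∧ ∀ p ∈ Metric.closedBall p₀ 1, ∀ x (η : V),
      ‖Complex.exp (-(Complex.I * (inner ℝ x η : ℝ))) • g (p, x)‖ ≤ bound x := by
  have := FiniteDimensional.proper ℝ P
  set d := Module.finrank ℝ V with hdd
  have hI₀ : Integrable fun x : V => (1 + ‖x‖) ^ (-((d : ℝ) + 1)) :=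
    integrable_one_add_norm (by simp [hdd])
  obtain ⟨C, hC⟩ := hg.2 _ (isCompact_closedBall p₀ 1) (d + 1) 0 le_rfl
  refine ⟨_, hI₀.const_mul C, fun p hp x η => ?_⟩
  have hpos : 0 < 1 + ‖x‖ := by positivity
  have h2 : (1 + ‖x‖) ^ (-((d : ℝ) + 1)) = ((1 + ‖x‖) ^ (d + 1))⁻¹ := by
    rw [Real.rpow_neg hpos.le]; norm_cast
  rw [norm_smul, norm_exp_neg_I_mul, one_mul, h2, ← div_eq_mul_inv,
    le_div_iff₀ (by positivity), mul_comm]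
  simpa using hC p hp x

theorem integrable_exp_smul {g : P × V → F} (hg : IsRapid 0 g) (q : P × V) :
    Integrable (fun x => Complex.exp (-(Complex.I * (inner ℝ x q.2 : ℝ))) • g (q.1, x)) := by
  obtain ⟨bound, hb, hC⟩ := exists_integrable_bound_exp_smul hg q.1
  exact hb.mono' (aestronglyMeasurable_exp_smul hg q) (Eventually.of_forall
      fun x => hC _ (Metric.mem_closedBall_self zero_le_one) x _)

theorem continuous_partialFourier {g : P × V → F} (hg : IsRapid 0 g) :
    Continuous (partialFourier g) := by
  refine continuous_iff_continuousAt.2 fun q => ?_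
  obtain ⟨bound, hb, hC⟩ := exists_integrable_bound_exp_smul hg q.1
  have hs : {y : P × V | y.1 ∈ Metric.closedBall q.1 1} ∈ 𝓝 q :=
    continuous_fst.continuousAt.preimage_mem_nhds (Metric.closedBall_mem_nhds q.1 one_pos)
  have hc : Continuous g := hg.1.continuous
  refine continuousAt_of_dominated (bound := bound)
    (Eventually.of_forall fun y => aestronglyMeasurable_exp_smul hg y) ?_ hb ?_
  · filter_upwards [hs] with y hy using Eventually.of_forall fun x => hC _ hy x _
  · exact Eventually.of_forall fun x => Continuous.continuousAt (by fun_prop)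

theorem hasFDerivAt_partialFourier {g : P × V → F} (hg : IsRapid 1 g) (q : P × V) :
    HasFDerivAt (partialFourier g) (partialFourier (fourierDeriv g) q) q := by
  have hd := isRapid_fourierDeriv (N := 0) hg
  obtain ⟨bound, hb, hC⟩ := exists_integrable_bound_exp_smul (F := P × V →L[ℝ] F) hd q.1
  have hs : {y : P × V | y.1 ∈ Metric.closedBall q.1 1} ∈ 𝓝 q :=
    continuous_fst.continuousAt.preimage_mem_nhds (Metric.closedBall_mem_nhds q.1 one_pos)
  have hg0 := hg.of_le (Nat.zero_le 1)
  refine hasFDerivAt_integral_of_dominated_of_fderiv_le (𝕜 := ℝ)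
    (F := fun (q : P × V) (x : V) => Complex.exp (-(Complex.I * (inner ℝ x q.2 : ℝ))) • g (q.1, x))
    (F' := fun q x => Complex.exp (-(Complex.I * (inner ℝ x q.2 : ℝ))) • fourierDeriv g (q.1, x))
    hs (Eventually.of_forall fun y => aestronglyMeasurable_exp_smul hg0 y)
    (integrable_exp_smul hg0 q)
    (aestronglyMeasurable_exp_smul (F := P × V →L[ℝ] F) hd q) ?_ hb ?_
  · exact Eventually.of_forall fun x y hy => hC _ hy x _
  · exact Eventually.of_forall fun x y _ =>
      hasFDerivAt_exp_smul (hg.1.differentiable (by simp)) x y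

/-- The fibrewise Fourier transform of a rapidly decreasing function of class `C^(N + M)` is of
class `C^N`, with derivatives that decay to order `M`. -/
theorem contDiff_partialFourier (M N : ℕ) :
    ∀ {F : Type u} [NormedAddCommGroup F] [NormedSpace ℂ F] {g : P × V → F}, IsRapid (N + M) g →
      ContDiff ℝ N (partialFourier g) ∧ ∀ K : Set P, IsCompact K → ∀ j ≤ N, ∃ C : ℝ,
        ∀ p ∈ K, ∀ η : V, (1 + ‖η‖) ^ M * ‖iteratedFDeriv ℝ j (partialFourier g) (p, η)‖ ≤ C := by
  induction N with
  | zero =>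
    intro F _ _ g hg
    refine ⟨?_, ?_⟩
    · rw [Nat.cast_zero, contDiff_zero]
      exact continuous_partialFourier (hg.of_le (by omega))
    · intro K hK j hj
      obtain rfl : j = 0 := by omega
      obtain ⟨C, hC⟩ := exists_norm_partialFourier_le (hg.of_le (Nat.le_add_left M 0)) hK
      exact ⟨C, fun p hp η => by simpa using hC p hp η⟩
  | succ N ih =>
    intro F _ _ g hg
    have h1 : IsRapid 1 g := hg.of_le (by omega)
    have hfd : fderiv ℝ (partialFourier g) = partialFourier (fourierDeriv g) :=
      funext fun q => (hasFDerivAt_partialFourier h1 q).fderiv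
    obtain ⟨i1, i2⟩ := ih (F := P × V →L[ℝ] F) (isRapid_fourierDeriv (N := N + M) (by
      rwa [show N + M + 1 = N + 1 + M by omega]))
    refine ⟨?_, ?_⟩
    · have hN : ((N + 1 : ℕ) : WithTop ℕ∞) = (N : WithTop ℕ∞) + 1 := by simp
      rw [hN, contDiff_succ_iff_fderiv]
      refine ⟨fun q => (hasFDerivAt_partialFourier h1 q).differentiableAt,
        fun h => absurd h (by simp), ?_⟩
      rwa [hfd]
    · intro K hK j hj
      rcases j with _ | j
      · obtain ⟨C, hC⟩ := exists_norm_partialFourier_le (hg.of_le (Nat.le_add_left M _)) hK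
        exact ⟨C, fun p hp η => by simpa using hC p hp η⟩
      · obtain ⟨C, hC⟩ := i2 K hK j (by omega)
        refine ⟨C, fun p hp η => ?_⟩
        rw [← norm_iteratedFDeriv_fderiv, hfd]
        exact hC p hp η

theorem isRapid_partialFourier {g : P × V → F} (hg : ∀ N, IsRapid N g) (N : ℕ) :
    IsRapid N (partialFourier g) :=
  ⟨(contDiff_partialFourier 0 N (hg _)).1, fun K hK M j hj =>
    (contDiff_partialFourier M N (hg _)).2 K hK j hj⟩

end Fourier

/-! ### Symbols from quasi-homogeneous functions -/

section Symbol

variable {P V : Type} [NormedAddCommGroup P] [NormedSpace ℝ P] [FiniteDimensional ℝ P]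
  [NormedAddCommGroup V] [NormedSpace ℝ V] [FiniteDimensional ℝ V]

/-- `f(u, λ² η, λ r) = λ^(2μ) f(u, η, r)` for `λ > 0` and `η ≠ 0`. -/
def IsQuasiHomogeneous (μ : ℂ) (f : (P × V) × ℝ → ℂ) : Prop :=
  ∀ c : ℝ, 0 < c → ∀ q : P × V, q.2 ≠ 0 → ∀ r,
    f ((q.1, c ^ 2 • q.2), c * r) = (c : ℂ) ^ (2 * μ) * f (q, r)

omit [FiniteDimensional ℝ P] [FiniteDimensional ℝ V] in
theorem continuous_section {U : Set (P × V)} (hU : IsOpen U) {f : (P × V) × ℝ → ℂ}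
    (hf : ContDiffOn ℝ ∞ f (U ×ˢ univ)) {q : P × V} (hq : q ∈ U) :
    Continuous fun r : ℝ => f (q, r) :=
  continuous_iff_continuousAt.2 fun r =>
    (hf.contDiffAt ((hU.prod isOpen_univ).mem_nhds ⟨hq, mem_univ r⟩)).continuousAt.comp
      (f := fun r : ℝ => (q, r)) (by fun_prop)

theorem eq_of_eq_off_zero {f g : ℝ → ℂ} (hf : Continuous f) (hg : Continuous g)
    (h : ∀ r ≠ 0, f r = g r) (r : ℝ) : f r = g r :=
  congrFun (Continuous.ext_on (dense_compl_singleton (0 : ℝ)) hf hg fun r hr => h r hr) r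

/-- The Taylor coefficients in `r²` of an even quasi-homogeneous function are again even and
quasi-homogeneous. -/
theorem IsQuasiHomogeneous.exists_succ {μ : ℂ} {f : (P × V) × ℝ → ℂ}
    (hf : ContDiffOn ℝ ∞ f ({q | q.2 ≠ 0} ×ˢ univ))
    (heven : ∀ q : P × V, q.2 ≠ 0 → ∀ r, f (q, -r) = f (q, r)) (hhom : IsQuasiHomogeneous μ f) :
    ∃ h : (P × V) × ℝ → ℂ, ContDiffOn ℝ ∞ h ({q | q.2 ≠ 0} ×ˢ univ) ∧
      (∀ q : P × V, q.2 ≠ 0 → ∀ r, h (q, -r) = h (q, r)) ∧ IsQuasiHomogeneous (μ - 1) h ∧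
      ∀ q : P × V, q.2 ≠ 0 → ∀ r, f (q, r) = f (q, 0) + r ^ 2 • h (q, r) := by
  have hU : IsOpen {q : P × V | q.2 ≠ 0} := isOpen_snd_ne_zero
  obtain ⟨h, hh, hev, heq⟩ := exists_contDiffOn_eq_add_sq_smul hU hf heven
  refine ⟨h, hh, hev, fun c hc q hq => ?_, heq⟩
  have hq' : ((q.1, c ^ 2 • q.2) : P × V).2 ≠ 0 := smul_ne_zero (by positivity) hq
  refine eq_of_eq_off_zero ((continuous_section hU hh hq').comp (continuous_const.mul continuous_id))
    (continuous_const.mul (continuous_section hU hh hq)) fun r hr => ?_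
  have h1 := heq _ hq' (c * r)
  have h0 := hhom c hc q hq 0
  rw [mul_zero] at h0
  rw [h0, hhom c hc q hq r, heq q hq r] at h1
  have hcc : (c : ℂ) ≠ 0 := by exact_mod_cast hc.ne'
  have hrc : (r : ℂ) ≠ 0 := by exact_mod_cast hr
  have hpow : (c : ℂ) ^ (2 * μ) = (c : ℂ) ^ 2 * (c : ℂ) ^ (2 * (μ - 1)) := by
    rw [show 2 * μ = (2 : ℕ) + 2 * (μ - 1) by push_cast; ring, Complex.cpow_add _ _ hcc,
      Complex.cpow_natCast]
  simp only [Complex.real_smul] at h1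
  push_cast at h1
  rw [hpow] at h1
  have : (c : ℂ) ^ 2 * (r : ℂ) ^ 2 ≠ 0 := by positivity
  refine mul_left_cancel₀ this ?_
  linear_combination -h1

/-- The Taylor remainders `f j` of `B` in `r²`, all of them quasi-homogeneous. -/
theorem exists_quasiHomogeneous_expansion {m : ℂ} {B : (P × V) × ℝ → ℂ}
    (hB : ContDiffOn ℝ ∞ B ({q | q.2 ≠ 0} ×ˢ univ))
    (heven : ∀ q : P × V, q.2 ≠ 0 → ∀ r, B (q, -r) = B (q, r)) (hhom : IsQuasiHomogeneous m B) :
    ∃ f : ℕ → (P × V) × ℝ → ℂ, f 0 = B ∧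
      (∀ j, ContDiffOn ℝ ∞ (f j) ({q | q.2 ≠ 0} ×ˢ univ)) ∧
      (∀ j : ℕ, IsQuasiHomogeneous (m - j) (f j)) ∧
      ∀ j, ∀ q : P × V, q.2 ≠ 0 → ∀ r, f j (q, r) = f j (q, 0) + r ^ 2 • f (j + 1) (q, r) := by
  let S (j : ℕ) := {f : (P × V) × ℝ → ℂ // ContDiffOn ℝ ∞ f ({q | q.2 ≠ 0} ×ˢ univ) ∧
    (∀ q : P × V, q.2 ≠ 0 → ∀ r, f (q, -r) = f (q, r)) ∧ IsQuasiHomogeneous (m - j) f}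
  have step : ∀ j (f : S j), ∃ h : S (j + 1),
      ∀ q : P × V, q.2 ≠ 0 → ∀ r, f.1 (q, r) = f.1 (q, 0) + r ^ 2 • h.1 (q, r) := by
    intro j f
    obtain ⟨h, h1, h2, h3, h4⟩ := f.2.2.2.exists_succ f.2.1 f.2.2.1
    refine ⟨⟨h, h1, h2, ?_⟩, h4⟩
    have : m - ((j + 1 : ℕ) : ℂ) = m - j - 1 := by push_cast; ring
    rwa [this]
  choose g hg using step
  let f (j : ℕ) : S j := Nat.rec ⟨B, hB, heven, by simpa using hhom⟩ (fun j f => g j f) j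
  exact ⟨fun j => (f j).1, rfl, fun j => (f j).2.1, fun j => (f j).2.2.2, fun j => hg j (f j)⟩

end Symbol

theorem sqrt_cpow_two_mul {t : ℝ} (ht : 0 < t) (μ : ℂ) : ((√t : ℝ) : ℂ) ^ (2 * μ) = (t : ℂ) ^ μ := by
  have h0 : ((√t : ℝ) : ℂ) ≠ 0 := by exact_mod_cast (Real.sqrt_pos.2 ht).ne'
  rw [two_mul, Complex.cpow_add _ _ h0, ← Complex.mul_cpow_ofReal_nonneg (Real.sqrt_nonneg t)
    (Real.sqrt_nonneg t), ← Complex.ofReal_mul, Real.mul_self_sqrt ht.le]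

/-- An even quasi-homogeneous function `B(u, η, r)`, smooth off `(η, r) = 0`, restricts to a
classical symbol on `r = 1`: its expansion is the Taylor expansion of `B` at `r = 0`. -/
theorem isClassicalSymbol_of_isQuasiHomogeneous {p n : ℕ} {m : ℂ} {B : Coord p n × ℝ → ℂ}
    (hB : ContDiffOn ℝ ∞ B {x | x.1.2 ≠ 0 ∨ x.2 ≠ 0})
    (heven : ∀ q : Coord p n, q.2 ≠ 0 → ∀ r, B (q, -r) = B (q, r))
    (hhom : IsQuasiHomogeneous m B) : IsClassicalSymbol m fun q => B (q, 1) := by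
  have hU : IsOpen {q : Coord p n | q.2 ≠ 0} := isOpen_snd_ne_zero
  obtain ⟨f, rfl, hf, hh, hexp⟩ := exists_quasiHomogeneous_expansion
    (hB.mono fun x hx => Or.inl hx.1) heven hhom
  refine ⟨?_, fun j q => f j (q, 0), fun j => ?_, fun j t u ξ ht hξ => ?_, ?_⟩
  · refine contDiff_iff_contDiffAt.2 fun q => ContDiffAt.comp (f := fun q => (q, (1 : ℝ))) q
      (hB.contDiffAt (IsOpen.mem_nhds ?_ (Or.inr one_ne_zero))) (by fun_prop)
    exact (isOpen_ne_fun (by fun_prop) continuous_const).union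
      (isOpen_ne_fun continuous_snd continuous_const)
  · exact (hf j).comp (f := fun q => (q, (0 : ℝ))) (by fun_prop) fun q hq => ⟨hq, mem_univ _⟩
  · have h := hh j (√t) (Real.sqrt_pos.2 ht) (u, ξ) hξ 0
    rw [mul_zero, Real.sq_sqrt ht.le] at h
    rw [sqrt_cpow_two_mul ht] at h
    exact h
  · intro k i l K hK
    -- at `r = 1` the remainder after `k` terms is `f k`
    have hsum : ∀ k : ℕ, ∀ q : Coord p n, q.2 ≠ 0 →
        f 0 (q, 1) - ∑ j ∈ Finset.range k, f j (q, 0) = f k (q, 1) := by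
      intro k q hq
      induction k with
      | zero => simp
      | succ k ih =>
        rw [Finset.sum_range_succ, ← sub_sub, ih, hexp k q hq 1]
        simp
    -- the homogeneity reduces the estimate to the compact set `‖η‖ = 1`, `0 ≤ r ≤ 1`
    have hcomp : IsCompact ((K ×ˢ Metric.sphere (0 : EuclideanSpace ℝ (Fin n)) 1) ×ˢ
        Icc (0 : ℝ) 1) := (hK.prod (isCompact_sphere 0 1)).prod isCompact_Icc
    have hcont : ContinuousOn (fun x => ‖iteratedFDeriv ℝ (i + l) (f k) x‖)
        ((K ×ˢ Metric.sphere (0 : EuclideanSpace ℝ (Fin n)) 1) ×ˢ Icc (0 : ℝ) 1) := by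
      intro x hx
      have hx' : x ∈ {q : Coord p n | q.2 ≠ 0} ×ˢ (univ : Set ℝ) :=
        ⟨ne_zero_of_mem_unit_sphere ⟨x.1.2, hx.1.2⟩, mem_univ _⟩
      exact ((((hf k).contDiffAt ((hU.prod isOpen_univ).mem_nhds hx')).iteratedFDeriv_right
        (m := 0) (by exact_mod_cast le_top)).continuousAt.norm).continuousWithinAt
    obtain ⟨C, hC⟩ := hcomp.exists_bound_of_continuousOn hcont
    refine ⟨C, fun u hu ξ hξ => ?_⟩
    have hR : 0 < ‖ξ‖ := by linarith
    have hξ0 : ξ ≠ 0 := norm_pos_iff.1 hR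
    set R := ‖ξ‖ with hRdef
    set s : ℝ := (√R)⁻¹ with hs
    have hspos : 0 < s := inv_pos.2 (Real.sqrt_pos.2 hR)
    let H : Coord p n → ℂ := fun q => f k (q, s)
    have hHs : ContDiffOn ℝ ∞ H {q | q.2 ≠ 0} :=
      (hf k).comp (f := fun q => (q, s)) (by fun_prop) fun q hq => ⟨hq, mem_univ _⟩
    let A : EuclideanSpace ℝ (Fin n) → _ := fun η => iteratedFDeriv ℝ l (fun v => H (v, η)) u
    -- freeze `R = ‖ξ‖`, `s = R ^ (-1/2)`; then `f k (v, η, 1) = R ^ (m - k) f k (v, η / R, s)` is a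
    -- linear change of variables
    have hev : (fun η => iteratedFDeriv ℝ l
        (fun v => f 0 ((v, η), 1) - ∑ j ∈ Finset.range k, f j ((v, η), 0)) u)
        =ᶠ[𝓝 ξ] fun η => ((√R : ℝ) : ℂ) ^ (2 * (m - k)) • A (R⁻¹ • η) := by
      filter_upwards [isOpen_ne.mem_nhds hξ0] with η hη
      have h1 : (fun v => f 0 ((v, η), 1) - ∑ j ∈ Finset.range k, f j ((v, η), 0))
          = fun v => ((√R : ℝ) : ℂ) ^ (2 * (m - k)) • H (v, R⁻¹ • η) := by
        funext v
        rw [hsum k (v, η) hη, smul_eq_mul]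
        have hη' : ((v, R⁻¹ • η) : Coord p n).2 ≠ 0 := smul_ne_zero (by positivity) hη
        rw [← hh k (√R) (Real.sqrt_pos.2 hR) (v, R⁻¹ • η) hη' s]
        simp only [Real.sq_sqrt hR.le, hs]
        rw [smul_inv_smul₀ hR.ne', mul_inv_cancel₀ (Real.sqrt_pos.2 hR).ne']
      rw [h1, iteratedFDeriv_const_smul_apply' (f := fun v => H (v, R⁻¹ • η))]
      have hη' : R⁻¹ • η ≠ 0 := smul_ne_zero (by positivity) hη
      exact (((hHs.contDiffAt (hU.mem_nhds hη')).comp (f := fun v => (v, R⁻¹ • η)) u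
        (by fun_prop)).of_le (by exact_mod_cast le_top))
    have hξ' : R⁻¹ • ξ ≠ 0 := smul_ne_zero (by positivity) hξ0
    have hA : ContDiffAt ℝ i A (R⁻¹ • ξ) :=
      ((contDiffOn_iteratedFDeriv_partial_left hU hHs l).contDiffAt
        (x := (u, R⁻¹ • ξ)) (hU.mem_nhds hξ')).of_le (by exact_mod_cast le_top) |>.comp
        (f := fun η => (u, η)) _ (by fun_prop)
    let L : EuclideanSpace ℝ (Fin n) →L[ℝ] EuclideanSpace ℝ (Fin n) :=
      R⁻¹ • ContinuousLinearMap.id ℝ _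
    have hL : ‖L‖ ≤ R⁻¹ := by
      refine ContinuousLinearMap.opNorm_le_bound _ (by positivity) fun x => ?_
      simp [L, norm_smul, abs_of_pos hR]
    have hmix : ‖iteratedFDeriv ℝ i A (R⁻¹ • ξ)‖ ≤ C := by
      refine (norm_mixed_iteratedFDeriv_le hU hHs (x := u) (y := R⁻¹ • ξ) hξ' i l).trans ?_
      refine (norm_iteratedFDeriv_partial_left_le (f := f k) (y := s) ?_).trans ?_
      · exact ((hf k).contDiffAt (x := ((u, R⁻¹ • ξ), s)) ((hU.prod isOpen_univ).mem_nhds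
          ⟨hξ', mem_univ _⟩)).of_le
          (by exact_mod_cast le_top)
      · refine (le_abs_self _).trans (hC _ ⟨⟨hu, ?_⟩, hspos.le, ?_⟩)
        · simp [norm_smul, ← hRdef, abs_of_pos hR, hR.ne']
        · exact inv_le_one_of_one_le₀ (Real.one_le_sqrt.2 hξ)
    have hC0 : 0 ≤ C := (norm_nonneg _).trans hmix
    rw [(Filter.EventuallyEq.iteratedFDeriv ℝ hev i).eq_of_nhds,
      iteratedFDeriv_const_smul_apply' (f := fun η => A (R⁻¹ • η))
        (hA.comp (f := L) ξ L.contDiff.contDiffAt), norm_smul]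
    have h2 : ‖iteratedFDeriv ℝ i (fun η => A (R⁻¹ • η)) ξ‖ ≤ C * R⁻¹ ^ i := by
      refine (norm_iteratedFDeriv_comp_clm_le (f := A) L (x := ξ) hA).trans ?_
      gcongr
      exact hmix
    have h3 : ‖((√R : ℝ) : ℂ) ^ (2 * (m - k))‖ = R ^ (m.re - k) := by
      rw [Complex.norm_cpow_eq_rpow_re_of_pos (Real.sqrt_pos.2 hR), Real.sqrt_eq_rpow,
        ← Real.rpow_mul hR.le]
      congr 1
      simp
    rw [h3]
    calc R ^ (m.re - k) * _ ≤ R ^ (m.re - k) * (C * R⁻¹ ^ i) := by gcongr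
      _ = C * R ^ (m.re - k - i) := by
        rw [Real.rpow_sub hR _ (i : ℝ), Real.rpow_natCast, inv_pow]
        ring

/-! ### Fourier inversion and oscillatory integrals -/

section Inversion

variable {V : Type*} [NormedAddCommGroup V] [InnerProductSpace ℝ V] [FiniteDimensional ℝ V]
  [MeasurableSpace V] [BorelSpace V]

/-- Exchange of the integrations in a product with a Fourier transform. -/
theorem integral_fourier_mul {f g : V → ℂ} (hf : Integrable f) (hg : Integrable g) (s : ℝ) :
    ∫ x, (∫ η, Complex.exp (-(Complex.I * (inner ℝ x (s • η) : ℝ))) * f η) * g x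
      = ∫ η, f η * ∫ x, Complex.exp (-(Complex.I * (inner ℝ x (s • η) : ℝ))) * g x := by
  have hint : Integrable (fun z : V × V =>
      Complex.exp (-(Complex.I * (inner ℝ z.1 (s • z.2) : ℝ))) * (g z.1 * f z.2))
      (volume.prod volume) := by
    refine (hg.mul_prod hf).bdd_mul (c := 1) ?_ (Eventually.of_forall fun z => ?_)
    · exact Continuous.aestronglyMeasurable (by fun_prop)
    · exact (norm_exp_neg_I_mul _).le
  have := integral_integral_swap (f := fun x η : V =>
      Complex.exp (-(Complex.I * (inner ℝ x (s • η) : ℝ))) * (g x * f η)) hint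
  calc _ = ∫ x, ∫ η, Complex.exp (-(Complex.I * (inner ℝ x (s • η) : ℝ))) * (g x * f η) := by
        refine integral_congr_ae (Eventually.of_forall fun x => ?_)
        simp only
        rw [← integral_mul_const]
        congr 1; ext η; ring
    _ = _ := by
        rw [this]
        refine integral_congr_ae (Eventually.of_forall fun η => ?_)
        simp only
        rw [← integral_const_mul]
        congr 1; ext x; ring

/-- Fourier inversion without factors `2π` in the exponent. -/
theorem fourier_inversion {f : V → ℂ} (hf : Integrable f) (hc : Continuous f)
    (hF : Integrable fun η : V => ∫ x : V, Complex.exp (-(Complex.I * (inner ℝ x η : ℝ))) * f x)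
    (x : V) :
    f x = ((2 * Real.pi : ℝ) : ℂ)⁻¹ ^ Module.finrank ℝ V *
      ∫ η, Complex.exp (Complex.I * (inner ℝ x η : ℝ)) *
        ∫ y : V, Complex.exp (-(Complex.I * (inner ℝ y η : ℝ))) * f y := by
  have hpi : (0 : ℝ) < 2 * Real.pi := by positivity
  set F : V → ℂ := fun η => ∫ x : V, Complex.exp (-(Complex.I * (inner ℝ x η : ℝ))) * f x with hFdef
  have hFT : ∀ w, FourierTransform.fourier f w = F ((2 * Real.pi) • w) := by
    intro w
    rw [Real.fourier_eq', hFdef]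
    congr 1
    ext x
    rw [smul_eq_mul, inner_smul_right]
    congr 2
    push_cast
    ring
  have hI : Integrable (FourierTransform.fourier f) := by
    have := hF.comp_smul hpi.ne'
    exact this.congr (Eventually.of_forall fun w => (hFT w).symm)
  have hinv := congrFun (hc.fourierInv_fourier_eq hf hI) x
  rw [← hinv, Real.fourierInv_eq']
  have := MeasureTheory.Measure.integral_comp_smul (volume : Measure V)
    (fun η => Complex.exp (Complex.I * (inner ℝ x η : ℝ)) * F η) (2 * Real.pi)
  have hint : ∫ v, Complex.exp (↑(2 * Real.pi * inner ℝ v x) * Complex.I)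
      • FourierTransform.fourier f v = ∫ v, Complex.exp (Complex.I *
        (inner ℝ x ((2 * Real.pi) • v) : ℝ)) * F ((2 * Real.pi) • v) := by
    congr 1
    ext v
    rw [hFT, smul_eq_mul, inner_smul_right, real_inner_comm x v]
    congr 2
    push_cast
    ring
  rw [hint, this, abs_of_pos (by positivity), Complex.real_smul]
  push_cast
  rw [inv_pow]

end Inversion

section Rapid

variable {P V : Type u} [NormedAddCommGroup P] [NormedSpace ℝ P] [FiniteDimensional ℝ P]
  [NormedAddCommGroup V] [InnerProductSpace ℝ V] [FiniteDimensional ℝ V]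

omit [FiniteDimensional ℝ P] in
theorem isRapid_of_bounded_support {F : Type*} [NormedAddCommGroup F] [NormedSpace ℝ F] {N : ℕ}
    {g : P × V → F} (hg : ContDiff ℝ N g) {R : ℝ} (hR : ∀ p ξ, R < ‖ξ‖ → g (p, ξ) = 0) :
    IsRapid N g := by
  refine ⟨hg, fun K hK M j hj => ?_⟩
  have := FiniteDimensional.proper ℝ V
  have hc : Continuous fun q : P × V => (1 + ‖q.2‖) ^ M * ‖iteratedFDeriv ℝ j g q‖ :=
    ((continuous_const.add continuous_snd.norm).pow M).mul
      (hg.continuous_iteratedFDeriv (by exact_mod_cast hj)).norm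
  obtain ⟨C, hC⟩ := (hK.prod (isCompact_closedBall (0 : V) R)).exists_bound_of_continuousOn
    hc.continuousOn
  refine ⟨|C|, fun p hp ξ => ?_⟩
  rcases le_or_gt ‖ξ‖ R with h | h
  · exact (le_abs_self _).trans ((hC (p, ξ) ⟨hp, by simpa using h⟩).trans (le_abs_self _))
  · have hev : g =ᶠ[𝓝 (p, ξ)] fun _ => 0 := by
      have : ∀ᶠ q : P × V in 𝓝 (p, ξ), R < ‖q.2‖ :=
        ContinuousAt.eventually_lt continuousAt_const (by fun_prop) h
      filter_upwards [this] with q hq using hR _ _ hq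
    rw [(Filter.EventuallyEq.iteratedFDeriv ℝ hev j).eq_of_nhds]
    simp

end Rapid

section Coordinates

variable {p n : ℕ}

theorem isRapid_of_hasCompactSupport {F : Coord p n → ℂ} (hF : ContDiff ℝ ∞ F)
    (hs : HasCompactSupport F) (N : ℕ) : IsRapid N F := by
  obtain ⟨R, hR⟩ := hs.isBounded.exists_norm_le
  refine isRapid_of_bounded_support (hF.of_le (by exact_mod_cast le_top)) (R := R)
    fun u ξ h => image_eq_zero_of_notMem_tsupport fun hmem => ?_
  have := hR _ hmem
  exact absurd ((norm_snd_le (u, ξ)).trans this) (not_le.2 h)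

theorem isRapid_fibreFourier {F : Coord p n → ℂ} (hF : ContDiff ℝ ∞ F)
    (hs : HasCompactSupport F) (N : ℕ) : IsRapid N (fibreFourier F) :=
  isRapid_partialFourier (isRapid_of_hasCompactSupport hF hs) N

theorem fibreFourier_eq_zero {F : Coord p n → ℂ} {u : EuclideanSpace ℝ (Fin p)}
    (hu : ∀ x, F (u, x) = 0) (ξ : EuclideanSpace ℝ (Fin n)) : fibreFourier F (u, ξ) = 0 := by
  simp [fibreFourier, hu]

/-- A measurable function on `ℝᵖ × ℝⁿ` that decays in the fibres and vanishes outside a compact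
set of parameters is integrable. -/
theorem integrable_of_decay {h : Coord p n → ℂ} (hm : AEStronglyMeasurable h)
    {K : Set (EuclideanSpace ℝ (Fin p))} (hK : IsCompact K) (h0 : ∀ q : Coord p n, q.1 ∉ K → h q = 0)
    {C : ℝ} (hC : ∀ q : Coord p n, q.1 ∈ K → (1 + ‖q.2‖) ^ (n + 1) * ‖h q‖ ≤ C) :
    Integrable h := by
  have h1 : Integrable (K.indicator fun _ : EuclideanSpace ℝ (Fin p) => C) :=
    (integrable_indicator_iff hK.measurableSet).2 (integrableOn_const hK.measure_lt_top.ne)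
  have h2 : Integrable fun x : EuclideanSpace ℝ (Fin n) => (1 + ‖x‖) ^ (-((n : ℝ) + 1)) :=
    integrable_one_add_norm (by simp)
  refine (h1.mul_prod h2).mono' hm (Eventually.of_forall fun q => ?_)
  by_cases hq : q.1 ∈ K
  · have hpos : 0 < 1 + ‖q.2‖ := by positivity
    have h3 : (1 + ‖q.2‖) ^ (-((n : ℝ) + 1)) = ((1 + ‖q.2‖) ^ (n + 1))⁻¹ := by
      rw [Real.rpow_neg hpos.le]; norm_cast
    rw [indicator_of_mem hq, h3, ← div_eq_mul_inv, le_div_iff₀ (by positivity), mul_comm]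
    exact hC q hq
  · simp [h0 q hq, indicator_of_notMem hq]

/-- The parameters over which `F` does not vanish lie in a compact set. -/
theorem exists_isCompact_fst {F : Coord p n → ℂ} (hs : HasCompactSupport F) :
    ∃ K : Set (EuclideanSpace ℝ (Fin p)), IsCompact K ∧ ∀ u ∉ K, ∀ x, F (u, x) = 0 :=
  ⟨Prod.fst '' tsupport F, hs.isCompact.image continuous_fst, fun u hu x =>
    image_eq_zero_of_notMem_tsupport fun h => hu ⟨(u, x), h, rfl⟩⟩

theorem integrable_mul_fibreFourier {F : Coord p n → ℂ} (hF : ContDiff ℝ ∞ F)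
    (hs : HasCompactSupport F) {w : Coord p n → ℂ} (hw : AEStronglyMeasurable w) (M : ℕ)
    (hC : ∀ K : Set (EuclideanSpace ℝ (Fin p)), IsCompact K →
      ∃ C : ℝ, ∀ q : Coord p n, q.1 ∈ K → ‖w q‖ ≤ C * (1 + ‖q.2‖) ^ M) :
    Integrable fun q => w q * fibreFourier F q := by
  obtain ⟨K, hK, hK0⟩ := exists_isCompact_fst hs
  obtain ⟨C, hC⟩ := hC K hK
  have hr := isRapid_fibreFourier hF hs 0
  obtain ⟨D, hD⟩ := hr.2 K hK (M + (n + 1)) 0 le_rfl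
  refine integrable_of_decay (hw.mul hr.1.continuous.aestronglyMeasurable) hK
    (fun q hq => ?_) (C := C * D) fun q hq => ?_
  · rw [show q = (q.1, q.2) from rfl, fibreFourier_eq_zero (hK0 _ hq), mul_zero]
  · have h1 := hD q.1 hq q.2
    rw [norm_iteratedFDeriv_zero] at h1
    have hC0 : 0 ≤ C := by
      have := (norm_nonneg _).trans (hC q hq)
      exact nonneg_of_mul_nonneg_left this (by positivity)
    rw [norm_mul]
    calc (1 + ‖q.2‖) ^ (n + 1) * (‖w q‖ * ‖fibreFourier F q‖)
        ≤ (1 + ‖q.2‖) ^ (n + 1) * (C * (1 + ‖q.2‖) ^ M * ‖fibreFourier F q‖) := by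
          gcongr; exact hC q hq
      _ = C * ((1 + ‖q.2‖) ^ (M + (n + 1)) * ‖fibreFourier F (q.1, q.2)‖) := by
          rw [pow_add]; ring
      _ ≤ C * D := by gcongr

theorem integrable_fibre {F : Coord p n → ℂ} (hF : ContDiff ℝ ∞ F) (hs : HasCompactSupport F)
    (u : EuclideanSpace ℝ (Fin p)) : Integrable fun x => F (u, x) := by
  have hr := integrable_exp_smul (isRapid_of_hasCompactSupport hF hs 0) (u, 0)
  simpa using hr

theorem integrable_fibre_fibreFourier {F : Coord p n → ℂ} (hF : ContDiff ℝ ∞ F)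
    (hs : HasCompactSupport F) (u : EuclideanSpace ℝ (Fin p)) :
    Integrable fun η => fibreFourier F (u, η) := by
  have hr := integrable_exp_smul (isRapid_fibreFourier hF hs 0) (u, 0)
  simpa using hr

theorem fibreFourier_inversion {F : Coord p n → ℂ} (hF : ContDiff ℝ ∞ F)
    (hs : HasCompactSupport F) (q : Coord p n) :
    F q = ((2 * Real.pi : ℝ) : ℂ)⁻¹ ^ n *
      ∫ η, Complex.exp (Complex.I * (inner ℝ q.2 η : ℝ)) * fibreFourier F (q.1, η) := by
  have hc : Continuous F := hF.continuous
  have := fourier_inversion (integrable_fibre hF hs q.1) (by fun_prop)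
    (integrable_fibre_fibreFourier hF hs q.1) q.2
  rwa [finrank_euclideanSpace_fin] at this

/-- A classical symbol has at most polynomial growth. -/
theorem IsClassicalSymbol.exists_growth {m : ℂ} {a : Coord p n → ℂ} (ha : IsClassicalSymbol m a) :
    ∃ M : ℕ, ∀ K : Set (EuclideanSpace ℝ (Fin p)), IsCompact K →
      ∃ C : ℝ, ∀ q : Coord p n, q.1 ∈ K → ‖a q‖ ≤ C * (1 + ‖q.2‖) ^ M := by
  obtain ⟨hs, b, -, -, hb⟩ := ha
  obtain ⟨M, hM⟩ := exists_nat_ge m.re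
  refine ⟨M, fun K hK => ?_⟩
  obtain ⟨C, hC⟩ := hb 0 0 0 K hK
  obtain ⟨D, hD⟩ := (hK.prod (isCompact_closedBall (0 : EuclideanSpace ℝ (Fin n)) 1)
    ).exists_bound_of_continuousOn hs.continuous.continuousOn
  refine ⟨max C D, fun q hq => ?_⟩
  have hone : 1 ≤ 1 + ‖q.2‖ := by simp
  rcases le_or_gt ‖q.2‖ 1 with h | h
  · have hD0 : 0 ≤ D := (norm_nonneg _).trans (hD q ⟨hq, by simpa using h⟩)
    calc ‖a q‖ ≤ D := hD q ⟨hq, by simpa using h⟩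
      _ ≤ max C D * 1 := by simp
      _ ≤ _ := by
        gcongr
        exact one_le_pow₀ hone
  · have h1 := hC q.1 hq q.2 h.le
    simp only [Finset.range_zero, Finset.sum_empty, sub_zero, CharP.cast_eq_zero,
      norm_iteratedFDeriv_zero] at h1
    have hC0 : 0 ≤ C := by
      refine nonneg_of_mul_nonneg_left ((norm_nonneg _).trans h1) ?_
      positivity
    have h2 : ‖q.2‖ ^ m.re ≤ (1 + ‖q.2‖) ^ M := by
      rw [← Real.rpow_natCast]
      exact (Real.rpow_le_rpow_of_exponent_le h.le hM).trans
        (Real.rpow_le_rpow (norm_nonneg _) (by simp) (by positivity))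
    calc ‖a q‖ ≤ C * ‖q.2‖ ^ m.re := h1
      _ ≤ max C D * (1 + ‖q.2‖) ^ M := by
        gcongr
        exact le_max_left _ _

/-- Continuity of `P_a` on functions with support in a fixed compact set. -/
theorem exists_norm_oscillatory_le {m : ℂ} {a : Coord p n → ℂ} (ha : IsClassicalSymbol m a)
    {Z : Set (Coord p n)} (hZ : IsCompact Z) :
    ∃ (N : ℕ) (C : ℝ), 0 ≤ C ∧ ∀ (F : Coord p n → ℂ) (B : ℝ), ContDiff ℝ ∞ F → (∀ q ∉ Z, F q = 0) →
      (∀ j ≤ N, ∀ q ∈ Z, ‖iteratedFDeriv ℝ j F q‖ ≤ B) → 0 ≤ B → ‖oscillatory a F‖ ≤ C * B := by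
  obtain ⟨M, hM⟩ := ha.exists_growth
  let K := Prod.fst '' Z
  have hK : IsCompact K := hZ.image continuous_fst
  obtain ⟨C, hC⟩ := hM K hK
  -- `a` grows like `‖η‖ ^ M`, so `M` derivatives of `F` compensate it and `n + 1` more make the
  -- product integrable
  obtain ⟨A, hA, hFT⟩ := exists_norm_fourier_le (EuclideanSpace ℝ (Fin n)) ℂ (M + (n + 1))
  obtain ⟨R, hR⟩ := hZ.isBounded.exists_norm_le
  set N := M + (n + 1) with hN
  let b : Coord p n → ℝ := fun q => K.indicator (fun _ => (1 : ℝ)) q.1 * (1 + ‖q.2‖) ^ (-((n : ℝ) + 1))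
  have hb : Integrable b := by
    refine Integrable.mul_prod (f := K.indicator fun _ => (1 : ℝ))
      (g := fun x : EuclideanSpace ℝ (Fin n) => (1 + ‖x‖) ^ (-((n : ℝ) + 1)))
      ((integrable_indicator_iff hK.measurableSet).2 (integrableOn_const hK.measure_lt_top.ne))
      (integrable_one_add_norm (by simp))
  refine ⟨N, ‖((2 * Real.pi : ℝ) : ℂ)⁻¹ ^ n‖ * (|C| * (A * (1 + |R|) ^ (n + 1)) * ∫ q, b q), ?_,
    fun F B hF h0 hB hB0 => ?_⟩
  · have : 0 ≤ ∫ q, b q := integral_nonneg fun q =>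
      mul_nonneg (indicator_nonneg (fun _ _ => zero_le_one) _) (by positivity)
    positivity
  have hder : ∀ j ≤ N, ∀ q : Coord p n, ‖iteratedFDeriv ℝ j F q‖ ≤ B := by
    intro j hj q
    by_cases hq : q ∈ Z
    · exact hB j hj q hq
    · have hev : F =ᶠ[𝓝 q] fun _ => 0 := by
        filter_upwards [hZ.isClosed.isOpen_compl.mem_nhds hq] with x hx using h0 x hx
      rw [(Filter.EventuallyEq.iteratedFDeriv ℝ hev j).eq_of_nhds]
      simpa using hB0
  have hFN : ContDiff ℝ N F := hF.of_le (by exact_mod_cast le_top)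
  have hfib : ∀ u, ∀ η, (1 + ‖η‖) ^ N * ‖fibreFourier F (u, η)‖ ≤ A * ((1 + |R|) ^ (n + 1) * B) := by
    intro u η
    refine hFT (fun x => F (u, x)) _ (contDiff_fibre hFN u) (fun j hj x => ?_) η
    rw [finrank_euclideanSpace_fin]
    rcases le_or_gt ‖x‖ |R| with hx | hx
    · gcongr
      exact (norm_iteratedFDeriv_fibre_le hj hFN u x).trans (hder j hj _)
    · have hev : (fun x => F (u, x)) =ᶠ[𝓝 x] fun _ => 0 := by
        have : ∀ᶠ y : EuclideanSpace ℝ (Fin n) in 𝓝 x, |R| < ‖y‖ :=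
          ContinuousAt.eventually_lt continuousAt_const (by fun_prop) hx
        filter_upwards [this] with y hy
        refine h0 _ fun hmem => ?_
        exact absurd (((norm_snd_le (u, y)).trans (hR _ hmem)).trans (le_abs_self R)) (not_le.2 hy)
      rw [(Filter.EventuallyEq.iteratedFDeriv ℝ hev j).eq_of_nhds]
      simp only [iteratedFDeriv_fun_zero, Pi.zero_apply, norm_zero, mul_zero]
      positivity
  rw [oscillatory, norm_mul, mul_assoc]
  refine mul_le_mul_of_nonneg_left ?_ (norm_nonneg _)
  rw [mul_assoc, mul_comm (∫ q, b q) B, ← mul_assoc, ← integral_const_mul]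
  refine norm_integral_le_of_norm_le (hb.const_mul _) (Eventually.of_forall fun q => ?_)
  by_cases hq : q.1 ∈ K
  · have hpos : 0 < 1 + ‖q.2‖ := by positivity
    have h3 : (1 + ‖q.2‖) ^ (-((n : ℝ) + 1)) = ((1 + ‖q.2‖) ^ (n + 1))⁻¹ := by
      rw [Real.rpow_neg hpos.le]; norm_cast
    simp only [b, indicator_of_mem hq, one_mul]
    rw [h3, ← div_eq_mul_inv, le_div_iff₀ (by positivity), norm_mul]
    have h4 := hfib q.1 q.2
    have h5 : ‖a q‖ ≤ |C| * (1 + ‖q.2‖) ^ M :=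
      (hC q hq).trans (mul_le_mul_of_nonneg_right (le_abs_self C) (by positivity))
    calc ‖a q‖ * ‖fibreFourier F q‖ * (1 + ‖q.2‖) ^ (n + 1)
        ≤ |C| * (1 + ‖q.2‖) ^ M * ‖fibreFourier F q‖ * (1 + ‖q.2‖) ^ (n + 1) := by gcongr
      _ = |C| * ((1 + ‖q.2‖) ^ N * ‖fibreFourier F (q.1, q.2)‖) := by
          rw [hN, pow_add]; ring
      _ ≤ |C| * (A * ((1 + |R|) ^ (n + 1) * B)) := by gcongr
      _ = _ := by ring
  · have : ∀ x, F (q.1, x) = 0 := fun x => h0 _ fun hmem => hq ⟨_, hmem, rfl⟩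
    rw [show q = (q.1, q.2) from rfl, fibreFourier_eq_zero this]
    simp [b, hq]

end Coordinates

/-! ### Compactly supported Schwartz functions in an adapted chart -/

/-- A Schwartz function on the deformation to the normal cone of `ℝᵖ × {0}` in `ℝᵖ × ℝⁿ`,
supported in a ball of radius `R`, together with its lift `G(u, ξ, τ, s)` to the blow-up. -/
structure LocalKernel (p n : ℕ) where
  /-- the function on `ℝᵖ × ℝⁿ × ℝ` -/
  k : Coord p n → ℝ → ℂ
  /-- its lift in the coordinates `(u, ξ, τ, s) ↦ ((u, s ξ), s τ)` -/
  G : EuclideanSpace ℝ (Fin p) × EuclideanSpace ℝ (Fin n) × ℝ × ℝ → ℂ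
  /-- a bound for the support -/
  R : ℝ
  R_nonneg : 0 ≤ R
  eq_zero : ∀ q, ∀ t ≤ 0, k q t = 0
  bounded : ∀ q t, k q t ≠ 0 → ‖q‖ ≤ R ∧ t ≤ R
  contDiffOn : ContDiffOn ℝ ∞ G {w | (w.2.1, w.2.2.1) ≠ 0 ∧ 0 ≤ w.2.2.2}
  lift_eq : ∀ u ξ τ s, (ξ, τ) ≠ 0 → 0 < s → G (u, ξ, τ, s) = k (u, s • ξ) (s * τ)

namespace LocalKernel

variable {p n : ℕ} (κ : LocalKernel p n)

/-- The lift as a function of `τ` and `(u, ζ, σ)`, where `s = σ²`; the substitution extends it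
to negative `σ`. -/
def sqLift (x : (EuclideanSpace ℝ (Fin p) × EuclideanSpace ℝ (Fin n) × ℝ) × ℝ) : ℂ :=
  κ.G (x.1.1, x.1.2.1, x.2, x.1.2.2 ^ 2)

theorem contDiffAt_sqLift {x : (EuclideanSpace ℝ (Fin p) × EuclideanSpace ℝ (Fin n) × ℝ) × ℝ}
    (hx : (x.1.2.1, x.2) ≠ 0) : ContDiffAt ℝ ∞ κ.sqLift x := by
  have hO : IsOpen {x : (EuclideanSpace ℝ (Fin p) × EuclideanSpace ℝ (Fin n) × ℝ) × ℝ |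
      (x.1.2.1, x.2) ≠ 0} := isOpen_ne_fun (by fun_prop) continuous_const
  have : ContDiffOn ℝ ∞ κ.sqLift {x | (x.1.2.1, x.2) ≠ 0} :=
    κ.contDiffOn.comp (by fun_prop) fun x hx => ⟨hx, sq_nonneg _⟩
  exact this.contDiffAt (hO.mem_nhds hx)

theorem sqLift_eq {u : EuclideanSpace ℝ (Fin p)} {ζ : EuclideanSpace ℝ (Fin n)} {σ τ : ℝ}
    (h : (ζ, τ) ≠ 0) (hσ : σ ≠ 0) :
    κ.sqLift ((u, ζ, σ), τ) = κ.k (u, σ ^ 2 • ζ) (σ ^ 2 * τ) :=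
  κ.lift_eq _ _ _ _ h (by positivity)

theorem continuous_sqLift {u : EuclideanSpace ℝ (Fin p)} {ζ : EuclideanSpace ℝ (Fin n)} {τ : ℝ}
    (h : (ζ, τ) ≠ 0) : Continuous fun σ => κ.sqLift ((u, ζ, σ), τ) :=
  continuous_iff_continuousAt.2 fun σ => ContinuousAt.comp (f := fun σ => ((u, ζ, σ), τ))
    (κ.contDiffAt_sqLift (x := ((u, ζ, σ), τ)) h).continuousAt (by fun_prop)

theorem sqLift_eq_zero {u : EuclideanSpace ℝ (Fin p)} {ζ : EuclideanSpace ℝ (Fin n)} {τ : ℝ}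
    (h : (ζ, τ) ≠ 0) (hτ : τ ≤ 0) (σ : ℝ) : κ.sqLift ((u, ζ, σ), τ) = 0 :=
  eq_of_eq_off_zero (κ.continuous_sqLift h) continuous_const (fun σ hσ => by
    rw [κ.sqLift_eq h hσ, κ.eq_zero]
    exact mul_nonpos_of_nonneg_of_nonpos (sq_nonneg σ) hτ) σ

theorem sqLift_neg {u : EuclideanSpace ℝ (Fin p)} {ζ : EuclideanSpace ℝ (Fin n)} {σ τ : ℝ} :
    κ.sqLift ((u, ζ, -σ), τ) = κ.sqLift ((u, ζ, σ), τ) := by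
  simp [sqLift]

/-- The coordinates `(ζ, τ, s)` and `(c⁻¹ ζ, c⁻¹ τ, c s)` describe the same point of the blow-up. -/
theorem sqLift_scale {u : EuclideanSpace ℝ (Fin p)} {ζ : EuclideanSpace ℝ (Fin n)} {τ c : ℝ}
    (h : (ζ, τ) ≠ 0) (hc : 0 < c) (σ : ℝ) :
    κ.sqLift ((u, ζ, σ), τ) = κ.sqLift ((u, c⁻¹ • ζ, √c * σ), c⁻¹ * τ) := by
  have h' : (c⁻¹ • ζ, c⁻¹ * τ) ≠ 0 := by
    have := smul_ne_zero (inv_ne_zero hc.ne') h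
    simpa using this
  refine eq_of_eq_off_zero (κ.continuous_sqLift h)
    ((κ.continuous_sqLift h').comp (continuous_const.mul continuous_id)) (fun σ hσ => ?_) σ
  have h2 : √c * σ ≠ 0 := mul_ne_zero (Real.sqrt_pos.2 hc).ne' hσ
  change _ = κ.sqLift ((u, c⁻¹ • ζ, √c * σ), c⁻¹ * τ)
  rw [κ.sqLift_eq h hσ, κ.sqLift_eq h' h2, mul_pow, Real.sq_sqrt hc.le, smul_smul]
  rw [show c * σ ^ 2 * c⁻¹ = σ ^ 2 by field_simp,
    show c * σ ^ 2 * (c⁻¹ * τ) = σ ^ 2 * τ by field_simp]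

theorem bounded_of_sqLift_ne_zero {u : EuclideanSpace ℝ (Fin p)} {ζ : EuclideanSpace ℝ (Fin n)}
    {σ τ : ℝ} (h : (ζ, τ) ≠ 0) (hne : κ.sqLift ((u, ζ, σ), τ) ≠ 0) :
    ‖u‖ ≤ κ.R ∧ σ ^ 2 * ‖ζ‖ ≤ κ.R ∧ σ ^ 2 * τ ≤ κ.R := by
  have key : ∀ σ ≠ 0, κ.sqLift ((u, ζ, σ), τ) ≠ 0 →
      ‖u‖ ≤ κ.R ∧ σ ^ 2 * ‖ζ‖ ≤ κ.R ∧ σ ^ 2 * τ ≤ κ.R := by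
    intro σ hσ hne
    rw [κ.sqLift_eq h hσ] at hne
    obtain ⟨h1, h2⟩ := κ.bounded _ _ hne
    refine ⟨(norm_fst_le _).trans h1, ?_, h2⟩
    have := (norm_snd_le _).trans h1
    simpa [norm_smul] using this
  rcases eq_or_ne σ 0 with rfl | hσ
  · refine ⟨?_, by simpa using κ.R_nonneg, by simpa using κ.R_nonneg⟩
    by_contra hu
    exact hne (eq_of_eq_off_zero (κ.continuous_sqLift h) continuous_const (fun σ hσ => by
      by_contra h0
      exact hu (key σ hσ h0).1) 0)
  · exact key σ hσ hne

/-- The lift is divisible by any power of `τ` away from `ζ = 0`. -/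
theorem exists_sqLift_eq_pow (N : ℕ) :
    ∃ H : (EuclideanSpace ℝ (Fin p) × EuclideanSpace ℝ (Fin n) × ℝ) × ℝ → ℂ,
      ContDiffOn ℝ ∞ H ({q | q.2.1 ≠ 0} ×ˢ univ) ∧
      (∀ u ζ σ τ, ζ ≠ 0 → κ.sqLift ((u, ζ, σ), τ) = τ ^ N • H ((u, ζ, σ), τ)) ∧
      ∀ u ζ σ τ, ζ ≠ 0 → H ((u, ζ, σ), τ) ≠ 0 → σ ^ 2 * ‖ζ‖ ≤ κ.R := by
  have hU : IsOpen {q : EuclideanSpace ℝ (Fin p) × EuclideanSpace ℝ (Fin n) × ℝ | q.2.1 ≠ 0} :=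
    isOpen_snd_fst_ne_zero
  have hne : ∀ (ζ : EuclideanSpace ℝ (Fin n)) (τ : ℝ), ζ ≠ 0 → (ζ, τ) ≠ 0 := fun ζ τ h h' =>
    h (congrArg Prod.fst h')
  obtain ⟨H, hH, -, heq⟩ := exists_contDiffOn_eq_pow_smul_of_neg hU (f := κ.sqLift)
    (fun x hx => (κ.contDiffAt_sqLift (hne _ _ hx.1)).contDiffWithinAt)
    (fun q hq s hs => κ.sqLift_eq_zero (hne _ _ hq) hs.le _) N
  refine ⟨H, hH, fun u ζ σ τ hζ => heq _ hζ τ, fun u ζ σ τ hζ h0 => ?_⟩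
  by_contra hlt
  refine h0 ?_
  have hc : Continuous fun τ => H ((u, ζ, σ), τ) := by
    refine continuous_iff_continuousAt.2 fun τ => ?_
    exact (hH.contDiffAt ((hU.prod isOpen_univ).mem_nhds
      (show ((u, ζ, σ), τ) ∈ _ from ⟨hζ, mem_univ _⟩))).continuousAt.comp
      (f := fun τ : ℝ => ((u, ζ, σ), τ)) (by fun_prop)
  refine eq_of_eq_off_zero hc continuous_const (fun τ hτ => ?_) τ
  have h1 := heq (u, ζ, σ) hζ τ
  have h2 : κ.sqLift ((u, ζ, σ), τ) = 0 := by
    by_contra h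
    exact hlt (κ.bounded_of_sqLift_ne_zero (hne _ _ hζ) h).2.1
  rw [h2] at h1
  exact (smul_eq_zero.1 h1.symm).resolve_left (pow_ne_zero _ hτ)

/-- The function `(u, r, ξ) ↦ k(u, r² ξ, r²)`, extended to `r = 0`. -/
def fibreKernel (x : (EuclideanSpace ℝ (Fin p) × ℝ) × EuclideanSpace ℝ (Fin n)) : ℂ :=
  κ.sqLift ((x.1.1, x.2, x.1.2), 1)

theorem contDiff_fibreKernel : ContDiff ℝ ∞ κ.fibreKernel := by
  refine contDiff_iff_contDiffAt.2 fun x => ContDiffAt.comp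
    (f := fun x : (EuclideanSpace ℝ (Fin p) × ℝ) × EuclideanSpace ℝ (Fin n) =>
      ((x.1.1, x.2, x.1.2), (1 : ℝ))) x (κ.contDiffAt_sqLift ?_) (by fun_prop)
  simp

theorem fibreKernel_eq {u : EuclideanSpace ℝ (Fin p)} {r : ℝ} (hr : r ≠ 0)
    (ξ : EuclideanSpace ℝ (Fin n)) :
    κ.fibreKernel ((u, r), ξ) = κ.k (u, r ^ 2 • ξ) (r ^ 2) := by
  rw [fibreKernel, κ.sqLift_eq (by simp) hr, mul_one]

theorem fibreKernel_eq_zero {u : EuclideanSpace ℝ (Fin p)} {r : ℝ}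
    (h : κ.R < ‖u‖ ∨ κ.R < r ^ 2) (ξ : EuclideanSpace ℝ (Fin n)) :
    κ.fibreKernel ((u, r), ξ) = 0 := by
  by_contra hne
  obtain ⟨h1, -, h2⟩ := κ.bounded_of_sqLift_ne_zero (by simp) hne
  rw [mul_one] at h2
  rcases h with h | h
  · exact absurd h1 (not_le.2 h)
  · exact absurd h2 (not_le.2 h)

/-- Rapid decay in the fibres of the normal bundle is flatness of the lift at `τ = 0`. -/
theorem isRapid_fibreKernel (N : ℕ) : IsRapid N κ.fibreKernel := by
  refine ⟨κ.contDiff_fibreKernel.of_le (by exact_mod_cast le_top), fun K hK M j hj => ?_⟩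
  have hU : IsOpen {q : EuclideanSpace ℝ (Fin p) × EuclideanSpace ℝ (Fin n) × ℝ | q.2.1 ≠ 0} :=
    isOpen_snd_fst_ne_zero
  -- for `‖ξ‖ = ρ > 1` the point `(ξ, 1, r²)` is `(ξ / ρ, 1 / ρ, ρ r²)`; dividing the lift by
  -- `τ ^ (M + j)` gives decay of order `M` after the loss of `ρ ^ j` in `j` derivatives
  obtain ⟨H, hH, heq, hsupp⟩ := κ.exists_sqLift_eq_pow (M + j)
  have hc : Continuous fun x : (EuclideanSpace ℝ (Fin p) × ℝ) × EuclideanSpace ℝ (Fin n) =>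
      (1 + ‖x.2‖) ^ M * ‖iteratedFDeriv ℝ j κ.fibreKernel x‖ :=
    ((continuous_const.add continuous_snd.norm).pow M).mul
      (κ.contDiff_fibreKernel.continuous_iteratedFDeriv (by exact_mod_cast le_top)).norm
  obtain ⟨C, hC⟩ := (hK.prod (isCompact_closedBall (0 : EuclideanSpace ℝ (Fin n)) 1)
    ).exists_bound_of_continuousOn hc.continuousOn
  let Z : Set ((EuclideanSpace ℝ (Fin p) × EuclideanSpace ℝ (Fin n) × ℝ) × ℝ) :=
    ((Prod.fst '' K) ×ˢ (Metric.sphere (0 : EuclideanSpace ℝ (Fin n)) 1 ×ˢ Icc (-√κ.R) √κ.R))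
      ×ˢ Icc 0 1
  have hZ : IsCompact Z :=
    ((hK.image continuous_fst).prod ((isCompact_sphere 0 1).prod isCompact_Icc)).prod isCompact_Icc
  have hHat : ∀ q τ, q.2.1 ≠ 0 → ContDiffAt ℝ ∞ H (q, τ) := fun q τ hq =>
    hH.contDiffAt ((hU.prod isOpen_univ).mem_nhds ⟨hq, mem_univ _⟩)
  obtain ⟨D, hD⟩ := hZ.exists_bound_of_continuousOn (f := fun x => ‖iteratedFDeriv ℝ j H x‖)
    fun x hx => (((hHat x.1 x.2 (ne_zero_of_mem_unit_sphere ⟨x.1.2.1, hx.1.2.1⟩)).iteratedFDeriv_right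
        (m := 0) (by exact_mod_cast le_top)).continuousAt.norm).continuousWithinAt
  refine ⟨max |C| (2 ^ M * |D|), fun x hx ξ => ?_⟩
  obtain ⟨u, r⟩ := x
  rcases le_or_gt ‖ξ‖ 1 with h | h
  · exact (le_abs_self _).trans ((hC ((u, r), ξ) ⟨hx, by simpa using h⟩).trans
      ((le_abs_self _).trans (le_max_left _ _)))
  refine le_trans ?_ (le_max_right _ _)
  set ρ := ‖ξ‖ with hρ
  have hρ0 : 0 < ρ := by linarith
  have hξ0 : ξ ≠ 0 := norm_pos_iff.1 hρ0
  have hsq1 : 1 ≤ √ρ := Real.one_le_sqrt.2 h.le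
  have hsqρ : √ρ ≤ ρ := by
    rw [Real.sqrt_le_left (by positivity)]; nlinarith
  -- `ρ` is frozen, so that the change of variables is linear
  let L : (EuclideanSpace ℝ (Fin p) × ℝ) × EuclideanSpace ℝ (Fin n) →L[ℝ]
      EuclideanSpace ℝ (Fin p) × EuclideanSpace ℝ (Fin n) × ℝ :=
    ((ContinuousLinearMap.fst ℝ _ _).comp (ContinuousLinearMap.fst ℝ _ _)).prod
      ((ρ⁻¹ • ContinuousLinearMap.snd ℝ _ _).prod
        (√ρ • (ContinuousLinearMap.snd ℝ _ _).comp (ContinuousLinearMap.fst ℝ _ _)))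
  have hLapp : ∀ u r ξ, L ((u, r), ξ) = (u, ρ⁻¹ • ξ, √ρ * r) := fun u r ξ => by simp [L]
  have hL : ‖L‖ ≤ ρ := by
    refine ContinuousLinearMap.opNorm_le_bound _ hρ0.le fun y => ?_
    obtain ⟨⟨u, r⟩, ξ⟩ := y
    rw [hLapp]
    have n1 : ‖u‖ ≤ ‖((u, r), ξ)‖ := (norm_fst_le (u, r)).trans (norm_fst_le ((u, r), ξ))
    have n2 : ‖r‖ ≤ ‖((u, r), ξ)‖ := (norm_snd_le (u, r)).trans (norm_fst_le ((u, r), ξ))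
    have n3 : ‖ξ‖ ≤ ‖((u, r), ξ)‖ := norm_snd_le ((u, r), ξ)
    have hn := norm_nonneg ((u, r), ξ)
    refine norm_prod_le_iff.2 ⟨?_, norm_prod_le_iff.2 ⟨?_, ?_⟩⟩
    · nlinarith
    · simp only [norm_smul, norm_inv, Real.norm_of_nonneg hρ0.le]
      have : ρ⁻¹ ≤ 1 := inv_le_one_of_one_le₀ h.le
      calc ρ⁻¹ * ‖ξ‖ ≤ 1 * ‖ξ‖ := by gcongr
        _ ≤ ρ * _ := by gcongr
    · rw [norm_mul, Real.norm_of_nonneg (by positivity)]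
      gcongr
  let A : EuclideanSpace ℝ (Fin p) × EuclideanSpace ℝ (Fin n) × ℝ → ℂ := fun q => H (q, ρ⁻¹)
  have hev : κ.fibreKernel =ᶠ[𝓝 ((u, r), ξ)] fun y => (ρ⁻¹) ^ (M + j) • A (L y) := by
    have : ∀ᶠ y : (EuclideanSpace ℝ (Fin p) × ℝ) × EuclideanSpace ℝ (Fin n) in 𝓝 ((u, r), ξ),
        y.2 ≠ 0 := (isOpen_ne.preimage continuous_snd).mem_nhds hξ0
    filter_upwards [this] with y hy
    obtain ⟨⟨u, r⟩, ξ⟩ := y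
    rw [fibreKernel, κ.sqLift_scale (c := ρ) (by simp) hρ0, mul_one,
      heq _ _ _ _ (smul_ne_zero (inv_ne_zero hρ0.ne') hy), hLapp]
  have hζ : ρ⁻¹ • ξ ≠ 0 := smul_ne_zero (inv_ne_zero hρ0.ne') hξ0
  have hζ1 : ‖ρ⁻¹ • ξ‖ = 1 := by
    rw [norm_smul, norm_inv, Real.norm_of_nonneg hρ0.le, ← hρ, inv_mul_cancel₀ hρ0.ne']
  have hAat : ContDiffAt ℝ j A (L ((u, r), ξ)) := by
    rw [hLapp]
    exact ((hHat (u, ρ⁻¹ • ξ, √ρ * r) ρ⁻¹ hζ).of_le (by exact_mod_cast le_top)).comp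
      (f := fun q => (q, ρ⁻¹)) _ (by fun_prop)
  have hAD : ‖iteratedFDeriv ℝ j A (L ((u, r), ξ))‖ ≤ |D| := by
    rw [hLapp]
    rcases le_or_gt ((√ρ * r) ^ 2) κ.R with hσ | hσ
    · refine (norm_iteratedFDeriv_partial_left_le (f := H) (y := ρ⁻¹)
        ((hHat _ _ hζ).of_le (by exact_mod_cast le_top))).trans ?_
      refine (le_abs_self _).trans ((hD _ ⟨⟨⟨(u, r), hx, rfl⟩, ?_, ?_⟩, ?_⟩).trans (le_abs_self _))
      · simpa using hζ1
      · exact abs_le.1 (Real.abs_le_sqrt hσ)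
      · exact ⟨by positivity, inv_le_one_of_one_le₀ h.le⟩
    · have hev0 : A =ᶠ[𝓝 (u, ρ⁻¹ • ξ, √ρ * r)] fun _ => 0 := by
        have h1 : ∀ᶠ q : EuclideanSpace ℝ (Fin p) × EuclideanSpace ℝ (Fin n) × ℝ in
            𝓝 (u, ρ⁻¹ • ξ, √ρ * r), q.2.1 ≠ 0 := hU.mem_nhds hζ
        have h2 : ∀ᶠ q : EuclideanSpace ℝ (Fin p) × EuclideanSpace ℝ (Fin n) × ℝ in
            𝓝 (u, ρ⁻¹ • ξ, √ρ * r), κ.R < q.2.2 ^ 2 * ‖q.2.1‖ := by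
          refine ContinuousAt.eventually_lt continuousAt_const (by fun_prop) ?_
          simpa only [hζ1, mul_one] using hσ
        filter_upwards [h1, h2] with q hq1 hq2
        by_contra hne
        exact absurd (hsupp q.1 q.2.1 q.2.2 ρ⁻¹ hq1 hne) (not_le.2 hq2)
      rw [(Filter.EventuallyEq.iteratedFDeriv ℝ hev0 j).eq_of_nhds]
      simp
  rw [(Filter.EventuallyEq.iteratedFDeriv ℝ hev j).eq_of_nhds,
    iteratedFDeriv_const_smul_apply' (f := fun y => A (L y))
      (ContDiffAt.comp (f := L) _ hAat L.contDiff.contDiffAt), norm_smul]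
  have h2 : ‖iteratedFDeriv ℝ j (fun y => A (L y)) ((u, r), ξ)‖ ≤ |D| * ρ ^ j := by
    refine (norm_iteratedFDeriv_comp_clm_le (f := A) L hAat).trans ?_
    gcongr
  have h3 : (1 + ρ) ^ M ≤ (2 * ρ) ^ M := by gcongr; linarith
  rw [norm_pow, Real.norm_of_nonneg (inv_nonneg.2 hρ0.le)]
  calc (1 + ρ) ^ M * (ρ⁻¹ ^ (M + j) * _) ≤ (2 * ρ) ^ M * (ρ⁻¹ ^ (M + j) * (|D| * ρ ^ j)) := by
        gcongr
    _ = 2 ^ M * |D| := by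
        rw [mul_pow, inv_pow, pow_add]; field_simp

end LocalKernel

/-! ### Flatness -/

/-- A smooth function on the line all of whose derivatives vanish at `0` is `O(t ^ N)`. -/
theorem exists_norm_le_pow_of_flat {h : ℝ → ℂ} (hh : ContDiff ℝ ∞ h)
    (h0 : ∀ j : ℕ, iteratedDeriv j h 0 = 0) {T : ℝ} (hT : 0 < T) (N : ℕ) :
    ∃ C : ℝ, ∀ t ∈ Icc 0 T, ‖h t‖ ≤ C * t ^ N := by
  obtain ⟨C, hC⟩ := exists_taylor_mean_remainder_bound (f := h) (a := 0) (b := T) (n := N) hT.le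
    (hh.of_le (by exact_mod_cast le_top)).contDiffOn
  have hz : ∀ t, taylorWithinEval h N (Icc 0 T) 0 t = 0 := by
    intro t
    rw [taylor_within_apply]
    refine Finset.sum_eq_zero fun j _ => ?_
    rw [iteratedDerivWithin_eq_iteratedDeriv (uniqueDiffOn_Icc hT)
      (hh.contDiffAt.of_le (by exact_mod_cast le_top)) (left_mem_Icc.2 hT.le), h0, smul_zero]
  refine ⟨|C| * T, fun t ht => ?_⟩
  have := hC t ht
  rw [hz, sub_zero, sub_zero, pow_succ] at this
  refine this.trans ?_
  have ht0 : 0 ≤ t ^ N := pow_nonneg ht.1 N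
  calc C * (t ^ N * t) ≤ |C| * (t ^ N * T) := by
        gcongr
        · exact mul_nonneg ht0 ht.1
        · exact le_abs_self C
        · exact ht.2
    _ = _ := by ring

namespace LocalKernel

variable {p n : ℕ} (κ : LocalKernel p n)

/-- The Fourier transform `χ(u, η, r) = ∫ k(u, r² ξ, r²) e^{i⟨ξ, η⟩} dξ`. -/
def fourierKernel (x : Coord p n × ℝ) : ℂ := partialFourier κ.fibreKernel ((x.1.1, x.2), -x.1.2)

theorem contDiff_fourierKernel : ContDiff ℝ ∞ κ.fourierKernel := by
  have h : ContDiff ℝ ∞ (partialFourier κ.fibreKernel) := contDiff_infty.2 fun N =>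
    (isRapid_partialFourier κ.isRapid_fibreKernel N).1
  exact h.comp (by fun_prop)

theorem fourierKernel_eq_zero {q : Coord p n} {r : ℝ} (h : κ.R < ‖q.1‖ ∨ κ.R < r ^ 2) :
    κ.fourierKernel (q, r) = 0 := by
  simp [fourierKernel, partialFourier, κ.fibreKernel_eq_zero h]

theorem fourierKernel_neg (q : Coord p n) (r : ℝ) :
    κ.fourierKernel (q, -r) = κ.fourierKernel (q, r) := by
  simp [fourierKernel, partialFourier, fibreKernel, κ.sqLift_neg]

/-- The Fourier transform decreases rapidly with its derivatives, uniformly in `u` and `r`. -/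
theorem exists_norm_fourierKernel_le (M j : ℕ) : ∃ C : ℝ, 0 ≤ C ∧ ∀ (q : Coord p n) (r : ℝ),
    (1 + ‖(q.2, r)‖) ^ M * ‖iteratedFDeriv ℝ j κ.fourierKernel (q, r)‖ ≤ C := by
  let K : Set (EuclideanSpace ℝ (Fin p) × ℝ) := Metric.closedBall 0 κ.R ×ˢ Icc (-√κ.R) √κ.R
  have hK : IsCompact K := (isCompact_closedBall 0 _).prod isCompact_Icc
  have hr := isRapid_partialFourier κ.isRapid_fibreKernel j
  obtain ⟨C, hC⟩ := hr.2 K hK M j le_rfl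
  let L : Coord p n × ℝ →L[ℝ] (EuclideanSpace ℝ (Fin p) × ℝ) × EuclideanSpace ℝ (Fin n) :=
    (((ContinuousLinearMap.fst ℝ _ _).comp (ContinuousLinearMap.fst ℝ _ _)).prod
      (ContinuousLinearMap.snd ℝ _ _)).prod
      (-(ContinuousLinearMap.snd ℝ _ _).comp (ContinuousLinearMap.fst ℝ _ _))
  have hL : κ.fourierKernel = partialFourier κ.fibreKernel ∘ L := by
    funext x; simp [fourierKernel, L]
  refine ⟨(1 + √κ.R) ^ M * (|C| * ‖L‖ ^ j), by positivity, fun q r => ?_⟩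
  by_cases hq : (q.1, r) ∈ K
  · have h1 : ‖iteratedFDeriv ℝ j κ.fourierKernel (q, r)‖
        ≤ ‖iteratedFDeriv ℝ j (partialFourier κ.fibreKernel) ((q.1, r), -q.2)‖ * ‖L‖ ^ j := by
      rw [hL]
      exact norm_iteratedFDeriv_comp_clm_le L hr.1.contDiffAt
    have h2 := hC _ hq (-q.2)
    rw [norm_neg] at h2
    have hr' : ‖r‖ ≤ √κ.R := abs_le.2 hq.2
    have h3 : 1 + ‖(q.2, r)‖ ≤ (1 + √κ.R) * (1 + ‖q.2‖) := by
      have h4 : ‖(q.2, r)‖ ≤ ‖q.2‖ + ‖r‖ :=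
        norm_prod_le_iff.2 ⟨by simp, by simp⟩
      nlinarith [norm_nonneg q.2, Real.sqrt_nonneg κ.R]
    calc _ ≤ ((1 + √κ.R) * (1 + ‖q.2‖)) ^ M * (‖iteratedFDeriv ℝ j
          (partialFourier κ.fibreKernel) ((q.1, r), -q.2)‖ * ‖L‖ ^ j) := by gcongr
      _ = (1 + √κ.R) ^ M * (((1 + ‖q.2‖) ^ M * ‖iteratedFDeriv ℝ j
          (partialFourier κ.fibreKernel) ((q.1, r), -q.2)‖) * ‖L‖ ^ j) := by rw [mul_pow]; ring
      _ ≤ _ := by gcongr; exact h2.trans (le_abs_self C)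
  · have hev : κ.fourierKernel =ᶠ[𝓝 (q, r)] fun _ => 0 := by
      have hopen : IsOpen {x : Coord p n × ℝ | (x.1.1, x.2) ∉ K} :=
        hK.isClosed.isOpen_compl.preimage (by fun_prop)
      filter_upwards [hopen.mem_nhds hq] with x hx
      refine κ.fourierKernel_eq_zero ?_
      by_contra hcon
      push Not at hcon
      exact hx ⟨by simpa using hcon.1, abs_le.1 (Real.abs_le_sqrt hcon.2)⟩
    rw [(Filter.EventuallyEq.iteratedFDeriv ℝ hev j).eq_of_nhds]
    simp only [iteratedFDeriv_fun_zero, Pi.zero_apply, norm_zero, mul_zero]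
    positivity

/-- The family `w ↦ (u, w² η, w r)` of dilations applied to the Fourier transform. -/
def dilatedKernel (x : (Coord p n × ℝ) × ℝ) : ℂ :=
  κ.fourierKernel ((x.1.1.1, x.2 ^ 2 • x.1.1.2), x.2 * x.1.2)

theorem contDiff_dilatedKernel : ContDiff ℝ ∞ κ.dilatedKernel :=
  κ.contDiff_fourierKernel.comp (by fun_prop)

theorem continuous_k {t : ℝ} (ht : 0 < t) : Continuous fun q => κ.k q t := by
  have : (fun q => κ.k q t) = fun q : Coord p n => κ.G (q.1, q.2, t, 1) := by
    funext q
    rw [κ.lift_eq _ _ _ _ (by simp [ht.ne']) one_pos]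
    simp
  rw [this]
  refine κ.contDiffOn.continuousOn.comp_continuous (by fun_prop) fun q => ?_
  simp [ht.ne']

theorem hasCompactSupport_k (t : ℝ) : HasCompactSupport fun q => κ.k q t :=
  HasCompactSupport.of_support_subset_isCompact (isCompact_closedBall 0 κ.R) fun q hq => by
    simpa using (κ.bounded q t hq).1

/-- The pairing with a function on `ℝᵖ × ℝⁿ`, in the coordinates of the normal bundle. -/
theorem pairing_eq_integral {F : Coord p n → ℂ} (hF : Continuous F) {r : ℝ} (hr : r ≠ 0) :
    (((r ^ 2 : ℝ) : ℂ)⁻¹) ^ n * ∫ q, κ.k q (r ^ 2) * F q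
      = ∫ u, ∫ ξ, κ.fibreKernel ((u, r), ξ) * F (u, r ^ 2 • ξ) := by
  have hr2 : 0 < r ^ 2 := by positivity
  have hint : Integrable fun q => κ.k q (r ^ 2) * F q :=
    ((κ.continuous_k hr2).mul hF).integrable_of_hasCompactSupport
      ((κ.hasCompactSupport_k _).mul_right)
  rw [Measure.volume_eq_prod, integral_prod _ hint, ← integral_const_mul]
  congr 1
  ext u
  have := MeasureTheory.Measure.integral_comp_smul (volume : Measure (EuclideanSpace ℝ (Fin n)))
    (fun x => κ.k (u, x) (r ^ 2) * F (u, x)) (r ^ 2)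
  rw [finrank_euclideanSpace_fin, abs_of_pos (by positivity), Complex.real_smul] at this
  simp only [κ.fibreKernel_eq hr, this]
  push_cast
  rw [inv_pow]

end LocalKernel

namespace LocalKernel

variable {p n : ℕ} (κ : LocalKernel p n)

/-- The pairings with smooth functions vanish to infinite order at `t = 0`. -/
def IsFlat : Prop := ∀ F : Coord p n → ℂ, ContDiff ℝ ∞ F → ∃ h : ℝ → ℂ, ContDiff ℝ ∞ h ∧
  (∀ t : ℝ, 0 < t → h t = (t : ℂ)⁻¹ ^ n * ∫ q, κ.k q t * F q) ∧ ∀ j : ℕ, iteratedDeriv j h 0 = 0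

variable {κ}

/-- Testing flatness on `f(u) e^{i⟨x, η⟩ / r²}`. -/
theorem IsFlat.exists_test (hκ : κ.IsFlat) {f : EuclideanSpace ℝ (Fin p) → ℝ} (hf : ContDiff ℝ ∞ f)
    (η : EuclideanSpace ℝ (Fin n)) {r : ℝ} (hr : r ≠ 0) :
    ∃ h : ℝ → ℂ, ContDiff ℝ ∞ h ∧ (∀ j : ℕ, iteratedDeriv j h 0 = 0) ∧ ∀ w : ℝ, w ≠ 0 →
      ∫ u, f u • κ.dilatedKernel (((u, η), r), w) = h ((w * r) ^ 2) := by
  let F : Coord p n → ℂ := fun q =>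
    (f q.1 : ℂ) * Complex.exp (Complex.I * (inner ℝ q.2 ((r ^ 2)⁻¹ • η) : ℝ))
  have hF : ContDiff ℝ ∞ F := by
    refine ContDiff.mul ?_ (ContDiff.cexp ?_)
    · exact Complex.ofRealCLM.contDiff.comp (hf.comp contDiff_fst)
    · exact contDiff_const.mul (Complex.ofRealCLM.contDiff.comp
        (contDiff_snd.inner ℝ contDiff_const))
  obtain ⟨h, hh, heq, h0⟩ := hκ F hF
  refine ⟨h, hh, h0, fun w hw => ?_⟩
  have hwr : w * r ≠ 0 := mul_ne_zero hw hr
  rw [heq _ (by positivity), κ.pairing_eq_integral hF.continuous hwr]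
  congr 1
  ext u
  rw [dilatedKernel, fourierKernel, partialFourier, Complex.real_smul, ← integral_const_mul]
  congr 1
  ext ξ
  have he : Complex.I * ((inner ℝ ((w * r) ^ 2 • ξ) ((r ^ 2)⁻¹ • η) : ℝ) : ℂ)
      = -(Complex.I * ((inner ℝ ξ (-(w ^ 2 • η)) : ℝ) : ℂ)) := by
    rw [inner_smul_left, inner_smul_right, inner_neg_right, inner_smul_right, conj_trivial]
    have : (r : ℂ) ≠ 0 := by exact_mod_cast hr
    push_cast
    field_simp
  simp only [F, smul_eq_mul]
  rw [he]
  ring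

/-- Flatness of the pairings makes `χ(u, w² η, w r)` globally and smoothly divisible by every power of `w`. -/
theorem IsFlat.exists_dilatedKernel_eq_pow (hκ : κ.IsFlat) (N : ℕ) :
    ∃ Ψ : (Coord p n × ℝ) × ℝ → ℂ, ContDiff ℝ ∞ Ψ ∧
      ∀ q w, κ.dilatedKernel (q, w) = w ^ N • Ψ (q, w) := by
  induction N with
  | zero => exact ⟨κ.dilatedKernel, κ.contDiff_dilatedKernel, by simp⟩
  | succ N ih =>
    obtain ⟨Ψ, hΨ, heq⟩ := ih
    have hΨc : Continuous Ψ := hΨ.continuous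
    -- the quotient `Ψ` vanishes at `w = 0`: for `r ≠ 0` its integrals against all functions of `u` do
    have hz1 : ∀ η r, r ≠ 0 → ∀ u, Ψ (((u, η), r), 0) = 0 := by
      intro η r hr
      have hcu : Continuous fun u => Ψ (((u, η), r), 0) := by fun_prop
      have hae : ∀ᵐ u, Ψ (((u, η), r), 0) = 0 := by
        refine ae_eq_zero_of_integral_contDiff_smul_eq_zero hcu.locallyIntegrable fun f hf hfs => ?_
        obtain ⟨h, hh, h0, hint⟩ := hκ.exists_test hf η hr
        have hfc : Continuous f := hf.continuous
        let I : ℝ → ℂ := fun w => ∫ u, f u • Ψ (((u, η), r), w)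
        have hI : Continuous I := by
          have h1 : Continuous fun w : ℝ => ∫ u in tsupport f, f u • Ψ (((u, η), r), w) :=
            continuous_parametric_integral_of_continuous (by fun_prop) hfs.isCompact
          convert h1 using 2 with w
          refine (setIntegral_eq_integral_of_forall_compl_eq_zero fun u hu => ?_).symm
          rw [image_eq_zero_of_notMem_tsupport hu, zero_smul]
        -- `w ^ N I(w)` is a flat function of `(w r)²`, hence `I(w) → 0`
        have hIw : ∀ w, w ≠ 0 → w ^ N • I w = h ((w * r) ^ 2) := by
          intro w hw
          rw [← hint w hw, ← integral_smul]
          congr 1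
          ext u
          rw [heq, smul_comm]
        obtain ⟨C, hC⟩ := exists_norm_le_pow_of_flat hh h0 (T := r ^ 2) (by positivity) (N + 1)
        have hbound : ∀ w ∈ Ioo (0 : ℝ) 1, ‖I w‖ ≤ |C| * (r ^ 2) ^ (N + 1) * w := by
          intro w hw
          have hwr : (w * r) ^ 2 ≤ r ^ 2 := by
            rw [mul_pow]
            exact mul_le_of_le_one_left (sq_nonneg r) (pow_le_one₀ hw.1.le hw.2.le)
          have h2 := hC _ ⟨sq_nonneg _, hwr⟩
          rw [← hIw w hw.1.ne', norm_smul, norm_pow, Real.norm_of_nonneg hw.1.le] at h2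
          have hwN : 0 < w ^ N := pow_pos hw.1 N
          refine le_of_mul_le_mul_left ?_ hwN
          calc w ^ N * ‖I w‖ ≤ C * ((w * r) ^ 2) ^ (N + 1) := h2
            _ ≤ |C| * ((w * r) ^ 2) ^ (N + 1) := by gcongr; exact le_abs_self C
            _ = w ^ N * (|C| * (r ^ 2) ^ (N + 1) * w) * w ^ (N + 1) := by ring
            _ ≤ w ^ N * (|C| * (r ^ 2) ^ (N + 1) * w) * 1 := by
              have := hw.1.le
              gcongr
              exact pow_le_one₀ hw.1.le hw.2.le
            _ = _ := mul_one _
        have hlim : Tendsto I (𝓝[>] 0) (𝓝 0) := by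
          refine squeeze_zero_norm' ?_ (a := fun w => |C| * (r ^ 2) ^ (N + 1) * w) ?_
          · filter_upwards [Ioo_mem_nhdsGT (zero_lt_one' ℝ)] with w hw using hbound w hw
          · have : Tendsto (fun w : ℝ => |C| * (r ^ 2) ^ (N + 1) * w) (𝓝 0)
                (𝓝 (|C| * (r ^ 2) ^ (N + 1) * 0)) :=
              (continuous_const.mul continuous_id).tendsto 0
            rw [mul_zero] at this
            exact this.mono_left nhdsWithin_le_nhds
        exact tendsto_nhds_unique ((hI.tendsto 0).mono_left nhdsWithin_le_nhds) hlim
      exact congrFun ((hcu.ae_eq_iff_eq volume continuous_const).1 hae)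
    -- the value `r = 0` follows by continuity
    have hz : ∀ q, Ψ (q, 0) = 0 := fun q =>
      eq_of_eq_off_zero (f := fun r => Ψ ((q.1, r), 0)) (by fun_prop) continuous_const
        (fun r hr => hz1 q.1.2 r hr q.1.1) q.2
    obtain ⟨Ψ', hΨ', heq'⟩ := exists_contDiffOn_eq_add_smul isOpen_univ (fun _ _ _ _ => mem_univ _)
      hΨ.contDiffOn
    refine ⟨Ψ', contDiffOn_univ.1 hΨ', fun q w => ?_⟩
    rw [heq, heq' (q, w) (mem_univ _), hz, zero_add, smul_smul, pow_succ]

/-! ### The symbol of a flat kernel -/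

/-- The homogeneous function `2 ∫₀^∞ χ(u, w² η, w r) w^(-1-2m) dw`. -/
def mellinKernel (κ : LocalKernel p n) (m : ℂ) (x : Coord p n × ℝ) : ℂ :=
  2 * ∫ w in Ioi (0 : ℝ), (w : ℂ) ^ (-1 - 2 * m) • κ.dilatedKernel (x, w)

theorem isQuasiHomogeneous_mellinKernel (m : ℂ) : IsQuasiHomogeneous m (κ.mellinKernel m) := by
  intro c hc q _ r
  have hc0 : (c : ℂ) ≠ 0 := by exact_mod_cast hc.ne'
  have h := integral_comp_mul_left_Ioi
    (fun w : ℝ => (w : ℂ) ^ (-1 - 2 * m) • κ.dilatedKernel ((q, r), w)) 0 hc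
  rw [mul_zero] at h
  have h1 : ∀ w ∈ Ioi (0 : ℝ), ((c * w : ℝ) : ℂ) ^ (-1 - 2 * m) • κ.dilatedKernel ((q, r), c * w)
      = (c : ℂ) ^ (-1 - 2 * m) • ((w : ℂ) ^ (-1 - 2 * m) •
        κ.dilatedKernel (((q.1, c ^ 2 • q.2), c * r), w)) := by
    intro w hw
    rw [Complex.ofReal_mul, Complex.mul_cpow_ofReal_nonneg hc.le (le_of_lt hw), smul_smul]
    simp only [dilatedKernel, smul_smul, mul_pow]
    rw [mul_comm (c ^ 2) (w ^ 2), mul_comm c w, mul_assoc]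
  rw [setIntegral_congr_fun measurableSet_Ioi h1, integral_smul] at h
  have h2 : (c : ℂ) ^ (2 * m) * ((c : ℂ) ^ (-1 - 2 * m) * c) = 1 := by
    nth_rewrite 3 [← Complex.cpow_one (c : ℂ)]
    rw [← Complex.cpow_add _ _ hc0, ← Complex.cpow_add _ _ hc0]
    ring_nf
    exact Complex.cpow_zero _
  simp only [mellinKernel]
  rw [Complex.real_smul, Complex.ofReal_inv, smul_eq_mul, eq_inv_mul_iff_mul_eq₀ hc0] at h
  rw [← h]
  linear_combination (2 * -(∫ w in Ioi (0 : ℝ), (w : ℂ) ^ (-1 - 2 * m) •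
        κ.dilatedKernel (((q.1, c ^ 2 • q.2), c * r), w))) * h2

theorem mellinKernel_neg (m : ℂ) (q : Coord p n) (r : ℝ) :
    κ.mellinKernel m (q, -r) = κ.mellinKernel m (q, r) := by
  simp [mellinKernel, dilatedKernel, κ.fourierKernel_neg]

/-- Decay of the dilated family and of its derivatives for `w ≥ 1`, away from `(η, r) = 0`. Each
derivative costs a factor `w²`, which the rapid decay of `χ` compensates. -/
theorem exists_norm_iteratedFDeriv_dilatedKernel_le (M i : ℕ) : ∃ C : ℝ, 0 ≤ C ∧
    ∀ (x : Coord p n × ℝ) (w : ℝ), 1 ≤ w → 0 < ‖(x.1.2, x.2)‖ →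
      ‖iteratedFDeriv ℝ i (fun x => κ.dilatedKernel (x, w)) x‖
        ≤ C * (‖(x.1.2, x.2)‖ ^ (M + 2 * i))⁻¹ * (w ^ M)⁻¹ := by
  obtain ⟨C, hC0, hC⟩ := κ.exists_norm_fourierKernel_le (M + 2 * i) i
  refine ⟨C, hC0, fun x w hw hx => ?_⟩
  have hw0 : 0 < w := by linarith
  let L : Coord p n × ℝ →L[ℝ] Coord p n × ℝ :=
    (((ContinuousLinearMap.fst ℝ _ _).comp (ContinuousLinearMap.fst ℝ _ _)).prod
      (w ^ 2 • (ContinuousLinearMap.snd ℝ _ _).comp (ContinuousLinearMap.fst ℝ _ _))).prod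
      (w • ContinuousLinearMap.snd ℝ _ _)
  have hLapp : ∀ x, L x = ((x.1.1, w ^ 2 • x.1.2), w * x.2) := fun x => by simp [L]
  have hww : w ≤ w ^ 2 := by nlinarith
  have hw2 : 1 ≤ w ^ 2 := by nlinarith
  have hL : ‖L‖ ≤ w ^ 2 := by
    refine ContinuousLinearMap.opNorm_le_bound _ (by positivity) fun y => ?_
    rw [hLapp]
    have n1 : ‖y.1.1‖ ≤ ‖y‖ := (norm_fst_le y.1).trans (norm_fst_le y)
    have n2 : ‖y.1.2‖ ≤ ‖y‖ := (norm_snd_le y.1).trans (norm_fst_le y)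
    have n3 : ‖y.2‖ ≤ ‖y‖ := norm_snd_le y
    have hn := norm_nonneg y
    refine norm_prod_le_iff.2 ⟨norm_prod_le_iff.2 ⟨?_, ?_⟩, ?_⟩
    · simp only; nlinarith
    · simp only [norm_smul, Real.norm_of_nonneg (sq_nonneg w)]
      gcongr
    · simp only [norm_mul, Real.norm_of_nonneg hw0.le]
      gcongr
  have heq : (fun x => κ.dilatedKernel (x, w)) = κ.fourierKernel ∘ L := by
    funext x; simp [dilatedKernel, hLapp]
  have h1 : ‖iteratedFDeriv ℝ i (fun x => κ.dilatedKernel (x, w)) x‖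
      ≤ ‖iteratedFDeriv ℝ i κ.fourierKernel (L x)‖ * (w ^ 2) ^ i := by
    rw [heq]
    refine (norm_iteratedFDeriv_comp_clm_le L
      (κ.contDiff_fourierKernel.contDiffAt.of_le (by exact_mod_cast le_top))).trans ?_
    gcongr
  have h2 : w * ‖(x.1.2, x.2)‖ ≤ 1 + ‖((L x).1.2, (L x).2)‖ := by
    have : ‖w • (x.1.2, x.2)‖ ≤ ‖((L x).1.2, (L x).2)‖ := by
      rw [hLapp, Prod.smul_mk]
      refine norm_prod_le_iff.2 ⟨le_trans ?_ (norm_fst_le _), norm_snd_le (w ^ 2 • x.1.2, w * x.2)⟩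
      simp only [norm_smul, Real.norm_of_nonneg hw0.le, Real.norm_of_nonneg (sq_nonneg w)]
      gcongr
    rw [norm_smul, Real.norm_of_nonneg hw0.le] at this
    linarith
  set ν := ‖(x.1.2, x.2)‖ with hν
  have h3 := hC (L x).1 (L x).2
  have h4 : (w * ν) ^ (M + 2 * i) * ‖iteratedFDeriv ℝ i κ.fourierKernel (L x)‖ ≤ C :=
    le_trans (by gcongr) h3
  refine h1.trans ?_
  have hpos : 0 < w ^ M * ν ^ (M + 2 * i) := by positivity
  rw [mul_assoc, ← mul_inv, ← div_eq_mul_inv, le_div_iff₀ (by positivity)]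
  calc _ = (w * ν) ^ (M + 2 * i) * ‖iteratedFDeriv ℝ i κ.fourierKernel (L x)‖ := by
        rw [mul_pow, pow_add w, pow_mul]; ring
    _ ≤ C := h4

theorem norm_cpow_neg_one_sub {w : ℝ} (hw : 0 < w) (z : ℂ) :
    ‖(w : ℂ) ^ (-1 - z)‖ = w ^ (-1 - z.re) := by
  rw [Complex.norm_cpow_eq_rpow_re_of_pos hw]; simp

/-- The Mellin integral is smooth off `(η, r) = 0`: divisibility by powers of `w` makes it converge
at `0`, rapid decay makes it converge at `∞`. -/
theorem IsFlat.contDiffOn_mellinKernel (hκ : κ.IsFlat) (m : ℂ) :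
    ContDiffOn ℝ ∞ (κ.mellinKernel m) {x | x.1.2 ≠ 0 ∨ x.2 ≠ 0} := by
  rw [contDiffOn_infty]
  intro N
  have hU : IsOpen {x : Coord p n × ℝ | x.1.2 ≠ 0 ∨ x.2 ≠ 0} :=
    (isOpen_ne_fun (by fun_prop) continuous_const).union
      (isOpen_ne_fun continuous_snd continuous_const)
  obtain ⟨J, hJ⟩ := exists_nat_ge (2 * m.re + 1)
  obtain ⟨Ψ, hΨ, heq⟩ := hκ.exists_dilatedKernel_eq_pow J
  have hsm : ∀ {f : (Coord p n × ℝ) × ℝ → ℂ}, ContDiff ℝ ∞ f → ∀ s : Set _, ContDiffOn ℝ N f s :=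
    fun hf s => (hf.of_le (by exact_mod_cast le_top)).contDiffOn
  -- the weight `w^(-1-2m)` is made integrable at `0` by a factor `w^J`
  have hI1 : IntegrableOn (fun w : ℝ => (w : ℂ) ^ (-1 - 2 * m) * (w : ℂ) ^ J) (Ioc 0 1) := by
    have hcont : ContinuousOn (fun w : ℝ => (w : ℂ) ^ (-1 - 2 * m) * (w : ℂ) ^ J) (Ioc 0 1) := by
      intro w hw
      have : ContinuousAt (fun w : ℝ => (w : ℂ) ^ (-1 - 2 * m)) w :=
        ContinuousAt.cpow (by fun_prop) continuousAt_const (Or.inl (by simpa using hw.1))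
      exact (this.mul (by fun_prop)).continuousWithinAt
    refine Integrable.mono' (g := fun _ => (1 : ℝ)) (integrableOn_const (by simp))
      (hcont.aestronglyMeasurable measurableSet_Ioc) ?_
    filter_upwards [ae_restrict_mem measurableSet_Ioc] with w hw
    rw [norm_mul, norm_cpow_neg_one_sub hw.1, norm_pow, Complex.norm_real,
      Real.norm_of_nonneg hw.1.le, ← Real.rpow_natCast, ← Real.rpow_add hw.1]
    refine Real.rpow_le_one hw.1.le hw.2 ?_
    simp only [Complex.mul_re, Complex.re_ofNat, Complex.im_ofNat, zero_mul, sub_zero]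
    linarith
  have hA : ContDiffOn ℝ N (fun x => ∫ w in Icc (0 : ℝ) 1,
      ((w : ℂ) ^ (-1 - 2 * m) * (w : ℂ) ^ J) • Ψ (x, w)) {x | x.1.2 ≠ 0 ∨ x.2 ≠ 0} :=
    contDiffOn_setIntegral_smul_of_isCompact hU isOpen_univ isCompact_Icc (subset_univ _)
      (hsm hΨ _) ((integrableOn_Icc_iff_integrableOn_Ioc enorm_ne_top).2 hI1)
  -- for `w ≥ 1` the decay `w ^ (-M)` makes the weight integrable
  obtain ⟨M, hM⟩ := exists_nat_ge (-2 * m.re + 1)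
  have hcontI : ContinuousOn (fun w : ℝ => (w : ℂ) ^ (-1 - 2 * m)) (Ioi 1) := fun w hw =>
    (ContinuousAt.cpow (by fun_prop) continuousAt_const
      (Or.inl (by simpa using zero_lt_one.trans hw))).continuousWithinAt
  have hwt : AEStronglyMeasurable (fun w : ℝ => (w : ℂ) ^ (-1 - 2 * m)) (volume.restrict (Ioi 1)) :=
    hcontI.aestronglyMeasurable measurableSet_Ioi
  have hwM : IntegrableOn (fun w : ℝ => ‖(w : ℂ) ^ (-1 - 2 * m)‖ * (w ^ M)⁻¹) (Ioi 1) := by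
    refine Integrable.mono' (integrableOn_Ioi_rpow_of_lt (a := -2) (by norm_num) one_pos)
      (hwt.norm.mul (by fun_prop)) ?_
    filter_upwards [ae_restrict_mem measurableSet_Ioi] with w hw
    have hw0 : 0 < w := zero_lt_one.trans hw
    rw [norm_mul, norm_norm, norm_cpow_neg_one_sub hw0, norm_inv, norm_pow,
      Real.norm_of_nonneg hw0.le, ← Real.rpow_natCast, ← Real.rpow_neg hw0.le, ← Real.rpow_add hw0]
    refine Real.rpow_le_rpow_of_exponent_le (le_of_lt hw) ?_
    simp only [Complex.mul_re, Complex.re_ofNat, Complex.im_ofNat, zero_mul, sub_zero]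
    linarith
  have key : ∀ i, ∀ x ∈ {x : Coord p n × ℝ | x.1.2 ≠ 0 ∨ x.2 ≠ 0}, ∃ D : ℝ, ∃ s ∈ 𝓝 x,
      ∀ w ∈ Ioi (1 : ℝ), ∀ x' ∈ s,
        ‖iteratedFDeriv ℝ i (fun v => κ.dilatedKernel (v, w)) x'‖ ≤ D * (w ^ M)⁻¹ := by
    intro i x hx
    obtain ⟨C, hC0, hC⟩ := exists_norm_iteratedFDeriv_dilatedKernel_le (κ := κ) M i
    have hx0 : 0 < ‖(x.1.2, x.2)‖ := by
      rw [norm_pos_iff]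
      intro h
      rcases hx with hx | hx
      · exact hx (congrArg Prod.fst h)
      · exact hx (congrArg Prod.snd h)
    refine ⟨C * ((‖(x.1.2, x.2)‖ / 2) ^ (M + 2 * i))⁻¹,
      {x' | ‖(x.1.2, x.2)‖ / 2 < ‖(x'.1.2, x'.2)‖}, ?_, fun w hw x' hx' => ?_⟩
    · exact (isOpen_lt continuous_const (by fun_prop)).mem_nhds (half_lt_self hx0)
    · have hx'' : ‖(x.1.2, x.2)‖ / 2 < ‖(x'.1.2, x'.2)‖ := hx'
      have hp : 0 < ‖(x.1.2, x.2)‖ / 2 := by positivity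
      have hw0 : (0 : ℝ) < w := zero_lt_one.trans hw
      refine (hC x' w (le_of_lt hw) (hp.trans hx')).trans ?_
      gcongr
  have hB : ContDiffOn ℝ N (fun x => ∫ w in Ioi (1 : ℝ),
      ((w : ℂ) ^ (-1 - 2 * m)) • κ.dilatedKernel (x, w)) {x | x.1.2 ≠ 0 ∨ x.2 ≠ 0} := by
    refine contDiffOn_setIntegral_smul hU isOpen_univ measurableSet_Ioi (subset_univ _)
      (hsm κ.contDiff_dilatedKernel _) hwt fun i _ x hx => ?_
    obtain ⟨D, s, hs, hD⟩ := key i x hx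
    refine ⟨fun w => D * (w ^ M)⁻¹, ?_, s, hs, hD⟩
    refine (hwM.const_mul D).congr (Eventually.of_forall fun w => ?_)
    simp only
    ring
  refine ((contDiffOn_const (c := (2 : ℂ))).mul (hA.add hB)).congr fun x hx => ?_
  simp only [mellinKernel]
  congr 1
  have hd : ∀ w ∈ Ioc (0 : ℝ) 1, ((w : ℂ) ^ (-1 - 2 * m) * (w : ℂ) ^ J) • Ψ (x, w)
      = (w : ℂ) ^ (-1 - 2 * m) • κ.dilatedKernel (x, w) := by
    intro w _
    rw [heq, ← smul_smul, ← Complex.ofReal_pow, Complex.coe_smul]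
  rw [integral_Icc_eq_integral_Ioc, setIntegral_congr_fun measurableSet_Ioc hd,
    ← Ioc_union_Ioi_eq_Ioi (zero_le_one' ℝ)]
  refine setIntegral_union (Ioc_disjoint_Ioi le_rfl) measurableSet_Ioi ?_ ?_
  · rw [← integrableOn_congr_fun hd measurableSet_Ioc]
    have hc : Continuous fun w => Ψ (x, w) := hΨ.continuous.comp (by fun_prop)
    obtain ⟨C, hC⟩ := isCompact_Icc.exists_bound_of_continuousOn (s := Icc (0 : ℝ) 1) hc.continuousOn
    refine Integrable.mul_bdd (c := C) hI1 hc.aestronglyMeasurable ?_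
    filter_upwards [ae_restrict_mem measurableSet_Ioc] with w hw using hC w (Ioc_subset_Icc_self hw)
  · obtain ⟨D, s, hs, hD⟩ := key 0 x hx
    have hc : Continuous fun w => κ.dilatedKernel (x, w) :=
      κ.contDiff_dilatedKernel.continuous.comp (by fun_prop)
    refine Integrable.mono' (hwM.const_mul D) (hwt.smul hc.aestronglyMeasurable) ?_
    filter_upwards [ae_restrict_mem measurableSet_Ioi] with w hw
    have := hD w hw x (mem_of_mem_nhds hs)
    rw [norm_iteratedFDeriv_zero] at this
    rw [norm_smul, mul_left_comm]
    gcongr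

end LocalKernel

namespace LocalKernel

variable {p n : ℕ} {κ : LocalKernel p n}

/-- `χ(u, w² η, w)` is `O(w ^ N)` with polynomial growth in `η`. -/
theorem IsFlat.exists_norm_dilatedKernel_le (hκ : κ.IsFlat) (N : ℕ) : ∃ C : ℝ, 0 ≤ C ∧
    ∀ (q : Coord p n) (w : ℝ), 0 < w →
      ‖κ.dilatedKernel ((q, 1), w)‖ ≤ C * ((1 + ‖q.2‖) ^ N * w ^ N) := by
  obtain ⟨Ψ, hΨ, heq⟩ := hκ.exists_dilatedKernel_eq_pow N
  obtain ⟨C, hC0, hC⟩ := κ.exists_norm_fourierKernel_le 0 0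
  let Z : Set ((Coord p n × ℝ) × ℝ) :=
    ((Metric.closedBall 0 κ.R ×ˢ Metric.closedBall 0 1) ×ˢ Icc 0 1) ×ˢ Icc 0 1
  have hZ : IsCompact Z := (((isCompact_closedBall 0 _).prod (isCompact_closedBall 0 _)).prod
    isCompact_Icc).prod isCompact_Icc
  obtain ⟨D, hD⟩ := hZ.exists_bound_of_continuousOn hΨ.continuous.continuousOn
  refine ⟨max C |D|, hC0.trans (le_max_left _ _), fun q w hw => ?_⟩
  rcases lt_or_ge κ.R ‖q.1‖ with hu | hu
  · rw [dilatedKernel, κ.fourierKernel_eq_zero (q := (q.1, w ^ 2 • q.2)) (Or.inl hu), norm_zero]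
    have := hC0.trans (le_max_left C |D|)
    positivity
  -- the dilation by `c = (1 + ‖η‖)^(1/2)` moves `(η, 1)` into the unit ball
  set c : ℝ := √(1 + ‖q.2‖) with hc
  have h1 : 1 ≤ 1 + ‖q.2‖ := by simp
  have hc1 : 1 ≤ c := Real.one_le_sqrt.2 h1
  have hc0 : 0 < c := by linarith
  have hcle : c ≤ 1 + ‖q.2‖ := by
    rw [hc, Real.sqrt_le_left (by positivity)]; nlinarith
  have hc2 : c ^ 2 = 1 + ‖q.2‖ := Real.sq_sqrt (by positivity)
  have hscale : κ.dilatedKernel ((q, 1), w)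
      = κ.dilatedKernel (((q.1, (c ^ 2)⁻¹ • q.2), c⁻¹), c * w) := by
    simp only [dilatedKernel, smul_smul]
    rw [show (c * w) ^ 2 * (c ^ 2)⁻¹ = w ^ 2 by field_simp, show c * w * c⁻¹ = w * 1 by field_simp]
  have hfin : (c * w) ^ N ≤ (1 + ‖q.2‖) ^ N * w ^ N := by
    rw [mul_pow]; gcongr
  rcases le_or_gt (c * w) 1 with h | h
  · rw [hscale, heq, norm_smul, norm_pow, Real.norm_of_nonneg (by positivity)]
    have hmem : (((q.1, (c ^ 2)⁻¹ • q.2), c⁻¹), c * w) ∈ Z := by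
      refine ⟨⟨⟨by simpa using hu, ?_⟩, ⟨by positivity, inv_le_one_of_one_le₀ hc1⟩⟩,
        ⟨by positivity, h⟩⟩
      rw [mem_closedBall_zero_iff, norm_smul, norm_inv, norm_pow, Real.norm_of_nonneg hc0.le, hc2,
        inv_mul_le_one₀ (by positivity)]
      simp
    calc _ ≤ (c * w) ^ N * |D| := by gcongr; exact (hD _ hmem).trans (le_abs_self D)
      _ ≤ ((1 + ‖q.2‖) ^ N * w ^ N) * max C |D| := by gcongr; exact le_max_right _ _
      _ = _ := mul_comm _ _
  · have h2 := hC (q.1, w ^ 2 • q.2) (w * 1)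
    rw [pow_zero, one_mul, norm_iteratedFDeriv_zero] at h2
    calc ‖κ.dilatedKernel ((q, 1), w)‖ ≤ C * 1 := by rw [mul_one]; exact h2
      _ ≤ max C |D| * ((1 + ‖q.2‖) ^ N * w ^ N) := by
        have : 1 ≤ (1 + ‖q.2‖) ^ N * w ^ N := (one_le_pow₀ h.le).trans hfin
        gcongr
        exact le_max_left _ _

/-- Parseval's formula in the fibres. -/
theorem IsFlat.integral_fibreKernel_mul (hκ : κ.IsFlat) {F : Coord p n → ℂ} (hF : ContDiff ℝ ∞ F)
    (hs : HasCompactSupport F) {w : ℝ} (hw : 0 < w) :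
    ∫ u, ∫ ξ, κ.fibreKernel ((u, w), ξ) * F (u, w ^ 2 • ξ)
      = ((2 * Real.pi : ℝ) : ℂ)⁻¹ ^ n *
        ∫ q, κ.dilatedKernel ((q, 1), w) * fibreFourier F q := by
  obtain ⟨C, hC0, hC⟩ := hκ.exists_norm_dilatedKernel_le 0
  have hcont : Continuous fun q => κ.dilatedKernel ((q, 1), w) :=
    κ.contDiff_dilatedKernel.continuous.comp (by fun_prop)
  have hint : Integrable fun q => κ.dilatedKernel ((q, 1), w) * fibreFourier F q := by
    refine integrable_mul_fibreFourier hF hs hcont.aestronglyMeasurable 0 fun K _ => ⟨C, ?_⟩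
    intro q _
    simpa using hC q w hw
  rw [Measure.volume_eq_prod, integral_prod _ hint, ← integral_const_mul]
  congr 1
  ext u
  have hg : Integrable fun ξ => κ.fibreKernel ((u, w), ξ) := by
    simpa using integrable_exp_smul (κ.isRapid_fibreKernel 0) ((u, w), 0)
  -- insert Fourier inversion for `F` and exchange the integrations
  have h := integral_fourier_mul (integrable_fibre_fibreFourier hF hs u) hg (-w ^ 2)
  calc ∫ ξ, κ.fibreKernel ((u, w), ξ) * F (u, w ^ 2 • ξ)
      = ∫ ξ, ((2 * Real.pi : ℝ) : ℂ)⁻¹ ^ n * ((∫ η, Complex.exp (-(Complex.I *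
          (inner ℝ ξ (-w ^ 2 • η) : ℝ))) * fibreFourier F (u, η)) * κ.fibreKernel ((u, w), ξ)) := by
        congr 1
        ext ξ
        rw [fibreFourier_inversion hF hs, mul_comm, mul_assoc]
        congr 3
        ext η
        congr 2
        simp only [inner_smul_left, inner_smul_right, conj_trivial]
        push_cast
        ring
    _ = _ := by
        rw [integral_const_mul, h]
        congr 2
        ext η
        rw [mul_comm, dilatedKernel, fourierKernel, partialFourier]
        simp only [neg_smul, mul_one, smul_eq_mul]

/-- The Mellin transform of a flat family of distributions is an oscillatory integral. -/
theorem IsFlat.integral_pairing (hκ : κ.IsFlat) (m : ℂ) {F : Coord p n → ℂ} (hF : ContDiff ℝ ∞ F)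
    (hs : HasCompactSupport F) :
    ∫ t in Ioi (0 : ℝ), ((t : ℂ)⁻¹ ^ n * ∫ q, κ.k q t * F q) * (t : ℂ) ^ (-1 - m)
      = oscillatory (fun q => κ.mellinKernel m (q, 1)) F := by
  obtain ⟨N, hN⟩ := exists_nat_ge (2 * m.re + 1)
  obtain ⟨C, hC0, hC⟩ := hκ.exists_norm_dilatedKernel_le N
  set S : ℝ := √κ.R + 1 with hS
  have hS0 : 0 < S := by positivity
  have hzero : ∀ q w, S < w → κ.dilatedKernel ((q, 1), w) = 0 := by
    intro q w hw
    refine κ.fourierKernel_eq_zero (Or.inr ?_)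
    rw [mul_one]
    exact Real.lt_sq_of_sqrt_lt (by linarith)
  have hFc : Continuous (fibreFourier F) := (isRapid_fibreFourier hF hs 0).1.continuous
  have hwint : IntegrableOn (fun w : ℝ => (Ioc 0 S).indicator
      (fun w => C * w ^ ((N : ℝ) - 1 - 2 * m.re)) w) (Ioi 0) := by
    refine ((integrable_indicator_iff measurableSet_Ioc).2 ?_).integrableOn
    refine Integrable.const_mul ?_ C
    have := (intervalIntegral.intervalIntegrable_rpow' (a := 0) (b := S)
      (r := (N : ℝ) - 1 - 2 * m.re) (by linarith))
    exact (intervalIntegrable_iff_integrableOn_Ioc_of_le hS0.le).1 this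
  have hqint : Integrable fun q : Coord p n => (1 + ‖q.2‖) ^ N * ‖fibreFourier F q‖ := by
    have := (integrable_mul_fibreFourier hF hs (w := fun q => (((1 + ‖q.2‖) ^ N : ℝ) : ℂ))
      (Continuous.aestronglyMeasurable (by fun_prop)) N (fun K _ => ⟨1, fun q _ => by
        rw [Complex.norm_real, Real.norm_of_nonneg (by positivity), one_mul]⟩)).norm
    refine this.congr (Eventually.of_forall fun q => ?_)
    simp only [norm_mul, Complex.norm_real, Real.norm_of_nonneg (show 0 ≤ (1 + ‖q.2‖) ^ N by positivity)]
  have hprod : Integrable (fun z : ℝ × Coord p n => (z.1 : ℂ) ^ (-1 - 2 * m) •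
      (κ.dilatedKernel ((z.2, 1), z.1) * fibreFourier F z.2))
      ((volume.restrict (Ioi 0)).prod volume) := by
    have hdc := κ.contDiff_dilatedKernel.continuous
    refine (hwint.mul_prod hqint).mono' ?_ ?_
    · refine AEStronglyMeasurable.smul (f := fun z : ℝ × Coord p n => (z.1 : ℂ) ^ (-1 - 2 * m))
        (g := fun z => κ.dilatedKernel ((z.2, 1), z.1) * fibreFourier F z.2) ?_ ?_
      · exact ((Complex.measurable_ofReal.comp measurable_fst).pow_const _).aestronglyMeasurable
      · exact Continuous.aestronglyMeasurable (by fun_prop)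
    · have hae : ∀ᵐ z : ℝ × Coord p n ∂((volume.restrict (Ioi 0)).prod volume), z.1 ∈ Ioi (0 : ℝ) :=
        Measure.quasiMeasurePreserving_fst.ae (ae_restrict_mem measurableSet_Ioi)
      filter_upwards [hae] with z hz
      have hz0 : 0 < z.1 := hz
      rcases lt_or_ge S z.1 with h | h
      · rw [hzero _ _ h]
        simp only [zero_mul, smul_zero, norm_zero]
        exact mul_nonneg (indicator_nonneg (fun w hw => by
          have := hw.1
          positivity) _) (by positivity)
      · rw [indicator_of_mem (show z.1 ∈ Ioc 0 S from ⟨hz0, h⟩), norm_smul, norm_mul,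
          norm_cpow_neg_one_sub hz0]
        have h3 : z.1 ^ ((N : ℝ) - 1 - 2 * m.re) = z.1 ^ (-1 - (2 * m).re) * z.1 ^ N := by
          rw [← Real.rpow_natCast, ← Real.rpow_add hz0]
          congr 1
          simp
          ring
        rw [h3]
        calc _ ≤ z.1 ^ (-1 - (2 * m).re) *
              (C * ((1 + ‖z.2.2‖) ^ N * z.1 ^ N) * ‖fibreFourier F z.2‖) := by
              gcongr
              exact hC _ _ hz0
          _ = _ := by ring
  have hswap := integral_integral_swap (f := fun (w : ℝ) (q : Coord p n) =>
    (w : ℂ) ^ (-1 - 2 * m) • (κ.dilatedKernel ((q, 1), w) * fibreFourier F q)) hprod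
  -- substitute `t = w²`
  rw [← integral_comp_rpow_Ioi_of_pos (p := 2) two_pos]
  have hcongr : ∀ w ∈ Ioi (0 : ℝ), ((2 : ℝ) * w ^ ((2 : ℝ) - 1)) •
      ((((w ^ (2 : ℝ) : ℝ) : ℂ)⁻¹ ^ n * ∫ q, κ.k q (w ^ (2 : ℝ)) * F q)
        * ((w ^ (2 : ℝ) : ℝ) : ℂ) ^ (-1 - m))
      = ((2 * Real.pi : ℝ) : ℂ)⁻¹ ^ n * 2 * ∫ q, (w : ℂ) ^ (-1 - 2 * m) •
        (κ.dilatedKernel ((q, 1), w) * fibreFourier F q) := by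
    intro w hw
    have hw0 : 0 < w := hw
    have hwc : (w : ℂ) ≠ 0 := by exact_mod_cast hw0.ne'
    have h4 : ((w ^ 2 : ℝ) : ℂ) ^ (-1 - m) * w = (w : ℂ) ^ (-1 - 2 * m) := by
      rw [← sqrt_cpow_two_mul (by positivity), Real.sqrt_sq hw0.le]
      nth_rewrite 2 [← Complex.cpow_one (w : ℂ)]
      rw [← Complex.cpow_add _ _ hwc]
      ring_nf
    rw [Real.rpow_two, show (2 : ℝ) - 1 = 1 by norm_num, Real.rpow_one,
      κ.pairing_eq_integral hF.continuous hw0.ne', hκ.integral_fibreKernel_mul hF hs hw0,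
      integral_smul, ← h4, Complex.real_smul, smul_eq_mul]
    push_cast
    ring
  rw [setIntegral_congr_fun measurableSet_Ioi hcongr, integral_const_mul, hswap, oscillatory,
    mul_assoc, ← integral_const_mul]
  congr 2
  ext q
  rw [mellinKernel, mul_assoc, ← integral_mul_const]
  congr 2
  ext w
  simp only [smul_eq_mul]
  ring

/-- The Mellin transform of a flat Schwartz function on the model is conormal. -/
theorem IsFlat.exists_symbol (hκ : κ.IsFlat) (m : ℂ) : ∃ a : Coord p n → ℂ, IsClassicalSymbol m a ∧
    ∀ F : Coord p n → ℂ, ContDiff ℝ ∞ F → HasCompactSupport F →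
      ∫ t in Ioi (0 : ℝ), ((t : ℂ)⁻¹ ^ n * ∫ q, κ.k q t * F q) * (t : ℂ) ^ (-1 - m)
        = oscillatory a F :=
  ⟨_, isClassicalSymbol_of_isQuasiHomogeneous (hκ.contDiffOn_mellinKernel m)
    (fun q _ r => mellinKernel_neg m q r) (isQuasiHomogeneous_mellinKernel m),
    fun _ hF hs => hκ.integral_pairing m hF hs⟩

end LocalKernel

/-! ### Cut-off functions -/

/-- A bump function with support in `[5/4, 7/4]`. -/
def unitBump : ContDiffBump (3 / 2 : ℝ) := ⟨1 / 8, 1 / 4, by norm_num, by norm_num⟩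

/-- A smooth function `φ ≥ 0` with support in `(1, 2)` such that `∫ φ(s) s⁻¹ ds = 1`. -/
def radialBump (s : ℝ) : ℝ := s * unitBump.normed volume s

theorem contDiff_radialBump : ContDiff ℝ ∞ radialBump := contDiff_id.mul unitBump.contDiff_normed

theorem radialBump_eq_zero {s : ℝ} (hs : s ≤ 5 / 4 ∨ 7 / 4 ≤ s) : radialBump s = 0 := by
  have : s ∉ Function.support (unitBump.normed volume) := by
    rw [unitBump.support_normed_eq, Metric.mem_ball, Real.dist_eq]
    intro h
    have h' : |s - 3 / 2| < 1 / 4 := h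
    rw [abs_lt] at h'
    rcases hs with hs | hs <;> linarith [h'.1, h'.2]
  rw [radialBump, Function.notMem_support.1 this, mul_zero]

theorem radialBump_nonneg (s : ℝ) : 0 ≤ radialBump s := by
  rcases le_or_gt s (5 / 4) with h | h
  · rw [radialBump_eq_zero (Or.inl h)]
  · exact mul_nonneg (by linarith) (unitBump.nonneg_normed s)

theorem hasCompactSupport_radialBump : HasCompactSupport radialBump :=
  HasCompactSupport.of_support_subset_isCompact (isCompact_Icc (a := (5 / 4 : ℝ)) (b := 7 / 4))
    fun s hs => by
      by_contra h
      refine hs (radialBump_eq_zero ?_)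
      rw [mem_Icc, not_and_or, not_le, not_le] at h
      exact h.imp le_of_lt le_of_lt

theorem exists_radialBump_le : ∃ B : ℝ, 0 ≤ B ∧ ∀ s, radialBump s ≤ B := by
  obtain ⟨B, hB⟩ := hasCompactSupport_radialBump.exists_bound_of_continuous
    contDiff_radialBump.continuous
  exact ⟨B, (norm_nonneg _).trans (hB 0), fun s => (le_abs_self _).trans (hB s)⟩

theorem integral_radialBump : ∫ s in Ioi (0 : ℝ), s⁻¹ * radialBump s = 1 := by
  have h1 : ∀ s ∈ Ioi (0 : ℝ), s⁻¹ * radialBump s = unitBump.normed volume s := fun s hs => by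
    rw [radialBump, inv_mul_cancel_left₀ (ne_of_gt hs)]
  rw [setIntegral_congr_fun measurableSet_Ioi h1, setIntegral_eq_integral_of_forall_compl_eq_zero,
    unitBump.integral_normed]
  intro s hs
  by_contra h
  have : s ∈ Function.support (unitBump.normed volume) := h
  rw [unitBump.support_normed_eq, Metric.mem_ball, Real.dist_eq] at this
  have h' : |s - 3 / 2| < 1 / 4 := this
  exact hs (show 0 < s by rw [abs_lt] at h'; linarith [h'.1])

/-- A smooth function of `t` equal to `1` for `t ≤ 1` and to `0` for `t ≥ 2`. -/
def timeCutoff (t : ℝ) : ℝ := Real.smoothTransition (2 - t)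

theorem contDiff_timeCutoff : ContDiff ℝ ∞ timeCutoff :=
  Real.smoothTransition.contDiff.comp (contDiff_const.sub contDiff_id)

theorem timeCutoff_eq_one {t : ℝ} (ht : t ≤ 1) : timeCutoff t = 1 :=
  Real.smoothTransition.one_of_one_le (by linarith)

theorem timeCutoff_eq_zero {t : ℝ} (ht : 2 ≤ t) : timeCutoff t = 0 :=
  Real.smoothTransition.zero_of_nonpos (by linarith)

theorem timeCutoff_nonneg (t : ℝ) : 0 ≤ timeCutoff t := Real.smoothTransition.nonneg _

theorem timeCutoff_le_one (t : ℝ) : timeCutoff t ≤ 1 := Real.smoothTransition.le_one _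

/-! ### The Schwartz function of a symbol -/

section Family

variable {p n : ℕ}

/-- The localised and rescaled symbol `φ(‖η‖) t^m a(u, η / t)`, extended by `0` to `t ≤ 0`. -/
def symbolFamily (m : ℂ) (a : Coord p n → ℂ)
    (x : (EuclideanSpace ℝ (Fin p) × ℝ) × EuclideanSpace ℝ (Fin n)) : ℂ :=
  (radialBump ‖x.2‖ : ℂ) * dilated (-m) a (x.1.1, x.2, x.1.2)

/-- The function `(2π)⁻ⁿ c(t) t^m ∫ φ(‖η‖) a(u, η / t) e^{-i⟨x, η⟩ / t} dη`, where `t > 0`. -/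
def symbolKernel (m : ℂ) (a : Coord p n → ℂ) (q : Coord p n) (t : ℝ) : ℂ :=
  if 0 < t then ((2 * Real.pi : ℝ) : ℂ)⁻¹ ^ n * timeCutoff t *
    partialFourier (symbolFamily m a) ((q.1, t), t⁻¹ • q.2) else 0

/-- The remainders of the asymptotic expansion of a symbol decay with all their derivatives. -/
theorem decaysAt_remainder {m : ℂ} {a : Coord p n → ℂ} (ha : ContDiff ℝ ∞ a)
    {b : ℕ → Coord p n → ℂ} (hb : ∀ j, ContDiffOn ℝ ∞ (b j) {q | q.2 ≠ 0})
    (hest : ∀ (k i l : ℕ) (K : Set (EuclideanSpace ℝ (Fin p))), IsCompact K →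
      ∃ C : ℝ, ∀ u ∈ K, ∀ ξ : EuclideanSpace ℝ (Fin n), 1 ≤ ‖ξ‖ →
        ‖iteratedFDeriv ℝ i (fun η => iteratedFDeriv ℝ l
            (fun v => a (v, η) - ∑ j ∈ Finset.range k, b j (v, η)) u) ξ‖
          ≤ C * ‖ξ‖ ^ (m.re - k - i)) (N : ℕ) {M : ℝ} {k : ℕ} (hk : m.re + M ≤ k) :
    DecaysAt N M fun q => a q - ∑ j ∈ Finset.range k, b j q := by
  have hO : IsOpen {q : Coord p n | q.2 ≠ 0} := isOpen_snd_ne_zero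
  set f : Coord p n → ℂ := fun q => a q - ∑ j ∈ Finset.range k, b j q with hf
  have hfs : ContDiffOn ℝ ∞ f {q | q.2 ≠ 0} :=
    ha.contDiffOn.sub (ContDiffOn.sum fun j _ => hb j)
  intro K hK
  choose A hA0 hA using fun N' => exists_norm_iteratedFDeriv_le_of_mixed hO N' ℂ
  choose C hC using fun i l => hest k i l K hK
  refine ⟨∑ j ∈ Finset.range (N + 1), A j * ∑ i ∈ Finset.range (N + 1),
    ∑ l ∈ Finset.range (N + 1), |C i l|, fun u hu ζ hζ j hj => ?_⟩
  set S := ∑ i ∈ Finset.range (N + 1), ∑ l ∈ Finset.range (N + 1), |C i l| with hS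
  have hS0 : 0 ≤ S := Finset.sum_nonneg fun i _ => Finset.sum_nonneg fun l _ => abs_nonneg _
  have hζ0 : ζ ≠ 0 := norm_pos_iff.1 (by linarith)
  have hpow : (0 : ℝ) ≤ ‖ζ‖ ^ (-M) := Real.rpow_nonneg (norm_nonneg _) _
  have h1 : ‖iteratedFDeriv ℝ j f (u, ζ)‖ ≤ A j * (S * ‖ζ‖ ^ (-M)) := by
    refine hA j f hfs u ζ hζ0 _ fun i l hil => ?_
    refine (hC i l u hu ζ hζ).trans ?_
    have hCS : |C i l| ≤ S := by
      refine le_trans ?_ (Finset.single_le_sum (f := fun i => ∑ l ∈ Finset.range (N + 1), |C i l|)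
        (fun i _ => Finset.sum_nonneg fun l _ => abs_nonneg _)
        (Finset.mem_range.2 (show i < N + 1 by omega)))
      exact Finset.single_le_sum (f := fun l => |C i l|) (fun l _ => abs_nonneg _)
        (Finset.mem_range.2 (show l < N + 1 by omega))
    have h2 : ‖ζ‖ ^ (m.re - k - i) ≤ ‖ζ‖ ^ (-M) := by
      refine Real.rpow_le_rpow_of_exponent_le hζ ?_
      have : (0 : ℝ) ≤ i := by positivity
      linarith
    calc C i l * ‖ζ‖ ^ (m.re - k - i) ≤ |C i l| * ‖ζ‖ ^ (m.re - k - i) := by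
          gcongr; exact le_abs_self _
      _ ≤ S * ‖ζ‖ ^ (-M) := by gcongr
  refine h1.trans ?_
  rw [← mul_assoc, ← Finset.sum_mul]
  gcongr
  exact Finset.single_le_sum (f := A) (fun j _ => hA0 j) (Finset.mem_range.2 (by omega))

/-- For every `N` the rescaled symbol has an extension of class `C^N` across `t = 0`. -/
theorem IsClassicalSymbol.exists_extension {m : ℂ} {a : Coord p n → ℂ} (ha : IsClassicalSymbol m a)
    (N : ℕ) : ∃ E : (EuclideanSpace ℝ (Fin p) × ℝ) × EuclideanSpace ℝ (Fin n) → ℂ,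
      IsRapid N E ∧ ∀ u t η, 0 < t → E ((u, t), η) = symbolFamily m a ((u, t), η) := by
  obtain ⟨hs, b, hb, hhom, hest⟩ := ha
  obtain ⟨k, hk⟩ := exists_nat_ge (m.re + ((-m).re + 2 * N + 2))
  have hdec := decaysAt_remainder hs hb hest N hk
  set r : Coord p n → ℂ := fun q => a q - ∑ j ∈ Finset.range k, b j q with hr
  have hO : IsOpen {x : EuclideanSpace ℝ (Fin p) × EuclideanSpace ℝ (Fin n) × ℝ | x.2.1 ≠ 0} :=
    isOpen_snd_fst_ne_zero
  have hrs : ContDiffOn ℝ N r {q | q.2 ≠ 0} :=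
    (hs.contDiffOn.sub (ContDiffOn.sum fun j _ => hb j)).of_le (by exact_mod_cast le_top)
  have hdil : ContDiffOn ℝ N (dilated (-m) r) {x | x.2.1 ≠ 0} := contDiffOn_dilated N hrs hdec le_rfl
  -- by homogeneity `t ^ m b_j(u, η / t) = t ^ j b_j(u, η)`, which is smooth in `t`; what remains
  -- of `a` decays fast enough for its dilations to be of class `C^N`
  let E : (EuclideanSpace ℝ (Fin p) × ℝ) × EuclideanSpace ℝ (Fin n) → ℂ := fun x =>
    (radialBump ‖x.2‖ : ℂ) * (∑ j ∈ Finset.range k, (x.1.2 : ℂ) ^ j * b j (x.1.1, x.2)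
      + dilated (-m) r (x.1.1, x.2, x.1.2))
  refine ⟨E, isRapid_of_bounded_support ?_ (R := 2) fun x η h => ?_, fun u t η ht => ?_⟩
  · refine contDiff_iff_contDiffAt.2 fun x => ?_
    rcases eq_or_ne x.2 0 with hx | hx
    · have hev : E =ᶠ[𝓝 x] fun _ => 0 := by
        have : ∀ᶠ y : (EuclideanSpace ℝ (Fin p) × ℝ) × EuclideanSpace ℝ (Fin n) in 𝓝 x,
            ‖y.2‖ < 1 :=
          ContinuousAt.eventually_lt (by fun_prop) continuousAt_const (by simp [hx])
        filter_upwards [this] with y hy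
        simp only [E]
        rw [radialBump_eq_zero (Or.inl (by linarith))]
        simp
      exact contDiffAt_const.congr_of_eventuallyEq hev
    · have h1 : ContDiffAt ℝ N (fun x : (EuclideanSpace ℝ (Fin p) × ℝ) × EuclideanSpace ℝ (Fin n) =>
          (radialBump ‖x.2‖ : ℂ)) x := by
        refine Complex.ofRealCLM.contDiff.contDiffAt.comp x ?_
        refine (contDiff_radialBump.of_le (by exact_mod_cast le_top)).contDiffAt.comp x ?_
        exact contDiffAt_snd.norm ℝ hx
      have h2 : ∀ j, ContDiffAt ℝ N (fun x : (EuclideanSpace ℝ (Fin p) × ℝ) ×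
          EuclideanSpace ℝ (Fin n) => (x.1.2 : ℂ) ^ j * b j (x.1.1, x.2)) x := by
        intro j
        refine ContDiffAt.mul ?_ ?_
        · exact (Complex.ofRealCLM.contDiff.contDiffAt.comp x (by fun_prop)).pow j
        · refine ContDiffAt.comp (f := fun x : (EuclideanSpace ℝ (Fin p) × ℝ) ×
            EuclideanSpace ℝ (Fin n) => (x.1.1, x.2)) x (((hb j).contDiffAt
              (isOpen_snd_ne_zero.mem_nhds (show ((x.1.1, x.2) : Coord p n) ∈ _ from hx))).of_le
              (by exact_mod_cast le_top)) (by fun_prop)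
      have h3 : ContDiffAt ℝ N (fun x : (EuclideanSpace ℝ (Fin p) × ℝ) ×
          EuclideanSpace ℝ (Fin n) => dilated (-m) r (x.1.1, x.2, x.1.2)) x :=
        ContDiffAt.comp (f := fun x : (EuclideanSpace ℝ (Fin p) × ℝ) ×
          EuclideanSpace ℝ (Fin n) => (x.1.1, x.2, x.1.2)) x
          (hdil.contDiffAt (hO.mem_nhds (show (x.1.1, x.2, x.1.2) ∈ _ from hx))) (by fun_prop)
      exact h1.mul ((ContDiffAt.sum fun j _ => h2 j).add h3)
  · simp only [E]
    rw [radialBump_eq_zero (Or.inr (by linarith))]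
    simp
  · simp only [E, symbolFamily]
    rcases eq_or_ne η 0 with rfl | hη
    · have h0 : radialBump 0 = 0 := radialBump_eq_zero (Or.inl (by norm_num))
      simp [h0]
    congr 1
    have htc : (t : ℂ) ≠ 0 := by exact_mod_cast ht.ne'
    have hj : ∀ j, (t : ℂ) ^ j * b j (u, η) = (t : ℂ) ^ m * b j (u, t⁻¹ • η) := by
      intro j
      have := hhom j t u (t⁻¹ • η) ht (smul_ne_zero (inv_ne_zero ht.ne') hη)
      rw [smul_inv_smul₀ ht.ne'] at this
      rw [this, ← mul_assoc, Complex.cpow_sub _ _ htc, Complex.cpow_natCast]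
      field_simp
    simp only [dilated, ht, if_true, neg_neg, smul_eq_mul, hr, hj, ← Finset.mul_sum]
    ring

/-- If `r` is also regular at `ζ = 0`, the dilated family is of class `C^N` off `(ζ, τ) = 0`. -/
theorem contDiffOn_dilated_of_contDiff {P Z : Type} [NormedAddCommGroup P] [NormedSpace ℝ P]
    [FiniteDimensional ℝ P] [NormedAddCommGroup Z] [NormedSpace ℝ Z] {N : ℕ} {M : ℝ}
    {r : P × Z → ℂ} (hr : ContDiff ℝ N r) (hd : DecaysAt N M r) (hM : 2 * N + 2 ≤ M) :
    ContDiffOn ℝ N (dilated 0 r) {x | x.2 ≠ 0} := by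
  intro x hx
  refine ContDiffAt.contDiffWithinAt ?_
  rcases eq_or_ne x.2.1 0 with hζ | hζ
  · have hτ : x.2.2 ≠ 0 := fun h => hx (Prod.ext hζ h)
    rcases lt_or_gt_of_ne hτ with h | h
    · have hev : dilated 0 r =ᶠ[𝓝 x] fun _ => 0 := by
        have : ∀ᶠ y : P × Z × ℝ in 𝓝 x, y.2.2 < 0 :=
          ContinuousAt.eventually_lt (by fun_prop) continuousAt_const h
        filter_upwards [this] with y hy
        simp [dilated, hy.le]
      exact contDiffAt_const.congr_of_eventuallyEq hev
    · have hev : dilated 0 r =ᶠ[𝓝 x] fun y => r (y.1, y.2.2⁻¹ • y.2.1) := by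
        have : ∀ᶠ y : P × Z × ℝ in 𝓝 x, 0 < y.2.2 :=
          ContinuousAt.eventually_lt continuousAt_const (by fun_prop) h
        filter_upwards [this] with y hy
        simp [dilated, hy]
      refine ContDiffAt.congr_of_eventuallyEq ?_ hev
      refine hr.contDiffAt.comp x ?_
      have hinv : ContDiffAt ℝ N (fun y : P × Z × ℝ => y.2.2⁻¹) x :=
        ContDiffAt.inv (by fun_prop) h.ne'
      exact contDiffAt_fst.prodMk (hinv.smul (by fun_prop))
  · exact (contDiffOn_dilated N hr.contDiffOn hd (by simpa using hM)).contDiffAt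
      (isOpen_snd_fst_ne_zero.mem_nhds hζ)

/-- The lift of the kernel to the blow-up has extensions of every finite order of
differentiability across the exceptional divisor `s = 0`. -/
theorem IsClassicalSymbol.exists_lift_symbolKernel {m : ℂ} {a : Coord p n → ℂ}
    (ha : IsClassicalSymbol m a) (N : ℕ) :
    ∃ G : EuclideanSpace ℝ (Fin p) × EuclideanSpace ℝ (Fin n) × ℝ × ℝ → ℂ,
      ContDiffOn ℝ N G {w | (w.2.1, w.2.2.1) ≠ 0} ∧ ∀ u ξ τ s, 0 < s →
        G (u, ξ, τ, s) = symbolKernel m a (u, s • ξ) (s * τ) := by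
  set M := 2 * N + 2 with hM
  obtain ⟨E, hE, hEeq⟩ := ha.exists_extension (N + M)
  obtain ⟨hF, hFd⟩ := contDiff_partialFourier M N hE
  have hdec : DecaysAt N (M : ℝ) (partialFourier E) := by
    intro K hK
    choose! C hC using hFd K hK
    refine ⟨∑ j ∈ Finset.range (N + 1), |C j|, fun x hx ζ hζ j hj => ?_⟩
    have hζ0 : 0 < ‖ζ‖ := by linarith
    have h1 := hC j hj x hx ζ
    have h2 : |C j| ≤ ∑ j ∈ Finset.range (N + 1), |C j| :=
      Finset.single_le_sum (f := fun j => |C j|) (fun _ _ => abs_nonneg _)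
        (Finset.mem_range.2 (by omega))
    rw [Real.rpow_neg hζ0.le, Real.rpow_natCast, ← div_eq_mul_inv, le_div_iff₀ (by positivity),
      mul_comm]
    refine le_trans ?_ ((h1.trans (le_abs_self _)).trans h2)
    gcongr
    linarith
  -- in the coordinates of the blow-up `x / t = ξ / τ`: the kernel is a dilated family in `(ξ, τ)`
  have hdil := contDiffOn_dilated_of_contDiff hF hdec (by rw [hM]; push_cast; rfl)
  refine ⟨fun w => ((2 * Real.pi : ℝ) : ℂ)⁻¹ ^ n * timeCutoff (w.2.2.2 * w.2.2.1) *
    dilated 0 (partialFourier E) ((w.1, w.2.2.2 * w.2.2.1), w.2.1, w.2.2.1), ?_,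
    fun u ξ τ s hs => ?_⟩
  · refine ContDiffOn.mul (contDiffOn_const.mul ?_) (hdil.comp (f := fun w : EuclideanSpace ℝ (Fin p) ×
      EuclideanSpace ℝ (Fin n) × ℝ × ℝ => ((w.1, w.2.2.2 * w.2.2.1), w.2.1, w.2.2.1))
      (by fun_prop) fun w hw => hw)
    exact (Complex.ofRealCLM.contDiff.comp ((contDiff_timeCutoff.of_le
      (by exact_mod_cast le_top)).comp (by fun_prop))).contDiffOn
  · simp only [dilated, symbolKernel]
    rcases lt_or_ge 0 τ with hτ | hτ
    · have hst : 0 < s * τ := mul_pos hs hτ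
      rw [if_pos hτ, if_pos hst, neg_zero, Complex.cpow_zero, one_smul, smul_smul,
        show (s * τ)⁻¹ * s = τ⁻¹ by field_simp]
      congr 1
      simp only [partialFourier, hEeq _ _ _ hst]
    · rw [if_neg (not_lt.2 hτ), if_neg (not_lt.2 (mul_nonpos_of_nonneg_of_nonpos hs.le hτ)), mul_zero]

end Family

/-! ### Pairings with the Schwartz function of a symbol -/

section Pairing

variable {p n : ℕ} {m : ℂ} {a : Coord p n → ℂ}

theorem symbolKernel_of_nonpos (q : Coord p n) {t : ℝ} (ht : t ≤ 0) : symbolKernel m a q t = 0 :=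
  if_neg (not_lt.2 ht)

theorem symbolKernel_of_two_le (q : Coord p n) {t : ℝ} (ht : 2 ≤ t) : symbolKernel m a q t = 0 := by
  simp [symbolKernel, timeCutoff_eq_zero ht]

theorem continuous_symbolFamily_fibre (ha : Continuous a) (u : EuclideanSpace ℝ (Fin p)) {t : ℝ}
    (ht : 0 < t) : Continuous fun η => symbolFamily m a ((u, t), η) := by
  simp only [symbolFamily, dilated, ht, if_true]
  have := contDiff_radialBump.continuous
  fun_prop

theorem symbolFamily_eq_zero {x : EuclideanSpace ℝ (Fin p) × ℝ} {η : EuclideanSpace ℝ (Fin n)}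
    (h : 2 ≤ ‖η‖) : symbolFamily m a (x, η) = 0 := by
  simp only [symbolFamily]
  rw [radialBump_eq_zero (Or.inr (by linarith))]
  simp

theorem integrable_symbolFamily_fibre (ha : Continuous a) (u : EuclideanSpace ℝ (Fin p)) {t : ℝ}
    (ht : 0 < t) : Integrable fun η => symbolFamily m a ((u, t), η) := by
  refine (continuous_symbolFamily_fibre ha u ht).integrable_of_hasCompactSupport ?_
  refine HasCompactSupport.of_support_subset_isCompact (isCompact_closedBall 0 2) fun η hη => ?_
  by_contra h
  exact hη (symbolFamily_eq_zero (le_of_lt (by simpa using h)))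

/-- `u ↦ ∫ k(u, x, t) F(u, x) dx`, by exchange of integrations. -/
theorem integral_symbolKernel_fibre (ha : Continuous a) {F : Coord p n → ℂ} (hF : ContDiff ℝ ∞ F)
    (hs : HasCompactSupport F) {t : ℝ} (ht : 0 < t) (u : EuclideanSpace ℝ (Fin p)) :
    (t : ℂ)⁻¹ ^ n * ∫ x, symbolKernel m a (u, x) t * F (u, x)
      = ((2 * Real.pi : ℝ) : ℂ)⁻¹ ^ n * ∫ η, (timeCutoff t * ((radialBump (t * ‖η‖) : ℂ) *
        (t : ℂ) ^ m)) * (a (u, η) * fibreFourier F (u, η)) := by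
  have h := integral_fourier_mul (integrable_symbolFamily_fibre (m := m) ha u ht)
    (integrable_fibre hF hs u) t⁻¹
  have h1 : ∫ x, symbolKernel m a (u, x) t * F (u, x) = ((2 * Real.pi : ℝ) : ℂ)⁻¹ ^ n *
      timeCutoff t * ∫ x, (∫ η, Complex.exp (-(Complex.I * (inner ℝ x (t⁻¹ • η) : ℝ))) *
        symbolFamily m a ((u, t), η)) * F (u, x) := by
    rw [← integral_const_mul]
    congr 1
    ext x
    simp only [symbolKernel, ht, if_true, partialFourier, smul_eq_mul]
    rw [mul_assoc]
    congr 3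
    ext η
    rw [inner_smul_right, inner_smul_right, real_inner_comm]
  have h2 := MeasureTheory.Measure.integral_comp_smul (volume : Measure (EuclideanSpace ℝ (Fin n)))
    (fun η => symbolFamily m a ((u, t), η) * fibreFourier F (u, t⁻¹ • η)) t
  rw [finrank_euclideanSpace_fin, abs_of_pos (by positivity), Complex.real_smul] at h2
  have h3 : ∫ η, symbolFamily m a ((u, t), η) * ∫ x, Complex.exp (-(Complex.I *
      (inner ℝ x (t⁻¹ • η) : ℝ))) * F (u, x)
      = ∫ η, symbolFamily m a ((u, t), η) * fibreFourier F (u, t⁻¹ • η) := rfl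
  rw [h1, h, h3]
  have htc : (t : ℂ) ≠ 0 := by exact_mod_cast ht.ne'
  have h4 : ∫ η, (timeCutoff t * ((radialBump (t * ‖η‖) : ℂ) *
        (t : ℂ) ^ m)) * (a (u, η) * fibreFourier F (u, η)) = timeCutoff t *
      ∫ η, symbolFamily m a ((u, t), t • η) * fibreFourier F (u, t⁻¹ • (t • η)) := by
    rw [← integral_const_mul]
    congr 1
    ext η
    simp only [symbolFamily, dilated, ht, if_true, neg_neg, smul_eq_mul, norm_smul,
      Real.norm_of_nonneg ht.le, inv_smul_smul₀ ht.ne']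
    ring
  rw [h4, h2]
  push_cast
  rw [inv_pow]
  ring

theorem continuous_symbolKernel (ha : IsClassicalSymbol m a) {t : ℝ} (ht : 0 < t) :
    Continuous fun q => symbolKernel m a q t := by
  obtain ⟨G, hG, heq⟩ := ha.exists_lift_symbolKernel 0
  have : (fun q => symbolKernel m a q t) = fun q => G (q.1, q.2, t, 1) := by
    funext q
    rw [heq _ _ _ _ one_pos]
    simp
  rw [this]
  refine hG.continuousOn.comp_continuous (by fun_prop) fun q => ?_
  simp [ht.ne']

/-- `t^m φ(t)`, extended by `0` to `t ≤ 0`. -/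
def powRadialBump (m : ℂ) (t : ℝ) : ℂ := if 0 < t then (t : ℂ) ^ m * radialBump t else 0

theorem powRadialBump_eq_zero (m : ℂ) {s : ℝ} (hs : s ≤ 5 / 4 ∨ 7 / 4 ≤ s) :
    powRadialBump m s = 0 := by
  simp [powRadialBump, radialBump_eq_zero hs]

theorem contDiff_powRadialBump (m : ℂ) : ContDiff ℝ ∞ (powRadialBump m) := by
  refine contDiff_iff_contDiffAt.2 fun t => ?_
  rcases lt_or_ge 0 t with h | h
  · have hev : powRadialBump m =ᶠ[𝓝 t] fun t => (t : ℂ) ^ m * radialBump t := by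
      filter_upwards [lt_mem_nhds h] with s hs
      simp [powRadialBump, hs]
    refine ContDiffAt.congr_of_eventuallyEq (ContDiffAt.mul ?_ ?_) hev
    · have hlog : (fun t : ℝ => (t : ℂ) ^ m) =ᶠ[𝓝 t] fun t => Complex.exp ((Real.log t : ℝ) * m) := by
        filter_upwards [lt_mem_nhds h] with s hs
        rw [Complex.cpow_def_of_ne_zero (by exact_mod_cast ne_of_gt hs), Complex.ofReal_log hs.le]
      refine ContDiffAt.congr_of_eventuallyEq (ContDiffAt.cexp (ContDiffAt.mul ?_ contDiffAt_const)) hlog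
      exact Complex.ofRealCLM.contDiff.contDiffAt.comp t (Real.contDiffAt_log.2 h.ne')
    · exact Complex.ofRealCLM.contDiff.contDiffAt.comp t contDiff_radialBump.contDiffAt
  · have hev : powRadialBump m =ᶠ[𝓝 t] fun _ => 0 := by
      filter_upwards [gt_mem_nhds (lt_of_le_of_lt h (zero_lt_one' ℝ))] with s hs
      exact powRadialBump_eq_zero m (Or.inl (by linarith))
    exact contDiffAt_const.congr_of_eventuallyEq hev

theorem hasCompactSupport_powRadialBump (m : ℂ) : HasCompactSupport (powRadialBump m) :=
  HasCompactSupport.of_support_subset_isCompact (isCompact_Icc (a := (5 / 4 : ℝ)) (b := 7 / 4))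
    fun s hs => by
      by_contra h
      refine hs (powRadialBump_eq_zero m ?_)
      rw [mem_Icc, not_and_or, not_le, not_le] at h
      exact h.imp le_of_lt le_of_lt

/-- The power `t ^ m` is traded for the constant `R ^ (-m)` and dilations of one fixed smooth function. -/
theorem powRadialBump_mul (m : ℂ) {t R : ℝ} (ht : 0 < t) (hR : 0 < R) :
    (radialBump (t * R) : ℂ) * (t : ℂ) ^ m = (R : ℂ) ^ (-m) * powRadialBump m (t * R) := by
  have hRc : (R : ℂ) ≠ 0 := by exact_mod_cast hR.ne'
  rw [powRadialBump, if_pos (mul_pos ht hR), Complex.ofReal_mul,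
    Complex.mul_cpow_ofReal_nonneg ht.le hR.le, Complex.cpow_neg]
  have : (R : ℂ) ^ m ≠ 0 := by simp [Complex.cpow_eq_zero_iff, hRc]
  field_simp

theorem exists_norm_cpow_neg_le (m : ℂ) :
    ∃ (J : ℕ) (C : ℝ), 0 ≤ C ∧ ∀ R : ℝ, 1 / 4 ≤ R → ‖(R : ℂ) ^ (-m)‖ ≤ C * (1 + R) ^ J := by
  obtain ⟨J, hJ⟩ := exists_nat_ge |m.re|
  refine ⟨J, 4 ^ J, by positivity, fun R hR => ?_⟩
  have hR0 : 0 < R := by linarith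
  rw [Complex.norm_cpow_eq_rpow_re_of_pos hR0, Complex.neg_re]
  have h1 : 1 ≤ 1 + R := by linarith
  rcases le_or_gt 0 m.re with h | h
  · rw [abs_of_nonneg h] at hJ
    calc R ^ (-m.re) ≤ (1 / 4 : ℝ) ^ (-m.re) :=
          Real.rpow_le_rpow_of_nonpos (by norm_num) hR (by linarith)
      _ = (4 : ℝ) ^ m.re := by
          rw [one_div, Real.inv_rpow (by norm_num), Real.rpow_neg (by norm_num), inv_inv]
      _ ≤ (4 : ℝ) ^ (J : ℝ) := Real.rpow_le_rpow_of_exponent_le (by norm_num) hJ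
      _ = 4 ^ J * 1 := by rw [Real.rpow_natCast, mul_one]
      _ ≤ _ := by gcongr; exact one_le_pow₀ h1
  · rw [abs_of_neg h] at hJ
    calc R ^ (-m.re) ≤ (1 + R) ^ (-m.re) :=
          Real.rpow_le_rpow hR0.le (by linarith) (by linarith)
      _ ≤ (1 + R) ^ (J : ℝ) := Real.rpow_le_rpow_of_exponent_le h1 hJ
      _ = 1 * (1 + R) ^ J := by rw [Real.rpow_natCast, one_mul]
      _ ≤ _ := by gcongr; exact one_le_pow₀ (by norm_num)

/-- The pairings of the kernel of a symbol with a test function extend smoothly by `0` to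
`t ≤ 0`. -/
theorem IsClassicalSymbol.exists_flat_pairing (ha : IsClassicalSymbol m a) {F : Coord p n → ℂ}
    (hF : ContDiff ℝ ∞ F) (hs : HasCompactSupport F) : ∃ h : ℝ → ℂ, ContDiff ℝ ∞ h ∧
      (∀ t ≤ 0, h t = 0) ∧ (∀ t, 0 < t → h t = ((2 * Real.pi : ℝ) : ℂ)⁻¹ ^ n *
        ∫ q, (timeCutoff t * ((radialBump (t * ‖q.2‖) : ℂ) * (t : ℂ) ^ m)) *
          (a q * fibreFourier F q)) := by
  have hac : Continuous a := ha.1.continuous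
  have hFc : Continuous (fibreFourier F) := (isRapid_fibreFourier hF hs 0).1.continuous
  obtain ⟨Ma, hMa⟩ := ha.exists_growth
  obtain ⟨J, Cm, hCm0, hCm⟩ := exists_norm_cpow_neg_le m
  -- `c(t) φ(t ‖η‖) ≠ 0` forces `t < 2` and `t ‖η‖ > 1`; so the integral runs over `‖η‖ ≥ 1/4`,
  -- where `‖η‖ ^ (-m)` is smooth
  let S : Set (Coord p n) := {q | 1 / 4 ≤ ‖q.2‖}
  have hSm : MeasurableSet S := (isClosed_le continuous_const continuous_snd.norm).measurableSet
  let wt : Coord p n → ℂ := fun q => (‖q.2‖ : ℂ) ^ (-m) * (a q * fibreFourier F q)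
  have hwtm : Measurable fun q : Coord p n => (‖q.2‖ : ℂ) ^ (-m) :=
    (Complex.measurable_ofReal.comp (measurable_snd.norm)).pow_const _
  have hwt : AEStronglyMeasurable wt (volume.restrict S) :=
    (hwtm.aestronglyMeasurable.mul (hac.mul hFc).aestronglyMeasurable)
  have hint : ∀ i : ℕ, IntegrableOn (fun q => ‖wt q‖ * ‖q.2‖ ^ i) S := by
    intro i
    have h1 : Integrable fun q => S.indicator (fun q => (‖q.2‖ : ℂ) ^ (-m) * a q * (‖q.2‖ : ℂ) ^ i) q
        * fibreFourier F q := by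
      refine integrable_mul_fibreFourier hF hs ?_ (J + Ma + i) fun K hK => ?_
      · refine AEStronglyMeasurable.indicator ?_ hSm
        exact (hwtm.aestronglyMeasurable.mul hac.aestronglyMeasurable).mul
          (Continuous.aestronglyMeasurable (by fun_prop))
      · obtain ⟨C, hC⟩ := hMa K hK
        refine ⟨Cm * |C|, fun q hq => ?_⟩
        by_cases hqS : q ∈ S
        · rw [indicator_of_mem hqS, norm_mul, norm_mul, norm_pow, Complex.norm_real, norm_norm]
          calc _ ≤ Cm * (1 + ‖q.2‖) ^ J * (|C| * (1 + ‖q.2‖) ^ Ma) * (1 + ‖q.2‖) ^ i := by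
                have h2 := hCm _ hqS
                have h3 : ‖a q‖ ≤ |C| * (1 + ‖q.2‖) ^ Ma := (hC q hq).trans
                  (mul_le_mul_of_nonneg_right (le_abs_self C) (by positivity))
                gcongr
                linarith
            _ = _ := by rw [pow_add, pow_add]; ring
        · rw [indicator_of_notMem hqS, norm_zero]
          positivity
    refine (h1.norm.integrableOn (s := S)).congr_fun (fun q hq => ?_) hSm
    simp only [indicator_of_mem hq, wt, norm_mul, norm_pow, Complex.norm_real, norm_norm]
    ring
  have hsm : ContDiffOn ℝ ∞ (fun t => ∫ q in S, wt q • powRadialBump m (t * ‖q.2‖)) univ := by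
    rw [contDiffOn_infty]
    intro N
    have hΩ : IsOpen {q : Coord p n | q.2 ≠ 0} := isOpen_snd_ne_zero
    refine contDiffOn_setIntegral_smul (f := fun x : ℝ × Coord p n =>
      powRadialBump m (x.1 * ‖x.2.2‖)) isOpen_univ hΩ hSm ?_ ?_ hwt fun i hi t _ => ?_
    · intro q hq h0
      have hq' : (1 / 4 : ℝ) ≤ ‖q.2‖ := hq
      rw [h0, norm_zero] at hq'
      norm_num at hq'
    · intro x hx
      refine ContDiffAt.contDiffWithinAt ?_
      refine ((contDiff_powRadialBump m).of_le (by exact_mod_cast le_top)).contDiffAt.comp x ?_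
      refine contDiffAt_fst.mul (ContDiffAt.norm ℝ ?_ hx.2)
      exact contDiffAt_snd.comp x contDiffAt_snd
    · obtain ⟨C, hC⟩ := ((hasCompactSupport_powRadialBump m).iteratedFDeriv (𝕜 := ℝ)
        i).exists_bound_of_continuous
        ((contDiff_powRadialBump m).continuous_iteratedFDeriv (by exact_mod_cast le_top))
      refine ⟨fun q => C * ‖q.2‖ ^ i, ?_, univ, univ_mem, fun q _ t' _ => ?_⟩
      · refine ((hint i).const_mul C).congr (Eventually.of_forall fun q => ?_)
        simp only
        ring
      · let L : ℝ →L[ℝ] ℝ := ‖q.2‖ • ContinuousLinearMap.id ℝ ℝ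
        have hL : ‖L‖ ≤ ‖q.2‖ := by
          refine ContinuousLinearMap.opNorm_le_bound _ (norm_nonneg _) fun x => ?_
          simp [L]
        have heq : (fun v => powRadialBump m (v * ‖q.2‖)) = powRadialBump m ∘ L := by
          funext v; simp [L, mul_comm]
        rw [heq]
        refine (norm_iteratedFDeriv_comp_clm_le L ((contDiff_powRadialBump m).contDiffAt.of_le
          (by exact_mod_cast le_top))).trans ?_
        have hC0 : 0 ≤ C := (norm_nonneg _).trans (hC 0)
        change _ ≤ C * ‖q.2‖ ^ i
        gcongr
        exact hC _
  refine ⟨fun t => ((2 * Real.pi : ℝ) : ℂ)⁻¹ ^ n * (timeCutoff t *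
    ∫ q in S, wt q • powRadialBump m (t * ‖q.2‖)), ?_, fun t ht => ?_, fun t ht => ?_⟩
  · refine contDiff_const.mul (ContDiff.mul ?_ (contDiffOn_univ.1 hsm))
    exact Complex.ofRealCLM.contDiff.comp contDiff_timeCutoff
  · have : ∀ q : Coord p n, powRadialBump m (t * ‖q.2‖) = 0 := fun q =>
      powRadialBump_eq_zero m (Or.inl (by nlinarith [norm_nonneg q.2]))
    simp [this]
  · simp only
    congr 1
    rcases le_or_gt 2 t with h2 | h2
    · simp [timeCutoff_eq_zero h2]
    rw [← integral_const_mul, ← integral_indicator hSm]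
    congr 1
    ext q
    by_cases hq : q ∈ S
    · have hq' : (1 / 4 : ℝ) ≤ ‖q.2‖ := hq
      rw [indicator_of_mem hq, powRadialBump_mul m ht (by linarith)]
      simp only [wt, smul_eq_mul]
      ring
    · have hq' : ‖q.2‖ < 1 / 4 := not_le.1 hq
      rw [indicator_of_notMem hq, radialBump_eq_zero (Or.inl (by nlinarith [norm_nonneg q.2]))]
      simp

end Pairing

/-! ### Mellin transforms and low frequencies -/

section Pairing

variable {p n : ℕ} {m : ℂ} {a : Coord p n → ℂ}

theorem integrable_scaled_symbol (ha : IsClassicalSymbol m a) {F : Coord p n → ℂ}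
    (hF : ContDiff ℝ ∞ F) (hs : HasCompactSupport F) (t : ℝ) (c : ℂ) :
    Integrable fun q => ((radialBump (t * ‖q.2‖) : ℂ) * c) * (a q * fibreFourier F q) := by
  obtain ⟨M, hM⟩ := ha.exists_growth
  obtain ⟨B, hB0, hB⟩ := exists_radialBump_le
  have hac : Continuous a := ha.1.continuous
  have hr := contDiff_radialBump.continuous
  have := integrable_mul_fibreFourier hF hs (w := fun q => ((radialBump (t * ‖q.2‖) : ℂ) * c) * a q)
    (Continuous.aestronglyMeasurable (by fun_prop)) M fun K hK => by
      obtain ⟨C, hC⟩ := hM K hK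
      refine ⟨B * ‖c‖ * C, fun q hq => ?_⟩
      rw [norm_mul, norm_mul, Complex.norm_real, Real.norm_of_nonneg (radialBump_nonneg _)]
      calc _ ≤ B * ‖c‖ * (C * (1 + ‖q.2‖) ^ M) := by
            gcongr
            · exact hB _
            · exact hC q hq
        _ = _ := by ring
  refine this.congr (Eventually.of_forall fun q => ?_)
  simp only
  ring

/-- The pairings of the kernel of a symbol are localisations of `P_a` to frequencies `‖η‖ ≈ 1 / t`. -/
theorem IsClassicalSymbol.pairing_symbolKernel (ha : IsClassicalSymbol m a) {F : Coord p n → ℂ}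
    (hF : ContDiff ℝ ∞ F) (hs : HasCompactSupport F) {t : ℝ} (ht : 0 < t) :
    (t : ℂ)⁻¹ ^ n * ∫ q, symbolKernel m a q t * F q = ((2 * Real.pi : ℝ) : ℂ)⁻¹ ^ n *
        ∫ q, (timeCutoff t * ((radialBump (t * ‖q.2‖) : ℂ) * (t : ℂ) ^ m)) *
          (a q * fibreFourier F q) := by
  have hac : Continuous a := ha.1.continuous
  have h1 : Integrable fun q => symbolKernel m a q t * F q :=
    ((continuous_symbolKernel ha ht).mul hF.continuous).integrable_of_hasCompactSupport hs.mul_left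
  have h2 : Integrable fun q => (timeCutoff t * ((radialBump (t * ‖q.2‖) : ℂ) * (t : ℂ) ^ m)) *
          (a q * fibreFourier F q) := by
    refine ((integrable_scaled_symbol ha hF hs t ((t : ℂ) ^ m)).const_mul (timeCutoff t : ℂ)).congr
      (Eventually.of_forall fun q => ?_)
    simp only
    ring
  rw [Measure.volume_eq_prod] at h1 h2 ⊢
  rw [integral_prod _ h1, integral_prod _ h2, ← integral_const_mul, ← integral_const_mul]
  congr 1
  ext u
  exact integral_symbolKernel_fibre hac hF hs ht u

/-- The function `∫ c(t) φ(t R) t⁻¹ dt`, equal to `1` for `R ≥ 2`. -/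
def mellinCutoff (R : ℝ) : ℝ := ∫ t in Ioi (0 : ℝ), t⁻¹ * timeCutoff t * radialBump (t * R)

theorem mellinCutoff_eq_one {R : ℝ} (hR : 2 ≤ R) : mellinCutoff R = 1 := by
  have hR0 : 0 < R := by linarith
  have h := integral_comp_mul_right_Ioi (fun s : ℝ => s⁻¹ * radialBump s) 0 hR0
  rw [zero_mul, integral_radialBump] at h
  have h1 : ∀ t ∈ Ioi (0 : ℝ), t⁻¹ * timeCutoff t * radialBump (t * R)
      = R * ((t * R)⁻¹ * radialBump (t * R)) := by
    intro t ht
    have ht0 : (0 : ℝ) < t := ht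
    -- `φ(t R) ≠ 0` forces `t R < 2`, hence `t < 1`, where `c(t) = 1`
    rcases le_or_gt t 1 with h' | h'
    · rw [timeCutoff_eq_one h']
      field_simp
    · rw [radialBump_eq_zero (Or.inr (by nlinarith))]
      simp
  rw [mellinCutoff, setIntegral_congr_fun measurableSet_Ioi h1, integral_const_mul, h]
  simp [hR0.ne']

theorem measurable_mellinCutoff : Measurable mellinCutoff := by
  have hm : StronglyMeasurable fun z : ℝ × ℝ => z.2⁻¹ * timeCutoff z.2 * radialBump (z.2 * z.1) := by
    have h1 := contDiff_timeCutoff.continuous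
    have h2 := contDiff_radialBump.continuous
    refine Measurable.stronglyMeasurable ?_
    refine (measurable_snd.inv.mul (h1.comp continuous_snd).measurable).mul ?_
    exact (h2.comp (continuous_snd.mul continuous_fst)).measurable
  exact (hm.integral_prod_right' (ν := volume.restrict (Ioi 0))).measurable

theorem norm_mellin_integrand_le {B : ℝ} (hB0 : 0 ≤ B) (hB : ∀ s, radialBump s ≤ B) {t R : ℝ}
    (ht : 0 < t) (hR : 0 ≤ R) :
    t⁻¹ * timeCutoff t * radialBump (t * R) ≤ (Ioc 0 2).indicator (fun _ => R * B) t := by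
  rcases le_or_gt t 2 with h | h
  · rw [indicator_of_mem (show t ∈ Ioc (0 : ℝ) 2 from ⟨ht, h⟩)]
    rcases le_or_gt (t * R) 1 with h1 | h1
    · rw [radialBump_eq_zero (Or.inl (by linarith)), mul_zero]
      positivity
    · have h2 : t⁻¹ ≤ R := by
        rw [inv_le_iff_one_le_mul₀ ht]; linarith
      calc _ ≤ R * 1 * B := by
            have := timeCutoff_nonneg t
            have := timeCutoff_le_one t
            have := radialBump_nonneg (t * R)
            gcongr
            exact hB _
        _ = _ := by ring
  · rw [timeCutoff_eq_zero h.le, indicator_of_notMem fun h' => absurd h'.2 (not_le.2 h)]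
    simp

theorem mellin_integrand_nonneg {t R : ℝ} (ht : 0 < t) :
    0 ≤ t⁻¹ * timeCutoff t * radialBump (t * R) :=
  mul_nonneg (mul_nonneg (inv_nonneg.2 ht.le) (timeCutoff_nonneg t)) (radialBump_nonneg _)

theorem exists_norm_mellinCutoff_le : ∃ C : ℝ, 0 ≤ C ∧ ∀ R, 0 ≤ R → |mellinCutoff R| ≤ C * (1 + R) := by
  obtain ⟨B, hB0, hB⟩ := exists_radialBump_le
  refine ⟨B * 2, by positivity, fun R hR => ?_⟩
  have hint : IntegrableOn (fun t : ℝ => (Ioc 0 2).indicator (fun _ => R * B) t) (Ioi 0) :=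
    ((integrable_indicator_iff measurableSet_Ioc).2 (integrableOn_const (by simp))).integrableOn
  have h1 := norm_integral_le_of_norm_le hint (f := fun t : ℝ =>
    t⁻¹ * timeCutoff t * radialBump (t * R)) (by
      filter_upwards [ae_restrict_mem measurableSet_Ioi] with t ht
      rw [Real.norm_of_nonneg (mellin_integrand_nonneg ht)]
      exact norm_mellin_integrand_le hB0 hB ht hR)
  have h2 : ∫ t in Ioi (0 : ℝ), (Ioc 0 2).indicator (fun _ => R * B) t = R * B * 2 := by
    rw [setIntegral_indicator measurableSet_Ioc,
      inter_eq_right.2 (show Ioc (0 : ℝ) 2 ⊆ Ioi 0 from fun t ht => ht.1), setIntegral_const]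
    simp
    ring
  rw [h2] at h1
  refine h1.trans ?_
  nlinarith

/-- The Mellin transform of the kernel of a symbol. -/
theorem IsClassicalSymbol.integral_pairing_symbolKernel (ha : IsClassicalSymbol m a)
    {F : Coord p n → ℂ} (hF : ContDiff ℝ ∞ F) (hs : HasCompactSupport F) :
    ∫ t in Ioi (0 : ℝ), ((t : ℂ)⁻¹ ^ n * ∫ q, symbolKernel m a q t * F q) * (t : ℂ) ^ (-1 - m)
      = ((2 * Real.pi : ℝ) : ℂ)⁻¹ ^ n *
        ∫ q, (mellinCutoff ‖q.2‖ : ℂ) * (a q * fibreFourier F q) := by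
  obtain ⟨M, hM⟩ := ha.exists_growth
  obtain ⟨B, hB0, hB⟩ := exists_radialBump_le
  have hac : Continuous a := ha.1.continuous
  have hFc : Continuous (fibreFourier F) := (isRapid_fibreFourier hF hs 0).1.continuous
  have hct := contDiff_timeCutoff.continuous
  have hcr := contDiff_radialBump.continuous
  have hq : Integrable fun q : Coord p n => ((‖q.2‖ : ℂ) * a q) * fibreFourier F q := by
    refine integrable_mul_fibreFourier hF hs (Continuous.aestronglyMeasurable (by fun_prop)) (1 + M)
      fun K hK => ?_
    obtain ⟨C, hC⟩ := hM K hK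
    refine ⟨C, fun q hq => ?_⟩
    rw [norm_mul, Complex.norm_real, norm_norm]
    have := hC q hq
    have h0 : 0 ≤ C * (1 + ‖q.2‖) ^ M := (norm_nonneg _).trans this
    calc _ ≤ (1 + ‖q.2‖) * (C * (1 + ‖q.2‖) ^ M) := by
          gcongr; linarith
      _ = _ := by ring
  have hprod : Integrable (fun z : ℝ × Coord p n =>
      ((z.1⁻¹ * timeCutoff z.1 * radialBump (z.1 * ‖z.2.2‖) : ℝ) : ℂ) * (a z.2 * fibreFourier F z.2))
      ((volume.restrict (Ioi 0)).prod volume) := by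
    have hint : IntegrableOn (fun t : ℝ => (Ioc (0 : ℝ) 2).indicator (fun _ => B) t) (Ioi 0) :=
      ((integrable_indicator_iff measurableSet_Ioc).2 (integrableOn_const (by simp))).integrableOn
    refine (hint.mul_prod hq.norm).mono' ?_ ?_
    · refine AEStronglyMeasurable.mul ?_ (Continuous.aestronglyMeasurable (by fun_prop))
      refine (Complex.measurable_ofReal.comp ?_).aestronglyMeasurable
      refine (measurable_fst.inv.mul (hct.comp continuous_fst).measurable).mul ?_
      exact (hcr.comp (by fun_prop : Continuous fun z : ℝ × Coord p n => z.1 * ‖z.2.2‖)).measurable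
    · have hae : ∀ᵐ z : ℝ × Coord p n ∂((volume.restrict (Ioi 0)).prod volume), z.1 ∈ Ioi (0 : ℝ) :=
        Measure.quasiMeasurePreserving_fst.ae (ae_restrict_mem measurableSet_Ioi)
      filter_upwards [hae] with z hz
      rw [norm_mul, Complex.norm_real, Real.norm_of_nonneg (mellin_integrand_nonneg hz)]
      calc _ ≤ (Ioc (0 : ℝ) 2).indicator (fun _ => ‖z.2.2‖ * B) z.1 *
            ‖a z.2 * fibreFourier F z.2‖ := by
            gcongr
            exact norm_mellin_integrand_le hB0 hB hz (norm_nonneg _)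
        _ = _ := by
            by_cases h : z.1 ∈ Ioc (0 : ℝ) 2
            · simp only [indicator_of_mem h, norm_mul, Complex.norm_real, norm_norm]; ring
            · simp only [indicator_of_notMem h, zero_mul]
  have hswap := integral_integral_swap (f := fun (t : ℝ) (q : Coord p n) =>
    ((t⁻¹ * timeCutoff t * radialBump (t * ‖q.2‖) : ℝ) : ℂ) * (a q * fibreFourier F q)) hprod
  have hcongr : ∀ t ∈ Ioi (0 : ℝ),
      ((t : ℂ)⁻¹ ^ n * ∫ q, symbolKernel m a q t * F q) * (t : ℂ) ^ (-1 - m)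
      = ((2 * Real.pi : ℝ) : ℂ)⁻¹ ^ n * ∫ q, ((t⁻¹ * timeCutoff t * radialBump (t * ‖q.2‖) : ℝ) : ℂ) *
        (a q * fibreFourier F q) := by
    intro t ht
    have ht0 : (0 : ℝ) < t := ht
    have htc : (t : ℂ) ≠ 0 := by exact_mod_cast ht0.ne'
    rw [ha.pairing_symbolKernel hF hs ht0, mul_assoc, ← integral_mul_const]
    congr 2
    ext q
    rw [Complex.cpow_sub _ _ htc, Complex.cpow_neg_one]
    have : (t : ℂ) ^ m ≠ 0 := by simp [Complex.cpow_eq_zero_iff, htc]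
    push_cast
    field_simp
  rw [setIntegral_congr_fun measurableSet_Ioi hcongr, integral_const_mul, hswap]
  congr 2
  ext q
  rw [integral_mul_const, mellinCutoff, integral_complex_ofReal]

/-- The smooth kernel of the low-frequency part of an oscillatory integral. -/
def lowFrequencyKernel (a : Coord p n → ℂ) (q : Coord p n) : ℂ :=
  ((2 * Real.pi : ℝ) : ℂ)⁻¹ ^ n * ∫ η in Metric.closedBall (0 : EuclideanSpace ℝ (Fin n)) 2,
    (1 - (mellinCutoff ‖η‖ : ℂ)) • (Complex.exp (-(Complex.I * (inner ℝ q.2 η : ℝ))) * a (q.1, η))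

theorem measurable_one_sub_mellinCutoff :
    Measurable fun η : EuclideanSpace ℝ (Fin n) => 1 - (mellinCutoff ‖η‖ : ℂ) :=
  measurable_const.sub (Complex.measurable_ofReal.comp (measurable_mellinCutoff.comp measurable_norm))

theorem integrableOn_one_sub_mellinCutoff : IntegrableOn
    (fun η : EuclideanSpace ℝ (Fin n) => 1 - (mellinCutoff ‖η‖ : ℂ)) (Metric.closedBall 0 2) := by
  obtain ⟨C, hC0, hC⟩ := exists_norm_mellinCutoff_le
  refine Measure.integrableOn_of_bounded (M := 1 + C * 3) (measure_closedBall_lt_top.ne)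
    measurable_one_sub_mellinCutoff.aestronglyMeasurable ?_
  filter_upwards [ae_restrict_mem measurableSet_closedBall] with η hη
  have h1 : ‖η‖ ≤ 2 := by simpa using hη
  refine (norm_sub_le _ _).trans ?_
  rw [norm_one, Complex.norm_real, Real.norm_eq_abs]
  have := hC ‖η‖ (norm_nonneg _)
  nlinarith

theorem contDiff_lowFrequencyKernel (ha : ContDiff ℝ ∞ a) : ContDiff ℝ ∞ (lowFrequencyKernel a) := by
  refine contDiff_const.mul (contDiffOn_univ.1 (contDiffOn_infty.2 fun N => ?_))
  refine contDiffOn_setIntegral_smul_of_isCompact (f := fun x : Coord p n × EuclideanSpace ℝ (Fin n)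
    => Complex.exp (-(Complex.I * (inner ℝ x.1.2 x.2 : ℝ))) * a (x.1.1, x.2)) isOpen_univ isOpen_univ
    (isCompact_closedBall 0 2) (subset_univ _) (ContDiff.contDiffOn ?_)
    integrableOn_one_sub_mellinCutoff
  refine ContDiff.mul (ContDiff.cexp (ContDiff.neg (contDiff_const.mul ?_)))
    ((ha.of_le (by exact_mod_cast le_top)).comp (by fun_prop))
  exact Complex.ofRealCLM.contDiff.comp ((contDiff_snd.comp contDiff_fst).inner ℝ contDiff_snd)

/-- Pairing with the low-frequency kernel is `P_a` with the symbol cut off to low frequencies. -/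
theorem IsClassicalSymbol.integral_lowFrequencyKernel (ha : IsClassicalSymbol m a)
    {F : Coord p n → ℂ} (hF : ContDiff ℝ ∞ F) (hs : HasCompactSupport F) :
    ∫ q, lowFrequencyKernel a q * F q = ((2 * Real.pi : ℝ) : ℂ)⁻¹ ^ n *
        ∫ q, (1 - (mellinCutoff ‖q.2‖ : ℂ)) * (a q * fibreFourier F q) := by
  obtain ⟨M, hM⟩ := ha.exists_growth
  obtain ⟨C₀, hC₀, hcut⟩ := exists_norm_mellinCutoff_le
  have hac : Continuous a := ha.1.continuous
  have h1 : Integrable fun q => lowFrequencyKernel a q * F q :=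
    ((contDiff_lowFrequencyKernel ha.1).continuous.mul
      hF.continuous).integrable_of_hasCompactSupport hs.mul_left
  have hmeas : AEStronglyMeasurable (fun q : Coord p n => (1 - (mellinCutoff ‖q.2‖ : ℂ)) * a q) :=
    (measurable_one_sub_mellinCutoff.comp measurable_snd).aestronglyMeasurable.mul
      hac.aestronglyMeasurable
  have h2 : Integrable fun q => (1 - (mellinCutoff ‖q.2‖ : ℂ)) * (a q * fibreFourier F q) := by
    refine (integrable_mul_fibreFourier hF hs hmeas (1 + M) fun K hK => ?_).congr
      (Eventually.of_forall fun q => mul_assoc _ _ _)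
    obtain ⟨C, hC⟩ := hM K hK
    refine ⟨(1 + C₀) * C, fun q hq => ?_⟩
    have h3 := hC q hq
    have h0 : 0 ≤ C * (1 + ‖q.2‖) ^ M := (norm_nonneg _).trans h3
    have h4 : ‖1 - (mellinCutoff ‖q.2‖ : ℂ)‖ ≤ (1 + C₀) * (1 + ‖q.2‖) := by
      refine (norm_sub_le _ _).trans ?_
      rw [norm_one, Complex.norm_real, Real.norm_eq_abs]
      have := hcut ‖q.2‖ (norm_nonneg _)
      nlinarith [norm_nonneg q.2]
    rw [norm_mul]
    calc _ ≤ (1 + C₀) * (1 + ‖q.2‖) * (C * (1 + ‖q.2‖) ^ M) := by gcongr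
      _ = _ := by ring
  rw [Measure.volume_eq_prod] at h1 h2 ⊢
  rw [integral_prod _ h1, integral_prod _ h2, ← integral_const_mul]
  congr 1
  ext u
  set A : EuclideanSpace ℝ (Fin n) → ℂ := (Metric.closedBall 0 2).indicator fun η =>
    (1 - (mellinCutoff ‖η‖ : ℂ)) * a (u, η) with hA
  have hAeq : ∀ η, A η = (1 - (mellinCutoff ‖η‖ : ℂ)) * a (u, η) := by
    intro η
    by_cases h : η ∈ Metric.closedBall (0 : EuclideanSpace ℝ (Fin n)) 2
    · rw [hA, indicator_of_mem h]
    · rw [hA, indicator_of_notMem h, mellinCutoff_eq_one (le_of_lt (by simpa using h))]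
      simp
  have hau : Continuous fun η => a (u, η) := by fun_prop
  have hAint : Integrable A := by
    refine (integrable_indicator_iff measurableSet_closedBall).2 ?_
    obtain ⟨D, hD⟩ := (isCompact_closedBall (0 : EuclideanSpace ℝ (Fin n)) 2
      ).exists_bound_of_continuousOn hau.continuousOn
    refine Integrable.mul_bdd (c := D) integrableOn_one_sub_mellinCutoff hau.aestronglyMeasurable ?_
    filter_upwards [ae_restrict_mem measurableSet_closedBall] with η hη using hD η hη
  have h := integral_fourier_mul hAint (integrable_fibre hF hs u) 1
  simp only [one_smul] at h
  calc ∫ x, lowFrequencyKernel a (u, x) * F (u, x)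
      = ((2 * Real.pi : ℝ) : ℂ)⁻¹ ^ n * ∫ x, (∫ η, Complex.exp (-(Complex.I * (inner ℝ x η : ℝ))) *
          A η) * F (u, x) := by
        rw [← integral_const_mul]
        congr 1
        ext x
        rw [lowFrequencyKernel, mul_assoc]
        congr 2
        rw [← integral_indicator measurableSet_closedBall]
        congr 1
        ext η
        by_cases h : η ∈ Metric.closedBall (0 : EuclideanSpace ℝ (Fin n)) 2
        · rw [indicator_of_mem h, hA, indicator_of_mem h, smul_eq_mul]
          ring
        · rw [indicator_of_notMem h, hA, indicator_of_notMem h, mul_zero]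
    _ = _ := by
        rw [h]
        congr 2
        ext η
        rw [hAeq, mul_assoc]
        rfl

/-- Every oscillatory integral is, up to a smooth kernel, the Mellin transform of the pairings
with its Schwartz function. -/
theorem IsClassicalSymbol.oscillatory_eq (ha : IsClassicalSymbol m a) {F : Coord p n → ℂ}
    (hF : ContDiff ℝ ∞ F) (hs : HasCompactSupport F) :
    oscillatory a F = (∫ t in Ioi (0 : ℝ),
      ((t : ℂ)⁻¹ ^ n * ∫ q, symbolKernel m a q t * F q) * (t : ℂ) ^ (-1 - m))
        + ∫ q, lowFrequencyKernel a q * F q := by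
  obtain ⟨M, hM⟩ := ha.exists_growth
  obtain ⟨C₀, hC₀, hcut⟩ := exists_norm_mellinCutoff_le
  have hac : Continuous a := ha.1.continuous
  have h1 : Integrable fun q => a q * fibreFourier F q :=
    integrable_mul_fibreFourier hF hs hac.aestronglyMeasurable M hM
  have h2 : Integrable fun q : Coord p n => (mellinCutoff ‖q.2‖ : ℂ) * (a q * fibreFourier F q) := by
    refine (integrable_mul_fibreFourier hF hs (w := fun q => (mellinCutoff ‖q.2‖ : ℂ) * a q)
      ?_ (1 + M) fun K hK => ?_).congr (Eventually.of_forall fun q => mul_assoc _ _ _)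
    · exact (Complex.measurable_ofReal.comp (measurable_mellinCutoff.comp
        measurable_snd.norm)).aestronglyMeasurable.mul hac.aestronglyMeasurable
    obtain ⟨C, hC⟩ := hM K hK
    refine ⟨C₀ * C, fun q hq => ?_⟩
    have h3 := hC q hq
    have h0 : 0 ≤ C * (1 + ‖q.2‖) ^ M := (norm_nonneg _).trans h3
    have h4 := hcut ‖q.2‖ (norm_nonneg _)
    rw [norm_mul, Complex.norm_real, Real.norm_eq_abs]
    calc _ ≤ C₀ * (1 + ‖q.2‖) * (C * (1 + ‖q.2‖) ^ M) := by gcongr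
      _ = _ := by ring
  rw [ha.integral_pairing_symbolKernel hF hs, ha.integral_lowFrequencyKernel hF hs, oscillatory,
    ← mul_add]
  congr 1
  simp only [sub_mul, one_mul]
  rw [integral_sub h1 h2]
  ring

end Pairing

/-! ### Charts, cutoffs and partitions of unity -/

section Charts

variable {E : Type*} [NormedAddCommGroup E] [NormedSpace ℝ E]
variable {M : Type*} [TopologicalSpace M] [ChartedSpace E M]
variable {p n : ℕ} {e : OpenPartialHomeomorph M (Coord p n)}
variable {F : Type*} [NormedAddCommGroup F] [NormedSpace ℝ F]

theorem IsSmoothChart.contDiffOn_comp_symm (he : IsSmoothChart E e) {f : M → F} {U : Set M}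
    (hf : ContMDiffOn 𝓘(ℝ, E) 𝓘(ℝ, F) ∞ f U) :
    ContDiffOn ℝ ∞ (f ∘ e.symm) (e.target ∩ e.symm ⁻¹' U) :=
  (hf.comp' he.2).contDiffOn

theorem IsSmoothChart.contDiffOn_comp_symm' (he : IsSmoothChart E e) {f : M → F}
    (hf : ContMDiff 𝓘(ℝ, E) 𝓘(ℝ, F) ∞ f) : ContDiffOn ℝ ∞ (f ∘ e.symm) e.target :=
  (hf.comp_contMDiffOn he.2).contDiffOn

theorem IsSmoothChart.contMDiffOn_comp (he : IsSmoothChart E e) {g : Coord p n → F}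
    (hg : ContDiffOn ℝ ∞ g e.target) : ContMDiffOn 𝓘(ℝ, E) 𝓘(ℝ, F) ∞ (g ∘ e) e.source :=
  hg.contMDiffOn.comp he.1 fun _ hx => e.map_source hx

/-- A function which is smooth on an open set and zero off a closed subset of it is smooth. -/
theorem contMDiff_of_eq_zero_off {f : M → F} {U K : Set M} (hU : IsOpen U) (hK : IsClosed K)
    (hKU : K ⊆ U) (hf : ContMDiffOn 𝓘(ℝ, E) 𝓘(ℝ, F) ∞ f U) (h0 : ∀ x ∉ K, f x = 0) :
    ContMDiff 𝓘(ℝ, E) 𝓘(ℝ, F) ∞ f := by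
  intro x
  by_cases hx : x ∈ U
  · exact hf.contMDiffAt (hU.mem_nhds hx)
  · refine (contMDiffAt_const (c := (0 : F))).congr_of_eventuallyEq ?_
    filter_upwards [hK.isOpen_compl.mem_nhds fun h => hx (hKU h)] with y hy using h0 y hy

theorem contDiff_of_eq_zero_off {X : Type*} [NormedAddCommGroup X] [NormedSpace ℝ X] {f : X → F}
    {U K : Set X} (hU : IsOpen U) (hK : IsClosed K) (hKU : K ⊆ U) (hf : ContDiffOn ℝ ∞ f U)
    (h0 : ∀ x ∉ K, f x = 0) : ContDiff ℝ ∞ f :=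
  contMDiff_iff_contDiff.1 (contMDiff_of_eq_zero_off hU hK hKU hf.contMDiffOn h0)

/-- A function supported in a compact part of a chart domain, read in the chart. -/
theorem IsSmoothChart.contDiff_indicator (he : IsSmoothChart E e) {f : M → F} {K : Set M}
    (hf : ContMDiffOn 𝓘(ℝ, E) 𝓘(ℝ, F) ∞ f e.source) (hK : IsCompact K) (hKe : K ⊆ e.source)
    (h0 : ∀ x ∉ K, f x = 0) :
    ContDiff ℝ ∞ (e.target.indicator (f ∘ e.symm)) ∧ IsCompact (e '' K) ∧ e '' K ⊆ e.target ∧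
      ∀ y ∉ e '' K, e.target.indicator (f ∘ e.symm) y = 0 := by
  have hc : IsCompact (e '' K) := hK.image_of_continuousOn (e.continuousOn.mono hKe)
  have hs : e '' K ⊆ e.target := by
    rintro _ ⟨x, hx, rfl⟩
    exact e.map_source (hKe hx)
  have hz : ∀ y ∉ e '' K, e.target.indicator (f ∘ e.symm) y = 0 := by
    intro y hy
    by_cases hyt : y ∈ e.target
    · rw [indicator_of_mem hyt]
      exact h0 _ fun h => hy ⟨_, h, e.right_inv hyt⟩
    · exact indicator_of_notMem hyt _
  refine ⟨contDiff_of_eq_zero_off e.open_target hc.isClosed hs ?_ hz, hc, hs, hz⟩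
  refine ((he.contDiffOn_comp_symm hf).mono fun y hy => ⟨hy, e.map_target hy⟩).congr ?_
  exact fun y hy => indicator_of_mem hy _

/-- A function supported in a compact part of the image of a chart, transported to the manifold. -/
theorem IsSmoothChart.contMDiff_indicator [T2Space M] (he : IsSmoothChart E e)
    {g : Coord p n → F} {Z : Set (Coord p n)} (hg : ContDiffOn ℝ ∞ g e.target) (hZ : IsCompact Z)
    (hZe : Z ⊆ e.target) (h0 : ∀ y ∈ e.target, y ∉ Z → g y = 0) :
    ContMDiff 𝓘(ℝ, E) 𝓘(ℝ, F) ∞ (e.source.indicator (g ∘ e)) := by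
  have hc : IsCompact (e.symm '' Z) := hZ.image_of_continuousOn (e.continuousOn_symm.mono hZe)
  refine contMDiff_of_eq_zero_off e.open_source hc.isClosed ?_
    ((he.contMDiffOn_comp hg).congr fun x hx => indicator_of_mem hx _) fun x hx => ?_
  · rintro _ ⟨y, hy, rfl⟩
    exact e.map_target (hZe hy)
  · by_cases hxe : x ∈ e.source
    · rw [indicator_of_mem hxe]
      exact h0 _ (e.map_source hxe) fun h => hx ⟨_, h, e.left_inv hxe⟩
    · exact indicator_of_notMem hxe _

theorem IsSmoothChart.restrOpen (he : IsSmoothChart E e) {W : Set M} (hW : IsOpen W) :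
    IsSmoothChart E (e.restrOpen W hW) := by
  refine ⟨he.1.mono ?_, he.2.mono ?_⟩
  · rw [e.restrOpen_source]
    exact inter_subset_left
  · intro y hy
    exact hy.1

theorem IsAdaptedChart.restrOpen {V : Set M} (he : IsAdaptedChart E V e) {W : Set M}
    (hW : IsOpen W) : IsAdaptedChart E V (e.restrOpen W hW) := by
  refine ⟨he.1.restrOpen hW, fun x hx => he.2 x ?_⟩
  rw [e.restrOpen_source] at hx
  exact hx.1

variable [FiniteDimensional ℝ E] [IsManifold 𝓘(ℝ, E) ∞ M]

theorem exists_isSmoothChart (hdim : Module.finrank ℝ E = p + n) (x : M) :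
    ∃ e : OpenPartialHomeomorph M (Coord p n), IsSmoothChart E e ∧ x ∈ e.source := by
  have h : Module.finrank ℝ E = Module.finrank ℝ (Coord p n) := by
    rw [Module.finrank_prod, finrank_euclideanSpace_fin, finrank_euclideanSpace_fin, hdim]
  let L : E ≃L[ℝ] Coord p n := ContinuousLinearEquiv.ofFinrankEq h
  refine ⟨(chartAt E x).transHomeomorph L.toHomeomorph, ⟨?_, ?_⟩, mem_chart_source E x⟩
  · exact L.contDiff.contMDiff.comp_contMDiffOn contMDiffOn_chart
  · exact (contMDiffOn_chart_symm (I := 𝓘(ℝ, E)) (x := x)).comp L.symm.contDiff.contMDiff.contMDiffOn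
      fun y hy => hy

variable (E) in
/-- Compactly supported smooth cut-off functions. -/
theorem exists_cutoff [T2Space M] [SecondCountableTopology M] {K W : Set M} (hK : IsCompact K)
    (hW : IsOpen W) (hKW : K ⊆ W) : ∃ (θ : M → ℂ) (Z U : Set M), ContMDiff 𝓘(ℝ, E) 𝓘(ℝ, ℂ) ∞ θ ∧
      IsCompact Z ∧ Z ⊆ W ∧ (∀ x ∉ Z, θ x = 0) ∧ IsOpen U ∧ K ⊆ U ∧ U ⊆ Z ∧ ∀ x ∈ U, θ x = 1 := by
  have : LocallyCompactSpace M := Manifold.locallyCompact_of_finiteDimensional 𝓘(ℝ, E)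
  obtain ⟨Z, hZ, hKZ, hZW⟩ := exists_compact_between hK hW hKW
  obtain ⟨f, hf1, hf0, -⟩ := exists_contMDiffMap_one_nhds_of_subset_interior (n := ⊤) 𝓘(ℝ, E)
    hK.isClosed hKZ
  obtain ⟨U, hU, hKU, hU1⟩ := mem_nhdsSet_iff_exists.1 hf1
  refine ⟨fun x => (f x : ℂ), Z, U ∩ interior Z,
    Complex.ofRealCLM.contDiff.contMDiff.comp f.contMDiff, hZ, hZW, ?_,
    hU.inter isOpen_interior, subset_inter hKU hKZ,
    fun x hx => interior_subset hx.2, ?_⟩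
  · intro x hx
    simp [hf0 x hx]
  · intro x hx
    have h : f x = 1 := hU1 hx.1
    simp [h]

variable (E) in
/-- Finite smooth partitions of unity near a compact set, with compact supports. -/
theorem exists_finite_partition [T2Space M] [SecondCountableTopology M] {K : Set M}
    (hK : IsCompact K) (U : M → Set M) (hU : ∀ x, IsOpen (U x)) (hxU : ∀ x, x ∈ U x) :
    ∃ (s : Finset M) (θ : M → M → ℂ) (Z : M → Set M) (W : Set M),
      (∀ i, ContMDiff 𝓘(ℝ, E) 𝓘(ℝ, ℂ) ∞ (θ i)) ∧ (∀ i, IsCompact (Z i)) ∧ (∀ i, Z i ⊆ U i) ∧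
      (∀ i, ∀ x ∉ Z i, θ i x = 0) ∧ IsOpen W ∧ K ⊆ W ∧ ∀ x ∈ W, ∑ i ∈ s, θ i x = 1 := by
  have : LocallyCompactSpace M := Manifold.locallyCompact_of_finiteDimensional 𝓘(ℝ, E)
  obtain ⟨K', hK', hKK'⟩ := exists_compact_superset hK
  choose Z hZ hxZ hZU using fun x => exists_compact_subset (hU x) (hxU x)
  obtain ⟨f, hf⟩ := SmoothPartitionOfUnity.exists_isSubordinate 𝓘(ℝ, E) hK'.isClosed
    (fun x => interior (Z x)) (fun x => isOpen_interior)
    fun x _ => mem_iUnion.2 ⟨x, hxZ x⟩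
  have hfin := f.locallyFinite.finite_nonempty_inter_compact hK'
  refine ⟨hfin.toFinset, fun i x => (f i x : ℂ), Z, interior K',
    fun i => Complex.ofRealCLM.contDiff.contMDiff.comp (f i).contMDiff, hZ, hZU, ?_,
    isOpen_interior, hKK', ?_⟩
  · intro i x hx
    have : x ∉ tsupport (f i) := fun h => hx (interior_subset (hf i h))
    simp [image_eq_zero_of_notMem_tsupport this]
  · intro x hx
    have hx' := interior_subset hx
    have h1 := f.sum_eq_one hx'
    rw [finsum_eq_sum_of_support_subset (s := hfin.toFinset)] at h1
    · change ∑ i ∈ hfin.toFinset, (f i x : ℂ) = 1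
      exact_mod_cast h1
    · intro i hi
      rw [Finite.coe_toFinset]
      exact ⟨x, hi, hx'⟩

end Charts

/-! ### Smooth measures and pairings -/

/-- A flat function has a convergent Mellin integral at every exponent. -/
theorem integrableOn_mul_cpow_of_flat {h : ℝ → ℂ} (hh : ContDiff ℝ ∞ h)
    (h0 : ∀ j : ℕ, iteratedDeriv j h 0 = 0) {T : ℝ} (hT : ∀ t, T < t → h t = 0) (m : ℂ) :
    IntegrableOn (fun t : ℝ => h t * (t : ℂ) ^ (-1 - m)) (Ioi 0) := by
  obtain ⟨N, hN⟩ := exists_nat_ge (1 + m.re)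
  set T' := max T 1 with hT'
  have hT'0 : 0 < T' := lt_of_lt_of_le one_pos (le_max_right _ _)
  obtain ⟨C, hC⟩ := exists_norm_le_pow_of_flat hh h0 hT'0 N
  have hcont : ContinuousOn (fun t : ℝ => h t * (t : ℂ) ^ (-1 - m)) (Ioi 0) := by
    refine hh.continuous.continuousOn.mul fun t ht => ContinuousAt.continuousWithinAt ?_
    exact Complex.continuousAt_ofReal_cpow_const _ _ (Or.inr (ne_of_gt ht))
  rw [← Ioc_union_Ioi_eq_Ioi hT'0.le]
  refine IntegrableOn.union ?_ ?_
  · refine IntegrableOn.of_bound (C := C * T' ^ ((N : ℝ) - 1 - m.re)) (by simp)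
      ((hcont.mono Ioc_subset_Ioi_self).aestronglyMeasurable measurableSet_Ioc) ?_
    filter_upwards [ae_restrict_mem measurableSet_Ioc] with t ht
    have hb := hC t ⟨ht.1.le, ht.2⟩
    have hC0 : 0 ≤ C := by
      have := (norm_nonneg _).trans hb
      exact nonneg_of_mul_nonneg_left this (pow_pos ht.1 N)
    rw [norm_mul, LocalKernel.norm_cpow_neg_one_sub ht.1]
    calc ‖h t‖ * t ^ (-1 - m.re) ≤ C * t ^ N * t ^ (-1 - m.re) := by
          gcongr
          exact Real.rpow_nonneg ht.1.le _
      _ = C * t ^ ((N : ℝ) - 1 - m.re) := by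
          rw [mul_assoc, ← Real.rpow_natCast, ← Real.rpow_add ht.1]
          ring_nf
      _ ≤ _ := mul_le_mul_of_nonneg_left
          (Real.rpow_le_rpow ht.1.le ht.2 (by linarith)) hC0
  · refine integrableOn_zero.congr_fun (fun t ht => ?_) measurableSet_Ioi
    simp [hT t (lt_of_le_of_lt (le_max_left _ _) ht)]

section Measure

variable {E : Type*} [NormedAddCommGroup E] [NormedSpace ℝ E]
variable {M : Type*} [TopologicalSpace M] [ChartedSpace E M]
variable {p n : ℕ} {e : OpenPartialHomeomorph M (Coord p n)} {V : Set M}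
variable [MeasurableSpace M] [BorelSpace M] {μ : Measure M}

/-- Integrals of functions living in a chart domain are Lebesgue integrals with a smooth positive
weight. -/
theorem IsSmoothMeasure.exists_density (hμ : IsSmoothMeasure E p n μ) (he : IsSmoothChart E e) :
    ∃ ρ : Coord p n → ℝ, ContDiffOn ℝ ∞ ρ e.target ∧ (∀ y ∈ e.target, 0 < ρ y) ∧
      ∀ f : M → ℂ, ContinuousOn f e.source → (∀ x ∉ e.source, f x = 0) →
        ∫ x, f x ∂μ = ∫ y in e.target, (ρ y : ℂ) * f (e.symm y) := by
  obtain ⟨ρ, hρ, hpos, hmap⟩ := hμ e he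
  refine ⟨ρ, hρ, hpos, fun f hf h0 => ?_⟩
  have hae : AEMeasurable e (μ.restrict e.source) :=
    e.continuousOn.aemeasurable e.open_source.measurableSet
  have hmeas : AEMeasurable (fun y => ENNReal.ofReal (ρ y)) (volume.restrict e.target) :=
    (hρ.continuousOn.aemeasurable e.open_target.measurableSet).ennreal_ofReal
  have hg : AEStronglyMeasurable (f ∘ e.symm) ((μ.restrict e.source).map e) := by
    rw [hmap]
    refine AEStronglyMeasurable.mono_ac (withDensity_absolutelyContinuous _ _) ?_
    exact (hf.comp e.continuousOn_symm fun y hy => e.map_target hy).aestronglyMeasurable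
      e.open_target.measurableSet
  have h1 : ∫ x, f x ∂μ = ∫ x in e.source, f x ∂μ :=
    (setIntegral_eq_integral_of_forall_compl_eq_zero h0).symm
  have h2 : ∫ x in e.source, f x ∂μ = ∫ x in e.source, (f ∘ e.symm) (e x) ∂μ :=
    setIntegral_congr_fun e.open_source.measurableSet fun x hx => by simp [e.left_inv hx]
  rw [h1, h2, ← integral_map hae hg, hmap, integral_withDensity_eq_integral_toReal_smul₀ hmeas
    (Eventually.of_forall fun _ => ENNReal.ofReal_lt_top)]
  refine setIntegral_congr_fun e.open_target.measurableSet fun y hy => ?_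
  simp [ENNReal.toReal_ofReal (hpos y hy).le]

theorem IsSmoothMeasure.isLocallyFiniteMeasure [FiniteDimensional ℝ E] [IsManifold 𝓘(ℝ, E) ∞ M]
    (hdim : Module.finrank ℝ E = p + n) (hμ : IsSmoothMeasure E p n μ) :
    IsLocallyFiniteMeasure μ := by
  refine ⟨fun x => ?_⟩
  obtain ⟨e, he, hx⟩ := exists_isSmoothChart (p := p) (n := n) hdim x
  obtain ⟨ρ, hρ, -, hmap⟩ := hμ e he
  obtain ⟨Z, hZ, hxZ, hZe⟩ := exists_compact_subset e.open_target (e.map_source hx)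
  refine ⟨e.source ∩ e ⁻¹' interior Z,
    (e.isOpen_inter_preimage isOpen_interior).mem_nhds ⟨hx, hxZ⟩, ?_⟩
  have hae : AEMeasurable e (μ.restrict e.source) :=
    e.continuousOn.aemeasurable e.open_source.measurableSet
  have h1 : (μ.restrict e.source).map e (interior Z) = μ (e.source ∩ e ⁻¹' interior Z) := by
    rw [Measure.map_apply_of_aemeasurable hae isOpen_interior.measurableSet, inter_comm,
      Measure.restrict_apply₀ (hae.nullMeasurable isOpen_interior.measurableSet)]
  rw [← h1, hmap, withDensity_apply _ isOpen_interior.measurableSet]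
  have hint : IntegrableOn ρ Z := (hρ.continuousOn.mono hZe).integrableOn_compact hZ
  refine lt_of_le_of_lt ?_ (Integrable.lintegral_lt_top hint)
  exact lintegral_mono' (Measure.restrict_mono' (LE.le.eventuallyLE interior_subset)
    Measure.restrict_le_self) le_rfl

omit [MeasurableSpace M] [BorelSpace M] in
theorem contMDiff_schwartzDNC {k : M → ℝ → ℂ} (hk : k ∈ schwartzDNC E p n V) {t : ℝ} (ht : 0 < t) :
    ContMDiff 𝓘(ℝ, E) 𝓘(ℝ, ℂ) ∞ fun x => k x t := by
  have h : ContMDiff 𝓘(ℝ, E) (𝓘(ℝ, E).prod 𝓘(ℝ, ℝ)) ∞ fun x : M => (x, t) :=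
    contMDiff_id.prodMk contMDiff_const
  exact contMDiffOn_univ.1 (hk.2.1.comp h.contMDiffOn fun x _ hx => ht.ne' hx.2)

omit [MeasurableSpace M] [BorelSpace M] in
theorem hasCompactSupport_schwartzDNC [T2Space M] {k : M → ℝ → ℂ}
    (hk : k ∈ schwartzDNC E p n V) (t : ℝ) : HasCompactSupport fun x => k x t := by
  obtain ⟨K, T, hK, hKT⟩ := hk.2.2.2
  exact HasCompactSupport.intro hK fun x hx => by
    by_contra h
    exact hx (hKT x t h).1

theorem integrable_schwartzDNC_mul [T2Space M] [IsFiniteMeasureOnCompacts μ] {k : M → ℝ → ℂ}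
    (hk : k ∈ schwartzDNC E p n V) {t : ℝ} (ht : 0 < t) {f : M → ℂ} (hf : Continuous f) :
    Integrable (fun x => k x t * f x) μ :=
  ((contMDiff_schwartzDNC hk ht).continuous.mul hf).integrable_of_hasCompactSupport
    (hasCompactSupport_schwartzDNC hk t).mul_right

omit [BorelSpace M] in
theorem integrableOn_pairing {k : M → ℝ → ℂ} (hk : k ∈ flatSchwartz E p n μ V)
    (f : SmoothFun E M) (m : ℂ) :
    IntegrableOn (fun t : ℝ => pairing n μ k t f.1 * (t : ℂ) ^ (-1 - m)) (Ioi 0) := by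
  obtain ⟨h, hh, hpair, h0⟩ := hk.2 f
  obtain ⟨K, T, hK, hKT⟩ := hk.1.2.2.2
  refine (integrableOn_mul_cpow_of_flat hh h0 (T := max T 0) (fun t ht => ?_) m).congr_fun
    (fun t ht => by simp only [hpair t ht]) measurableSet_Ioi
  rw [hpair t (lt_of_le_of_lt (le_max_right _ _) ht), pairing]
  have : ∀ x, k x t = 0 := fun x => by
    by_contra hne
    exact absurd (hKT x t hne).2 (not_le.2 (lt_of_le_of_lt (le_max_left _ _) ht))
  simp [this]

theorem pairing_add [T2Space M] [IsFiniteMeasureOnCompacts μ] {k k' : M → ℝ → ℂ}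
    (hk : k ∈ schwartzDNC E p n V) (hk' : k' ∈ schwartzDNC E p n V) {t : ℝ} (ht : 0 < t)
    (f : SmoothFun E M) :
    pairing n μ (k + k') t f.1 = pairing n μ k t f.1 + pairing n μ k' t f.1 := by
  have hf : Continuous f.1 := ContMDiff.continuous f.2
  simp only [pairing, Pi.add_apply, add_mul]
  rw [integral_add (integrable_schwartzDNC_mul hk ht hf) (integrable_schwartzDNC_mul hk' ht hf),
    mul_add]

omit [MeasurableSpace M] [BorelSpace M] in
theorem add_mem_schwartzDNC {k k' : M → ℝ → ℂ} (hk : k ∈ schwartzDNC E p n V)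
    (hk' : k' ∈ schwartzDNC E p n V) : k + k' ∈ schwartzDNC E p n V := by
  refine ⟨fun x t ht => by simp [hk.1 x t ht, hk'.1 x t ht], hk.2.1.add hk'.2.1,
    fun e he => ?_, ?_⟩
  · obtain ⟨G, hG, hGk⟩ := hk.2.2.1 e he
    obtain ⟨G', hG', hGk'⟩ := hk'.2.2.1 e he
    refine ⟨G + G', hG.add hG', fun u ξ τ s h0 hs ht => ?_⟩
    simp [hGk u ξ τ s h0 hs ht, hGk' u ξ τ s h0 hs ht]
  · obtain ⟨K, T, hK, hKT⟩ := hk.2.2.2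
    obtain ⟨K', T', hK', hKT'⟩ := hk'.2.2.2
    refine ⟨K ∪ K', max T T', hK.union hK', fun x t hne => ?_⟩
    by_cases h : k x t = 0
    · have h' : k' x t ≠ 0 := fun h' => hne (by simp [h, h'])
      exact ⟨Or.inr (hKT' x t h').1, (hKT' x t h').2.trans (le_max_right _ _)⟩
    · exact ⟨Or.inl (hKT x t h).1, (hKT x t h).2.trans (le_max_left _ _)⟩

theorem add_mem_flatSchwartz [T2Space M] [IsFiniteMeasureOnCompacts μ] {k k' : M → ℝ → ℂ}
    (hk : k ∈ flatSchwartz E p n μ V) (hk' : k' ∈ flatSchwartz E p n μ V) :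
    k + k' ∈ flatSchwartz E p n μ V := by
  refine ⟨add_mem_schwartzDNC hk.1 hk'.1, fun f => ?_⟩
  obtain ⟨h, hh, hp, h0⟩ := hk.2 f
  obtain ⟨h', hh', hp', h0'⟩ := hk'.2 f
  refine ⟨h + h', hh.add hh', fun t ht => ?_, fun j => ?_⟩
  · rw [pairing_add hk.1 hk'.1 ht, ← hp t ht, ← hp' t ht, Pi.add_apply]
  · rw [iteratedDeriv_add (hh.contDiffAt.of_le (by exact_mod_cast le_top))
      (hh'.contDiffAt.of_le (by exact_mod_cast le_top)), h0, h0', add_zero]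

variable (E p n μ V) in
/-- The form `Φ` on smooth functions is `f ↦ ∫ ⟨k_t | f⟩ t ^ (-1 - m) dt` for some `k` in
`𝓙(M, V)`. -/
def IsMellinForm (m : ℂ) (Φ : SmoothFun E M → ℂ) : Prop :=
  ∃ k ∈ flatSchwartz E p n μ V, ∀ f : SmoothFun E M,
    Φ f = ∫ t in Ioi (0 : ℝ), pairing n μ k t f.1 * (t : ℂ) ^ (-1 - m)

omit [BorelSpace M] in
theorem isMellinForm_zero (m : ℂ) : IsMellinForm E p n V μ m fun _ => 0 := by
  refine ⟨0, ⟨⟨fun _ _ _ => rfl, contMDiffOn_const, fun e _ => ⟨0, contDiffOn_const,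
    fun _ _ _ _ _ _ _ => rfl⟩, ∅, 0, isCompact_empty, fun x t h => absurd rfl h⟩,
    fun f => ⟨0, contDiff_const, fun t _ => by simp [pairing], fun j => ?_⟩⟩,
    fun f => by simp [pairing]⟩
  rw [show (0 : ℝ → ℂ) = fun _ => 0 from rfl, iteratedDeriv_const]
  simp

theorem IsMellinForm.add [T2Space M] [IsFiniteMeasureOnCompacts μ] {m : ℂ}
    {Φ Φ' : SmoothFun E M → ℂ} (hΦ : IsMellinForm E p n V μ m Φ)
    (hΦ' : IsMellinForm E p n V μ m Φ') : IsMellinForm E p n V μ m fun f => Φ f + Φ' f := by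
  obtain ⟨k, hk, hkΦ⟩ := hΦ
  obtain ⟨k', hk', hkΦ'⟩ := hΦ'
  refine ⟨k + k', add_mem_flatSchwartz hk hk', fun f => ?_⟩
  change Φ f + Φ' f = _
  rw [hkΦ, hkΦ', ← integral_add (integrableOn_pairing hk f m) (integrableOn_pairing hk' f m)]
  refine setIntegral_congr_fun measurableSet_Ioi fun t ht => ?_
  simp only [pairing_add hk.1 hk'.1 ht, add_mul]

theorem isMellinForm_sum [T2Space M] [IsFiniteMeasureOnCompacts μ] {m : ℂ} {ι : Type*}
    (s : Finset ι) {Φ : ι → SmoothFun E M → ℂ} (h : ∀ i ∈ s, IsMellinForm E p n V μ m (Φ i)) :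
    IsMellinForm E p n V μ m fun f => ∑ i ∈ s, Φ i f := by
  classical
  induction s using Finset.induction_on with
  | empty => simpa using isMellinForm_zero m
  | insert i s his ih =>
    simp only [Finset.sum_insert his]
    exact (h i (Finset.mem_insert_self i s)).add
      (ih fun j hj => h j (Finset.mem_insert_of_mem hj))

end Measure

/-! ### Mellin forms are conormal: local structure -/

section Forward

variable {E : Type*} [NormedAddCommGroup E] [NormedSpace ℝ E]
variable {M : Type*} [TopologicalSpace M] [ChartedSpace E M]
variable {p n : ℕ} {e : OpenPartialHomeomorph M (Coord p n)} {V : Set M}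

/-- Near a point of `V`, the product of a Schwartz function with a cutoff and with the density of
`μ` is a compactly supported kernel on the model. -/
theorem exists_localKernel [T2Space M] [MeasurableSpace M] [BorelSpace M] {μ : Measure M}
    (hμ : IsSmoothMeasure E p n μ) {k : M → ℝ → ℂ} (hk : k ∈ schwartzDNC E p n V)
    (he : IsAdaptedChart E V e) {θ : M → ℂ} (hθ : ContMDiff 𝓘(ℝ, E) 𝓘(ℝ, ℂ) ∞ θ) {Z : Set M}
    (hZ : IsCompact Z) (hZe : Z ⊆ e.source) (h0 : ∀ x ∉ Z, θ x = 0) :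
    ∃ κ : LocalKernel p n, ∀ t, 0 < t → ∀ (f : M → ℂ) (F : Coord p n → ℂ), Continuous f →
      (∀ x ∉ e.source, f x = 0) → (∀ y ∈ e.target, f (e.symm y) = θ (e.symm y) * F y) →
      ∫ x, k x t * f x ∂μ = ∫ q, κ.k q t * F q := by
  obtain ⟨ρ, hρ, -, hint⟩ := hμ.exists_density he.1
  obtain ⟨hA1, hZ', hZ't, hA0⟩ := he.1.contDiff_indicator hθ.contMDiffOn hZ hZe h0
  set Z' := e '' Z
  set A : Coord p n → ℂ := fun q => (ρ q : ℂ) * e.target.indicator (θ ∘ e.symm) q with hAdef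
  have hA0' : ∀ q ∉ Z', A q = 0 := fun q hq => by simp only [hAdef, hA0 q hq, mul_zero]
  have hA : ContDiff ℝ ∞ A := by
    refine contDiff_of_eq_zero_off e.open_target hZ'.isClosed hZ't ?_ hA0'
    exact (Complex.ofRealCLM.contDiff.comp_contDiffOn hρ).mul hA1.contDiffOn
  obtain ⟨G, hG, hGk⟩ := hk.2.2.1 e he
  obtain ⟨K, T, -, hKT⟩ := hk.2.2.2
  obtain ⟨R, hR⟩ := hZ'.isBounded.exists_norm_le
  have hc : Continuous fun w : EuclideanSpace ℝ (Fin p) × EuclideanSpace ℝ (Fin n) × ℝ × ℝ =>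
      ((w.1, w.2.2.2 • w.2.1) : Coord p n) := by fun_prop
  have hcs : ContDiff ℝ ∞ fun w : EuclideanSpace ℝ (Fin p) × EuclideanSpace ℝ (Fin n) × ℝ × ℝ =>
      ((w.1, w.2.2.2 • w.2.1) : Coord p n) := by fun_prop
  refine ⟨{ k := fun q t => A q * k (e.symm q) t
            G := fun w => A (w.1, w.2.2.2 • w.2.1) * G w
            R := max (max R T) 0
            R_nonneg := le_max_right _ _
            eq_zero := fun q t ht => (congrArg (A q * ·) (hk.1 (e.symm q) t ht)).trans (mul_zero _)
            bounded := fun q t hne => ?_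
            contDiffOn := fun w hw => ?_
            lift_eq := fun u ξ τ s h0 hs => ?_ }, fun t ht f F hf hfe hfF => ?_⟩
  · constructor
    · refine (hR q ?_).trans ((le_max_left _ _).trans (le_max_left _ _))
      by_contra hq
      exact hne (by simp only [hA0' q hq, zero_mul])
    · exact (hKT _ t fun h => hne ((congrArg (A q * ·) h).trans (mul_zero _))).2.trans
        ((le_max_right _ _).trans (le_max_left _ _))
  · by_cases hwt : (w.1, w.2.2.2 • w.2.1) ∈ e.target
    · refine (hA.comp hcs).contDiffAt.contDiffWithinAt.mul
        ((hG w ⟨hw.1, hw.2, hwt⟩).mono_of_mem_nhdsWithin ?_)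
      filter_upwards [self_mem_nhdsWithin,
        mem_nhdsWithin_of_mem_nhds (hc.continuousAt.preimage_mem_nhds
          (e.open_target.mem_nhds hwt))] with v hv hv' using ⟨hv.1, hv.2, hv'⟩
    · refine ContDiffWithinAt.congr_of_eventuallyEq_of_mem (f := fun _ => (0 : ℂ))
        contDiffWithinAt_const ?_ hw
      filter_upwards [mem_nhdsWithin_of_mem_nhds (hc.continuousAt.preimage_mem_nhds
        (hZ'.isClosed.isOpen_compl.mem_nhds fun h => hwt (hZ't h)))] with v hv
      rw [hA0' _ hv, zero_mul]
  · by_cases hwt : (u, s • ξ) ∈ e.target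
    · simp only [hGk u ξ τ s h0 hs hwt]
    · have : A (u, s • ξ) = 0 := hA0' _ fun h => hwt (hZ't h)
      simp only [this, zero_mul]
  · rw [hint (fun x => k x t * f x)
      ((contMDiff_schwartzDNC hk ht).continuous.mul hf).continuousOn
      fun x hx => by rw [hfe x hx, mul_zero]]
    have hout : ∀ q ∉ e.target, A q * k (e.symm q) t * F q = 0 := fun q hq => by
      rw [hA0' q fun h => hq (hZ't h), zero_mul, zero_mul]
    refine Eq.trans ?_ (setIntegral_eq_integral_of_forall_compl_eq_zero hout)
    refine setIntegral_congr_fun e.open_target.measurableSet fun y hy => ?_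
    simp only [hAdef, indicator_of_mem hy, hfF y hy, Function.comp_apply]
    ring

variable [FiniteDimensional ℝ E] [IsManifold 𝓘(ℝ, E) ∞ M] [T2Space M] [SecondCountableTopology M]
variable [MeasurableSpace M] [BorelSpace M] {μ : Measure M}

/-- Near a point of `V`, the Mellin form of an element of `𝓙(M, V)` is an oscillatory integral. -/
theorem exists_symbol_of_mem_flatSchwartz (hμ : IsSmoothMeasure E p n μ)
    (hV : IsClosedSubmanifold E p n V) {k : M → ℝ → ℂ} (hk : k ∈ flatSchwartz E p n μ V) (m : ℂ)
    {x₀ : M} (hx₀ : x₀ ∈ V) :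
    ∃ e : OpenPartialHomeomorph M (Coord p n), IsAdaptedChart E V e ∧ x₀ ∈ e.source ∧
      ∃ a : Coord p n → ℂ, IsClassicalSymbol m a ∧
        ∀ f : SmoothFun E M, HasCompactSupport f.1 → tsupport f.1 ⊆ e.source →
          ∫ t in Ioi (0 : ℝ), pairing n μ k t f.1 * (t : ℂ) ^ (-1 - m) =
            oscillatory a (e.target.indicator (f.1 ∘ e.symm)) := by
  obtain ⟨e, he, hxe⟩ := hV.2 x₀ hx₀
  obtain ⟨θ, Z, U, hθ, hZ, hZe, hθ0, hU, hxU, -, hθ1⟩ := exists_cutoff E (isCompact_singleton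
    (x := x₀)) e.open_source (singleton_subset_iff.2 hxe)
  -- `k` is localised by a cut-off `θ`, equal to `1` on `U`; the chart is then restricted to `U`
  obtain ⟨κ, hκ⟩ := exists_localKernel hμ hk.1 he hθ hZ hZe hθ0
  have hflat : κ.IsFlat := by
    intro F hF
    obtain ⟨hA1, hZ', hZ't, hA0⟩ := he.1.contDiff_indicator hθ.contMDiffOn hZ hZe hθ0
    have hf := he.1.contMDiff_indicator (hA1.mul hF).contDiffOn hZ' hZ't
      fun y _ hy => by simp only [hA0 y hy, zero_mul]
    obtain ⟨h, hh, hpair, h0⟩ := hk.2 ⟨_, hf⟩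
    refine ⟨h, hh, fun t ht => ?_, h0⟩
    rw [hpair t ht, pairing]
    congr 1
    refine hκ t ht _ _ hf.continuous (fun x hx => indicator_of_notMem hx _) fun y hy => ?_
    change e.source.indicator _ _ = _
    rw [indicator_of_mem (e.map_target hy)]
    simp only [Function.comp_apply, e.right_inv hy, indicator_of_mem hy]
  obtain ⟨a, ha, hint⟩ := hflat.exists_symbol m
  have he' := he.restrOpen hU
  refine ⟨e.restrOpen U hU, he', ?_, a, ha, fun f hf hfe => ?_⟩
  · rw [e.restrOpen_source]
    exact ⟨hxe, hxU rfl⟩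
  · have hf0 : ∀ x ∉ tsupport f.1, f.1 x = 0 := fun x hx => image_eq_zero_of_notMem_tsupport hx
    obtain ⟨hF, hc, -, hF0⟩ := he'.1.contDiff_indicator (ContMDiff.contMDiffOn f.2) hf hfe hf0
    rw [← hint _ hF (HasCompactSupport.intro hc hF0)]
    refine setIntegral_congr_fun measurableSet_Ioi fun t ht => ?_
    simp only [pairing]
    congr 2
    have hs : ∀ x, f.1 x ≠ 0 → x ∈ e.source ∩ U := fun x hx => by
      have := hfe (subset_tsupport _ hx)
      rwa [e.restrOpen_source] at this
    refine hκ t ht _ _ (ContMDiff.continuous f.2) (fun x hx => ?_) fun y hy => ?_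
    · by_contra h
      exact hx (hs x h).1
    · by_cases hyU : e.symm y ∈ U
      · have hy' : y ∈ (e.restrOpen U hU).target := ⟨hy, hyU⟩
        rw [hθ1 _ hyU, one_mul, indicator_of_mem hy']
        rfl
      · have hy' : y ∉ (e.restrOpen U hU).target := fun h => hyU h.2
        rw [indicator_of_notMem hy', mul_zero]
        by_contra h
        exact hyU (hs _ h).2

omit [FiniteDimensional ℝ E] [IsManifold 𝓘(ℝ, E) ∞ M] [T2Space M] [SecondCountableTopology M]
  [MeasurableSpace M] [BorelSpace M] in
/-- Off `V`, a Schwartz function is divisible by any power of `t`. -/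
theorem exists_eq_pow_smul_of_mem_schwartzDNC (hV : IsClosed V) {k : M → ℝ → ℂ}
    (hk : k ∈ schwartzDNC E p n V) (he : IsSmoothChart E e) (J : ℕ) :
    IsOpen (e.target ∩ e.symm ⁻¹' Vᶜ) ∧ ∃ h : Coord p n × ℝ → ℂ,
      ContDiffOn ℝ ∞ h ((e.target ∩ e.symm ⁻¹' Vᶜ) ×ˢ univ) ∧
      ∀ q ∈ e.target ∩ e.symm ⁻¹' Vᶜ, ∀ t, k (e.symm q) t = t ^ J • h (q, t) := by
  have hU : IsOpen (e.target ∩ e.symm ⁻¹' Vᶜ) := e.isOpen_inter_preimage_symm hV.isOpen_compl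
  refine ⟨hU, ?_⟩
  have hs : ContMDiffOn 𝓘(ℝ, Coord p n × ℝ) (𝓘(ℝ, E).prod 𝓘(ℝ, ℝ)) ∞
      (fun w : Coord p n × ℝ => (e.symm w.1, w.2)) ((e.target ∩ e.symm ⁻¹' Vᶜ) ×ˢ univ) := by
    refine ContMDiffOn.prodMk ?_ contDiff_snd.contMDiff.contMDiffOn
    exact he.2.comp contDiff_fst.contMDiff.contMDiffOn fun w hw => hw.1.1
  have hf : ContDiffOn ℝ ∞ (fun w : Coord p n × ℝ => k (e.symm w.1) w.2)
      ((e.target ∩ e.symm ⁻¹' Vᶜ) ×ˢ univ) :=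
    (hk.2.1.comp hs fun w hw h => hw.1.2 h.1).contDiffOn
  obtain ⟨h, hh, -, heq⟩ := exists_contDiffOn_eq_pow_smul_of_neg hU hf
    (fun q _ s hs => hk.1 _ s hs.le) J
  exact ⟨h, hh, heq⟩

/-- Enough powers of `t` make the weight `t ^ (-n - 1 - m)` integrable at `0`. -/
theorem integrableOn_cpow_mul_pow {m : ℂ} {n J : ℕ} (hJ : n + 1 + m.re ≤ J) (T : ℝ) :
    IntegrableOn (fun t : ℝ => (t : ℂ)⁻¹ ^ n * (t : ℂ) ^ (-1 - m) * (t : ℂ) ^ J) (Icc 0 T) ∧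
    ∀ t ∈ Ioc 0 T, ‖(t : ℂ)⁻¹ ^ n * (t : ℂ) ^ (-1 - m) * (t : ℂ) ^ J‖ ≤
      T ^ ((J : ℝ) - n - 1 - m.re) := by
  have hb : ∀ t ∈ Ioc 0 T, ‖(t : ℂ)⁻¹ ^ n * (t : ℂ) ^ (-1 - m) * (t : ℂ) ^ J‖ ≤
      T ^ ((J : ℝ) - n - 1 - m.re) := by
    intro t ht
    rw [norm_mul, norm_mul, LocalKernel.norm_cpow_neg_one_sub ht.1, norm_pow, norm_pow, norm_inv,
      Complex.norm_real, Real.norm_of_nonneg ht.1.le, inv_pow, ← Real.rpow_natCast,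
      ← Real.rpow_natCast, ← Real.rpow_neg ht.1.le, ← Real.rpow_add ht.1, ← Real.rpow_add ht.1]
    calc t ^ (-(n : ℝ) + (-1 - m.re) + J) = t ^ ((J : ℝ) - n - 1 - m.re) := by ring_nf
      _ ≤ _ := Real.rpow_le_rpow ht.1.le ht.2 (by linarith)
  refine ⟨(integrableOn_Icc_iff_integrableOn_Ioc enorm_ne_top).2 ?_, hb⟩
  refine IntegrableOn.of_bound (C := T ^ ((J : ℝ) - n - 1 - m.re)) (by simp) ?_ ?_
  · refine ContinuousOn.aestronglyMeasurable (fun t ht => ContinuousAt.continuousWithinAt ?_)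
      measurableSet_Ioc
    have h1 : (t : ℂ) ≠ 0 := by exact_mod_cast ht.1.ne'
    have h2 : ContinuousAt (fun t : ℝ => (t : ℂ) ^ (-1 - m)) t :=
      Complex.continuousAt_ofReal_cpow_const _ _ (Or.inr ht.1.ne')
    exact (((Complex.continuous_ofReal.continuousAt.inv₀ h1).pow n).mul h2).mul (by fun_prop)
  · filter_upwards [ae_restrict_mem measurableSet_Ioc] with t ht using hb t ht

omit [T2Space M] [SecondCountableTopology M] [MeasurableSpace M] [BorelSpace M] in
/-- Off `V`, the density of the Mellin form is obtained by integration in `t`, and it is smooth. -/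
theorem contMDiffOn_integral_schwartzDNC (hdim : Module.finrank ℝ E = p + n) (hV : IsClosed V)
    {k : M → ℝ → ℂ} (hk : k ∈ schwartzDNC E p n V) (m : ℂ) :
    ContMDiffOn 𝓘(ℝ, E) 𝓘(ℝ, ℂ) ∞
      (fun x => ∫ t in Ioi (0 : ℝ), (t : ℂ)⁻¹ ^ n * (t : ℂ) ^ (-1 - m) * k x t) Vᶜ := by
  obtain ⟨K, T, -, hKT⟩ := hk.2.2.2
  obtain ⟨J, hJ⟩ := exists_nat_ge (n + 1 + m.re)
  have hw := (integrableOn_cpow_mul_pow hJ T).1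
  intro x hx
  obtain ⟨e, he, hxe⟩ := exists_isSmoothChart (p := p) (n := n) hdim x
  obtain ⟨hU, h, hh, heq⟩ := exists_eq_pow_smul_of_mem_schwartzDNC hV hk he J
  set U := e.target ∩ e.symm ⁻¹' Vᶜ
  have hsm : ContDiffOn ℝ ∞ (fun q => ∫ t in Icc 0 T,
      ((t : ℂ)⁻¹ ^ n * (t : ℂ) ^ (-1 - m) * (t : ℂ) ^ J) • h (q, t)) U := by
    refine contDiffOn_infty.2 fun N => contDiffOn_setIntegral_smul_of_isCompact hU isOpen_univ
      isCompact_Icc (subset_univ _) (hh.of_le (by exact_mod_cast le_top)) hw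
  refine ContMDiffAt.contMDiffWithinAt ?_
  have hxU : e x ∈ U := ⟨e.map_source hxe, by simpa [e.left_inv hxe] using hx⟩
  have h1 : ContMDiffAt 𝓘(ℝ, E) 𝓘(ℝ, ℂ) ∞ ((fun q => ∫ t in Icc 0 T,
      ((t : ℂ)⁻¹ ^ n * (t : ℂ) ^ (-1 - m) * (t : ℂ) ^ J) • h (q, t)) ∘ e) x :=
    (hsm.contDiffAt (hU.mem_nhds hxU)).contMDiffAt.comp x
      (he.1.contMDiffAt (e.open_source.mem_nhds hxe))
  refine h1.congr_of_eventuallyEq ?_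
  filter_upwards [e.open_source.mem_nhds hxe, hV.isOpen_compl.mem_nhds hx] with y hye hyV
  have hyU : e y ∈ U := ⟨e.map_source hye, by simpa [e.left_inv hye] using hyV⟩
  have h2 : ∀ t : ℝ, ((t : ℂ)⁻¹ ^ n * (t : ℂ) ^ (-1 - m) * (t : ℂ) ^ J) • h (e y, t) =
      (t : ℂ)⁻¹ ^ n * (t : ℂ) ^ (-1 - m) * k y t := by
    intro t
    have := heq _ hyU t
    rw [e.left_inv hye] at this
    rw [this]
    simp [mul_assoc]
  simp only [Function.comp_apply, h2]
  rw [integral_Icc_eq_integral_Ioc]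
  refine (setIntegral_eq_of_subset_of_forall_sdiff_eq_zero measurableSet_Ioi Ioc_subset_Ioi_self
    fun t ht => ?_)
  have : k y t = 0 := by
    by_contra hne
    exact ht.2 ⟨ht.1, (hKT y t hne).2⟩
  rw [this, mul_zero]

omit [T2Space M] [SecondCountableTopology M] [MeasurableSpace M] [BorelSpace M] in
/-- A Schwartz function is `O(t ^ J)`, uniformly on compact sets disjoint from `V`. -/
theorem exists_norm_le_pow_of_mem_schwartzDNC (hdim : Module.finrank ℝ E = p + n)
    (hV : IsClosed V) {k : M → ℝ → ℂ} (hk : k ∈ schwartzDNC E p n V) {Z : Set M}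
    (hZ : IsCompact Z) (hZV : Z ⊆ Vᶜ) (J : ℕ) (T : ℝ) :
    ∃ C : ℝ, 0 ≤ C ∧ ∀ x ∈ Z, ∀ t ∈ Icc 0 T, ‖k x t‖ ≤ C * t ^ J := by
  refine hZ.induction_on (p := fun S => ∃ C : ℝ, 0 ≤ C ∧ ∀ x ∈ S, ∀ t ∈ Icc 0 T,
    ‖k x t‖ ≤ C * t ^ J) ⟨0, le_rfl, fun x hx => absurd hx (notMem_empty x)⟩ ?_ ?_ ?_
  · rintro S S' hSS' ⟨C, hC0, hC⟩
    exact ⟨C, hC0, fun x hx => hC x (hSS' hx)⟩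
  · rintro S S' ⟨C, hC0, hC⟩ ⟨C', hC0', hC'⟩
    refine ⟨C + C', by positivity, fun x hx t ht => ?_⟩
    have htJ : 0 ≤ t ^ J := pow_nonneg ht.1 J
    rcases hx with hx | hx
    · nlinarith [hC x hx t ht, mul_nonneg hC0' htJ]
    · nlinarith [hC' x hx t ht, mul_nonneg hC0 htJ]
  · intro x hx
    obtain ⟨e, he, hxe⟩ := exists_isSmoothChart (p := p) (n := n) hdim x
    obtain ⟨hU, h, hh, heq⟩ := exists_eq_pow_smul_of_mem_schwartzDNC hV hk he J
    set U := e.target ∩ e.symm ⁻¹' Vᶜ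
    have hxU : e x ∈ U := ⟨e.map_source hxe, by simpa [e.left_inv hxe] using hZV hx⟩
    obtain ⟨B, hB, hxB, hBU⟩ := exists_compact_subset hU hxU
    obtain ⟨C, hC⟩ := (hB.prod (isCompact_Icc (a := (0 : ℝ)) (b := T))).exists_bound_of_continuousOn
      (hh.continuousOn.mono (prod_mono hBU (subset_univ _)))
    refine ⟨e.source ∩ e ⁻¹' interior B, mem_nhdsWithin_of_mem_nhds
      ((e.isOpen_inter_preimage isOpen_interior).mem_nhds ⟨hxe, hxB⟩), |C|, abs_nonneg C,
      fun y hy t ht => ?_⟩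
    have hyB := interior_subset hy.2
    have h1 := heq (e y) (hBU hyB) t
    rw [e.left_inv hy.1] at h1
    rw [h1, norm_smul, norm_pow, Real.norm_of_nonneg ht.1, mul_comm]
    exact mul_le_mul_of_nonneg_right ((hC (e y, t) ⟨hyB, ht⟩).trans (le_abs_self C))
      (pow_nonneg ht.1 J)

omit [T2Space M] in
/-- On test functions supported off `V` the integrations over `M` and `t` can be exchanged. -/
theorem integral_pairing_off (hdim : Module.finrank ℝ E = p + n) (hμ : IsSmoothMeasure E p n μ)
    (hV : IsClosed V) {k : M → ℝ → ℂ} (hk : k ∈ schwartzDNC E p n V) (m : ℂ) {f : M → ℂ}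
    (hf : Continuous f) (hfc : HasCompactSupport f) (hfV : tsupport f ⊆ Vᶜ) :
    ∫ t in Ioi (0 : ℝ), pairing n μ k t f * (t : ℂ) ^ (-1 - m) =
      ∫ x, (∫ t in Ioi (0 : ℝ), (t : ℂ)⁻¹ ^ n * (t : ℂ) ^ (-1 - m) * k x t) * f x ∂μ := by
  have := hμ.isLocallyFiniteMeasure hdim
  obtain ⟨K, T, -, hKT⟩ := hk.2.2.2
  obtain ⟨J, hJ⟩ := exists_nat_ge (n + 1 + m.re)
  have hw := (integrableOn_cpow_mul_pow hJ T).2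
  obtain ⟨C, hC0, hC⟩ := exists_norm_le_pow_of_mem_schwartzDNC hdim hV hk hfc.isCompact hfV J T
  set C' := T ^ ((J : ℝ) - n - 1 - m.re)
  have hint : Integrable (Function.uncurry fun (t : ℝ) (x : M) =>
      (t : ℂ)⁻¹ ^ n * (t : ℂ) ^ (-1 - m) * k x t * f x) ((volume.restrict (Ioi 0)).prod μ) := by
    have hg : Integrable (fun w : ℝ × M => (Ioc 0 T).indicator (fun _ => C' * C) w.1 * ‖f w.2‖)
        ((volume.restrict (Ioi 0)).prod μ) :=
      Integrable.mul_prod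
        (((integrable_indicator_iff measurableSet_Ioc).2 (integrableOn_const (by simp))).restrict)
        (hf.integrable_of_hasCompactSupport hfc).norm
    refine hg.mono' ?_ ?_
    · have hr : (volume.restrict (Ioi (0 : ℝ))).prod μ =
          (volume.prod μ).restrict (Ioi 0 ×ˢ univ) := by
        rw [← Measure.prod_restrict, Measure.restrict_univ]
      rw [hr]
      refine ContinuousOn.aestronglyMeasurable ?_ (measurableSet_Ioi.prod MeasurableSet.univ)
      intro w hw
      have hw0 : 0 < w.1 := hw.1
      have h1 : (w.1 : ℂ) ≠ 0 := by exact_mod_cast hw0.ne'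
      have h2 : ContinuousAt (fun w : ℝ × M => (w.1 : ℂ) ^ (-1 - m)) w :=
        (Complex.continuousAt_ofReal_cpow_const _ _ (Or.inr hw0.ne')).comp
          (f := fun w : ℝ × M => w.1) continuousAt_fst
      have h3 : ContinuousAt (fun w : ℝ × M => k w.2 w.1) w := by
        have hopen : IsOpen {q : M × ℝ | 0 < q.2} := isOpen_lt continuous_const continuous_snd
        have hk2 : ContinuousOn (fun q : M × ℝ => k q.1 q.2) {q | 0 < q.2} :=
          hk.2.1.continuousOn.mono fun q hq h => (ne_of_gt hq) h.2
        exact (hk2.continuousAt (hopen.mem_nhds (show (w.2, w.1) ∈ _ from hw0))).comp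
          (f := fun w : ℝ × M => (w.2, w.1)) continuous_swap.continuousAt
      have h4 : ContinuousAt (fun w : ℝ × M => (w.1 : ℂ)⁻¹) w :=
        ContinuousAt.inv₀ (by fun_prop) h1
      exact ((((h4.pow n).mul h2).mul h3).mul
        (hf.comp continuous_snd).continuousAt).continuousWithinAt
    · have hae : ∀ᵐ w ∂((volume.restrict (Ioi (0 : ℝ))).prod μ), 0 < w.1 :=
        Measure.quasiMeasurePreserving_fst.ae (ae_restrict_mem measurableSet_Ioi)
      filter_upwards [hae] with w hw0
      simp only [Function.uncurry]
      rw [norm_mul]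
      by_cases hx : w.2 ∈ tsupport f
      · refine mul_le_mul_of_nonneg_right ?_ (norm_nonneg _)
        by_cases hwT : w.1 ≤ T
        · have hwI : w.1 ∈ Ioc 0 T := ⟨hw0, hwT⟩
          rw [indicator_of_mem hwI, norm_mul]
          have h1 := hw w.1 hwI
          rw [norm_mul _ ((w.1 : ℂ) ^ J), norm_pow (w.1 : ℂ) J, Complex.norm_real,
            Real.norm_of_nonneg hw0.le] at h1
          calc _ ≤ ‖(w.1 : ℂ)⁻¹ ^ n * (w.1 : ℂ) ^ (-1 - m)‖ * (C * w.1 ^ J) :=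
                mul_le_mul_of_nonneg_left (hC _ hx _ ⟨hw0.le, hwT⟩) (norm_nonneg _)
            _ = ‖(w.1 : ℂ)⁻¹ ^ n * (w.1 : ℂ) ^ (-1 - m)‖ * w.1 ^ J * C := by ring
            _ ≤ C' * C := mul_le_mul_of_nonneg_right h1 hC0
        · have hk0 : k w.2 w.1 = 0 := by
            by_contra hne
            exact hwT (hKT _ _ hne).2
          rw [hk0, mul_zero, norm_zero, indicator_of_notMem fun h => hwT h.2]
      · rw [image_eq_zero_of_notMem_tsupport hx, norm_zero, mul_zero, mul_zero]
  have hswap := integral_integral_swap hint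
  simp only [pairing]
  calc _ = ∫ t in Ioi (0 : ℝ), ∫ x, (t : ℂ)⁻¹ ^ n * (t : ℂ) ^ (-1 - m) * k x t * f x ∂μ := by
        refine integral_congr_ae (Eventually.of_forall fun t => ?_)
        simp only [mul_assoc, integral_const_mul]
        ring
    _ = _ := by
        rw [hswap]
        exact integral_congr_ae (Eventually.of_forall fun x => integral_mul_const _ _)

end Forward

/-! ### Mellin forms are conormal: continuity -/

section Continuity

/-- Leibniz estimate for the product with a fixed smooth function. -/
theorem exists_norm_iteratedFDeriv_mul_le {X : Type*} [NormedAddCommGroup X] [NormedSpace ℝ X]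
    {U Z : Set X} (hU : IsOpen U) (hZ : IsCompact Z) (hZU : Z ⊆ U) {θ : X → ℂ}
    (hθ : ContDiffOn ℝ ∞ θ U) (N : ℕ) : ∃ A : ℝ, 0 ≤ A ∧ ∀ (φ : X → ℂ) (B : ℝ),
      ContDiffOn ℝ ∞ φ U → 0 ≤ B → (∀ j ≤ N, ∀ x ∈ Z, ‖iteratedFDeriv ℝ j φ x‖ ≤ B) →
      ∀ j ≤ N, ∀ x ∈ Z, ‖iteratedFDeriv ℝ j (fun y => θ y * φ y) x‖ ≤ A * B := by
  have hb : ∀ i : ℕ, ∃ A : ℝ, ∀ x ∈ Z, ‖iteratedFDerivWithin ℝ i θ U x‖ ≤ A := fun i =>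
    hZ.exists_bound_of_continuousOn ((hθ.continuousOn_iteratedFDerivWithin
      (by exact_mod_cast le_top) hU.uniqueDiffOn).mono hZU)
  choose A hA using hb
  set A' : ℝ := ∑ i ∈ Finset.range (N + 1), |A i|
  have hA0 : 0 ≤ A' := Finset.sum_nonneg fun i _ => abs_nonneg _
  refine ⟨2 ^ N * A', by positivity, fun φ B hφ hB hφB j hj x hx => ?_⟩
  rw [← iteratedFDerivWithin_of_isOpen j hU (hZU hx)]
  refine (norm_iteratedFDerivWithin_mul_le hθ hφ hU.uniqueDiffOn (hZU hx)
    (n := j) (by exact_mod_cast le_top)).trans ?_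
  calc _ ≤ ∑ i ∈ Finset.range (j + 1), (j.choose i : ℝ) * A' * B := by
        refine Finset.sum_le_sum fun i hi => ?_
        have hi' : i ≤ j := Nat.lt_succ_iff.1 (Finset.mem_range.1 hi)
        have h1 : ‖iteratedFDerivWithin ℝ i θ U x‖ ≤ A' :=
          (hA i x hx).trans ((le_abs_self _).trans (Finset.single_le_sum
            (f := fun i => |A i|) (fun i _ => abs_nonneg _)
            (Finset.mem_range.2 (by omega))))
        have h2 : ‖iteratedFDerivWithin ℝ (j - i) φ U x‖ ≤ B := by
          rw [iteratedFDerivWithin_of_isOpen _ hU (hZU hx)]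
          exact hφB _ (by omega) x hx
        gcongr
    _ = 2 ^ j * A' * B := by
        rw [← Finset.sum_mul, ← Finset.sum_mul]
        congr 2
        exact_mod_cast Nat.sum_range_choose j
    _ ≤ 2 ^ N * A' * B := by
        gcongr
        norm_num

variable {E : Type*} [NormedAddCommGroup E] [NormedSpace ℝ E]
variable {M : Type*} [TopologicalSpace M] [ChartedSpace E M]
variable {p n : ℕ} {V : Set M}

/-- The product of two smooth functions. -/
def smoothMul {θ : M → ℂ} (hθ : ContMDiff 𝓘(ℝ, E) 𝓘(ℝ, ℂ) ∞ θ) (f : SmoothFun E M) :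
    SmoothFun E M :=
  ⟨fun x => θ x * f.1 x, (contDiff_mul (𝕜 := ℝ) (𝔸 := ℂ)).contMDiff.comp (hθ.prodMk_space f.2)⟩

theorem smoothMul_apply {θ : M → ℂ} (hθ : ContMDiff 𝓘(ℝ, E) 𝓘(ℝ, ℂ) ∞ θ) (f : SmoothFun E M)
    (x : M) : (smoothMul hθ f).1 x = θ x * f.1 x := rfl

/-- Localisation of a linear form by a partition of unity near its support. -/
theorem eq_sum_smoothMul (Q : SmoothFun E M →ₗ[ℂ] ℂ) {ι : Type*} (s : Finset ι) {θ : ι → M → ℂ}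
    (hθ : ∀ i, ContMDiff 𝓘(ℝ, E) 𝓘(ℝ, ℂ) ∞ (θ i)) {W : Set M} (hW : ∀ x ∈ W, ∑ i ∈ s, θ i x = 1)
    (hQ : ∀ f : SmoothFun E M, (∀ x ∈ W, f.1 x = 0) → Q f = 0) (f : SmoothFun E M) :
    Q f = ∑ i ∈ s, Q (smoothMul (hθ i) f) := by
  rw [← map_sum, ← sub_eq_zero, ← map_sub]
  refine hQ _ fun x hx => ?_
  have h : (∑ i ∈ s, smoothMul (hθ i) f : SmoothFun E M).1 x = ∑ i ∈ s, θ i x * f.1 x := by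
    rw [Submodule.coe_sum, Finset.sum_apply]
    rfl
  change f.1 x - (∑ i ∈ s, smoothMul (hθ i) f : SmoothFun E M).1 x = 0
  rw [h, ← Finset.sum_mul, hW x hx, one_mul, sub_self]

variable [FiniteDimensional ℝ E] [IsManifold 𝓘(ℝ, E) ∞ M] [T2Space M] [SecondCountableTopology M]

/-- A linear form which only depends on the values in a compact set, and which satisfies seminorm
estimates locally, is a compactly supported distribution. -/
theorem isCompactDistribution_of_local {Q : SmoothFun E M →ₗ[ℂ] ℂ} {K : Set M} (hK : IsCompact K)
    (hQK : ∀ f : SmoothFun E M, (∀ x ∈ K, f.1 x = 0) → Q f = 0)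
    (hloc : ∀ x : M, ∃ e : OpenPartialHomeomorph M (Coord p n), IsSmoothChart E e ∧ x ∈ e.source ∧
      ∀ Z : Set (Coord p n), IsCompact Z → Z ⊆ e.target → ∃ (N : ℕ) (C : ℝ), 0 ≤ C ∧
        ∀ (g : SmoothFun E M) (B : ℝ), 0 ≤ B → (∀ x ∉ e.symm '' Z, g.1 x = 0) →
          (∀ j ≤ N, ∀ q ∈ Z, ‖iteratedFDeriv ℝ j (g.1 ∘ e.symm) q‖ ≤ B) → ‖Q g‖ ≤ C * B) :
    IsCompactDistribution E p n Q := by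
  choose e he hxe hloc using hloc
  obtain ⟨s, θ, Z, W, hθ, hZ, hZe, hθ0, -, hKW, hW1⟩ := exists_finite_partition E hK
    (fun x => (e x).source) (fun x => (e x).open_source) hxe
  have hZ' : ∀ i, IsCompact (e i '' Z i) := fun i =>
    (hZ i).image_of_continuousOn ((e i).continuousOn.mono (hZe i))
  have hZt : ∀ i, e i '' Z i ⊆ (e i).target := by
    rintro i _ ⟨x, hx, rfl⟩
    exact (e i).map_source (hZe i hx)
  choose N C hC0 hC using fun i => hloc i _ (hZ' i) (hZt i)
  choose A hA0 hA using fun i => exists_norm_iteratedFDeriv_mul_le (e i).open_target (hZ' i) (hZt i)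
    ((he i).contDiffOn_comp_symm' (hθ i)) (N i)
  refine ⟨s.card, s.sup N, ∑ i ∈ s, C i * A i, fun j => e (s.equivFin.symm j),
    fun j => e (s.equivFin.symm j) '' Z (s.equivFin.symm j),
    fun j => ⟨he _, hZ' _, hZt _⟩, fun f B hB hfB => ?_⟩
  rw [eq_sum_smoothMul Q s hθ hW1 (fun f hf => hQK f fun x hx => hf x (hKW hx)) f, Finset.sum_mul]
  refine (norm_sum_le _ _).trans (Finset.sum_le_sum fun i hi => ?_)
  rw [mul_assoc]
  refine hC i _ (A i * B) (mul_nonneg (hA0 i) hB) (fun x hx => ?_) ?_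
  · rw [smoothMul_apply, hθ0 i x, zero_mul]
    intro hxZ
    exact hx ⟨e i x, ⟨x, hxZ, rfl⟩, (e i).left_inv (hZe i hxZ)⟩
  · refine hA i (f.1 ∘ (e i).symm) B ((he i).contDiffOn_comp_symm' f.2) hB fun j hj y hy => ?_
    have h := hfB (s.equivFin ⟨i, hi⟩) j (hj.trans (Finset.le_sup hi))
    simp only [Equiv.symm_apply_apply] at h
    exact h y hy

variable [MeasurableSpace M] [BorelSpace M] {μ : Measure M}

/-- Mellin forms are continuous: near `V` because oscillatory integrals are, off `V` because they
have a continuous density. -/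
theorem isCompactDistribution_of_mem_flatSchwartz (hdim : Module.finrank ℝ E = p + n)
    (hμ : IsSmoothMeasure E p n μ) (hV : IsClosedSubmanifold E p n V) {k : M → ℝ → ℂ}
    (hk : k ∈ flatSchwartz E p n μ V) (m : ℂ) {Q : SmoothFun E M →ₗ[ℂ] ℂ}
    (hQ : ∀ f : SmoothFun E M,
      Q f = ∫ t in Ioi (0 : ℝ), pairing n μ k t f.1 * (t : ℂ) ^ (-1 - m)) :
    IsCompactDistribution E p n Q := by
  have := hμ.isLocallyFiniteMeasure hdim
  obtain ⟨K, T, hK, hKT⟩ := hk.1.2.2.2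
  refine isCompactDistribution_of_local hK (fun f hf => ?_) fun x => ?_
  · have h : ∀ t x, k x t * f.1 x = 0 := fun t x => by
      by_cases hkx : k x t = 0
      · rw [hkx, zero_mul]
      · rw [hf x (hKT x t hkx).1, mul_zero]
    rw [hQ]
    simp [pairing, h]
  have hsupp : ∀ (e : OpenPartialHomeomorph M (Coord p n)) (Z : Set (Coord p n)), IsCompact Z →
      Z ⊆ e.target → ∀ g : SmoothFun E M, (∀ x ∉ e.symm '' Z, g.1 x = 0) →
      IsCompact (e.symm '' Z) ∧ HasCompactSupport g.1 ∧ tsupport g.1 ⊆ e.symm '' Z ∧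
        e.symm '' Z ⊆ e.source := by
    intro e Z hZ hZe g hg
    have hc : IsCompact (e.symm '' Z) := hZ.image_of_continuousOn (e.continuousOn_symm.mono hZe)
    refine ⟨hc, HasCompactSupport.intro hc hg, closure_minimal (fun x hx => ?_) hc.isClosed, ?_⟩
    · by_contra h
      exact hx (hg x h)
    · rintro _ ⟨y, hy, rfl⟩
      exact e.map_target (hZe hy)
  by_cases hx : x ∈ V
  · obtain ⟨e, he, hxe, a, ha, hosc⟩ := exists_symbol_of_mem_flatSchwartz hμ hV hk m hx
    refine ⟨e, he.1, hxe, fun Z hZ hZe => ?_⟩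
    obtain ⟨N, C, hC0, hC⟩ := exists_norm_oscillatory_le ha hZ
    refine ⟨N, C, hC0, fun g B hB hg hgB => ?_⟩
    obtain ⟨hc, hgc, hgs, hse⟩ := hsupp e Z hZ hZe g hg
    rw [hQ, hosc g hgc (hgs.trans hse)]
    obtain ⟨hF, -, -, hF0⟩ := he.1.contDiff_indicator (ContMDiff.contMDiffOn g.2) hc hse hg
    have himg : e '' (e.symm '' Z) = Z := by
      rw [← image_comp]
      exact (image_congr fun y hy => e.right_inv (hZe hy)).trans (image_id _)
    rw [himg] at hF0
    refine hC _ B hF hF0 (fun j hj q hq => ?_) hB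
    have heq : e.target.indicator (g.1 ∘ e.symm) =ᶠ[𝓝 q] g.1 ∘ e.symm := by
      filter_upwards [e.open_target.mem_nhds (hZe hq)] with y hy using indicator_of_mem hy _
    rw [(heq.iteratedFDeriv ℝ j).eq_of_nhds]
    exact hgB j hj q hq
  · obtain ⟨e, he, hxe⟩ := exists_isSmoothChart (p := p) (n := n) hdim x
    refine ⟨e.restrOpen Vᶜ hV.1.isOpen_compl, he.restrOpen _, ?_, fun Z hZ hZe => ?_⟩
    · rw [e.restrOpen_source]
      exact ⟨hxe, hx⟩
    set e' := e.restrOpen Vᶜ hV.1.isOpen_compl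
    have hsV : e'.source ⊆ Vᶜ := by
      rw [e.restrOpen_source]
      exact inter_subset_right
    have hc : IsCompact (e'.symm '' Z) := hZ.image_of_continuousOn (e'.continuousOn_symm.mono hZe)
    have hse : e'.symm '' Z ⊆ e'.source := by
      rintro _ ⟨y, hy, rfl⟩
      exact e'.map_target (hZe hy)
    obtain ⟨C, hC⟩ := hc.exists_bound_of_continuousOn
      ((contMDiffOn_integral_schwartzDNC hdim hV.1 hk.1 m).continuousOn.mono (hse.trans hsV))
    refine ⟨0, |C| * μ.real (e'.symm '' Z), by positivity, fun g B hB hg hgB => ?_⟩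
    obtain ⟨-, hgc, hgs, -⟩ := hsupp e' Z hZ hZe g hg
    rw [hQ, integral_pairing_off hdim hμ hV.1 hk.1 m (ContMDiff.continuous g.2) hgc
      (hgs.trans (hse.trans hsV)), ← setIntegral_eq_integral_of_forall_compl_eq_zero
      (s := e'.symm '' Z) fun x hx => by rw [hg x hx, mul_zero]]
    refine (norm_setIntegral_le_of_norm_le_const (C := |C| * B) hc.measure_lt_top ?_).trans
      (le_of_eq (by ring))
    rintro _ ⟨y, hy, rfl⟩
    rw [norm_mul]
    have hgy : ‖g.1 (e'.symm y)‖ ≤ B := by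
      have := hgB 0 le_rfl y hy
      rwa [norm_iteratedFDeriv_zero] at this
    exact mul_le_mul ((hC _ ⟨y, hy, rfl⟩).trans (le_abs_self C)) hgy (norm_nonneg _) (abs_nonneg C)

theorem mem_conormal_of_mem_flatSchwartz (hdim : Module.finrank ℝ E = p + n)
    (hμ : IsSmoothMeasure E p n μ) (hV : IsClosedSubmanifold E p n V) {k : M → ℝ → ℂ}
    (hk : k ∈ flatSchwartz E p n μ V) (m : ℂ) {Q : SmoothFun E M →ₗ[ℂ] ℂ}
    (hQ : ∀ f : SmoothFun E M,
      Q f = ∫ t in Ioi (0 : ℝ), pairing n μ k t f.1 * (t : ℂ) ^ (-1 - m)) :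
    Q ∈ conormal E p n μ V m := by
  refine ⟨isCompactDistribution_of_mem_flatSchwartz hdim hμ hV hk m hQ, fun x hx => ?_,
    fun x hx => ?_⟩
  · refine ⟨Vᶜ, hV.1.isOpen_compl, hx, _, contMDiffOn_integral_schwartzDNC hdim hV.1 hk.1 m,
      fun f hf hfV => ?_⟩
    rw [hQ]
    exact integral_pairing_off hdim hμ hV.1 hk.1 m (ContMDiff.continuous f.2) hf hfV
  · obtain ⟨e, he, hxe, a, ha, hosc⟩ := exists_symbol_of_mem_flatSchwartz hμ hV hk m hx
    refine ⟨e, he, hxe, a, fun _ => 0, ha, contMDiffOn_const, fun f hf hfe => ?_⟩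
    rw [hQ, hosc f hf hfe]
    simp

end Continuity

/-! ### Smooth densities as Mellin forms -/

theorem iteratedDeriv_zero_of_nonpos {h : ℝ → ℂ} (hh : ContDiff ℝ ∞ h) (h0 : ∀ t ≤ 0, h t = 0)
    (j : ℕ) : iteratedDeriv j h 0 = 0 := by
  have hc : Continuous (iteratedDeriv j h) := hh.continuous_iteratedDeriv j (by exact_mod_cast le_top)
  have h1 : Tendsto (iteratedDeriv j h) (𝓝[<] 0) (𝓝 (iteratedDeriv j h 0)) :=
    hc.continuousAt.tendsto.mono_left nhdsWithin_le_nhds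
  refine tendsto_nhds_unique h1 (tendsto_const_nhds.congr' ?_)
  filter_upwards [self_mem_nhdsWithin] with t ht
  have hev : h =ᶠ[𝓝 t] fun _ => 0 := by
    filter_upwards [gt_mem_nhds ht] with s hs using h0 s (le_of_lt hs)
  rw [hev.iteratedDeriv_eq, iteratedDeriv_const]
  simp

section

variable {E : Type*} [NormedAddCommGroup E] [NormedSpace ℝ E]
variable {M : Type*} [TopologicalSpace M] [ChartedSpace E M]
variable {p n : ℕ} {V : Set M}

/-- A smooth compactly supported density `κ` is a Mellin form: with `k = κ(x) tⁿ t ^ m φ(t)` the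
pairings are `t ^ m φ(t) ∫ κ f`, and `∫ t⁻¹ φ(t) dt = 1`. -/
theorem isMellinForm_integral_mul [T2Space M] [MeasurableSpace M]
    {μ : Measure M} {κ : M → ℂ} (hκ : ContMDiff 𝓘(ℝ, E) 𝓘(ℝ, ℂ) ∞ κ)
    {K : Set M} (hK : IsCompact K) (hK0 : ∀ x ∉ K, κ x = 0) (m : ℂ) :
    IsMellinForm E p n V μ m fun f => ∫ x, κ x * f.1 x ∂μ := by
  set g : ℝ → ℂ := fun t => (t : ℂ) ^ n * powRadialBump m t with hg
  have hgs : ContDiff ℝ ∞ g :=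
    (Complex.ofRealCLM.contDiff.pow n).mul (contDiff_powRadialBump m)
  have hg0 : ∀ t, t ≤ 5 / 4 ∨ 7 / 4 ≤ t → g t = 0 := fun t ht => by
    rw [hg]
    simp only [powRadialBump_eq_zero m ht, mul_zero]
  have hpair : ∀ (f : SmoothFun E M) (t : ℝ), 0 < t →
      pairing n μ (fun x t => κ x * g t) t f.1 = powRadialBump m t * ∫ x, κ x * f.1 x ∂μ := by
    intro f t ht
    have h1 : ∀ x, κ x * g t * f.1 x = g t * (κ x * f.1 x) := fun x => by ring
    have htc : (t : ℂ) ≠ 0 := by exact_mod_cast ht.ne'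
    change (t : ℂ)⁻¹ ^ n * ∫ x, κ x * g t * f.1 x ∂μ = _
    simp_rw [h1]
    rw [integral_const_mul, ← mul_assoc]
    change (t : ℂ)⁻¹ ^ n * ((t : ℂ) ^ n * powRadialBump m t) * _ = _
    rw [inv_pow, inv_mul_cancel_left₀ (pow_ne_zero _ htc)]
  have hmul := (contDiff_mul (𝕜 := ℝ) (𝔸 := ℂ) (n := ∞))
  refine ⟨fun x t => κ x * g t, ⟨⟨fun x t ht => ?_, ?_, fun e he => ?_, K, 2, hK, fun x t h => ?_⟩,
    fun f => ⟨fun t => powRadialBump m t * ∫ x, κ x * f.1 x ∂μ,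
      (contDiff_powRadialBump m).mul contDiff_const, fun t ht => (hpair f t ht).symm, ?_⟩⟩,
    fun f => ?_⟩
  · change κ x * g t = 0
    rw [hg0 t (Or.inl (by linarith)), mul_zero]
  · exact (hmul.contMDiff.comp ((hκ.comp contMDiff_fst).prodMk_space
      (hgs.contMDiff.comp contMDiff_snd))).contMDiffOn
  · refine ⟨fun w => κ (e.symm (w.1, w.2.2.2 • w.2.1)) * g (w.2.2.2 * w.2.2.1), ?_,
      fun u ξ τ s _ _ _ => rfl⟩
    refine ContDiffOn.mul ?_ (hgs.comp (by fun_prop)).contDiffOn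
    exact (he.1.contDiffOn_comp_symm' hκ).comp (t := e.target)
      (f := fun w : EuclideanSpace ℝ (Fin p) × EuclideanSpace ℝ (Fin n) × ℝ × ℝ =>
        ((w.1, w.2.2.2 • w.2.1) : Coord p n))
      (ContDiff.contDiffOn (by fun_prop)) fun w hw => hw.2.2
  · change κ x * g t ≠ 0 at h
    constructor
    · by_contra hx
      exact h (by rw [hK0 x hx, zero_mul])
    · by_contra ht
      exact h (by rw [hg0 t (Or.inr (by linarith)), mul_zero])
  · refine iteratedDeriv_zero_of_nonpos ((contDiff_powRadialBump m).mul contDiff_const)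
      fun t ht => ?_
    rw [powRadialBump_eq_zero m (Or.inl (by linarith)), zero_mul]
  · have h1 : ∀ t ∈ Ioi (0 : ℝ), pairing n μ (fun x t => κ x * g t) t f.1 * (t : ℂ) ^ (-1 - m) =
        ((t⁻¹ * radialBump t : ℝ) : ℂ) * ∫ x, κ x * f.1 x ∂μ := by
      intro t ht
      have htc : (t : ℂ) ≠ 0 := by exact_mod_cast (ne_of_gt ht)
      have h2 : (t : ℂ) ^ m * (t : ℂ) ^ (-1 - m) = (t : ℂ)⁻¹ := by
        rw [← Complex.cpow_add _ _ htc, ← Complex.cpow_neg_one]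
        ring_nf
      rw [hpair f t ht, powRadialBump, if_pos (mem_Ioi.1 ht)]
      push_cast
      rw [← h2]
      ring
    rw [setIntegral_congr_fun measurableSet_Ioi h1, integral_mul_const, integral_complex_ofReal,
      integral_radialBump, Complex.ofReal_one, one_mul]

end

/-! ### Lifts to the blow-up -/

/-- A function on `{0 < σ}` which near every point of `{0 ≤ σ}` has `C^N` extensions, for all `N`,
extends smoothly to `{0 ≤ σ}`: all these extensions restrict to the same limit on `{σ = 0}`. -/
theorem exists_contDiffOn_glue {X : Type*} [NormedAddCommGroup X] [NormedSpace ℝ X] {Ω : Set X}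
    {σ : X → ℝ} (hσ : ∀ w, σ w = 0 → w ∈ closure {v | 0 < σ v}) {g : X → ℂ}
    (hloc : ∀ w ∈ Ω, 0 ≤ σ w → ∀ N : ℕ, ∃ H : X → ℂ, ContDiffAt ℝ N H w ∧
      ∀ᶠ v in 𝓝 w, 0 < σ v → H v = g v) :
    ∃ G : X → ℂ, ContDiffOn ℝ ∞ G (Ω ∩ {w | 0 ≤ σ w}) ∧ ∀ w, 0 < σ w → G w = g w := by
  classical
  refine ⟨fun w => if 0 < σ w then g w else limUnder (𝓝[{v | 0 < σ v}] w) g, ?_,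
    fun w hw => if_pos hw⟩
  rw [contDiffOn_infty]
  rintro N w ⟨hw, hw0⟩
  obtain ⟨H, hH, hev⟩ := hloc w hw hw0 N
  have hHc : ∀ᶠ v in 𝓝 w, ContDiffAt ℝ N H v := hH.eventually (by simp)
  refine hH.contDiffWithinAt.congr_of_eventuallyEq_of_mem ?_ ⟨hw, hw0⟩
  filter_upwards [self_mem_nhdsWithin, mem_nhdsWithin_of_mem_nhds hev.eventually_nhds,
    mem_nhdsWithin_of_mem_nhds hHc] with v hv hvg hvH
  by_cases hpos : 0 < σ v
  · rw [if_pos hpos, hvg.self_of_nhds hpos]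
  · rw [if_neg hpos]
    have : (𝓝[{v | 0 < σ v}] v).NeBot := mem_closure_iff_nhdsWithin_neBot.1
      (hσ v (le_antisymm (not_lt.1 hpos) hv.2))
    refine Tendsto.limUnder_eq ((hvH.continuousAt.tendsto.mono_left nhdsWithin_le_nhds).congr' ?_)
    filter_upwards [self_mem_nhdsWithin, mem_nhdsWithin_of_mem_nhds hvg] with z hz hzg
      using hzg hz

section Transition

variable {E : Type*} [NormedAddCommGroup E] [NormedSpace ℝ E]
variable {M : Type*} [TopologicalSpace M] [ChartedSpace E M]
variable {p n : ℕ} {V : Set M}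

/-- A change of adapted charts lifts to the blow-up: its normal component at `(u, s ξ)` is `s`
times a smooth function, which does not vanish at `s = 0` if `ξ ≠ 0`. -/
theorem exists_transition_lift {e e' : OpenPartialHomeomorph M (Coord p n)}
    (he : IsAdaptedChart E V e) (he' : IsAdaptedChart E V e') {u₀ : EuclideanSpace ℝ (Fin p)}
    (hu : (u₀, 0) ∈ e.target) (hu' : e.symm (u₀, 0) ∈ e'.source) :
    ∃ (Ω : Set (Coord p n × ℝ)) (Ψ : Coord p n × ℝ → EuclideanSpace ℝ (Fin n)), IsOpen Ω ∧
      (∀ ξ, ((u₀, ξ), 0) ∈ Ω) ∧ ContDiffOn ℝ ∞ Ψ Ω ∧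
      (∀ w ∈ Ω, (w.1.1, w.2 • w.1.2) ∈ e.target ∩ e.symm ⁻¹' e'.source) ∧
      (∀ w ∈ Ω, (e' (e.symm (w.1.1, w.2 • w.1.2))).2 = w.2 • Ψ w) ∧
      ∀ ξ, ξ ≠ 0 → Ψ ((u₀, ξ), 0) ≠ 0 := by
  have hO : IsOpen (e.target ∩ e.symm ⁻¹' e'.source) :=
    e.isOpen_inter_preimage_symm e'.open_source
  have hΦ : ContDiffOn ℝ ∞ (e' ∘ e.symm) (e.target ∩ e.symm ⁻¹' e'.source) :=
    he.1.contDiffOn_comp_symm he'.1.1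
  have hu0 : ((u₀, 0) : Coord p n) ∈ e.target ∩ e.symm ⁻¹' e'.source := ⟨hu, hu'⟩
  obtain ⟨r, hr, hrO⟩ := Metric.isOpen_iff.1 hO _ hu0
  rw [← ball_prod_same] at hrO
  set Ω : Set (Coord p n × ℝ) := {w | w.1.1 ∈ Metric.ball u₀ r ∧ w.2 • w.1.2 ∈ Metric.ball 0 r}
    with hΩdef
  have hΩ : IsOpen Ω := by
    refine (Metric.isOpen_ball.preimage (f := fun w : Coord p n × ℝ => w.1.1) (by fun_prop)).inter
      (Metric.isOpen_ball.preimage (f := fun w : Coord p n × ℝ => w.2 • w.1.2) (by fun_prop))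
  have hΩO : ∀ w ∈ Ω, (w.1.1, w.2 • w.1.2) ∈ e.target ∩ e.symm ⁻¹' e'.source :=
    fun w hw => hrO ⟨hw.1, hw.2⟩
  have hmem : ∀ ξ, ((u₀, ξ), (0 : ℝ)) ∈ Ω := fun ξ =>
    ⟨Metric.mem_ball_self hr, by simpa using hr⟩
  have hf : ContDiffOn ℝ ∞ (fun w : Coord p n × ℝ => (e' (e.symm (w.1.1, w.2 • w.1.2))).2) Ω :=
    contDiff_snd.comp_contDiffOn (hΦ.comp (f := fun w : Coord p n × ℝ =>
      ((w.1.1, w.2 • w.1.2) : Coord p n)) (ContDiff.contDiffOn (by fun_prop)) hΩO)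
  have hzero : ∀ v : EuclideanSpace ℝ (Fin p), ((v, 0) : Coord p n) ∈
      e.target ∩ e.symm ⁻¹' e'.source → (e' (e.symm (v, 0))).2 = 0 := by
    intro v hv
    rw [← he'.2 _ hv.2, he.2 _ (e.map_target hv.1), e.right_inv hv.1]
  obtain ⟨Ψ, hΨ, hΨeq⟩ := exists_contDiffOn_eq_add_smul hΩ (fun w hw c hc => ⟨hw.1, by
    rw [mem_ball_zero_iff, mul_smul, norm_smul, Real.norm_of_nonneg hc.1]
    have := mem_ball_zero_iff.1 hw.2
    exact lt_of_le_of_lt (mul_le_of_le_one_left (norm_nonneg _) hc.2) this⟩) hf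
  have hΨ' : ∀ w ∈ Ω, (e' (e.symm (w.1.1, w.2 • w.1.2))).2 = w.2 • Ψ w := by
    intro w hw
    rw [hΨeq w hw, zero_smul, hzero _ (by simpa using hΩO (w.1, 0) ⟨hw.1, by simpa using hr⟩),
      zero_add]
  refine ⟨Ω, Ψ, hΩ, hmem, hΨ, hΩO, hΨ', fun ξ hξ hz => hξ ?_⟩
  -- the inverse change of charts is locally Lipschitz, so that `s ‖ξ‖ ≤ L s ‖Ψ(u₀, ξ, s)‖`
  have hO' : IsOpen (e'.target ∩ e'.symm ⁻¹' e.source) := e'.isOpen_inter_preimage_symm e.open_source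
  set y := e' (e.symm (u₀, 0)) with hy
  have hyO : y ∈ e'.target ∩ e'.symm ⁻¹' e.source := ⟨e'.map_source hu', by
    rw [mem_preimage, e'.left_inv hu']
    exact e.map_target hu⟩
  obtain ⟨L, t, ht, hL⟩ := (((he'.1.contDiffOn_comp_symm he.1.1).contDiffAt
    (hO'.mem_nhds hyO)).of_le (by simp : (1 : WithTop ℕ∞) ≤ ∞)).exists_lipschitzOnWith
  have hcont : ContinuousAt (fun s : ℝ => e' (e.symm (u₀, s • ξ))) 0 := by
    refine ContinuousAt.comp (f := fun s : ℝ => ((u₀, s • ξ) : Coord p n)) (g := e' ∘ e.symm) ?_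
      (by fun_prop)
    rw [zero_smul]
    exact hΦ.continuousOn.continuousAt (hO.mem_nhds hu0)
  have hcont0 : ContinuousAt
      (fun s : ℝ => (((e' (e.symm (u₀, s • ξ))).1, 0) : Coord p n)) 0 :=
    (continuousAt_fst.comp hcont).prodMk continuousAt_const
  have hy2 : y.2 = 0 := hzero _ hu0
  have hnear : ∀ᶠ s : ℝ in 𝓝 0, e' (e.symm (u₀, s • ξ)) ∈ t ∩ (e'.target ∩ e'.symm ⁻¹' e.source) :=
    hcont (by simpa [← hy] using inter_mem ht (hO'.mem_nhds hyO))
  have hnear0 : ∀ᶠ s : ℝ in 𝓝 0, (((e' (e.symm (u₀, s • ξ))).1, 0) : Coord p n) ∈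
      t ∩ (e'.target ∩ e'.symm ⁻¹' e.source) := by
    refine hcont0 ?_
    have : (((e' (e.symm (u₀, (0 : ℝ) • ξ))).1, 0) : Coord p n) = y := by
      rw [zero_smul, ← hy]
      exact Prod.ext rfl hy2.symm
    change _ ∈ 𝓝 (((e' (e.symm (u₀, (0 : ℝ) • ξ))).1, 0) : Coord p n)
    rw [this]
    exact inter_mem ht (hO'.mem_nhds hyO)
  have hΩs : ∀ᶠ s : ℝ in 𝓝 0, ((u₀, ξ), s) ∈ Ω :=
    (hΩ.preimage (f := fun s : ℝ => ((u₀, ξ), s)) (by fun_prop)).mem_nhds (hmem ξ)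
  have hlip : ∀ᶠ s : ℝ in 𝓝[>] 0, ‖ξ‖ ≤ L * ‖Ψ ((u₀, ξ), s)‖ := by
    filter_upwards [self_mem_nhdsWithin, mem_nhdsWithin_of_mem_nhds hnear,
      mem_nhdsWithin_of_mem_nhds hnear0, mem_nhdsWithin_of_mem_nhds hΩs] with s hs h1 h2 h3
    have hs0 : 0 < s := hs
    have h4 := hL.dist_le_mul _ h1.1 _ h2.1
    have h5 : (e ∘ e'.symm) (e' (e.symm (u₀, s • ξ))) = (u₀, s • ξ) := by
      have h := hΩO _ h3
      rw [Function.comp_apply, e'.left_inv h.2, e.right_inv h.1]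
    have h6 : ((e ∘ e'.symm) (((e' (e.symm (u₀, s • ξ))).1, 0) : Coord p n)).2 = 0 := by
      rw [Function.comp_apply, ← he.2 _ h2.2.2, he'.2 _ (e'.map_target h2.2.1),
        e'.right_inv h2.2.1]
    have h7 : dist (e' (e.symm (u₀, s • ξ))) (((e' (e.symm (u₀, s • ξ))).1, 0) : Coord p n) =
        s * ‖Ψ ((u₀, ξ), s)‖ := by
      rw [Prod.dist_eq, dist_self, dist_zero_right, hΨ' _ h3, norm_smul, Real.norm_of_nonneg hs0.le,
        max_eq_right (by positivity)]
    have h8 : s * ‖ξ‖ ≤ dist ((e ∘ e'.symm) (e' (e.symm (u₀, s • ξ))))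
        ((e ∘ e'.symm) (((e' (e.symm (u₀, s • ξ))).1, 0) : Coord p n)) := by
      rw [h5, Prod.dist_eq, h6]
      refine le_trans (le_of_eq ?_) (le_max_right _ _)
      rw [dist_zero_right, norm_smul, Real.norm_of_nonneg hs0.le]
    rw [h7] at h4
    have h9 : s * ‖ξ‖ ≤ s * (L * ‖Ψ ((u₀, ξ), s)‖) := by
      calc _ ≤ _ := h8.trans h4
        _ = _ := by ring
    exact le_of_mul_le_mul_left h9 hs0
  have hΨc : Tendsto (fun s : ℝ => L * ‖Ψ ((u₀, ξ), s)‖) (𝓝[>] 0) (𝓝 (L * ‖Ψ ((u₀, ξ), 0)‖)) := by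
    have : ContinuousAt (fun s : ℝ => Ψ ((u₀, ξ), s)) 0 :=
      (hΨ.continuousOn.continuousAt (hΩ.mem_nhds (hmem ξ))).comp (f := fun s : ℝ => ((u₀, ξ), s))
        (by fun_prop)
    exact (this.norm.const_mul _).tendsto.mono_left nhdsWithin_le_nhds
  have h := ge_of_tendsto hΨc hlip
  rw [hz, norm_zero, mul_zero] at h
  exact norm_le_zero_iff.1 h

end Transition

/-! ### Oscillatory integrals as Mellin forms -/

section SymbolPart

variable {E : Type*} [NormedAddCommGroup E] [NormedSpace ℝ E]
variable {M : Type*} [TopologicalSpace M] [ChartedSpace E M]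
variable {p n : ℕ} {V : Set M} {m : ℂ} {a : Coord p n → ℂ}

/-- The chart `s = 1` of the blow-up covers everything but the centre `{x = 0, t = 0}`. -/
theorem IsClassicalSymbol.contDiffAt_symbolKernel (ha : IsClassicalSymbol m a) {w : Coord p n × ℝ}
    (hw : (w.1.2, w.2) ≠ 0) :
    ContDiffAt ℝ ∞ (fun v : Coord p n × ℝ => symbolKernel m a v.1 v.2) w := by
  refine contDiffAt_infty.2 fun N => ?_
  obtain ⟨G, hG, hGk⟩ := ha.exists_lift_symbolKernel N
  have hopen : IsOpen {w : EuclideanSpace ℝ (Fin p) × EuclideanSpace ℝ (Fin n) × ℝ × ℝ |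
      (w.2.1, w.2.2.1) ≠ 0} := isOpen_ne_fun (by fun_prop) continuous_const
  have h := (hG.contDiffAt (hopen.mem_nhds (show (w.1.1, w.1.2, w.2, (1 : ℝ)) ∈ _ from hw))).comp
    (f := fun v : Coord p n × ℝ => (v.1.1, v.1.2, v.2, (1 : ℝ))) w (by fun_prop)
  refine h.congr_of_eventuallyEq (Eventually.of_forall fun v => ?_)
  simp only [Function.comp_apply, hGk _ _ _ _ one_pos, one_smul, one_mul, Prod.mk.eta]

/-- The kernel of a symbol on the model, multiplied by `A` and transported by the chart `e`. -/
def chartKernel (e : OpenPartialHomeomorph M (Coord p n)) (A : Coord p n → ℂ) (m : ℂ)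
    (a : Coord p n → ℂ) (x : M) (t : ℝ) : ℂ :=
  e.source.indicator (fun y => A (e y) * symbolKernel m a (e y) t) x

variable {e : OpenPartialHomeomorph M (Coord p n)} {A : Coord p n → ℂ} {Z : Set (Coord p n)}

omit [ChartedSpace E M] in
theorem chartKernel_eq_zero (hA0 : ∀ y ∉ Z, A y = 0) {x : M} (hx : x ∉ e.symm '' Z) (t : ℝ) :
    chartKernel e A m a x t = 0 := by
  by_cases hxe : x ∈ e.source
  · rw [chartKernel, indicator_of_mem hxe, hA0 _ fun h => hx ⟨_, h, e.left_inv hxe⟩, zero_mul]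
  · exact indicator_of_notMem hxe _

theorem contMDiffAt_chartKernel [T2Space M] (ha : IsClassicalSymbol m a)
    (he : IsAdaptedChart E V e) (hA : ContDiff ℝ ∞ A) (hZ : IsCompact Z) (hZe : Z ⊆ e.target)
    (hA0 : ∀ y ∉ Z, A y = 0) {w : M × ℝ} (hw : ¬ (w.1 ∈ V ∧ w.2 = 0)) :
    ContMDiffAt (𝓘(ℝ, E).prod 𝓘(ℝ, ℝ)) 𝓘(ℝ, ℂ) ∞ (fun q : M × ℝ => chartKernel e A m a q.1 q.2)
      w := by
  by_cases hwe : w.1 ∈ e.source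
  · have hne : ((e w.1).2, w.2) ≠ (0 : EuclideanSpace ℝ (Fin n) × ℝ) := by
      intro h
      exact hw ⟨(he.2 _ hwe).2 (congrArg Prod.fst h), congrArg Prod.snd h⟩
    have h1 : ContDiffAt ℝ ∞ (fun v : Coord p n × ℝ => A v.1 * symbolKernel m a v.1 v.2)
        (e w.1, w.2) :=
      (hA.comp contDiff_fst).contDiffAt.mul (ha.contDiffAt_symbolKernel hne)
    have h2 : ContMDiffAt (𝓘(ℝ, E).prod 𝓘(ℝ, ℝ)) 𝓘(ℝ, Coord p n × ℝ) ∞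
        (fun q : M × ℝ => (e q.1, q.2)) w :=
      ((he.1.1.contMDiffAt (e.open_source.mem_nhds hwe)).comp w contMDiffAt_fst).prodMk_space
        contMDiffAt_snd
    refine (h1.contMDiffAt.comp w h2).congr_of_eventuallyEq ?_
    filter_upwards [(e.open_source.preimage continuous_fst).mem_nhds hwe] with q hq
    exact indicator_of_mem (show q.1 ∈ e.source from hq) _
  · have hc : IsCompact (e.symm '' Z) := hZ.image_of_continuousOn (e.continuousOn_symm.mono hZe)
    have hn : w.1 ∉ e.symm '' Z := by
      rintro ⟨y, hy, hyw⟩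
      exact hwe (hyw ▸ e.map_target (hZe hy))
    refine (contMDiffAt_const (c := (0 : ℂ))).congr_of_eventuallyEq ?_
    filter_upwards [(hc.isClosed.isOpen_compl.preimage continuous_fst).mem_nhds hn] with q hq
    exact chartKernel_eq_zero hA0 hq _

/-- The transported kernel is a Schwartz function: in every adapted chart it has lifts of all finite
orders, which determine a smooth one. -/
theorem chartKernel_mem_schwartzDNC [T2Space M] (ha : IsClassicalSymbol m a)
    (he : IsAdaptedChart E V e) (hA : ContDiff ℝ ∞ A) (hZ : IsCompact Z) (hZe : Z ⊆ e.target)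
    (hA0 : ∀ y ∉ Z, A y = 0) : chartKernel e A m a ∈ schwartzDNC E p n V := by
  have hc : IsCompact (e.symm '' Z) := hZ.image_of_continuousOn (e.continuousOn_symm.mono hZe)
  have hZ' : ∀ x t, chartKernel e A m a x t ≠ 0 → x ∈ e.symm '' Z := fun x t h => by
    by_contra hx
    exact h (chartKernel_eq_zero hA0 hx t)
  refine ⟨fun x t ht => ?_, fun w hw => (contMDiffAt_chartKernel ha he hA hZ hZe hA0
    hw).contMDiffWithinAt, fun e₁ he₁ => ?_, e.symm '' Z, 2, hc, fun x t h => ⟨hZ' x t h, ?_⟩⟩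
  · by_contra h
    have hx : x ∈ e.source := by
      by_contra hx
      exact h (indicator_of_notMem hx _)
    rw [chartKernel, indicator_of_mem hx, symbolKernel_of_nonpos _ ht, mul_zero] at h
    exact h rfl
  · set Ω : Set (EuclideanSpace ℝ (Fin p) × EuclideanSpace ℝ (Fin n) × ℝ × ℝ) :=
      {w | (w.2.1, w.2.2.1) ≠ 0 ∧ (w.1, w.2.2.2 • w.2.1) ∈ e₁.target}
    have hmap : ContDiff ℝ ∞ fun w : EuclideanSpace ℝ (Fin p) × EuclideanSpace ℝ (Fin n) × ℝ × ℝ =>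
      ((w.1, w.2.2.2 • w.2.1) : Coord p n) := by fun_prop
    have hσ : ∀ w : EuclideanSpace ℝ (Fin p) × EuclideanSpace ℝ (Fin n) × ℝ × ℝ, w.2.2.2 = 0 →
        w ∈ closure {v : EuclideanSpace ℝ (Fin p) × EuclideanSpace ℝ (Fin n) × ℝ × ℝ |
          0 < v.2.2.2} := by
      rintro ⟨u, ξ, τ, s⟩ hs
      have hs' : s = 0 := hs
      have h0 : (0 : ℝ) ∈ closure (Ioi 0) := by rw [closure_Ioi]; exact self_mem_Ici
      rw [hs']
      exact map_mem_closure (f := fun s : ℝ => (u, ξ, τ, s)) (by fun_prop) h0 fun s hs => hs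
    have hloc : ∀ w ∈ Ω, 0 ≤ w.2.2.2 → ∀ N : ℕ,
        ∃ H : EuclideanSpace ℝ (Fin p) × EuclideanSpace ℝ (Fin n) × ℝ × ℝ → ℂ,
          ContDiffAt ℝ N H w ∧ ∀ᶠ v in 𝓝 w, 0 < v.2.2.2 → H v =
            chartKernel e A m a (e₁.symm (v.1, v.2.2.2 • v.2.1)) (v.2.2.2 * v.2.2.1) := by
      intro w hw hw0 N
      rcases hw0.lt_or_eq with hpos | hzero
      · -- off the boundary of the blow-up the chart kernel itself is smooth
        refine ⟨_, ?_, Eventually.of_forall fun v _ => rfl⟩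
        have hne : ¬ (e₁.symm (w.1, w.2.2.2 • w.2.1) ∈ V ∧ w.2.2.2 * w.2.2.1 = 0) := by
          rintro ⟨h1, h2⟩
          rw [he₁.2 _ (e₁.map_target hw.2), e₁.right_inv hw.2] at h1
          exact hw.1 (Prod.ext ((smul_eq_zero.1 h1).resolve_left hpos.ne')
            ((mul_eq_zero.1 h2).resolve_left hpos.ne'))
        have h1 := contMDiffAt_chartKernel (E := E)
          (w := (e₁.symm (w.1, w.2.2.2 • w.2.1), w.2.2.2 * w.2.2.1)) ha he hA hZ hZe hA0 hne
        have h2 : ContMDiffAt 𝓘(ℝ, EuclideanSpace ℝ (Fin p) × EuclideanSpace ℝ (Fin n) × ℝ × ℝ)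
            (𝓘(ℝ, E).prod 𝓘(ℝ, ℝ)) ∞
            (fun w : EuclideanSpace ℝ (Fin p) × EuclideanSpace ℝ (Fin n) × ℝ × ℝ =>
              (e₁.symm (w.1, w.2.2.2 • w.2.1), w.2.2.2 * w.2.2.1)) w := by
          refine ContMDiffAt.prodMk ?_ (ContDiff.contMDiff (by fun_prop)).contMDiffAt
          exact (he₁.1.2.contMDiffAt (e₁.open_target.mem_nhds hw.2)).comp w
            hmap.contMDiff.contMDiffAt
        have h3 := (ContMDiffAt.comp w h1 h2).contDiffAt
        exact h3.of_le (by exact_mod_cast le_top)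
      · obtain ⟨u₀, ξ₀, τ₀, s₀⟩ := w
        obtain rfl : 0 = s₀ := hzero
        have hwt : ((u₀, 0) : Coord p n) ∈ e₁.target := by simpa using hw.2
        by_cases hx : e₁.symm (u₀, 0) ∈ e.source
        · obtain ⟨O, Ψ, hO, hmem, hΨ, hOe, hΨeq, hΨne⟩ := exists_transition_lift he₁ he hwt hx
          obtain ⟨H, hH, hHk⟩ := ha.exists_lift_symbolKernel N
          have hΨN : ContDiffOn ℝ N Ψ O := hΨ.of_le (by exact_mod_cast le_top)
          have hΦN : ContDiffOn ℝ N (e ∘ e₁.symm) (e₁.target ∩ e₁.symm ⁻¹' e.source) :=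
            (he₁.1.contDiffOn_comp_symm he.1.1).of_le (by exact_mod_cast le_top)
          have hopen : IsOpen {w : EuclideanSpace ℝ (Fin p) × EuclideanSpace ℝ (Fin n) × ℝ × ℝ |
            (w.2.1, w.2.2.1) ≠ 0} := isOpen_ne_fun (by fun_prop) continuous_const
          -- on the exceptional divisor, compose the lift in the chart `e` with the lifted transition map
          have hne : (Ψ ((u₀, ξ₀), 0), τ₀) ≠ 0 := by
            intro h
            have h1 : τ₀ = 0 := congrArg Prod.snd h
            have h2 : ξ₀ = 0 := by
              by_contra hξ
              exact hΨne ξ₀ hξ (congrArg Prod.fst h)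
            exact hw.1 (Prod.ext h2 h1)
          have hΨw : ContDiffAt ℝ N
              (fun v : EuclideanSpace ℝ (Fin p) × EuclideanSpace ℝ (Fin n) × ℝ × ℝ =>
                Ψ ((v.1, v.2.1), v.2.2.2)) (u₀, ξ₀, τ₀, 0) :=
            ContDiffAt.comp (f := fun v : EuclideanSpace ℝ (Fin p) × EuclideanSpace ℝ (Fin n) ×
              ℝ × ℝ => (((v.1, v.2.1), v.2.2.2) : Coord p n × ℝ)) _
              (hΨN.contDiffAt (hO.mem_nhds (hmem ξ₀))) (by fun_prop)
          have hΦw : ContDiffAt ℝ N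
              (fun v : EuclideanSpace ℝ (Fin p) × EuclideanSpace ℝ (Fin n) × ℝ × ℝ =>
                e (e₁.symm (v.1, v.2.2.2 • v.2.1))) (u₀, ξ₀, τ₀, 0) := by
            refine ContDiffAt.comp (g := e ∘ e₁.symm) (f := fun v : EuclideanSpace ℝ (Fin p) ×
              EuclideanSpace ℝ (Fin n) × ℝ × ℝ => ((v.1, v.2.2.2 • v.2.1) : Coord p n)) _ ?_
              (hmap.contDiffAt.of_le (by exact_mod_cast le_top))
            refine hΦN.contDiffAt ((e₁.isOpen_inter_preimage_symm e.open_source).mem_nhds ?_)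
            simpa using hOe _ (hmem ξ₀)
          refine ⟨fun v => A (e (e₁.symm (v.1, v.2.2.2 • v.2.1))) *
            H ((e (e₁.symm (v.1, v.2.2.2 • v.2.1))).1, Ψ ((v.1, v.2.1), v.2.2.2), v.2.2.1,
              v.2.2.2), ?_, ?_⟩
          · refine ((hA.of_le (by exact_mod_cast le_top)).contDiffAt.comp _ hΦw).mul
              (ContDiffAt.comp (g := H) (f := fun v : EuclideanSpace ℝ (Fin p) ×
                EuclideanSpace ℝ (Fin n) × ℝ × ℝ => ((e (e₁.symm (v.1, v.2.2.2 • v.2.1))).1,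
                  Ψ ((v.1, v.2.1), v.2.2.2), v.2.2.1, v.2.2.2)) _
                (hH.contDiffAt (hopen.mem_nhds hne)) ?_)
            exact (contDiff_fst.contDiffAt.comp _ hΦw).prodMk (hΨw.prodMk (by fun_prop))
          · have hOw : ∀ᶠ v : EuclideanSpace ℝ (Fin p) × EuclideanSpace ℝ (Fin n) × ℝ × ℝ in
                𝓝 (u₀, ξ₀, τ₀, 0), (((v.1, v.2.1), v.2.2.2) : Coord p n × ℝ) ∈ O :=
              (hO.preimage (f := fun v : EuclideanSpace ℝ (Fin p) × EuclideanSpace ℝ (Fin n) ×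
                ℝ × ℝ => (((v.1, v.2.1), v.2.2.2) : Coord p n × ℝ)) (by fun_prop)).mem_nhds
                (hmem ξ₀)
            filter_upwards [hOw] with v hv hpos
            have h1 := hΨeq _ hv
            have h2 := (hOe _ hv).2
            have h2' : e₁.symm (v.1, v.2.2.2 • v.2.1) ∈ e.source := h2
            simp only at h1
            rw [hHk _ _ _ _ hpos, ← h1, chartKernel, indicator_of_mem h2']
        · -- the kernel vanishes near points off the support of `A`
          refine ⟨fun _ => 0, contDiffAt_const, ?_⟩
          have hn : e₁.symm (u₀, 0) ∉ e.symm '' Z := by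
            rintro ⟨y, hy, hyx⟩
            exact hx (hyx ▸ e.map_target (hZe hy))
          have hcont : ContinuousAt
              (fun v : EuclideanSpace ℝ (Fin p) × EuclideanSpace ℝ (Fin n) × ℝ × ℝ =>
                e₁.symm (v.1, v.2.2.2 • v.2.1)) (u₀, ξ₀, τ₀, 0) :=
            ContinuousAt.comp (f := fun v : EuclideanSpace ℝ (Fin p) × EuclideanSpace ℝ (Fin n) ×
              ℝ × ℝ => ((v.1, v.2.2.2 • v.2.1) : Coord p n))
              (e₁.continuousOn_symm.continuousAt (e₁.open_target.mem_nhds hw.2))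
              hmap.continuous.continuousAt
          have hev := hcont (hc.isClosed.isOpen_compl.mem_nhds (by simpa using hn))
          filter_upwards [hev] with v hv _
          exact (chartKernel_eq_zero hA0 hv _).symm
    obtain ⟨G, hG, hGk⟩ := exists_contDiffOn_glue hσ hloc
    exact ⟨G, hG.mono fun w hw => ⟨⟨hw.1, hw.2.2⟩, hw.2.1⟩, fun u ξ τ s _ hs _ => hGk _ hs⟩
  · by_contra ht
    have hx : x ∈ e.source := by
      by_contra hx
      exact h (indicator_of_notMem hx _)
    rw [chartKernel, indicator_of_mem hx, symbolKernel_of_two_le _ (not_le.1 ht).le, mul_zero] at h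
    exact h rfl

variable [MeasurableSpace M] [BorelSpace M] {μ : Measure M}

/-- An oscillatory integral, localized in an adapted chart, is a Mellin form: the kernel of the
symbol gives the high frequencies, and the low frequencies are a smooth density. -/
theorem isMellinForm_oscillatory [T2Space M] [IsFiniteMeasureOnCompacts μ]
    (hμ : IsSmoothMeasure E p n μ) (ha : IsClassicalSymbol m a)
    (he : IsAdaptedChart E V e) {θ : M → ℂ} (hθ : ContMDiff 𝓘(ℝ, E) 𝓘(ℝ, ℂ) ∞ θ) {K : Set M}
    (hK : IsCompact K) (hKe : K ⊆ e.source) (hθ0 : ∀ x ∉ K, θ x = 0) :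
    IsMellinForm E p n V μ m fun f =>
      oscillatory a (e.target.indicator ((smoothMul hθ f).1 ∘ e.symm)) := by
  obtain ⟨ρ, hρ, hpos, hint⟩ := hμ.exists_density he.1
  obtain ⟨hA1, hZ, hZt, hA10⟩ := he.1.contDiff_indicator hθ.contMDiffOn hK hKe hθ0
  set Z := e '' K
  -- the factor `ρ⁻¹` cancels the density of `μ` in the chart
  set A : Coord p n → ℂ := fun q => e.target.indicator (θ ∘ e.symm) q * (ρ q : ℂ)⁻¹ with hAdef
  have hρne : ∀ q ∈ e.target, (ρ q : ℂ) ≠ 0 := fun q hq => by exact_mod_cast (hpos q hq).ne'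
  have hA0 : ∀ q ∉ Z, A q = 0 := fun q hq => by rw [hAdef]; simp only [hA10 q hq, zero_mul]
  have hA : ContDiff ℝ ∞ A := by
    refine contDiff_of_eq_zero_off e.open_target hZ.isClosed hZt ?_ hA0
    exact hA1.contDiffOn.mul ((Complex.ofRealCLM.contDiff.comp_contDiffOn hρ).inv hρne)
  have hρA : ∀ q ∈ e.target, (ρ q : ℂ) * A q = θ (e.symm q) := fun q hq => by
    have := hρne q hq
    simp only [hAdef, indicator_of_mem hq, Function.comp_apply]
    field_simp
  -- integrals against kernels living in the chart
  have hchart : ∀ (f : SmoothFun E M) (g : Coord p n → ℂ), Continuous g →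
      ∫ x, e.source.indicator (fun y => A (e y) * g (e y)) x * f.1 x ∂μ =
        ∫ q, g q * e.target.indicator ((smoothMul hθ f).1 ∘ e.symm) q := by
    intro f g hg
    have hcont : ContinuousOn (fun x => e.source.indicator (fun y => A (e y) * g (e y)) x * f.1 x)
        e.source := by
      refine ContinuousOn.mul ?_ (ContMDiff.continuous f.2).continuousOn
      exact ((hA.continuous.mul hg).comp_continuousOn e.continuousOn).congr
        fun x hx => indicator_of_mem hx _
    rw [hint _ hcont fun x hx => by rw [indicator_of_notMem hx, zero_mul]]
    have hout : ∀ q ∉ e.target, g q * e.target.indicator ((smoothMul hθ f).1 ∘ e.symm) q = 0 :=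
      fun q hq => by rw [indicator_of_notMem hq, mul_zero]
    rw [← setIntegral_eq_integral_of_forall_compl_eq_zero hout]
    refine setIntegral_congr_fun e.open_target.measurableSet fun q hq => ?_
    simp only [indicator_of_mem hq, indicator_of_mem (e.map_target hq), e.right_inv hq,
      Function.comp_apply, smoothMul_apply, ← hρA q hq]
    ring
  have hF : ∀ f : SmoothFun E M, ContDiff ℝ ∞ (e.target.indicator ((smoothMul hθ f).1 ∘ e.symm)) ∧
      HasCompactSupport (e.target.indicator ((smoothMul hθ f).1 ∘ e.symm)) := by
    intro f
    obtain ⟨h1, h2, -, h3⟩ := he.1.contDiff_indicator (f := (smoothMul hθ f).1)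
      (ContMDiff.contMDiffOn (smoothMul hθ f).2) hK hKe
      fun x hx => by rw [smoothMul_apply, hθ0 x hx, zero_mul]
    exact ⟨h1, HasCompactSupport.intro h2 h3⟩
  have hpair : ∀ (f : SmoothFun E M) (t : ℝ), 0 < t → pairing n μ (chartKernel e A m a) t f.1 =
      (t : ℂ)⁻¹ ^ n * ∫ q, symbolKernel m a q t *
        e.target.indicator ((smoothMul hθ f).1 ∘ e.symm) q := fun f t ht => by
    rw [pairing, ← hchart f _ (continuous_symbolKernel ha ht)]
    rfl
  have h1 : IsMellinForm E p n V μ m fun f => ∫ t in Ioi (0 : ℝ),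
      ((t : ℂ)⁻¹ ^ n * ∫ q, symbolKernel m a q t *
        e.target.indicator ((smoothMul hθ f).1 ∘ e.symm) q) * (t : ℂ) ^ (-1 - m) := by
    refine ⟨chartKernel e A m a, ⟨chartKernel_mem_schwartzDNC ha he hA hZ hZt hA0,
      fun f => ?_⟩, fun f => ?_⟩
    · obtain ⟨h, hh, h0, heq⟩ := ha.exists_flat_pairing (hF f).1 (hF f).2
      refine ⟨h, hh, fun t ht => ?_, iteratedDeriv_zero_of_nonpos hh h0⟩
      rw [heq t ht, hpair f t ht, ha.pairing_symbolKernel (hF f).1 (hF f).2 ht]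
    · refine setIntegral_congr_fun measurableSet_Ioi fun t ht => ?_
      simp only [hpair f t ht]
  have hlow := contDiff_lowFrequencyKernel ha.1
  have hκ := he.1.contMDiff_indicator (hA.mul hlow).contDiffOn hZ hZt
    fun y _ hy => by rw [hA0 y hy, zero_mul]
  have h2 := isMellinForm_integral_mul (E := E) (p := p) (n := n) (V := V) (μ := μ) hκ
    (hZ.image_of_continuousOn (e.continuousOn_symm.mono hZt)) (fun x hx => by
      by_cases hxe : x ∈ e.source
      · rw [indicator_of_mem hxe, Function.comp_apply,
          hA0 _ fun h => hx ⟨_, h, e.left_inv hxe⟩, zero_mul]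
      · exact indicator_of_notMem hxe _) m
  have h3 := h1.add h2
  convert h3 using 2 with f
  rw [ha.oscillatory_eq (hF f).1 (hF f).2, ← hchart f _ hlow.continuous]
  rfl

variable [FiniteDimensional ℝ E] [IsManifold 𝓘(ℝ, E) ∞ M] [T2Space M] [SecondCountableTopology M]

/-- Conormal distributions are Mellin forms: a finite partition of unity reduces this to oscillatory
integrals and smooth densities. -/
theorem isMellinForm_of_mem_conormal (hdim : Module.finrank ℝ E = p + n)
    (hμ : IsSmoothMeasure E p n μ)
    {Q : SmoothFun E M →ₗ[ℂ] ℂ} (hQ : Q ∈ conormal E p n μ V m) :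
    IsMellinForm E p n V μ m Q := by
  have := hμ.isLocallyFiniteMeasure hdim
  obtain ⟨⟨r, N, C, c, L, hc, hb⟩, hoff, hon⟩ := hQ
  have hK : IsCompact (⋃ i, (c i).symm '' L i) := isCompact_iUnion fun i =>
    (hc i).2.1.image_of_continuousOn ((c i).continuousOn_symm.mono (hc i).2.2)
  -- near every point, `Q` is a Mellin form
  have hloc : ∀ x : M, ∃ U : Set M, IsOpen U ∧ x ∈ U ∧ ∀ (θ : M → ℂ)
      (hθ : ContMDiff 𝓘(ℝ, E) 𝓘(ℝ, ℂ) ∞ θ) (Z : Set M), IsCompact Z → Z ⊆ U →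
      (∀ x ∉ Z, θ x = 0) → IsMellinForm E p n V μ m fun f => Q (smoothMul hθ f) := by
    have hsupp : ∀ {θ : M → ℂ} (hθ : ContMDiff 𝓘(ℝ, E) 𝓘(ℝ, ℂ) ∞ θ) {Z : Set M}, IsCompact Z →
        (∀ x ∉ Z, θ x = 0) → ∀ f : SmoothFun E M,
        HasCompactSupport (smoothMul hθ f).1 ∧ tsupport (smoothMul hθ f).1 ⊆ Z := by
      intro θ hθ Z hZ hθ0 f
      have h0 : ∀ x ∉ Z, (smoothMul hθ f).1 x = 0 := fun x hx => by
        rw [smoothMul_apply, hθ0 x hx, zero_mul]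
      refine ⟨HasCompactSupport.intro hZ h0, closure_minimal (fun x hx => ?_) hZ.isClosed⟩
      by_contra h
      exact hx (h0 x h)
    have hsmooth : ∀ {θ : M → ℂ} (hθ : ContMDiff 𝓘(ℝ, E) 𝓘(ℝ, ℂ) ∞ θ) {Z U : Set M}
        {κ : M → ℂ}, IsOpen U → ContMDiffOn 𝓘(ℝ, E) 𝓘(ℝ, ℂ) ∞ κ U → IsCompact Z → Z ⊆ U →
        (∀ x ∉ Z, θ x = 0) →
        IsMellinForm E p n V μ m fun f => ∫ y, κ y * (smoothMul hθ f).1 y ∂μ := by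
      intro θ hθ Z U κ hU hκ hZ hZU hθ0
      have h0 : ∀ x ∉ Z, κ x * θ x = 0 := fun x hx => by rw [hθ0 x hx, mul_zero]
      have hκθ : ContMDiff 𝓘(ℝ, E) 𝓘(ℝ, ℂ) ∞ fun x => κ x * θ x :=
        contMDiff_of_eq_zero_off hU hZ.isClosed hZU ((contDiff_mul (𝕜 := ℝ)
          (𝔸 := ℂ)).contMDiff.comp_contMDiffOn (hκ.prodMk_space hθ.contMDiffOn)) h0
      convert isMellinForm_integral_mul (E := E) (p := p) (n := n) (V := V) (μ := μ) hκθ hZ h0 m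
        using 3 with f
      ext y
      rw [smoothMul_apply, mul_assoc]
    intro x
    by_cases hx : x ∈ V
    · obtain ⟨e, he, hxe, a, κ, ha, hκ, hQe⟩ := hon x hx
      refine ⟨e.source, e.open_source, hxe, fun θ hθ Z hZ hZU hθ0 => ?_⟩
      convert (isMellinForm_oscillatory hμ ha he hθ hZ hZU hθ0).add
        (hsmooth hθ e.open_source hκ hZ hZU hθ0) using 2 with f
      obtain ⟨h1, h2⟩ := hsupp hθ hZ hθ0 f
      exact hQe _ h1 (h2.trans hZU)
    · obtain ⟨U, hU, hxU, κ, hκ, hQU⟩ := hoff x hx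
      refine ⟨U, hU, hxU, fun θ hθ Z hZ hZU hθ0 => ?_⟩
      convert hsmooth hθ hU hκ hZ hZU hθ0 using 2 with f
      obtain ⟨h1, h2⟩ := hsupp hθ hZ hθ0 f
      exact hQU _ h1 (h2.trans hZU)
  choose U hU hxU hUQ using hloc
  obtain ⟨s, θ, Z, W, hθ, hZ, hZU, hθ0, hW, hKW, hW1⟩ := exists_finite_partition E hK U hU hxU
  -- the partition of unity is `1` near the support of `Q`, so that `Q` is the sum of its pieces
  have hsum := isMellinForm_sum s fun i _ => hUQ i (θ i) (hθ i) (Z i) (hZ i) (hZU i) (hθ0 i)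
  convert hsum using 2 with f
  refine eq_sum_smoothMul Q s hθ hW1 (fun f hf => ?_) f
  have h := hb f 0 le_rfl fun i j _ y hy => le_of_eq ?_
  · rw [mul_zero] at h
    exact norm_le_zero_iff.1 h
  · have hyt := (hc i).2.2 hy
    have hyW : (c i).symm y ∈ W := hKW (mem_iUnion.2 ⟨i, y, hy, rfl⟩)
    have hev : f.1 ∘ (c i).symm =ᶠ[𝓝 y] fun _ => 0 := by
      filter_upwards [((c i).isOpen_inter_preimage_symm hW).mem_nhds ⟨hyt, hyW⟩] with z hz
        using hf _ hz.2
    rw [(hev.iteratedFDeriv ℝ j).eq_of_nhds]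
    simp

end SymbolPart

end Conormal

end

theorem mainTheorem3
    {E : Type*} [NormedAddCommGroup E] [NormedSpace ℝ E] [FiniteDimensional ℝ E]
    {M : Type*} [TopologicalSpace M] [T2Space M] [SecondCountableTopology M]
    [ChartedSpace E M] [IsManifold 𝓘(ℝ, E) ∞ M]
    [MeasurableSpace M] [BorelSpace M]
    (p n : ℕ) (hdim : Module.finrank ℝ E = p + n)
    (μ : Measure M) (hμ : Conormal.IsSmoothMeasure E p n μ)
    (V : Set M) (hV : Conormal.IsClosedSubmanifold E p n V) (m : ℂ) :
    (∀ k ∈ Conormal.flatSchwartz E p n μ V, ∀ f : Conormal.SmoothFun E M,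
      IntegrableOn (fun t : ℝ => Conormal.pairing n μ k t f.1 * (t : ℂ) ^ (-1 - m)) (Ioi 0)) ∧
    Conormal.conormal E p n μ V m =
      {Q | ∃ k ∈ Conormal.flatSchwartz E p n μ V, ∀ f : Conormal.SmoothFun E M,
        Q f = ∫ t in Ioi (0 : ℝ), Conormal.pairing n μ k t f.1 * (t : ℂ) ^ (-1 - m)} := by
  refine ⟨fun k hk f => Conormal.integrableOn_pairing hk f m, Set.ext fun Q => ⟨fun hQ => ?_, ?_⟩⟩
  · exact Conormal.isMellinForm_of_mem_conormal hdim hμ hQ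
  · rintro ⟨k, hk, hQ⟩
    exact Conormal.mem_conormal_of_mem_flatSchwartz hdim hμ hV hk m hQ
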